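/- **Automata.** A DiP automaton (DiPA) $\mathcal A$ consists of a finite set $Q$ of states, partitioned into input and non-input states, an initial state $q_{\rm init}$, a finite output alphabet $\Gamma$, rational parameters $(d_q,\mu_q,d'_q,\mu'_q)$ with $d_q,d'_q\ge 0$ for every $q\in Q$, and a partial function $\delta: Q\times\{\mathsf{true},\ge,<\}\rightharpoonup Q\times(\Gamma\cup\{\sigma,\sigma'\})\times\{\mathsf{true},\mathsf{false}\}$ such that: if $\delta(q,\mathsf{true})$ is defined, then $\delta(q,\ge)$ and $\delta(q,<)$ are not; if $\delta(q,\ge)$ and $\delta(q,<)$ are both defined, their outputs are different and at least one of them is in $\Gamma$; $\delta(q_{\rm init},\mathsf{true})$ is defined, is the only transition from $q_{\rm init}$, and has third component $\mathsf{true}$; a non-input state has no transition with guard $\ge$ or $<$. A transition $t=(p,c,q,o,b)$ with $\delta(p,c)=(q,o,b)$ has guard $c$, outputs $o$, and is an assignment if $b=\mathsf{true}$; it is an input transition if $p$ is an input state. In a state $q$ the automaton reads a real number $a$ if $q$ is an input state (otherwise $a=0$), samples $\sigma\sim \mathrm{Lap}(d_q\epsilon,\mu_q)+a$ and $\sigma'\sim\mathrm{Lap}(d'_q\epsilon,\mu'_q)+a$,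 where $\mathrm{Lap}(k,\mu)$ has density $\frac k2e^{-k|z-\mu|}$, takes the transition whose guard is satisfied by comparing $\sigma$ with the stored value $x$ ($\ge$: $\sigma\ge x$; $<$: $\sigma<x$), produces its output, and stores $\sigma$ in $x$ if it is an assignment. **Differential privacy.** A path is a sequence of consecutive transitions, each together with the input read (in input states) and, if $\sigma$ or $\sigma'$ is output, an interval $(v,w)$, $v,w\in[-\infty,\infty]$. For a path $\rho$ from $q_{\rm init}$, $\Pr[\epsilon,\rho]$ is the probability that on these inputs the transitions of $\rho$ are taken and all real outputs lie in the given intervals, defined by recursion along $\rho$ as an iterated integral of the densities (a step with guard $\mathsf{true}$ that is no assignment and does not output $\sigma$ contributes no integral over $\sigma$; a step that does not output $\sigma'$ contributes none over $\sigma'$). $\mathcal A$ is $d\epsilon$-differentially private if $\Pr[\epsilon,\rho]\le e^{d\epsilon}\Pr[\epsilon,\rho']$ for all paths $\rho,\rho'$ from $q_{\rm init}$ which have the same transitions and intervals, and whose inputs differ by at most $1$ in each position. The *differential privacy problem* asks whether there is $d>0$ such that $\mathcal A$ is $d\epsilon$-differentially private for all $\epsilon>0$. **Well-formedness.** A cycle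 is a path of positive length from a state to itself; it is a G-cycle (L-cycle) if some transition on it has guard $\ge$ ($<$). An AG-path (AL-path) is a path all of whose assignments have guard $\ge$ ($<$). A path is reachable if its first state can be reached from $q_{\rm init}$. $\mathcal A$ is well-formed if none of the following exists: (1) a reachable cycle on which an assignment is followed, at a later position, by a transition with guard $\ne\mathsf{true}$; (2) a reachable cycle $C$ and a cycle $C'$ such that $C$ is an L-cycle, $C'$ a G-cycle and there is an AG-path from a state of $C$ to a state of $C'$, or the same with L and G (and AG and AL) exchanged; (3) a reachable cycle with an input transition that outputs $\sigma$ or $\sigma'$; (4) a reachable path $\rho$ such that (a) its first transition is an assignment that outputs $\sigma$, the rest of $\rho$ is an AG-path, and $\rho$ ends in a state of a G-cycle, or (b) $\rho$ is an AG-path, its first transition has guard $<$ and outputs $\sigma$, and $\rho$ ends in a state of a G-cycle, or (c) $\rho$ is an AG-path starting in a state of an L-cycle, and its last transition has guard $\ge$ and outputs $\sigma$, or one of (a)–(c) holds with G and L, AG and AL, $\ge$ and $<$ exchanged. **Weight.** A transition is critical if it lies on no reachable cycle. The cost of a transition $t$ from $p$ is $d_p$ if $t$ is a critical non-input transition, $2d_p$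 if $t$ is a critical input transition that does not output $\sigma'$, $2d_p+d'_p$ if $t$ is a critical input transition that outputs $\sigma'$, and $0$ otherwise. $\mathrm{weight}(\mathcal A)\in[0,\infty]$ is the supremum, over all paths (from any state), of the sum of the costs of the transitions of the path. **Machines.** A random access machine has finitely many arrays of natural numbers (words), which can be copied, compared, incremented and decremented in unit time and which index the arrays, and finitely many arrays of rational numbers, which can only be copied, added and compared. Initially the arrays contain $|Q|$, $|\Gamma|$, $q_{\rm init}$, the transition table and the parameters of $\mathcal A$, with $Q=\{0,\dots,n-1\}$ and $\Gamma=\{0,\dots,m-1\}$, and are zero elsewhere. Let $|\mathcal A|$ be the number of states plus the number of transitions, and $\|\mathcal A\|$ be $|\mathcal A|$ plus the total number of bits of the parameters. **Statement.** 1. The differential privacy problem for DiPAs is decidable in linear time: there are a machine and a constant $K$ such that, for every DiPA $\mathcal A$, the machine decides within $K\|\mathcal A\|$ steps whether some $d>0$ works for all $\epsilon>0$. Here each operation on rational numbers costs, besides one step, the number of bits of its operands. 2. Well-formedness of $\mathcal A$ is decidable, with the same cost of operations, within $K|\mathcal A|$ steps for some constant $K$. 3. $\mathrm{weight}(\mathcal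 A)$ is computable within $K|\mathcal A|$ steps for some constant $K$, if copying, addition and comparison of rational numbers take unit time. (The machine reports in a separate cell whether the weight is infinite.) -/

import Mathlib

open scoped BigOperators

/-! ## DiP automata -/

/-- Guards: `tt` is `true`, `ge` is `svar ≥ x`, `lt` is `svar < x`, where `x` is the stored value. -/
inductive Guard
  | tt
  | ge
  | lt
  deriving DecidableEq

instance : Fintype Guard := ⟨{.tt, .ge, .lt}, fun c => by cases c <;> decide⟩

/-- What a transition outputs: a symbol of the output alphabet, or one of the two sampled values. -/
inductive Out (Γ : Type*)
  | sym (g : Γ)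
  | svar
  | svar'

/-- Differentially private automata with set of states `Q` and output alphabet `Γ`. The parameters
of a state `q` are `(d q, μ q, d' q, μ' q)`: `svar` is sampled from `Lap (d ε, μ)` and `svar'` from
`Lap (d' ε, μ')`. -/
structure DiPA (Q Γ : Type*) where
  /-- `isInput q = true` for input states, `false` for non-input states. -/
  isInput : Q → Bool
  init : Q
  d : Q → ℚ≥0
  μ : Q → ℚ
  d' : Q → ℚ≥0
  μ' : Q → ℚ
  /-- The partial transition function: next state, output, and whether `svar` is stored in `x`. -/
  δ : Q → Guard → Option (Q × Out Γ × Bool)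
  /-- Determinism. -/
  determinism : ∀ q, (δ q .tt).isSome → δ q .ge = none ∧ δ q .lt = none
  /-- Output distinction. -/
  output_distinction : ∀ q q₁ o₁ b₁ q₂ o₂ b₂,
    δ q .ge = some (q₁, o₁, b₁) → δ q .lt = some (q₂, o₂, b₂) →
      o₁ ≠ o₂ ∧ ((∃ g, o₁ = .sym g) ∨ (∃ g, o₂ = .sym g))
  /-- Initialization. -/
  initialization : (∃ q o, δ init .tt = some (q, o, true)) ∧ δ init .ge = none ∧ δ init .lt = none
  /-- Non-input states have only transitions with guard `true`. -/
  non_input : ∀ q, isInput q = false → ∀ c, (δ q c).isSome → c = .tt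

/-- A transition `(src, guard, dst, out, asg)`; `asg` says whether it is an assignment. -/
structure Transition (Q Γ : Type*) where
  src : Q
  guard : Guard
  dst : Q
  out : Out Γ
  asg : Bool

/-- The label on a step of a path: an output symbol, or the name of a sampled value (`svar'` if
`primed`, otherwise `svar`) with an interval `(v, w)` in which the output value lies. -/
inductive Label (Γ : Type*)
  | sym (g : Γ)
  | real (primed : Bool) (v w : EReal)

/-- The output of the transition underlying a label. -/
def Label.out {Γ : Type*} : Label Γ → Out Γ
  | .sym g => .sym g
  | .real false _ _ => .svar
  | .real true _ _ => .svar'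

/-- A step of an execution: the transition taken, the input read (`none` is the empty string `τ`),
and the output label. The transition is determined by its source and its output, see
`DiPA.transition_unique`. -/
structure Step (Q Γ : Type*) where
  tr : Transition Q Γ
  inp : Option ℝ
  lab : Label Γ

/-- The density of the Laplace distribution with scaling parameter `k` and mean `m`. -/
noncomputable def lapDensity (k m z : ℝ) : ℝ := k / 2 * Real.exp (-k * |z - m|)

/-- The reals strictly between two extended reals; empty if `w ≤ v`. -/
def openInterval (v w : EReal) : Set ℝ := {z | v < (z : EReal) ∧ (z : EReal) < w}

/-- The result of comparing the sampled value `z` with the stored value `x` satisfies the guard. -/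
def Guard.Holds (x z : ℝ) : Guard → Prop
  | .tt => True
  | .ge => x ≤ z
  | .lt => z < x

/-- The condition which a label puts on the sampled value `z` of `svar`. -/
def Label.Admits {Γ : Type*} (z : ℝ) : Label Γ → Prop
  | .real false v w => z ∈ openInterval v w
  | _ => True

namespace DiPA

variable {Q Γ : Type*} (A : DiPA Q Γ)

/-- `t` is a transition of `A`. -/
def IsTransition (t : Transition Q Γ) : Prop := A.δ t.src t.guard = some (t.dst, t.out, t.asg)

/-- Source and output determine the transition. -/
theorem transition_unique {t t' : Transition Q Γ} (h : A.IsTransition t) (h' : A.IsTransition t')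
    (hs : t.src = t'.src) (ho : t.out = t'.out) : t = t' := by
  obtain ⟨p, c, q, o, b⟩ := t
  obtain ⟨p', c', q', o', b'⟩ := t'
  simp only [IsTransition] at h h' hs ho
  subst hs ho
  have hd := A.determinism p
  have hod := A.output_distinction p
  cases c <;> cases c'
  case ge.lt => exact absurd rfl (hod _ _ _ _ _ _ h h').1
  case lt.ge => exact absurd rfl (hod _ _ _ _ _ _ h' h).1
  all_goals simp_all

/-- `ts` is the sequence of transitions of a path from `p` to `q`. -/
def IsPath : Q → List (Transition Q Γ) → Q → Prop
  | p, [], q => p = q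
  | p, t :: ts, q => A.IsTransition t ∧ t.src = p ∧ IsPath t.dst ts q

/-- `ρ` is an execution (a path with inputs and outputs) from `p` to `q`. An input is read exactly
in the input states. -/
def IsExecution (p : Q) (ρ : List (Step Q Γ)) (q : Q) : Prop :=
  A.IsPath p (ρ.map Step.tr) q ∧
    ∀ s ∈ ρ, s.lab.out = s.tr.out ∧ (s.inp.isSome ↔ A.isInput s.tr.src = true)

/-! ### Path probabilities and differential privacy -/

/-- The probability of an execution for the privacy budget `ε` and the stored value `x`. A step
contributes the probability that `svar'` lies in its interval, if `svar'` is output, and that `svar`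
satisfies the guard and lies in its interval, if `svar` is output. -/
noncomputable def pathProb (ε : ℝ) : List (Step Q Γ) → ℝ → ℝ
  | [], _ => 1
  | s :: ρ, x =>
    let q := s.tr.src
    let a : ℝ := s.inp.getD 0
    let f : ℝ → ℝ := lapDensity (A.d q * ε) (A.μ q + a)
    let f' : ℝ → ℝ := lapDensity (A.d' q * ε) (A.μ' q + a)
    let k' : ℝ := match s.lab with
      | .real true v w => ∫ z in openInterval v w, f' z
      | _ => 1
    let I : Set ℝ := {z | s.tr.guard.Holds x z ∧ s.lab.Admits z}
    match s.tr.asg, s.tr.guard, s.lab with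
    | true, _, _ => k' * ∫ z in I, f z * pathProb ε ρ z
    | false, .tt, .sym _ => pathProb ε ρ x
    | false, .tt, .real true _ _ => k' * pathProb ε ρ x
    | false, _, _ => k' * (∫ z in I, f z) * pathProb ε ρ x

/-- The sequence of (real) inputs read in an execution. -/
def inputs (ρ : List (Step Q Γ)) : List ℝ := ρ.filterMap Step.inp

/-- Executions that differ at most in the inputs read. -/
def Equivalent (ρ ρ' : List (Step Q Γ)) : Prop :=
  ρ.map (fun s => (s.tr, s.lab)) = ρ'.map (fun s => (s.tr, s.lab))

/-- Sequences of the same length whose entries differ by at most `1`. -/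
def Adjacent (a b : List ℝ) : Prop := List.Forall₂ (fun x y => |x - y| ≤ 1) a b

/-- `A` is `dε`-differentially private. The probability of an execution from the initial state does
not depend on the initially stored value, which is taken to be `0`. -/
def IsDPAt (d ε : ℝ) : Prop :=
  ∀ (ρ ρ' : List (Step Q Γ)) (q q' : Q),
    A.IsExecution A.init ρ q → A.IsExecution A.init ρ' q' →
    Equivalent ρ ρ' → Adjacent (inputs ρ) (inputs ρ') →
      A.pathProb ε ρ 0 ≤ Real.exp (d * ε) * A.pathProb ε ρ' 0

/-- The differential privacy problem: is there a `d` that works for all `ε`? -/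
def DifferentiallyPrivate : Prop := ∃ d : ℝ, 0 < d ∧ ∀ ε : ℝ, 0 < ε → A.IsDPAt d ε

/-! ### Well-formedness -/

def Reachable (q : Q) : Prop := ∃ ts, A.IsPath A.init ts q

/-- `C` is a cycle starting (and ending) in `q`. -/
def IsCycle (q : Q) (C : List (Transition Q Γ)) : Prop := C ≠ [] ∧ A.IsPath q C q

/-- Some transition of `C` has guard `g`: for a cycle, it is a G-cycle (`g = ge`) or an L-cycle
(`g = lt`). -/
def HasGuard (g : Guard) (C : List (Transition Q Γ)) : Prop := ∃ t ∈ C, t.guard = g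

/-- All assignment transitions have guard `g`: an AG-path (`g = ge`) or an AL-path (`g = lt`). -/
def AssignsOnly (g : Guard) (ts : List (Transition Q Γ)) : Prop :=
  ∀ t ∈ ts, t.asg = true → t.guard = g

/-- `q` is a state of a G-cycle (`g = ge`) or of an L-cycle (`g = lt`). -/
def InCycle (g : Guard) (q : Q) : Prop :=
  ∃ p C, A.IsCycle p C ∧ HasGuard g C ∧ ∃ t ∈ C, t.src = q

/-- An assignment is followed, later on the path, by a guard other than `true`. -/
def Leaking (ts : List (Transition Q Γ)) : Prop :=
  ∃ (i j : ℕ) (hij : i < j) (hj : j < ts.length),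
    (ts[i]'(hij.trans hj)).asg = true ∧ (ts[j]'hj).guard ≠ .tt

/-- A leaking pair of cycles. -/
def LeakingPair (C C' : List (Transition Q Γ)) : Prop :=
  (HasGuard .lt C ∧ HasGuard .ge C' ∧
    ∃ t ∈ C, ∃ t' ∈ C', ∃ ts, A.IsPath t.src ts t'.src ∧ AssignsOnly .ge ts) ∨
  (HasGuard .ge C ∧ HasGuard .lt C' ∧
    ∃ t ∈ C, ∃ t' ∈ C', ∃ ts, A.IsPath t.src ts t'.src ∧ AssignsOnly .lt ts)

/-- Some input transition outputs `svar` or `svar'`. -/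
def Disclosing (C : List (Transition Q Γ)) : Prop :=
  ∃ t ∈ C, A.isInput t.src = true ∧ (t.out = .svar ∨ t.out = .svar')

/-- One of the two dual conditions (`g = ge`, `g' = lt`, and vice versa) for the path `ts` from `p`
to `q` to be privacy violating. -/
def ViolatingFor (g g' : Guard) (p : Q) (ts : List (Transition Q Γ)) (q : Q) : Prop :=
  (∃ t tl, ts = t :: tl ∧ AssignsOnly g tl ∧ A.InCycle g q ∧ t.asg = true ∧ t.out = .svar) ∨
  (∃ t tl, ts = t :: tl ∧ AssignsOnly g ts ∧ A.InCycle g q ∧ t.guard = g' ∧ t.out = .svar) ∨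
  (∃ t hd, ts = hd ++ [t] ∧ AssignsOnly g ts ∧ A.InCycle g' p ∧ t.guard = g ∧ t.out = .svar)

/-- Well-formed automata: no reachable leaking cycle, no leaking pair with reachable first cycle, no
reachable disclosing cycle, and no reachable privacy violating path. -/
def WellFormed : Prop :=
  (∀ q C, A.Reachable q → A.IsCycle q C → ¬ Leaking C) ∧
  (∀ q C q' C', A.Reachable q → A.IsCycle q C → A.IsCycle q' C' → ¬ A.LeakingPair C C') ∧
  (∀ q C, A.Reachable q → A.IsCycle q C → ¬ A.Disclosing C) ∧
  (∀ p ts q, A.Reachable p → A.IsPath p ts q →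
    ¬ A.ViolatingFor .ge .lt p ts q ∧ ¬ A.ViolatingFor .lt .ge p ts q)

/-! ### Weight -/

/-- `t` does not lie on a reachable cycle. -/
def Critical (t : Transition Q Γ) : Prop := ¬ ∃ q C, A.Reachable q ∧ A.IsCycle q C ∧ t ∈ C

open Classical in
/-- The cost of a transition. -/
noncomputable def cost (t : Transition Q Γ) : ℚ≥0 :=
  if A.Critical t then
    if A.isInput t.src = true then
      if t.out = .svar' then 2 * A.d t.src + A.d' t.src else 2 * A.d t.src
    else A.d t.src
  else 0

/-- The sum of the costs of the transitions of a path. -/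
noncomputable def pathWeight (ts : List (Transition Q Γ)) : ℚ≥0 := (ts.map A.cost).sum

/-- The supremum of the weights of all paths, in `[0, ∞]`. -/
noncomputable def weight : EReal :=
  ⨆ (p : Q) (ts : List (Transition Q Γ)) (q : Q) (_ : A.IsPath p ts q), ((A.pathWeight ts : ℝ) : EReal)

end DiPA

/-! ## Random access machines

A machine has finitely many arrays of words (natural numbers) and finitely many arrays of (rational)
numbers; the cells `a[0]` serve as registers. Words can only be copied, compared, incremented and
decremented, and they index the arrays; so a word never exceeds the largest word of the program and
the input plus a constant times the number of steps. Numbers can only be copied, added and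
compared. -/

namespace RAM

/-- The memory: `word a i` is cell `i` of the word array `a`, `num a i` cell `i` of the number
array `a`. -/
structure Mem where
  word : ℕ → ℕ → ℕ
  num : ℕ → ℕ → ℚ

/-- Word expressions; `get a i` reads the cell `a[i]`. -/
inductive Expr
  | lit (c : ℕ)
  | get (a : ℕ) (i : Expr)
  | succ (e : Expr)
  | pred (e : Expr)

def Expr.eval (M : Mem) : Expr → ℕ
  | .lit c => c
  | .get a i => M.word a (i.eval M)
  | .succ e => e.eval M + 1
  | .pred e => e.eval M - 1

/-- Tests: (in)equality of words, comparison of two number cells, and Boolean combinations. -/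
inductive Test
  | eq (e₁ e₂ : Expr)
  | lt (e₁ e₂ : Expr)
  | numLt (a : ℕ) (i : Expr) (b : ℕ) (j : Expr)
  | not (t : Test)
  | and (t₁ t₂ : Test)

def Test.Holds (M : Mem) : Test → Prop
  | .eq e₁ e₂ => e₁.eval M = e₂.eval M
  | .lt e₁ e₂ => e₁.eval M < e₂.eval M
  | .numLt a i b j => M.num a (i.eval M) < M.num b (j.eval M)
  | .not t => ¬ t.Holds M
  | .and t₁ t₂ => t₁.Holds M ∧ t₂.Holds M

/-- The time for a test, if handling a number `r` takes time `κ r` on top of unit time. -/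
def Test.time (κ : ℚ → ℕ) (M : Mem) : Test → ℕ
  | .eq _ _ => 1
  | .lt _ _ => 1
  | .numLt a i b j => 1 + κ (M.num a (i.eval M)) + κ (M.num b (j.eval M))
  | .not t => 1 + t.time κ M
  | .and t₁ t₂ => 1 + t₁.time κ M + t₂.time κ M

/-- Programs. -/
inductive Prog
  | skip
  /-- `a[i] := e` for words. -/
  | set (a : ℕ) (i : Expr) (e : Expr)
  /-- `c[k] := a[i]` for numbers. -/
  | numCopy (c : ℕ) (k : Expr) (a : ℕ) (i : Expr)
  /-- `c[k] := a[i] + b[j]` for numbers. -/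
  | numAdd (c : ℕ) (k : Expr) (a : ℕ) (i : Expr) (b : ℕ) (j : Expr)
  | seq (P₁ P₂ : Prog)
  | ite (t : Test) (P₁ P₂ : Prog)
  | while (t : Test) (P : Prog)

def Mem.setWord (M : Mem) (a i v : ℕ) : Mem :=
  { M with word := Function.update M.word a (Function.update (M.word a) i v) }

def Mem.setNum (M : Mem) (a i : ℕ) (v : ℚ) : Mem :=
  { M with num := Function.update M.num a (Function.update (M.num a) i v) }

/-- `Runs κ P M n M'`: started in memory `M`, the program `P` halts after `n` steps in memory `M'`.
Every elementary command and every test takes one step, and handling a number `r` takes `κ r`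
additional steps. (The expressions have constant size for each program.) -/
inductive Runs (κ : ℚ → ℕ) : Prog → Mem → ℕ → Mem → Prop
  | skip (M : Mem) : Runs κ .skip M 1 M
  | set (M : Mem) (a : ℕ) (i e : Expr) :
      Runs κ (.set a i e) M 1 (M.setWord a (i.eval M) (e.eval M))
  | numCopy (M : Mem) (c : ℕ) (k : Expr) (a : ℕ) (i : Expr) :
      Runs κ (.numCopy c k a i) M (1 + κ (M.num a (i.eval M)))
        (M.setNum c (k.eval M) (M.num a (i.eval M)))
  | numAdd (M : Mem) (c : ℕ) (k : Expr) (a : ℕ) (i : Expr) (b : ℕ) (j : Expr) :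
      Runs κ (.numAdd c k a i b j) M (1 + κ (M.num a (i.eval M)) + κ (M.num b (j.eval M)))
        (M.setNum c (k.eval M) (M.num a (i.eval M) + M.num b (j.eval M)))
  | seq {P₁ P₂ : Prog} {M M₁ M₂ : Mem} {n₁ n₂ : ℕ} :
      Runs κ P₁ M n₁ M₁ → Runs κ P₂ M₁ n₂ M₂ → Runs κ (.seq P₁ P₂) M (n₁ + n₂) M₂
  | iteTrue {t : Test} {P₁ P₂ : Prog} {M M' : Mem} {n : ℕ} :
      t.Holds M → Runs κ P₁ M n M' → Runs κ (.ite t P₁ P₂) M (t.time κ M + n) M'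
  | iteFalse {t : Test} {P₁ P₂ : Prog} {M M' : Mem} {n : ℕ} :
      ¬ t.Holds M → Runs κ P₂ M n M' → Runs κ (.ite t P₁ P₂) M (t.time κ M + n) M'
  | whileTrue {t : Test} {P : Prog} {M M₁ M₂ : Mem} {n₁ n₂ : ℕ} :
      t.Holds M → Runs κ P M n₁ M₁ → Runs κ (.while t P) M₁ n₂ M₂ →
        Runs κ (.while t P) M (t.time κ M + n₁ + n₂) M₂
  | whileFalse {t : Test} {P : Prog} {M : Mem} :
      ¬ t.Holds M → Runs κ (.while t P) M (t.time κ M) M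

/-- A program has at most one halting run from a given memory. -/
theorem Runs.unique {κ : ℚ → ℕ} {P : Prog} {M M₁ M₂ : Mem} {n₁ n₂ : ℕ}
    (h₁ : Runs κ P M n₁ M₁) (h₂ : Runs κ P M n₂ M₂) : n₁ = n₂ ∧ M₁ = M₂ := by
  induction h₁ generalizing n₂ M₂ with
  | skip | set | numCopy | numAdd => cases h₂; exact ⟨rfl, rfl⟩
  | seq _ _ ih₁ ih₂ =>
    cases h₂ with
    | seq k₁ k₂ =>
      obtain ⟨rfl, rfl⟩ := ih₁ k₁
      obtain ⟨rfl, rfl⟩ := ih₂ k₂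
      exact ⟨rfl, rfl⟩
  | iteTrue ht _ ih =>
    cases h₂ with
    | iteTrue _ k => obtain ⟨rfl, rfl⟩ := ih k; exact ⟨rfl, rfl⟩
    | iteFalse hf _ => exact absurd ht hf
  | iteFalse hf _ ih =>
    cases h₂ with
    | iteTrue ht _ => exact absurd ht hf
    | iteFalse _ k => obtain ⟨rfl, rfl⟩ := ih k; exact ⟨rfl, rfl⟩
  | whileTrue ht _ _ ih₁ ih₂ =>
    cases h₂ with
    | whileTrue _ k₁ k₂ =>
      obtain ⟨rfl, rfl⟩ := ih₁ k₁
      obtain ⟨rfl, rfl⟩ := ih₂ k₂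
      exact ⟨rfl, rfl⟩
    | whileFalse hf => exact absurd ht hf
  | whileFalse hf =>
    cases h₂ with
    | whileTrue ht _ _ => exact absurd ht hf
    | whileFalse _ => exact ⟨rfl, rfl⟩

/-- The number of bits of numerator and denominator. -/
def bitLength (r : ℚ) : ℕ := Nat.size r.num.natAbs + Nat.size r.den

/-- The cost of numbers when copying, addition and comparison of numbers take unit time. -/
def unitCost : ℚ → ℕ := fun _ => 0

end RAM

/-! ## Automata as inputs of machines -/

/-- Outputs as words: `svar`, `svar'`, and then the symbols. -/
def Out.code {m : ℕ} : Out (Fin m) → ℕ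
  | .svar => 0
  | .svar' => 1
  | .sym g => g + 2

/-- The transition table of an automaton, as words, for a state and a guard: the successor state
plus one (`0` if there is no transition), the code of the output, and the assignment bit. -/
def entryCode {n m : ℕ} : Option (Fin n × Out (Fin m) × Bool) → ℕ × ℕ × ℕ
  | none => (0, 0, 0)
  | some (q, o, b) => (q + 1, o.code, b.toNat)

namespace DiPA

/-- The word arrays that hold an automaton with `n` states and `m` output symbols. Array `0` holds
`n`, `m` and the initial state, array `1` the partition into input and non-input states, and the
arrays `2,3,4`, `5,6,7`, `8,9,10` the transition table for the guards `true`, `≥`, `<`. -/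
def encodeWord {n m : ℕ} (A : DiPA (Fin n) (Fin m)) (a i : ℕ) : ℕ :=
  if a = 0 then
    (if i = 0 then n else if i = 1 then m else if i = 2 then (A.init : ℕ) else 0)
  else if h : i < n then
    match a with
    | 1 => (A.isInput ⟨i, h⟩).toNat
    | 2 => (entryCode (A.δ ⟨i, h⟩ .tt)).1
    | 3 => (entryCode (A.δ ⟨i, h⟩ .tt)).2.1
    | 4 => (entryCode (A.δ ⟨i, h⟩ .tt)).2.2
    | 5 => (entryCode (A.δ ⟨i, h⟩ .ge)).1
    | 6 => (entryCode (A.δ ⟨i, h⟩ .ge)).2.1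
    | 7 => (entryCode (A.δ ⟨i, h⟩ .ge)).2.2
    | 8 => (entryCode (A.δ ⟨i, h⟩ .lt)).1
    | 9 => (entryCode (A.δ ⟨i, h⟩ .lt)).2.1
    | 10 => (entryCode (A.δ ⟨i, h⟩ .lt)).2.2
    | _ => 0
  else 0

/-- The number arrays `0,1,2,3` hold the parameters `d`, `μ`, `d'`, `μ'` of the states. -/
def encodeNum {n m : ℕ} (A : DiPA (Fin n) (Fin m)) (a i : ℕ) : ℚ :=
  if h : i < n then
    match a with
    | 0 => (A.d ⟨i, h⟩ : ℚ)
    | 1 => A.μ ⟨i, h⟩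
    | 2 => (A.d' ⟨i, h⟩ : ℚ)
    | 3 => A.μ' ⟨i, h⟩
    | _ => 0
  else 0

/-- The initial memory of a machine whose input is `A`; all other cells are zero. -/
def encode {n m : ℕ} (A : DiPA (Fin n) (Fin m)) : RAM.Mem where
  word := A.encodeWord
  num := A.encodeNum

/-- The number of states plus the number of transitions. -/
def size {n m : ℕ} (A : DiPA (Fin n) (Fin m)) : ℕ :=
  n + (Finset.univ.filter fun p : Fin n × Guard => (A.δ p.1 p.2).isSome).card

/-- The size of an automaton including the number of bits of its parameters. -/
def bitSize {n m : ℕ} (A : DiPA (Fin n) (Fin m)) : ℕ :=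
  A.size + ∑ q, (RAM.bitLength (A.d q) + RAM.bitLength (A.μ q) + RAM.bitLength (A.d' q) +
    RAM.bitLength (A.μ' q))

end DiPA

open scoped BigOperators
open MeasureTheory

/-! ### The Laplace density -/

/-! When all samples come from distributions with positive parameters, differential privacy is
equivalent to well-formedness. Well-formedness is a statement about reachability in a graph with at
most three edges per state, so linear-time graph search decides it.

Well-formed implies private (`WellFormed.pathProb_le`). Two executions with adjacent inputs are
compared by translating the samples, so that the second stored value is the first one moved by r ∈
{-1, 0, 1}. A transition that occurs again later must be free of charge: its sample moves exactly
with its input, and its guard survives only if the stored value moves a full unit in the favourable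
direction. A transition that outputs σ keeps its sample at its last occurrence, so r must not point
in the unfavourable direction. `Compatible` collects these demands of the rest of the path. At an
assignment a new shift can be chosen that meets them (`WellFormed.exists_compatible`), because
conflicting demands would form a leaking pair or a violating path. Each transition is then charged
only at its last occurrence, by at most 2d + d', and the total does not depend on the length of the
path (`budget_le`).

Private implies well-formed (`DifferentiallyPrivate.wellFormed`); the single budget ε = 1 suffices.
Along any path, inputs and output intervals can be chosen such that every sample falls into a window
around its mean with probability at least 1 - η. If a forbidden pattern exists, changing the inputs
by a bounded amount makes each of ℓ traversals of a cycle improbable, with total probability at most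
(2η)^ℓ. The bounded change costs a constant factor under differential privacy, while the original
probability is at least a constant times ((1 - η)^2)^(n₁ℓ); for small η this is a contradiction
(`not_differentiallyPrivate_of_runs`).

A Laplace density with parameter 0 vanishes identically, so transitions that sample from it have
probability 0 and can be deleted (`differentiallyPrivate_iff`). Comparing the parameters d and d'
with 0 is the only use of rational numbers in the decision procedures, which explains the two
measures of size.

For the algorithms, an edge lies on a cycle iff it stays within a strongly connected component, and
a state lies on a G-cycle iff its component contains an edge with guard ≥. The path-based algorithm
finds the components in linear time (`scc_rule`), and a fixed number of passes and searches along
AG-edges and AL-edges finishes the test (`wfCheck_rule`).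

The weight is infinite iff some unreachable cycle contains a transition of positive cost. Otherwise
edges within components cost nothing, and the weight is the length of a longest path in the acyclic
graph of components, found by relaxing edges in the order in which the components were completed
(`relaxLoop_rule`, `weight_eq`). -/

theorem lapDensity_nonneg {k : ℝ} (hk : 0 ≤ k) (m z : ℝ) : 0 ≤ lapDensity k m z := by
  unfold lapDensity; positivity

theorem continuous_lapDensity (k m : ℝ) : Continuous (lapDensity k m) := by
  unfold lapDensity; fun_prop

/-- By the triangle inequality, the exponent changes by at most k times the displacement of the
point relative to the mean. Every loss of privacy below is an instance of this; a point that moves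
along with its mean costs nothing. -/
theorem lapDensity_le {k : ℝ} (hk : 0 ≤ k) {m m' z z' w : ℝ} (h : |(z' - m') - (z - m)| ≤ w) :
    lapDensity k m z ≤ Real.exp (k * w) * lapDensity k m' z' := by
  unfold lapDensity
  rw [mul_left_comm, ← Real.exp_add]
  have h1 : |z' - m'| ≤ |z - m| + w := by
    have := abs_sub_abs_le_abs_sub (z' - m') (z - m)
    linarith
  gcongr
  nlinarith

/-- Beyond the mean the density is a pure exponential. T = 0 gives half of the total mass, and large
T the estimates for windows. -/
theorem lapDensity_tail_right {k : ℝ} (hk : 0 < k) (m : ℝ) {T : ℝ} (hT : 0 ≤ T) :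
    IntegrableOn (lapDensity k m) (Set.Ioi (m + T)) ∧
      ∫ z in Set.Ioi (m + T), lapDensity k m z = Real.exp (-(k * T)) / 2 := by
  have h : Set.EqOn (lapDensity k m) (fun z => k / 2 * Real.exp (k * m) * Real.exp (-k * z))
      (Set.Ioi (m + T)) := by
    intro z hz
    have hz' : m + T < z := hz
    simp only [lapDensity]
    rw [abs_of_nonneg (by linarith), mul_assoc, ← Real.exp_add]
    congr 2; ring
  constructor
  · refine IntegrableOn.congr_fun ?_ h.symm measurableSet_Ioi
    exact (integrableOn_exp_mul_Ioi (by linarith) _).const_mul _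
  · rw [setIntegral_congr_fun measurableSet_Ioi h, integral_const_mul,
      integral_exp_mul_Ioi (by linarith)]
    have : Real.exp (-k * (m + T)) = Real.exp (-(k * T)) * (Real.exp (k * m))⁻¹ := by
      rw [← Real.exp_neg, ← Real.exp_add]; congr 1; ring
    rw [this]
    have := Real.exp_pos (k * m)
    field_simp

theorem lapDensity_tail_left {k : ℝ} (hk : 0 < k) (m : ℝ) {T : ℝ} (hT : 0 ≤ T) :
    IntegrableOn (lapDensity k m) (Set.Iic (m - T)) ∧
      ∫ z in Set.Iic (m - T), lapDensity k m z = Real.exp (-(k * T)) / 2 := by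
  have h : Set.EqOn (lapDensity k m) (fun z => k / 2 * Real.exp (-(k * m)) * Real.exp (k * z))
      (Set.Iic (m - T)) := by
    intro z hz
    have hz' : z ≤ m - T := hz
    simp only [lapDensity]
    rw [abs_of_nonpos (by linarith), mul_assoc, ← Real.exp_add]
    congr 2; ring
  constructor
  · refine IntegrableOn.congr_fun ?_ h.symm measurableSet_Iic
    exact (integrableOn_exp_mul_Iic hk _).const_mul _
  · rw [setIntegral_congr_fun measurableSet_Iic h, integral_const_mul,
      integral_exp_mul_Iic hk]
    have : Real.exp (k * (m - T)) = Real.exp (-(k * T)) * (Real.exp (-(k * m)))⁻¹ := by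
      rw [← Real.exp_neg, ← Real.exp_add]; congr 1; ring
    rw [this]
    have := Real.exp_pos (-(k * m))
    field_simp

theorem integrable_lapDensity {k : ℝ} (hk : 0 ≤ k) (m : ℝ) : Integrable (lapDensity k m) := by
  -- The parameter 0 is allowed. The density is then identically zero, so its total mass is 0 and
  -- not 1.
  rcases hk.eq_or_lt with rfl | hk
  · have : lapDensity 0 m = fun _ => 0 := by ext; simp [lapDensity]
    rw [this]; exact integrable_zero _ _ _
  have h1 := (lapDensity_tail_left hk m le_rfl).1
  have h2 := (lapDensity_tail_right hk m le_rfl).1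
  simp only [sub_zero, add_zero] at h1 h2
  rw [← integrableOn_univ, ← Set.Iic_union_Ioi (a := m)]
  exact h1.union h2

theorem integral_lapDensity {k : ℝ} (hk : 0 < k) (m : ℝ) : ∫ z, lapDensity k m z = 1 := by
  have h1 := lapDensity_tail_left hk m le_rfl
  have h2 := lapDensity_tail_right hk m le_rfl
  simp only [sub_zero, add_zero, mul_zero, neg_zero, Real.exp_zero] at h1 h2
  rw [← setIntegral_univ, ← Set.Iic_union_Ioi (a := m),
    setIntegral_union (Set.Iic_disjoint_Ioi le_rfl) measurableSet_Ioi h1.1 h2.1, h1.2, h2.2]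
  norm_num

theorem integral_lapDensity_le_one {k : ℝ} (hk : 0 ≤ k) (m : ℝ) : ∫ z, lapDensity k m z ≤ 1 := by
  rcases hk.eq_or_lt with rfl | hk
  · simp [lapDensity]
  · exact (integral_lapDensity hk m).le

/-- A product of a Laplace density with a measurable function bounded by `1`. -/
theorem integrable_lapDensity_mul {k : ℝ} (hk : 0 ≤ k) (m : ℝ) {g : ℝ → ℝ} (hg : Measurable g)
    (h0 : ∀ z, 0 ≤ g z) (h1 : ∀ z, g z ≤ 1) : Integrable fun z => lapDensity k m z * g z := by
  refine (integrable_lapDensity hk m).mono'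
    ((continuous_lapDensity k m).measurable.mul hg).aestronglyMeasurable (ae_of_all _ fun z => ?_)
  rw [Real.norm_of_nonneg (mul_nonneg (lapDensity_nonneg hk _ _) (h0 z))]
  exact mul_le_of_le_one_right (lapDensity_nonneg hk _ _) (h1 z)

theorem setIntegral_lapDensity_nonneg {k : ℝ} (hk : 0 ≤ k) (m : ℝ) (I : Set ℝ) :
    0 ≤ ∫ z in I, lapDensity k m z :=
  integral_nonneg fun _ => lapDensity_nonneg hk _ _

theorem setIntegral_lapDensity_le_one {k : ℝ} (hk : 0 ≤ k) (m : ℝ) (I : Set ℝ) :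
    ∫ z in I, lapDensity k m z ≤ 1 :=
  (setIntegral_le_integral (integrable_lapDensity hk m)
    (ae_of_all _ fun _ => lapDensity_nonneg hk _ _)).trans (integral_lapDensity_le_one hk m)

/-- The probability of a set that is far above or below the mean. -/
theorem setIntegral_lapDensity_far {k : ℝ} (hk : 0 < k) {m T : ℝ} (hT : 0 ≤ T) {I : Set ℝ}
    (hI : I ⊆ Set.Ici (m + T) ∨ I ⊆ Set.Iic (m - T)) :
    ∫ z in I, lapDensity k m z ≤ Real.exp (-(k * T)) := by
  have key : ∀ J : Set ℝ, I ⊆ J → ∫ z in I, lapDensity k m z ≤ ∫ z in J, lapDensity k m z :=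
    fun J hJ => setIntegral_mono_set (integrable_lapDensity hk.le m).integrableOn
      (ae_of_all _ fun _ => lapDensity_nonneg hk.le _ _) (ae_of_all _ hJ)
  have hp := Real.exp_pos (-(k * T))
  rcases hI with hI | hI
  · refine (key _ hI).trans ?_
    rw [integral_Ici_eq_integral_Ioi, (lapDensity_tail_right hk m hT).2]; linarith
  · refine (key _ hI).trans ?_
    rw [(lapDensity_tail_left hk m hT).2]; linarith

/-- The probability of the window of radius `T` around the mean. -/
theorem setIntegral_lapDensity_window {k : ℝ} (hk : 0 < k) (m : ℝ) {T : ℝ} (hT : 0 < T) {I : Set ℝ}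
    (hm : MeasurableSet I) (hI : Set.Ioo (m - T) (m + T) ⊆ I) :
    1 - Real.exp (-(k * T)) ≤ ∫ z in I, lapDensity k m z := by
  have h1 := lapDensity_tail_left hk m hT.le
  have h2 := lapDensity_tail_right hk m hT.le
  have h3 := integral_add_compl hm (integrable_lapDensity hk.le m)
  rw [integral_lapDensity hk] at h3
  -- The complement of the window lies in two tails, each of mass exp(-kT)/2.
  have h4 : ∫ z in Iᶜ, lapDensity k m z ≤ ∫ z in Set.Iic (m - T) ∪ Set.Ici (m + T), lapDensity k m z := by
    refine setIntegral_mono_set (integrable_lapDensity hk.le m).integrableOn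
      (ae_of_all _ fun _ => lapDensity_nonneg hk.le _ _) (ae_of_all _ ?_)
    intro z hz
    by_contra hc
    exact hz (hI ⟨lt_of_not_ge fun h => hc (Or.inl h), lt_of_not_ge fun h => hc (Or.inr h)⟩)
  have h5 := setIntegral_union (μ := volume) (f := lapDensity k m)
    (Set.Iic_disjoint_Ici.2 (by linarith : ¬ m + T ≤ m - T)) measurableSet_Ici h1.1
    (integrable_lapDensity hk.le m).integrableOn
  rw [integral_Ici_eq_integral_Ioi, h1.2, h2.2] at h5
  linarith

theorem measurableSet_openInterval (v w : EReal) : MeasurableSet (openInterval v w) :=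
  ((measurable_coe_real_ereal measurableSet_Ioi).inter
    (measurable_coe_real_ereal measurableSet_Iio) : _)

/-! ### Path probabilities -/

/-- The values of `svar` which satisfy the guard and lie in the interval. -/
def Step.sampleSet {Q Γ : Type*} (s : Step Q Γ) (x : ℝ) : Set ℝ :=
  {z | s.tr.guard.Holds x z ∧ s.lab.Admits z}

theorem Label.measurableSet_admits {Γ : Type*} (l : Label Γ) : MeasurableSet {z | l.Admits z} := by
  rcases l with g | ⟨_ | _, v, w⟩
  · simp [Label.Admits]
  · exact measurableSet_openInterval v w
  · simp [Label.Admits]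

/-- Joint measurability in the stored value and the sample makes the integrals over the fibres
measurable in the stored value. -/
theorem Step.measurableSet_sampleSet_prod {Q Γ : Type*} (s : Step Q Γ) :
    MeasurableSet {p : ℝ × ℝ | p.2 ∈ s.sampleSet p.1} := by
  refine MeasurableSet.inter (s₁ := {p : ℝ × ℝ | s.tr.guard.Holds p.1 p.2})
    (s₂ := {p : ℝ × ℝ | s.lab.Admits p.2}) ?_ (measurable_snd s.lab.measurableSet_admits)
  cases s.tr.guard
  · simp [Guard.Holds]
  · exact measurableSet_le measurable_fst measurable_snd
  · exact measurableSet_lt measurable_snd measurable_fst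

theorem Step.measurableSet_sampleSet {Q Γ : Type*} (s : Step Q Γ) (x : ℝ) :
    MeasurableSet (s.sampleSet x) :=
  measurable_prodMk_left (x := x) s.measurableSet_sampleSet_prod

theorem Step.measurable_integral_sampleSet {Q Γ : Type*} (s : Step Q Γ) {h : ℝ → ℝ}
    (hh : Measurable h) : Measurable fun x => ∫ z in s.sampleSet x, h z := by
  have h1 : (fun x => ∫ z in s.sampleSet x, h z) = fun x => ∫ z,
      ({p : ℝ × ℝ | p.2 ∈ s.sampleSet p.1}.indicator fun p => h p.2) (x, z) := by
    ext x
    rw [← integral_indicator (s.measurableSet_sampleSet x)]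
    rfl
  rw [h1]
  exact (((hh.comp measurable_snd).indicator
    s.measurableSet_sampleSet_prod).stronglyMeasurable.integral_prod_right').measurable

namespace DiPA

variable {Q Γ : Type*} (A : DiPA Q Γ)

/-- The density of `svar` in a step. -/
noncomputable def dens (ε : ℝ) (s : Step Q Γ) : ℝ → ℝ :=
  lapDensity (A.d s.tr.src * ε) (A.μ s.tr.src + s.inp.getD 0)

/-- The probability that `svar'` lies in its interval. -/
noncomputable def primeFactor (ε : ℝ) (s : Step Q Γ) : ℝ :=
  match s.lab with
  | .real true v w =>
    ∫ z in openInterval v w, lapDensity (A.d' s.tr.src * ε) (A.μ' s.tr.src + s.inp.getD 0) z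
  | _ => 1

open Classical in
/-- The factor which a step that is no assignment contributes for `svar`. -/
noncomputable def guardFactor (ε : ℝ) (s : Step Q Γ) (x : ℝ) : ℝ :=
  if s.tr.guard = .tt ∧ s.lab.out ≠ .svar then 1 else ∫ z in s.sampleSet x, A.dens ε s z

/-- With `primeFactor` and `guardFactor` split off, the recursion has only two shapes: an assignment
integrates over the new stored value, and any other step multiplies by a factor and keeps the old
one. -/
theorem pathProb_cons_asg (ε : ℝ) (s : Step Q Γ) (ρ : List (Step Q Γ)) (x : ℝ)
    (h : s.tr.asg = true) : A.pathProb ε (s :: ρ) x =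
      A.primeFactor ε s * ∫ z in s.sampleSet x, A.dens ε s z * A.pathProb ε ρ z := by
  obtain ⟨⟨p, c, q, o, b⟩, i, l⟩ := s
  simp only at h
  subst h
  rcases l with g | ⟨_ | _, v, w⟩ <;> rfl

theorem pathProb_cons_of_not_asg (ε : ℝ) (s : Step Q Γ) (ρ : List (Step Q Γ)) (x : ℝ)
    (h : s.tr.asg = false) : A.pathProb ε (s :: ρ) x =
      A.primeFactor ε s * A.guardFactor ε s x * A.pathProb ε ρ x := by
  obtain ⟨⟨p, c, q, o, b⟩, i, l⟩ := s
  simp only at h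
  subst h
  rcases l with g | ⟨_ | _, v, w⟩ <;> cases c <;>
    simp [pathProb, primeFactor, guardFactor, Label.out, dens, Step.sampleSet]

variable {A} {ε : ℝ}

theorem scale_nonneg (hε : 0 ≤ ε) (q : Q) : (0 : ℝ) ≤ A.d q * ε :=
  mul_nonneg (by exact_mod_cast (A.d q).2) hε

theorem scale'_nonneg (hε : 0 ≤ ε) (q : Q) : (0 : ℝ) ≤ A.d' q * ε :=
  mul_nonneg (by exact_mod_cast (A.d' q).2) hε

theorem dens_nonneg (hε : 0 ≤ ε) (s : Step Q Γ) (z : ℝ) : 0 ≤ A.dens ε s z :=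
  lapDensity_nonneg (scale_nonneg hε _) _ _

theorem primeFactor_nonneg (hε : 0 ≤ ε) (s : Step Q Γ) : 0 ≤ A.primeFactor ε s := by
  unfold primeFactor
  split
  · exact setIntegral_lapDensity_nonneg (scale'_nonneg hε _) _ _
  · exact zero_le_one

theorem primeFactor_le_one (hε : 0 ≤ ε) (s : Step Q Γ) : A.primeFactor ε s ≤ 1 := by
  unfold primeFactor
  split
  · exact setIntegral_lapDensity_le_one (scale'_nonneg hε _) _ _
  · exact le_rfl

theorem guardFactor_nonneg (hε : 0 ≤ ε) (s : Step Q Γ) (x : ℝ) : 0 ≤ A.guardFactor ε s x := by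
  unfold guardFactor
  split
  · exact zero_le_one
  · exact setIntegral_lapDensity_nonneg (scale_nonneg hε _) _ _

theorem guardFactor_le_one (hε : 0 ≤ ε) (s : Step Q Γ) (x : ℝ) : A.guardFactor ε s x ≤ 1 := by
  unfold guardFactor
  split
  · exact le_rfl
  · exact setIntegral_lapDensity_le_one (scale_nonneg hε _) _ _

/-- The three facts need a common induction: integrability of a density times the probability of the
rest, used for the bound 1, rests on measurability and boundedness of the rest. -/
theorem pathProb_props (hε : 0 ≤ ε) (ρ : List (Step Q Γ)) :
    Measurable (A.pathProb ε ρ) ∧ (∀ x, 0 ≤ A.pathProb ε ρ x) ∧ ∀ x, A.pathProb ε ρ x ≤ 1 := by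
  induction ρ with
  | nil => exact ⟨measurable_const, fun _ => zero_le_one, fun _ => le_rfl⟩
  | cons s ρ ih =>
    obtain ⟨hm, h0, h1⟩ := ih
    have hd : Measurable (A.dens ε s) := (continuous_lapDensity _ _).measurable
    cases hs : s.tr.asg
    · have he : A.pathProb ε (s :: ρ) =
          fun x => A.primeFactor ε s * A.guardFactor ε s x * A.pathProb ε ρ x :=
        funext fun x => A.pathProb_cons_of_not_asg ε s ρ x hs
      rw [he]
      refine ⟨?_, fun x => ?_, fun x => ?_⟩
      · refine (Measurable.const_mul ?_ _).mul hm
        unfold guardFactor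
        split
        · exact measurable_const
        · exact s.measurable_integral_sampleSet hd
      · exact mul_nonneg (mul_nonneg (primeFactor_nonneg hε s) (guardFactor_nonneg hε s x)) (h0 x)
      · exact mul_le_one₀ (mul_le_one₀ (primeFactor_le_one hε s) (guardFactor_nonneg hε s x)
          (guardFactor_le_one hε s x)) (h0 x) (h1 x)
    · have he : A.pathProb ε (s :: ρ) =
          fun x => A.primeFactor ε s * ∫ z in s.sampleSet x, A.dens ε s z * A.pathProb ε ρ z :=
        funext fun x => A.pathProb_cons_asg ε s ρ x hs
      rw [he]
      have hnn : ∀ z, 0 ≤ A.dens ε s z * A.pathProb ε ρ z :=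
        fun z => mul_nonneg (dens_nonneg hε s z) (h0 z)
      refine ⟨?_, fun x => ?_, fun x => ?_⟩
      · exact (s.measurable_integral_sampleSet (hd.mul hm)).const_mul _
      · exact mul_nonneg (primeFactor_nonneg hε s) (integral_nonneg fun z => hnn z)
      · refine mul_le_one₀ (primeFactor_le_one hε s) (integral_nonneg fun z => hnn z) ?_
        have hi := integrable_lapDensity (scale_nonneg (A := A) hε s.tr.src) (A.μ s.tr.src + s.inp.getD 0)
        calc _ ≤ ∫ z in s.sampleSet x, A.dens ε s z :=
              setIntegral_mono (integrable_lapDensity_mul (scale_nonneg hε _) _ hm h0 h1).integrableOn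
                hi.integrableOn fun z => mul_le_of_le_one_right (dens_nonneg hε s z) (h1 z)
          _ ≤ 1 := setIntegral_lapDensity_le_one (scale_nonneg hε _) _ _

theorem measurable_pathProb (hε : 0 ≤ ε) (ρ : List (Step Q Γ)) : Measurable (A.pathProb ε ρ) :=
  (pathProb_props hε ρ).1

theorem pathProb_nonneg (hε : 0 ≤ ε) (ρ : List (Step Q Γ)) (x : ℝ) : 0 ≤ A.pathProb ε ρ x :=
  (pathProb_props hε ρ).2.1 x

theorem pathProb_le_one (hε : 0 ≤ ε) (ρ : List (Step Q Γ)) (x : ℝ) : A.pathProb ε ρ x ≤ 1 :=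
  (pathProb_props hε ρ).2.2 x

theorem integrable_dens_mul_pathProb (hε : 0 ≤ ε) (s : Step Q Γ) (ρ : List (Step Q Γ)) :
    Integrable fun z => A.dens ε s z * A.pathProb ε ρ z :=
  integrable_lapDensity_mul (scale_nonneg hε _) _ (measurable_pathProb hε ρ) (pathProb_nonneg hε ρ)
    (pathProb_le_one hε ρ)

end DiPA

/-! ### Paths and cycles -/

/-- Exchanges `≥` and `<`. -/
def Guard.dual : Guard → Guard
  | .tt => .tt
  | .ge => .lt
  | .lt => .ge

theorem Guard.dual_dual (g : Guard) : g.dual.dual = g := by cases g <;> rfl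

theorem Guard.dual_ne {g : Guard} (hg : g ≠ .tt) : g.dual ≠ g := by cases g <;> simp_all [Guard.dual]

theorem Guard.dual_ne_tt {g : Guard} (hg : g ≠ .tt) : g.dual ≠ .tt := by
  cases g <;> simp_all [Guard.dual]

theorem Guard.eq_or_eq_dual {g h : Guard} (hg : g ≠ .tt) (hh : h ≠ .tt) : h = g ∨ h = g.dual := by
  cases g <;> cases h <;> simp_all [Guard.dual]

/-- The direction in which the stored value has to move to make the guard more likely. -/
def Guard.sgn : Guard → ℝ
  | .tt => 0
  | .ge => -1
  | .lt => 1

theorem Guard.sgn_dual (g : Guard) : g.dual.sgn = -g.sgn := by cases g <;> simp [Guard.dual, Guard.sgn]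

theorem Guard.sgn_mul_sgn {g : Guard} (hg : g ≠ .tt) : g.sgn * g.sgn = 1 := by
  cases g <;> simp_all [Guard.sgn]

namespace DiPA

variable {Q Γ : Type*} {A : DiPA Q Γ}

theorem isPath_append {p q : Q} {ts us : List (Transition Q Γ)} :
    A.IsPath p (ts ++ us) q ↔ ∃ r, A.IsPath p ts r ∧ A.IsPath r us q := by
  induction ts generalizing p with
  | nil => simp [IsPath]
  | cons t ts ih => simp only [List.cons_append, IsPath, ih]; tauto

theorem isPath_singleton {p : Q} {t : Transition Q Γ} :
    A.IsTransition t → t.src = p → A.IsPath p [t] t.dst := fun h hp => ⟨h, hp, rfl⟩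

theorem IsPath.isTransition {p q : Q} {ts : List (Transition Q Γ)} (h : A.IsPath p ts q) :
    ∀ t ∈ ts, A.IsTransition t := by
  induction ts generalizing p with
  | nil => simp
  | cons t ts ih =>
    simp only [IsPath] at h
    simp only [List.mem_cons, forall_eq_or_imp]
    exact ⟨h.1, ih h.2.2⟩

theorem Reachable.trans {p q : Q} {ts : List (Transition Q Γ)} (h : A.Reachable p)
    (hp : A.IsPath p ts q) : A.Reachable q := by
  obtain ⟨us, hu⟩ := h
  exact ⟨us ++ ts, isPath_append.2 ⟨p, hu, hp⟩⟩

theorem AssignsOnly.append {g : Guard} {ts us : List (Transition Q Γ)} (h : AssignsOnly g ts)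
    (h' : AssignsOnly g us) : AssignsOnly g (ts ++ us) := by
  intro t ht
  rcases List.mem_append.1 ht with ht | ht
  exacts [h t ht, h' t ht]

theorem AssignsOnly.cons {g : Guard} {t : Transition Q Γ} {us : List (Transition Q Γ)}
    (h : t.asg = true → t.guard = g) (h' : AssignsOnly g us) : AssignsOnly g (t :: us) := by
  intro u hu
  rcases List.mem_cons.1 hu with rfl | hu
  exacts [h, h' u hu]

theorem IsCycle.append_self {q : Q} {C : List (Transition Q Γ)} (h : A.IsCycle q C) :
    A.IsCycle q (C ++ C) :=
  ⟨by simpa using h.1, isPath_append.2 ⟨q, h.2, h.2⟩⟩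

/-- The cycle rotated to one of its transitions. -/
theorem IsCycle.rotate {p : Q} {C : List (Transition Q Γ)} (h : A.IsCycle p C) {t : Transition Q Γ}
    (ht : t ∈ C) : ∃ D, A.IsCycle t.src (t :: D) ∧ ∀ u, u ∈ C ↔ u ∈ t :: D := by
  obtain ⟨c₁, c₂, rfl⟩ := List.append_of_mem ht
  obtain ⟨r, h1, h2⟩ := isPath_append.1 h.2
  have hr : t.src = r := h2.2.1
  subst hr
  refine ⟨c₂ ++ c₁, ⟨by simp, ?_⟩, fun u => ?_⟩
  · have := isPath_append.2 ⟨p, h2, h1⟩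
    simpa using this
  · simp only [List.mem_append, List.mem_cons]; tauto

/-- A cycle can be rotated so that it starts in any of its states. -/
theorem inCycle_iff {g : Guard} {q : Q} : A.InCycle g q ↔ ∃ C, A.IsCycle q C ∧ HasGuard g C := by
  constructor
  · rintro ⟨p, C, hC, ⟨u, hu, hg⟩, t, ht, rfl⟩
    obtain ⟨D, hD, hm⟩ := hC.rotate ht
    exact ⟨_, hD, u, (hm u).1 hu, hg⟩
  · rintro ⟨C, hC, hg⟩
    refine ⟨q, C, hC, hg, ?_⟩
    obtain ⟨h0, hp⟩ := hC
    cases C with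
    | nil => exact absurd rfl h0
    | cons t C => exact ⟨t, by simp, hp.2.1⟩

/-- A transition that occurs again closes a cycle. -/
theorem isCycle_of_mem {p q : Q} {t : Transition Q Γ} {ts : List (Transition Q Γ)}
    (h : A.IsPath p (t :: ts) q) (ht : t ∈ ts) :
    ∃ pre post, ts = pre ++ t :: post ∧ A.IsCycle p (t :: pre) := by
  obtain ⟨pre, post, rfl⟩ := List.append_of_mem ht
  refine ⟨pre, post, rfl, by simp, ?_⟩
  obtain ⟨r, h1, h2⟩ := isPath_append (ts := t :: pre).1 h
  have e1 : t.src = r := h2.2.1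
  have e2 : t.src = p := h.2.1
  rw [← e1, e2] at h1
  exact h1

/-- Quantifying over g and its dual covers both variants of a leaking pair at once, and the cycles
are replaced by states that lie on them. -/
theorem WellFormed.not_leakingPair (hA : A.WellFormed) {g : Guard} (hg : g ≠ .tt) {p q : Q}
    {ts : List (Transition Q Γ)} (hp : A.Reachable p) (hc : A.InCycle g.dual p) (h : A.IsPath p ts q)
    (ha : AssignsOnly g ts) (hq : A.InCycle g q) : False := by
  obtain ⟨C, hC, hCg⟩ := inCycle_iff.1 hc
  obtain ⟨C', hC', hCg'⟩ := inCycle_iff.1 hq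
  have h1 : ∃ t ∈ C, t.src = p := by
    obtain ⟨h0, hp⟩ := hC
    cases C with
    | nil => exact absurd rfl h0
    | cons t C => exact ⟨t, by simp, hp.2.1⟩
  have h2 : ∃ t ∈ C', t.src = q := by
    obtain ⟨h0, hp⟩ := hC'
    cases C' with
    | nil => exact absurd rfl h0
    | cons t C => exact ⟨t, by simp, hp.2.1⟩
  obtain ⟨t, ht, rfl⟩ := h1
  obtain ⟨t', ht', rfl⟩ := h2
  refine hA.2.1 _ C _ C' hp hC hC' ?_
  cases g with
  | tt => exact absurd rfl hg
  | ge => exact Or.inl ⟨hCg, hCg', t, ht, t', ht', ts, h, ha⟩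
  | lt => exact Or.inr ⟨hCg, hCg', t, ht, t', ht', ts, h, ha⟩

theorem WellFormed.not_violatingFor (hA : A.WellFormed) {g : Guard} (hg : g ≠ .tt) {p q : Q}
    {ts : List (Transition Q Γ)} (hp : A.Reachable p) (h : A.IsPath p ts q) :
    ¬ A.ViolatingFor g g.dual p ts q := by
  have := hA.2.2.2 p ts q hp h
  cases g with
  | tt => exact absurd rfl hg
  | ge => exact this.1
  | lt => exact this.2

/-- Going round the cycle twice puts every transition of the cycle after the assignment, namely in
the second copy. -/
theorem guard_eq_tt_of_not_leaking
    (hA : ∀ q C, A.Reachable q → A.IsCycle q C → ¬ Leaking C) {p : Q} {t : Transition Q Γ}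
    {C : List (Transition Q Γ)} (hp : A.Reachable p) (hC : A.IsCycle p (t :: C))
    (ht : t.asg = true) : ∀ u ∈ t :: C, u.guard = .tt := by
  intro u hu
  by_contra hne
  refine hA _ _ hp hC.append_self ?_
  obtain ⟨j, hj, rfl⟩ := List.getElem_of_mem hu
  refine ⟨0, (t :: C).length + j, by simp only [List.length_cons]; omega, by simp only [List.length_append]; omega,
    by simpa using ht, ?_⟩
  rw [List.getElem_append_right (by omega)]
  simpa using hne

theorem WellFormed.out_of_mem (hA : A.WellFormed) {p : Q} {t : Transition Q Γ}
    {C : List (Transition Q Γ)} (hp : A.Reachable p) (hC : A.IsCycle p C) (ht : t ∈ C)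
    (hi : A.isInput t.src = true) : ∃ g, t.out = .sym g := by
  have := hA.2.2.1 _ _ hp hC
  cases ho : t.out with
  | sym g => exact ⟨g, rfl⟩
  | svar => exact absurd ⟨t, ht, hi, Or.inl ho⟩ this
  | svar' => exact absurd ⟨t, ht, hi, Or.inr ho⟩ this

/-! ### Shifting the stored value -/

/-- A transition with guard `g` is taken repeatedly while the stored value is bounded by the current
one. -/
def NeedLoop (g : Guard) : List (Transition Q Γ) → Prop
  | [] => False
  | t :: ts => (t.guard = g ∧ t.asg = false ∧ t ∈ ts) ∨ ((t.asg = true → t.guard = g) ∧ NeedLoop g ts)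

/-- A transition with guard `g` outputs `svar` while the stored value is bounded by the current one. -/
def NeedOut (g : Guard) : List (Transition Q Γ) → Prop
  | [] => False
  | t :: ts => (t.guard = g ∧ t.out = .svar) ∨ ((t.asg = true → t.guard = g) ∧ NeedOut g ts)

/-- A transition that occurs again closes a cycle, so a demand made by the remaining path becomes a
configuration of the graph to which well-formedness applies. -/
theorem NeedLoop.exists_path {g : Guard} {ts : List (Transition Q Γ)} {p q : Q}
    (h : A.IsPath p ts q) (hn : NeedLoop g ts) :
    ∃ us r, A.IsPath p us r ∧ AssignsOnly g us ∧ A.InCycle g r := by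
  induction ts generalizing p with
  | nil => exact hn.elim
  | cons t ts ih =>
    rcases hn with ⟨h1, -, h3⟩ | ⟨h1, h2⟩
    · obtain ⟨pre, post, -, hC⟩ := isCycle_of_mem h h3
      exact ⟨[], p, rfl, by simp [AssignsOnly], inCycle_iff.2 ⟨_, hC, t, by simp, h1⟩⟩
    · obtain ⟨us, r, hu, ha, hr⟩ := ih h.2.2 h2
      exact ⟨t :: us, r, ⟨h.1, h.2.1, hu⟩, ha.cons h1, hr⟩

theorem NeedOut.exists_path {g : Guard} {ts : List (Transition Q Γ)} {p q : Q}
    (h : A.IsPath p ts q) (hn : NeedOut g ts) :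
    ∃ us u r, A.IsPath p (us ++ [u]) r ∧ AssignsOnly g (us ++ [u]) ∧ u.guard = g ∧ u.out = .svar := by
  induction ts generalizing p with
  | nil => exact hn.elim
  | cons t ts ih =>
    rcases hn with ⟨h1, h2⟩ | ⟨h1, h2⟩
    · exact ⟨[], t, t.dst, ⟨h.1, h.2.1, rfl⟩, by simp [AssignsOnly, h1], h1, h2⟩
    · obtain ⟨us, u, r, hu, ha, hr⟩ := ih h.2.2 h2
      exact ⟨t :: us, u, r, ⟨h.1, h.2.1, hu⟩, ha.cons h1, hr⟩

/-- The two demands would force the shift to be both 1 and -1. The earlier of the two repeated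
transitions lies on a cycle and assigns nothing; together with the path to the later cycle it gives
a leaking pair. -/
theorem WellFormed.needLoop_dual (hA : A.WellFormed) {g : Guard} (hg : g ≠ .tt)
    {ts : List (Transition Q Γ)} {p q : Q} (hp : A.Reachable p) (h : A.IsPath p ts q)
    (h1 : NeedLoop g ts) (h2 : NeedLoop g.dual ts) : False := by
  induction ts generalizing p with
  | nil => exact h1.elim
  | cons t ts ih =>
    have key : ∀ k : Guard, k ≠ .tt → t.guard = k → t.asg = false → t ∈ ts →
        NeedLoop k.dual ts → False := by
      intro k hk e1 e2 e3 e4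
      obtain ⟨pre, post, -, hC⟩ := isCycle_of_mem h e3
      obtain ⟨us, r, hu, ha, hr⟩ := e4.exists_path h.2.2
      refine hA.not_leakingPair (Guard.dual_ne_tt hk) hp (ts := t :: us) ?_ ⟨h.1, h.2.1, hu⟩
        (ha.cons (by simp [e2])) hr
      rw [Guard.dual_dual]
      exact inCycle_iff.2 ⟨_, hC, t, by simp, e1⟩
    rcases h1 with ⟨a1, a2, a3⟩ | ⟨-, a2⟩ <;> rcases h2 with ⟨b1, b2, b3⟩ | ⟨-, b2⟩
    · exact Guard.dual_ne hg (b1.symm.trans a1)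
    · exact key g hg a1 a2 a3 b2
    · exact key g.dual (Guard.dual_ne_tt hg) b1 b2 b3 (by rwa [Guard.dual_dual])
    · exact ih (hp.trans (isPath_singleton h.1 h.2.1)) h.2.2 a2 b2

/-- Here a full shift in one direction conflicts with an output of σ that forbids this direction.
Whichever comes first, the piece between them is a violating path: from a cycle to an output, or
from an output to a cycle. -/
theorem WellFormed.needLoop_needOut (hA : A.WellFormed) {g : Guard} (hg : g ≠ .tt)
    {ts : List (Transition Q Γ)} {p q : Q} (hp : A.Reachable p) (h : A.IsPath p ts q)
    (h1 : NeedLoop g ts) (h2 : NeedOut g.dual ts) : False := by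
  induction ts generalizing p with
  | nil => exact h1.elim
  | cons t ts ih =>
    rcases h1 with ⟨a1, a2, a3⟩ | ⟨a1, a2⟩ <;> rcases h2 with ⟨b1, b2⟩ | ⟨b1, b2⟩
    · exact Guard.dual_ne hg (b1.symm.trans a1)
    · obtain ⟨pre, post, -, hC⟩ := isCycle_of_mem h a3
      obtain ⟨us, u, r, hu, ha, hr⟩ := b2.exists_path h.2.2
      refine hA.not_violatingFor (Guard.dual_ne_tt hg) hp (ts := t :: (us ++ [u])) ⟨h.1, h.2.1, hu⟩
        (Or.inr (Or.inr ⟨u, t :: us, rfl, ha.cons (by simp [a2]), ?_, hr⟩))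
      rw [Guard.dual_dual]
      exact inCycle_iff.2 ⟨_, hC, t, by simp, a1⟩
    · obtain ⟨us, r, hu, ha, hr⟩ := a2.exists_path h.2.2
      exact hA.not_violatingFor hg hp (ts := t :: us) ⟨h.1, h.2.1, hu⟩
        (Or.inr (Or.inl ⟨t, us, rfl, ha.cons a1, hr, b1, b2⟩))
    · exact ih (hp.trans (isPath_singleton h.1 h.2.1)) h.2.2 a2 b2

/-- The shift `s` of the stored value makes all guards on the path `ts` at least as likely, where
this is necessary. -/
def Compatible (s : ℝ) (ts : List (Transition Q Γ)) : Prop :=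
  (s = 1 ∨ s = 0 ∨ s = -1) ∧
    ∀ g : Guard, g ≠ .tt → (NeedLoop g ts → g.sgn * s = 1) ∧ (NeedOut g ts → 0 ≤ g.sgn * s)

theorem Compatible.tail {s : ℝ} {t : Transition Q Γ} {ts : List (Transition Q Γ)}
    (h : Compatible s (t :: ts)) (ht : t.asg = false) : Compatible s ts :=
  ⟨h.1, fun g hg => ⟨fun hn => (h.2 g hg).1 (Or.inr ⟨by simp [ht], hn⟩),
    fun hn => (h.2 g hg).2 (Or.inr ⟨by simp [ht], hn⟩)⟩⟩

/-- At an assignment the shift of the stored value is chosen afresh. The sample that becomes the new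
stored value moves by s', so its own guard must survive the old shift s, and s' must vanish if the
sample is output. -/
theorem WellFormed.exists_compatible (hA : A.WellFormed) {s : ℝ} {t : Transition Q Γ}
    {ts : List (Transition Q Γ)} {p q : Q} (hp : A.Reachable p) (h : A.IsPath p (t :: ts) q)
    (hs : Compatible s (t :: ts)) (ht : t.asg = true) :
    ∃ s', Compatible s' ts ∧ (t.guard ≠ .tt → t.guard.sgn * s' ≤ t.guard.sgn * s) ∧
      (t.out = .svar → s' = 0) := by
  have hp' : A.Reachable t.dst := hp.trans (isPath_singleton h.1 h.2.1)
  -- Two reasons force s' to be the sign of g: a later loop with guard g, or a current guard dual to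
  -- g when the old shift already is that sign and the sample has to follow it.
  let up : Guard → Prop := fun g => NeedLoop g ts ∨ (t.guard = g.dual ∧ g.sgn * s = 1)
  have habs : ∀ g : Guard, g ≠ .tt → -1 ≤ g.sgn * s ∧ (g.sgn * s = -1 ∨ 0 ≤ g.sgn * s) := by
    intro g hg
    rcases hs.1 with rfl | rfl | rfl <;> cases g <;> simp [Guard.sgn] at *
  by_cases hup : ∃ g, g ≠ .tt ∧ up g
  · obtain ⟨g, hg, hu⟩ := hup
    have hgd := Guard.dual_ne_tt hg
    have hd : g.dual.sgn = -g.sgn := g.sgn_dual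
    have hgg := Guard.sgn_mul_sgn hg
    refine ⟨g.sgn, ⟨?_, ?_⟩, ?_, ?_⟩
    · cases g <;> simp [Guard.sgn]
    · intro k hk
      rcases Guard.eq_or_eq_dual hg hk with rfl | rfl
      · exact ⟨fun _ => hgg, fun _ => by rw [hgg]; exact zero_le_one⟩
      · refine ⟨fun hn => ?_, fun hn => ?_⟩
        · exfalso
          rcases hu with hu | ⟨e1, e2⟩
          · exact hA.needLoop_dual hg hp' h.2.2 hu hn
          · have := (hs.2 _ hk).1 (Or.inr ⟨fun _ => e1, hn⟩)
            rw [hd] at this; linarith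
        · exfalso
          rcases hu with hu | ⟨e1, e2⟩
          · exact hA.needLoop_needOut hg hp' h.2.2 hu hn
          · have := (hs.2 _ hk).2 (Or.inr ⟨fun _ => e1, hn⟩)
            rw [hd] at this; linarith
    · intro htt
      rcases Guard.eq_or_eq_dual hg htt with e | e
      · rw [e, hgg]
        rcases hu with hu | ⟨e1, e2⟩
        · rw [(hs.2 g hg).1 (Or.inr ⟨fun _ => e, hu⟩)]
        · exact absurd (e1.symm.trans e) (Guard.dual_ne hg)
      · have := (habs _ hgd).1
        rw [e]
        have h2 : g.dual.sgn * g.sgn = -1 := by rw [hd]; linarith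
        rw [h2]; exact this
    -- An output of σ excludes both reasons: a later loop would complete a violating path, and in
    -- the other case the old shift violates the demand that this very output makes on it.
    · intro ho
      exfalso
      rcases hu with hu | ⟨e1, e2⟩
      · obtain ⟨us, r, hu, ha, hr⟩ := hu.exists_path h.2.2
        exact hA.not_violatingFor hg hp (ts := t :: us) ⟨h.1, h.2.1, hu⟩
          (Or.inl ⟨t, us, rfl, ha, hr, ht, ho⟩)
      · have := (hs.2 _ hgd).2 (Or.inl ⟨e1, ho⟩)
        rw [hd] at this; linarith
  -- The shift 0 only fails if the old shift is a full unit against the current guard, which is the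
  -- second reason for the dual guard.
  · push Not at hup
    refine ⟨0, ⟨by simp, fun g hg => ⟨fun hn => absurd (Or.inl hn) (hup g hg), by simp⟩⟩, ?_,
      fun _ => rfl⟩
    intro htt
    rw [mul_zero]
    rcases (habs _ htt).2 with e | e
    · refine absurd (Or.inr ⟨?_, ?_⟩) (hup t.guard.dual (Guard.dual_ne_tt htt))
      · rw [Guard.dual_dual]
      · rw [Guard.sgn_dual]; linarith
    · exact e

/-! ### The privacy budget of a path -/

open Classical in
/-- Every transition is charged at its last occurrence. -/
noncomputable def budget (A : DiPA Q Γ) : List (Transition Q Γ) → ℝ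
  | [] => 0
  | t :: ts => (if t ∈ ts then 0 else 2 * (A.d t.src : ℝ) + A.d' t.src) + budget A ts

/-- A transition is charged only at its last occurrence, so the budget is a sum over distinct
transitions and is bounded independently of the path. -/
theorem budget_le [Fintype Q] {ts : List (Transition Q Γ)} (h : ∀ t ∈ ts, A.IsTransition t) :
    A.budget ts ≤ ∑ q : Q, ∑ _c : Guard, (2 * (A.d q : ℝ) + A.d' q) := by
  classical
  have h1 : A.budget ts = ∑ t ∈ ts.toFinset, (2 * (A.d t.src : ℝ) + A.d' t.src) := by
    clear h
    induction ts with
    | nil => simp [budget]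
    | cons t ts ih =>
      simp only [budget, List.toFinset_cons]
      split_ifs with ht
      · rw [Finset.insert_eq_of_mem (by simpa using ht), zero_add, ih]
      · rw [Finset.sum_insert (by simpa using ht), ih]
  -- Since δ is a function, a transition is determined by its source and guard.
  have h2 : Set.InjOn (fun t : Transition Q Γ => (t.src, t.guard)) (ts.toFinset : Set _) := by
    rintro ⟨p, c, q, o, b⟩ ht ⟨p', c', q', o', b'⟩ ht' he
    have e1 := h _ (by simpa using ht)
    have e2 := h _ (by simpa using ht')
    simp only [IsTransition, Prod.mk.injEq] at e1 e2 he
    obtain ⟨rfl, rfl⟩ := he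
    rw [e1] at e2
    simp only [Option.some.injEq, Prod.mk.injEq] at e2
    obtain ⟨rfl, rfl, rfl⟩ := e2
    rfl
  rw [h1, ← Finset.sum_product' (s := Finset.univ) (t := Finset.univ)
      (f := fun q _ => 2 * (A.d q : ℝ) + A.d' q)]
  rw [← Finset.sum_image (g := fun t : Transition Q Γ => (t.src, t.guard))
      (f := fun x : Q × Guard => 2 * (A.d x.1 : ℝ) + A.d' x.1) h2]
  exact Finset.sum_le_sum_of_subset_of_nonneg (fun x _ => by simp) fun x _ _ => by positivity

/-! ### Well-formed automata are differentially private -/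

/-- Substitute z + r for z and compare the integrands pointwise. Translation invariance of Lebesgue
measure makes the translation of the sample itself free. -/
theorem setIntegral_shift_le {I J : Set ℝ} (hI : MeasurableSet I) (hJ : MeasurableSet J)
    {F G : ℝ → ℝ} (hF : ∀ z, 0 ≤ F z) (hG : ∀ z, 0 ≤ G z) (hGi : Integrable G) {c r : ℝ}
    (hc : 0 ≤ c) (h : ∀ z ∈ I, z + r ∈ J ∧ F z ≤ c * G (z + r)) :
    ∫ z in I, F z ≤ c * ∫ z in J, G z := by
  rw [← integral_indicator hI, ← integral_indicator hJ, ← integral_const_mul,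
    ← integral_add_right_eq_self (fun z => c * J.indicator G z) r]
  refine integral_mono_of_nonneg (ae_of_all _ fun z => Set.indicator_nonneg (fun z _ => hF z) z)
    (((hGi.indicator hJ).comp_add_right r).const_mul c) (ae_of_all _ fun z => ?_)
  by_cases hz : z ∈ I
  · simp only [Set.indicator_of_mem hz, Set.indicator_of_mem (h z hz).1]
    exact (h z hz).2
  · simp only [Set.indicator_of_notMem hz]
    exact mul_nonneg hc (Set.indicator_nonneg (fun z _ => hG z) _)

/-- Steps with adjacent inputs. -/
structure AdjStep (A : DiPA Q Γ) (s s' : Step Q Γ) : Prop where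
  tr : s'.tr = s.tr
  lab : s'.lab = s.lab
  out : s.lab.out = s.tr.out
  inp : |s.inp.getD 0 - s'.inp.getD 0| ≤ 1
  inp_eq : A.isInput s.tr.src = false → s.inp.getD 0 = s'.inp.getD 0

/-- `inputs` drops the steps without input. Both executions have the same transitions and so read
inputs at the same positions; hence the lists of inputs are aligned with the steps. -/
theorem forall₂_adjStep {ρ ρ' : List (Step Q Γ)}
    (h : ∀ s ∈ ρ, s.lab.out = s.tr.out ∧ (s.inp.isSome ↔ A.isInput s.tr.src = true))
    (h' : ∀ s ∈ ρ', s.lab.out = s.tr.out ∧ (s.inp.isSome ↔ A.isInput s.tr.src = true))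
    (he : Equivalent ρ ρ') (ha : Adjacent (inputs ρ) (inputs ρ')) :
    List.Forall₂ A.AdjStep ρ ρ' := by
  induction ρ generalizing ρ' with
  | nil =>
    simp only [Equivalent, List.map_nil] at he
    have : ρ' = [] := by simpa using he.symm
    subst this; exact .nil
  | cons s ρ ih =>
    cases ρ' with
    | nil => simp [Equivalent] at he
    | cons s' ρ' =>
      simp only [Equivalent, List.map_cons, List.cons.injEq, Prod.mk.injEq] at he
      obtain ⟨⟨e1, e2⟩, e3⟩ := he
      have k := h s (by simp)
      have k' := h' s' (by simp)
      have hr := fun hh => ih (ρ' := ρ') (fun u hu => h u (by simp [hu]))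
        (fun u hu => h' u (by simp [hu])) e3 hh
      cases hi : s.inp with
      | none =>
        have hin : A.isInput s.tr.src = false := by
          have := k.2; rw [hi] at this; simpa using this
        have hi' : s'.inp = none := by
          have := k'.2; rw [← e1, hin] at this; simpa using this
        simp only [Adjacent, inputs, List.filterMap_cons, hi, hi'] at ha
        exact .cons ⟨e1.symm, e2.symm, k.1, by simp [hi, hi'], by simp [hi, hi']⟩ (hr ha)
      | some a =>
        have hin : A.isInput s.tr.src = true := by
          have := k.2; rw [hi] at this; simpa using this
        obtain ⟨a', hi'⟩ : ∃ a', s'.inp = some a' := by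
          have := k'.2; rw [← e1, hin] at this; exact Option.isSome_iff_exists.1 (by simpa using this)
        simp only [Adjacent, inputs, List.filterMap_cons, hi, hi', List.forall₂_cons] at ha
        exact .cons ⟨e1.symm, e2.symm, k.1, by simpa [hi, hi'] using ha.1, by simp [hin]⟩ (hr ha.2)

section Sufficiency

variable {ε : ℝ} {s s' : Step Q Γ}

theorem AdjStep.sampleSet_eq (h : A.AdjStep s s') (x : ℝ) : s'.sampleSet x = s.sampleSet x := by
  simp [Step.sampleSet, h.tr, h.lab]

theorem AdjStep.dens_le (h : A.AdjStep s s') (hε : 0 ≤ ε) {r w : ℝ}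
    (hw : |r + (s.inp.getD 0 - s'.inp.getD 0)| ≤ w) (z : ℝ) :
    A.dens ε s z ≤ Real.exp (ε * (w * A.d s.tr.src)) * A.dens ε s' (z + r) := by
  have := lapDensity_le (scale_nonneg (A := A) hε s.tr.src) (m := A.μ s.tr.src + s.inp.getD 0)
    (m' := A.μ s.tr.src + s'.inp.getD 0) (z := z) (z' := z + r) (w := w)
    (by convert hw using 2; ring)
  unfold dens
  rw [h.tr]
  convert this using 3
  ring

/-- The interval for σ' is fixed, so the sample stays where it is while its mean moves by at most 1.
This accounts for the summand d' of the budget. -/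
theorem AdjStep.primeFactor_le (h : A.AdjStep s s') (hε : 0 ≤ ε) :
    A.primeFactor ε s ≤ Real.exp (ε * A.d' s.tr.src) * A.primeFactor ε s' := by
  have h1 : 1 ≤ Real.exp (ε * A.d' s.tr.src) := Real.one_le_exp (by positivity)
  unfold primeFactor
  rw [h.lab, h.tr]
  rcases s.lab with g | ⟨_ | _, v, w⟩
  · simpa using h1
  · simpa using h1
  · refine setIntegral_shift_le (r := 0) (measurableSet_openInterval _ _)
      (measurableSet_openInterval _ _) (fun z => lapDensity_nonneg (scale'_nonneg hε _) _ _)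
      (fun z => lapDensity_nonneg (scale'_nonneg hε _) _ _)
      (integrable_lapDensity (scale'_nonneg hε _) _) (Real.exp_pos _).le ?_
    intro z hz
    rw [add_zero]
    refine ⟨hz, ?_⟩
    have := lapDensity_le (scale'_nonneg (A := A) hε s.tr.src) (m := A.μ' s.tr.src + s.inp.getD 0)
      (m' := A.μ' s.tr.src + s'.inp.getD 0) (z := z) (z' := z) (w := 1)
      (by convert h.inp using 2; ring)
    convert this using 3
    ring

theorem AdjStep.factors_eq (h : A.AdjStep s s') (hi : A.isInput s.tr.src = false) :
    A.primeFactor ε s' = A.primeFactor ε s ∧ A.dens ε s' = A.dens ε s := by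
  have := h.inp_eq hi
  unfold primeFactor dens
  rw [h.lab, h.tr, this]
  exact ⟨rfl, rfl⟩

theorem primeFactor_of_sym {g : Γ} (h : s.lab.out = .sym g) : A.primeFactor ε s = 1 := by
  unfold primeFactor
  rcases hl : s.lab with g | ⟨_ | _, v, w⟩
  · rfl
  · rfl
  · rw [hl] at h; simp [Label.out] at h

theorem _root_.Label.admits_of_out_ne {l : Label Γ} (h : l.out ≠ .svar) (z : ℝ) : l.Admits z := by
  rcases l with g | ⟨_ | _, v, w⟩ <;> simp_all [Label.out, Label.Admits]

theorem _root_.Guard.Holds.add {g : Guard} {x z s r : ℝ} (h : g.Holds x z)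
    (hr : g ≠ .tt → g.sgn * r ≤ g.sgn * s) : g.Holds (x + s) (z + r) := by
  cases g <;> simp [Guard.Holds, Guard.sgn] at * <;> linarith

theorem guard_tt_of_isInput_eq_false {t : Transition Q Γ} (h : A.IsTransition t)
    (hi : A.isInput t.src = false) : t.guard = .tt :=
  A.non_input _ hi _ (by rw [h]; rfl)

theorem sampleSet_of_tt (h : s.tr.guard = .tt) (x y : ℝ) : s.sampleSet x = s.sampleSet y := by
  simp [Step.sampleSet, h, Guard.Holds]

/-- The stored value does not matter if it is overwritten before it is used. -/
theorem pathProb_const {pre post : List (Transition Q Γ)} {t : Transition Q Γ}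
    {ρ : List (Step Q Γ)} (hρ : ρ.map Step.tr = pre ++ t :: post) (ht : t.asg = true)
    (htt : t.guard = .tt) (hpre : ∀ u ∈ pre, u.guard = .tt) (x y : ℝ) :
    A.pathProb ε ρ x = A.pathProb ε ρ y := by
  induction pre generalizing ρ x y with
  | nil =>
    cases ρ with
    | nil => simp at hρ
    | cons s ρ =>
      simp only [List.map_cons, List.nil_append, List.cons.injEq] at hρ
      rw [pathProb_cons_asg _ _ _ _ _ (by rw [hρ.1, ht]), pathProb_cons_asg _ _ _ _ _ (by rw [hρ.1, ht]),
        sampleSet_of_tt (by rw [hρ.1, htt])]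
  | cons u pre ih =>
    cases ρ with
    | nil => simp at hρ
    | cons s ρ =>
      simp only [List.map_cons, List.cons_append, List.cons.injEq] at hρ
      have hu : s.tr.guard = .tt := by rw [hρ.1]; exact hpre u (by simp)
      have hr := ih hρ.2 (fun v hv => hpre v (by simp [hv]))
      cases hs : s.tr.asg
      · rw [pathProb_cons_of_not_asg _ _ _ _ _ hs, pathProb_cons_of_not_asg _ _ _ _ _ hs, hr x y]
        simp only [guardFactor]
        rw [sampleSet_of_tt hu x y]
      · rw [pathProb_cons_asg _ _ _ _ _ hs, pathProb_cons_asg _ _ _ _ _ hs, sampleSet_of_tt hu x y]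

theorem guardFactor_eq_one {x : ℝ} (h : s.tr.guard = .tt ∧ s.lab.out ≠ .svar) :
    A.guardFactor ε s x = 1 := if_pos h

theorem guardFactor_eq_integral {x : ℝ} (h : ¬ (s.tr.guard = .tt ∧ s.lab.out ≠ .svar)) :
    A.guardFactor ε s x = ∫ z in s.sampleSet x, A.dens ε s z := if_neg h

/-- If the transition occurs again, it lies on a cycle and must be free: in a non-input state
nothing changes, and in an input state only a symbol is output, so the sample may follow its input.
At its last occurrence it may cost 2d + d'. -/
theorem WellFormed.factors_le (hA : A.WellFormed) (hε : 0 ≤ ε) {p q : Q}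
    {ts : List (Transition Q Γ)} (hp : A.Reachable p) (h : A.AdjStep s s')
    (hpath : A.IsPath p (s.tr :: ts) q) (hs : s.tr.asg = false) {r : ℝ}
    (hr : Compatible r (s.tr :: ts)) (x : ℝ) :
    A.primeFactor ε s * A.guardFactor ε s x ≤
      Real.exp (ε * (A.budget (s.tr :: ts) - A.budget ts)) *
        (A.primeFactor ε s' * A.guardFactor ε s' (x + r)) := by
  have hnn := fun u y => guardFactor_nonneg (A := A) hε u y
  have shift : ∀ r' w : ℝ, |r' + (s.inp.getD 0 - s'.inp.getD 0)| ≤ w →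
      (∀ z ∈ s.sampleSet x, z + r' ∈ s.sampleSet (x + r)) →
      ∫ z in s.sampleSet x, A.dens ε s z ≤ Real.exp (ε * (w * A.d s.tr.src)) *
        ∫ z in s'.sampleSet (x + r), A.dens ε s' z := by
    intro r' w h1 h2
    rw [h.sampleSet_eq]
    exact setIntegral_shift_le (s.measurableSet_sampleSet _) (s.measurableSet_sampleSet _)
      (dens_nonneg hε s) (dens_nonneg hε s') (integrable_lapDensity (scale_nonneg hε _) _)
      (Real.exp_pos _).le fun z hz => ⟨h2 z hz, h.dens_le hε h1 z⟩
  by_cases hmem : s.tr ∈ ts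
  · have hb : A.budget (s.tr :: ts) - A.budget ts = 0 := by simp [budget, hmem]
    rw [hb, mul_zero, Real.exp_zero, one_mul]
    obtain ⟨pre, post, -, hC⟩ := isCycle_of_mem hpath hmem
    cases hi : A.isInput s.tr.src
    · have htt := guard_tt_of_isInput_eq_false hpath.1 hi
      obtain ⟨e1, e2⟩ := h.factors_eq (ε := ε) hi
      rw [e1]
      by_cases hc : s.tr.guard = .tt ∧ s.lab.out ≠ .svar
      · rw [guardFactor_eq_one hc, guardFactor_eq_one (s := s') (by rwa [h.tr, h.lab])]
      · rw [guardFactor_eq_integral hc, guardFactor_eq_integral (s := s') (by rwa [h.tr, h.lab]),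
          h.sampleSet_eq, e2, sampleSet_of_tt htt x (x + r)]
    · obtain ⟨g, hg⟩ := hA.out_of_mem hp hC (t := s.tr) (by simp) hi
      have ho : s.lab.out = .sym g := h.out.trans hg
      rw [primeFactor_of_sym ho, primeFactor_of_sym (s := s') (by rw [h.lab, ho]), one_mul, one_mul]
      by_cases htt : s.tr.guard = .tt
      · have hc : s.tr.guard = .tt ∧ s.lab.out ≠ .svar := ⟨htt, by simp [ho]⟩
        rw [guardFactor_eq_one hc, guardFactor_eq_one (s := s') (by rwa [h.tr, h.lab])]
      · rw [guardFactor_eq_integral (by tauto),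
          guardFactor_eq_integral (s := s') (by rw [h.tr]; tauto)]
        have h1 := (hr.2 _ htt).1 (Or.inl ⟨rfl, hs, hmem⟩)
        -- The sample moves exactly as its mean does, so the density does not change. The guard
        -- survives because compatibility makes the stored value move one unit in the favourable
        -- direction and the input differs by at most 1.
        have := shift (s'.inp.getD 0 - s.inp.getD 0) 0 (by simp) ?_
        · simpa using this
        · rintro z ⟨hz, -⟩
          refine ⟨Guard.Holds.add hz fun _ => ?_, Label.admits_of_out_ne (by rw [ho]; simp) _⟩
          have := abs_le.1 h.inp
          rw [h1]
          cases hgd : s.tr.guard <;> simp [Guard.sgn] <;> linarith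
  · have hb : A.budget (s.tr :: ts) - A.budget ts = 2 * A.d s.tr.src + A.d' s.tr.src := by
      simp [budget, hmem]
    have hgf : A.guardFactor ε s x ≤
        Real.exp (ε * (2 * A.d s.tr.src)) * A.guardFactor ε s' (x + r) := by
      by_cases hc : s.tr.guard = .tt ∧ s.lab.out ≠ .svar
      · rw [guardFactor_eq_one hc, guardFactor_eq_one (s := s') (by rwa [h.tr, h.lab]), mul_one]
        exact Real.one_le_exp (by positivity)
      · rw [guardFactor_eq_integral hc, guardFactor_eq_integral (s := s') (by rwa [h.tr, h.lab])]
        have hab : |r| ≤ 1 := by rcases hr.1 with rfl | rfl | rfl <;> simp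
        -- An output σ stays in its interval without moving, and compatibility protects the guard.
        -- Otherwise the sample moves by r along with the stored value; relative to its mean it then
        -- moves by at most 1 + 1 = 2.
        by_cases ho : s.tr.out = .svar
        · refine shift 0 2 (by rw [zero_add]; linarith [h.inp]) ?_
          rintro z ⟨h1, h2⟩
          refine ⟨Guard.Holds.add h1 fun htt => ?_, by simpa using h2⟩
          rw [mul_zero]
          exact (hr.2 _ htt).2 (Or.inl ⟨rfl, ho⟩)
        · refine shift r 2 ((abs_add_le _ _).trans (by linarith [h.inp])) ?_
          rintro z ⟨h1, h2⟩
          exact ⟨Guard.Holds.add h1 fun _ => le_rfl, Label.admits_of_out_ne (by rwa [h.out]) _⟩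
    calc _ ≤ (Real.exp (ε * A.d' s.tr.src) * A.primeFactor ε s') *
          (Real.exp (ε * (2 * A.d s.tr.src)) * A.guardFactor ε s' (x + r)) :=
          mul_le_mul (h.primeFactor_le hε) hgf (hnn _ _)
            (mul_nonneg (Real.exp_pos _).le (primeFactor_nonneg hε _))
      _ = _ := by
          rw [hb, show ε * (2 * (A.d s.tr.src : ℝ) + A.d' s.tr.src) =
            ε * A.d' s.tr.src + ε * (2 * A.d s.tr.src) by ring, Real.exp_add]
          ring

/-- The translation of the sample is now also the shift r' of the next stored value. This is paid
for at the last occurrence. On a cycle, r' is ignored and the sample follows its input, because the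
stored value is not used before the next occurrence. -/
theorem WellFormed.asg_le (hA : A.WellFormed) (hε : 0 ≤ ε) {p q : Q} {ρ ρ' : List (Step Q Γ)}
    (hp : A.Reachable p) (h : A.AdjStep s s')
    (hpath : A.IsPath p (s.tr :: ρ.map Step.tr) q) (hρ : ρ'.map Step.tr = ρ.map Step.tr)
    (hs : s.tr.asg = true) {r r' c : ℝ} (hc : 0 ≤ c) (hr : |r'| ≤ 1)
    (hg : s.tr.guard ≠ .tt → s.tr.guard.sgn * r' ≤ s.tr.guard.sgn * r)
    (ho : s.tr.out = .svar → r' = 0)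
    (ih : ∀ x, A.pathProb ε ρ x ≤ c * A.pathProb ε ρ' (x + r')) (x : ℝ) :
    A.pathProb ε (s :: ρ) x ≤
      Real.exp (ε * (A.budget (s.tr :: ρ.map Step.tr) - A.budget (ρ.map Step.tr))) * c *
        A.pathProb ε (s' :: ρ') (x + r) := by
  rw [pathProb_cons_asg _ _ _ _ _ hs, pathProb_cons_asg _ _ _ _ _ (by rw [h.tr, hs]), h.sampleSet_eq]
  have hP := fun ρ z => pathProb_nonneg (A := A) hε ρ z
  have shift : ∀ r₁ w : ℝ, |r₁ + (s.inp.getD 0 - s'.inp.getD 0)| ≤ w →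
      (∀ z ∈ s.sampleSet x, z + r₁ ∈ s.sampleSet (x + r)) →
      (∀ z, A.pathProb ε ρ z ≤ c * A.pathProb ε ρ' (z + r₁)) →
      ∫ z in s.sampleSet x, A.dens ε s z * A.pathProb ε ρ z ≤
        (Real.exp (ε * (w * A.d s.tr.src)) * c) *
        ∫ z in s.sampleSet (x + r), A.dens ε s' z * A.pathProb ε ρ' z := by
    intro r₁ w h1 h2 h3
    refine setIntegral_shift_le (s.measurableSet_sampleSet _) (s.measurableSet_sampleSet _)
      (fun z => mul_nonneg (dens_nonneg hε s z) (hP _ _))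
      (fun z => mul_nonneg (dens_nonneg hε s' z) (hP _ _)) (integrable_dens_mul_pathProb hε s' ρ')
      (mul_nonneg (Real.exp_pos _).le hc) fun z hz => ⟨h2 z hz, ?_⟩
    calc _ ≤ (Real.exp (ε * (w * A.d s.tr.src)) * A.dens ε s' (z + r₁)) *
          (c * A.pathProb ε ρ' (z + r₁)) :=
          mul_le_mul (h.dens_le hε h1 z) (h3 z) (hP _ _)
            (mul_nonneg (Real.exp_pos _).le (dens_nonneg hε _ _))
      _ = _ := by ring
  have hJ : 0 ≤ ∫ z in s.sampleSet (x + r), A.dens ε s' z * A.pathProb ε ρ' z :=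
    integral_nonneg fun z => mul_nonneg (dens_nonneg hε s' z) (hP _ _)
  by_cases hmem : s.tr ∈ ρ.map Step.tr
  · have hb : A.budget (s.tr :: ρ.map Step.tr) - A.budget (ρ.map Step.tr) = 0 := by
      simp [budget, hmem]
    rw [hb, mul_zero, Real.exp_zero, one_mul]
    obtain ⟨pre, post, hsplit, hC⟩ := isCycle_of_mem hpath hmem
    have htt := guard_eq_tt_of_not_leaking hA.1 hp hC hs
    -- No leaking cycle: all guards up to the next occurrence of this assignment are `true`, so the
    -- probability of the rest does not depend on the stored value. This allows any translation in
    -- place of r'.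
    have hconst := pathProb_const (A := A) (ε := ε) (hρ.trans hsplit) hs (htt _ (by simp))
      (fun u hu => htt u (by simp [hu]))
    have h1 := shift (s'.inp.getD 0 - s.inp.getD 0) 0 (by simp) ?_
      (fun z => (ih z).trans (by rw [hconst]))
    · have h2 : A.primeFactor ε s ≤ A.primeFactor ε s' := by
        cases hi : A.isInput s.tr.src
        · rw [(h.factors_eq hi).1]
        · obtain ⟨g, hg⟩ := hA.out_of_mem hp hC (t := s.tr) (by simp) hi
          have ho : s.lab.out = .sym g := h.out.trans hg
          rw [primeFactor_of_sym ho, primeFactor_of_sym (s := s') (by rw [h.lab, ho])]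
      rw [zero_mul, mul_zero, Real.exp_zero, one_mul] at h1
      calc _ ≤ A.primeFactor ε s' * (c * _) :=
            mul_le_mul h2 h1 (integral_nonneg fun z => mul_nonneg (dens_nonneg hε s z) (hP _ _))
              (primeFactor_nonneg hε _)
        _ = _ := by ring
    · rintro z ⟨hz1, hz2⟩
      refine ⟨by simp [htt s.tr (by simp), Guard.Holds], ?_⟩
      cases hi : A.isInput s.tr.src
      · rw [h.inp_eq hi]; simpa using hz2
      · obtain ⟨g, hg⟩ := hA.out_of_mem hp hC (t := s.tr) (by simp) hi
        exact Label.admits_of_out_ne (by rw [h.out, hg]; simp) _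
  · have hb : A.budget (s.tr :: ρ.map Step.tr) - A.budget (ρ.map Step.tr) =
        2 * A.d s.tr.src + A.d' s.tr.src := by
      simp [budget, hmem]
    -- The sample moves by r' and its mean by the difference of the inputs, each at most 1.
    have h1 := shift r' 2 ((abs_add_le _ _).trans (by linarith [h.inp])) ?_ ih
    · calc _ ≤ (Real.exp (ε * A.d' s.tr.src) * A.primeFactor ε s') *
            (Real.exp (ε * (2 * A.d s.tr.src)) * c *
              ∫ z in s.sampleSet (x + r), A.dens ε s' z * A.pathProb ε ρ' z) :=
            mul_le_mul (h.primeFactor_le hε) h1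
              (integral_nonneg fun z => mul_nonneg (dens_nonneg hε s z) (hP _ _))
              (mul_nonneg (Real.exp_pos _).le (primeFactor_nonneg hε _))
        _ = _ := by
            rw [hb, show ε * (2 * (A.d s.tr.src : ℝ) + A.d' s.tr.src) =
              ε * A.d' s.tr.src + ε * (2 * A.d s.tr.src) by ring, Real.exp_add]
            ring
    · rintro z ⟨hz1, hz2⟩
      refine ⟨Guard.Holds.add hz1 hg, ?_⟩
      by_cases hsv : s.tr.out = .svar
      · rw [ho hsv, add_zero]; exact hz2
      · exact Label.admits_of_out_ne (by rwa [h.out]) _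

/-- Induction along the path with the shift of the stored value as a parameter. An assignment
replaces it by the shift from `exists_compatible`, and other steps keep it. -/
theorem WellFormed.pathProb_le (hA : A.WellFormed) (hε : 0 ≤ ε) {ρ ρ' : List (Step Q Γ)} {p q : Q}
    (hp : A.Reachable p) (hpath : A.IsPath p (ρ.map Step.tr) q) (h : List.Forall₂ A.AdjStep ρ ρ')
    {r : ℝ} (hr : Compatible r (ρ.map Step.tr)) (x : ℝ) :
    A.pathProb ε ρ x ≤ Real.exp (ε * A.budget (ρ.map Step.tr)) * A.pathProb ε ρ' (x + r) := by
  induction h generalizing p r x with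
  | nil => simp [pathProb, budget]
  | @cons s s' ρ ρ' hs hρ ih =>
    simp only [List.map_cons] at hpath hr ⊢
    have hp' : A.Reachable s.tr.dst := hp.trans (isPath_singleton hpath.1 hpath.2.1)
    have hsplit : Real.exp (ε * A.budget (s.tr :: ρ.map Step.tr)) =
        Real.exp (ε * (A.budget (s.tr :: ρ.map Step.tr) - A.budget (ρ.map Step.tr))) *
          Real.exp (ε * A.budget (ρ.map Step.tr)) := by
      rw [← Real.exp_add]; congr 1; ring
    rw [hsplit]
    cases hasg : s.tr.asg
    · rw [pathProb_cons_of_not_asg _ _ _ _ _ hasg,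
        pathProb_cons_of_not_asg _ _ _ _ _ (by rw [hs.tr, hasg])]
      have h1 := hA.factors_le hε hp hs hpath hasg hr x
      have h2 := ih hp' hpath.2.2 (hr.tail hasg) x
      calc _ ≤ _ := mul_le_mul h1 h2 (pathProb_nonneg hε _ _)
            (mul_nonneg (Real.exp_pos _).le
              (mul_nonneg (primeFactor_nonneg hε _) (guardFactor_nonneg hε _ _)))
        _ = _ := by ring
    · obtain ⟨r', h1, h2, h3⟩ := hA.exists_compatible hp hpath hr hasg
      have hρ' : ρ'.map Step.tr = ρ.map Step.tr := by
        clear ih hpath hr hsplit h1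
        induction hρ with
        | nil => rfl
        | cons a _ ih => simp [a.tr, ih]
      exact hA.asg_le hε hp hs hpath hρ' hasg (Real.exp_pos _).le
        (by rcases h1.1 with rfl | rfl | rfl <;> simp) h2 h3
        (fun y => ih hp' hpath.2.2 h1 y) x

end Sufficiency

theorem WellFormed.differentiallyPrivate [Fintype Q] (hA : A.WellFormed) :
    A.DifferentiallyPrivate := by
  -- The summand 1 only ensures that d is positive if all parameters vanish.
  refine ⟨(∑ q : Q, ∑ _c : Guard, (2 * (A.d q : ℝ) + A.d' q)) + 1, by positivity, ?_⟩
  intro ε hε ρ ρ' q q' hρ hρ' he ha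
  -- The first transition is an assignment with guard `true`, so no later guard refers to the value
  -- stored at the start, and equal starting values are compatible.
  have hr : Compatible 0 (ρ.map Step.tr) := by
    refine ⟨by simp, fun g hg => ⟨fun hn => ?_, by simp⟩⟩
    exfalso
    cases ρ with
    | nil => exact hn
    | cons s ρ =>
      have h1 := hρ.1
      simp only [List.map_cons, IsPath] at h1
      obtain ⟨ht, hsrc, -⟩ := h1
      obtain ⟨⟨q₁, o, hi⟩, hge, hlt⟩ := A.initialization
      have htt : s.tr.guard = .tt ∧ s.tr.asg = true := by
        unfold IsTransition at ht
        rw [hsrc] at ht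
        cases hgd : s.tr.guard <;> rw [hgd] at ht <;> simp_all
      rcases hn with ⟨h2, -⟩ | ⟨h2, -⟩
      · exact hg (h2.symm.trans htt.1)
      · exact hg ((h2 htt.2).symm.trans htt.1)
  have := hA.pathProb_le hε.le ⟨[], rfl⟩ hρ.1 (forall₂_adjStep hρ.2 hρ'.2 he ha) hr 0
  rw [add_zero] at this
  refine this.trans ?_
  gcongr ?_ * _
  · exact pathProb_nonneg hε.le _ _
  · apply Real.exp_le_exp.2
    have := budget_le hρ.1.isTransition
    nlinarith

end DiPA

namespace DiPA

variable {Q Γ : Type*} (A : DiPA Q Γ)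

/-! ### Executions with windows -/

/-- All transitions have positive probability. -/
def Alive : Prop := ∀ t, A.IsTransition t →
  (t.asg = true ∨ t.guard ≠ .tt ∨ t.out = .svar → 0 < A.d t.src) ∧ (t.out = .svar' → 0 < A.d' t.src)

/-- Windows of radius `T` have probability at least `1 - η`. -/
def WindowBound (T η : ℝ) : Prop := 0 < T ∧ ∀ q,
  (0 < A.d q → Real.exp (-((A.d q : ℝ) * 1 * T)) ≤ η) ∧
  (0 < A.d' q → Real.exp (-((A.d' q : ℝ) * 1 * T)) ≤ η)

/-- There are finitely many states, so one large T serves for all of them. The factor 1 in the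
exponents is the budget ε = 1, the only one used in this direction. -/
theorem exists_windowBound [Finite Q] {η : ℝ} (hη : 0 < η) : ∃ T, A.WindowBound T η := by
  have key : ∀ k : ℝ, ∀ᶠ T in Filter.atTop, 0 < k → Real.exp (-(k * 1 * T)) ≤ η := by
    intro k
    by_cases hk : 0 < k
    · have : Filter.Tendsto (fun T => Real.exp (-(k * 1 * T))) Filter.atTop (nhds 0) := by
        refine Real.tendsto_exp_neg_atTop_nhds_zero.comp ?_
        exact Filter.tendsto_id.const_mul_atTop (by linarith)
      filter_upwards [this.eventually (gt_mem_nhds hη)] with T hT _ using le_of_lt hT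
    · exact Filter.Eventually.of_forall fun T h => absurd h hk
  have h := (Filter.eventually_gt_atTop (0 : ℝ)).and (Filter.eventually_all.2 fun q =>
    (key (A.d q)).and (key (A.d' q)))
  obtain ⟨T, hT⟩ := h.exists
  exact ⟨T, hT.1, fun q => ⟨fun h => (hT.2 q).1 (by exact_mod_cast h),
    fun h => (hT.2 q).2 (by exact_mod_cast h)⟩⟩

/-- The centre of the window for `svar` if the stored value lies in a window around `c`. -/
noncomputable def center (T : ℝ) (t : Transition Q Γ) (c : ℝ) : ℝ :=
  if A.isInput t.src = true then c - 2 * T * t.guard.sgn else A.μ t.src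

/-- The step whose input is chosen such that the mean of `svar` is the centre of its window, shifted
by `r` in input states. -/
noncomputable def windowStep (T r c : ℝ) (t : Transition Q Γ) : Step Q Γ where
  tr := t
  inp := if A.isInput t.src = true then some (A.center T t c - A.μ t.src + r) else none
  lab := match t.out with
    | .sym g => .sym g
    | .svar => .real false ((A.center T t c - T : ℝ) : EReal) ((A.center T t c + T : ℝ) : EReal)
    | .svar' => .real true ((A.μ' t.src + (A.center T t c - A.μ t.src) - T : ℝ) : EReal)
        ((A.μ' t.src + (A.center T t c - A.μ t.src) + T : ℝ) : EReal)

/-- The centre for the stored value after a transition. -/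
noncomputable def nextCenter (T : ℝ) (t : Transition Q Γ) (c : ℝ) : ℝ :=
  if t.asg = true then A.center T t c else c

/-- The execution with windows along a path whose transitions are annotated with shifts. -/
noncomputable def run (T : ℝ) : List (Transition Q Γ × ℝ) → ℝ → List (Step Q Γ)
  | [], _ => []
  | u :: l, c => A.windowStep T u.2 c u.1 :: run T l (A.nextCenter T u.1 c)

/-- The centre for the stored value at the end of `run`. -/
noncomputable def endCenter (T : ℝ) : List (Transition Q Γ × ℝ) → ℝ → ℝ
  | [], c => c
  | u :: l, c => endCenter T l (A.nextCenter T u.1 c)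

variable {A}

theorem run_append (T : ℝ) (l l' : List (Transition Q Γ × ℝ)) (c : ℝ) :
    A.run T (l ++ l') c = A.run T l c ++ A.run T l' (A.endCenter T l c) := by
  induction l generalizing c with
  | nil => rfl
  | cons u l ih => simp [run, endCenter, ih]

theorem endCenter_of_not_asg {T : ℝ} {l : List (Transition Q Γ × ℝ)} (h : ∀ u ∈ l, u.1.asg = false)
    (c : ℝ) : A.endCenter T l c = c := by
  induction l with
  | nil => rfl
  | cons u l ih =>
    simp only [List.mem_cons, forall_eq_or_imp] at h
    simp [endCenter, nextCenter, h.1, ih h.2]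

theorem map_tr_run (T : ℝ) (l : List (Transition Q Γ × ℝ)) (c : ℝ) :
    (A.run T l c).map Step.tr = l.map Prod.fst := by
  induction l generalizing c with
  | nil => rfl
  | cons u l ih => simp [run, windowStep, ih]

theorem isExecution_run {T : ℝ} {l : List (Transition Q Γ × ℝ)} {p q : Q}
    (h : A.IsPath p (l.map Prod.fst) q) (c : ℝ) : A.IsExecution p (A.run T l c) q := by
  refine ⟨by rwa [map_tr_run], ?_⟩
  clear h
  induction l generalizing c with
  | nil => simp [run]
  | cons u l ih =>
    simp only [run, List.mem_cons, forall_eq_or_imp]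
    refine ⟨⟨?_, ?_⟩, ih _⟩
    · simp only [windowStep]
      cases u.1.out <;> rfl
    · simp only [windowStep]
      split_ifs with hi <;> simp [hi]

/-- Multiplies all shifts by `r`. -/
def scale (r : ℝ) (l : List (Transition Q Γ × ℝ)) : List (Transition Q Γ × ℝ) :=
  l.map fun u => (u.1, r * u.2)

theorem map_fst_scale (r : ℝ) (l : List (Transition Q Γ × ℝ)) :
    (scale r l).map Prod.fst = l.map Prod.fst := by
  simp [scale]

theorem equivalent_run_scale (T r r' : ℝ) (l : List (Transition Q Γ × ℝ)) (c : ℝ) :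
    Equivalent (A.run T (scale r l) c) (A.run T (scale r' l) c) := by
  unfold Equivalent scale
  induction l generalizing c with
  | nil => rfl
  | cons u l ih => simp only [List.map_cons, run, List.cons.injEq]; exact ⟨rfl, ih _⟩

theorem adjacent_run_scale {T r r' : ℝ} {l : List (Transition Q Γ × ℝ)}
    (h : ∀ u ∈ l, |r - r'| * |u.2| ≤ 1) (c : ℝ) :
    Adjacent (inputs (A.run T (scale r l) c)) (inputs (A.run T (scale r' l) c)) := by
  unfold Adjacent scale
  induction l generalizing c with
  | nil => exact .nil
  | cons u l ih =>
    simp only [List.mem_cons, forall_eq_or_imp] at h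
    have := ih h.2 (A.nextCenter T u.1 c)
    simp only [List.map_cons, run, inputs, windowStep]
    by_cases hi : A.isInput u.1.src = true
    · simp only [List.filterMap_cons, hi, if_true]
      refine .cons ?_ this
      rw [add_sub_add_left_eq_sub, ← sub_mul, abs_mul]
      exact h.1
    · simp only [List.filterMap_cons, hi]
      exact this

/-- Group privacy: the shifts are introduced in N + 1 equal parts, each of which changes every input
by at most 1 and costs a factor exp d. -/
theorem pathProb_run_le {d : ℝ} (hd : A.IsDPAt d 1) {T : ℝ} {l : List (Transition Q Γ × ℝ)} {q : Q}
    (hl : A.IsPath A.init (l.map Prod.fst) q) {N : ℕ} (hN : ∀ u ∈ l, |u.2| ≤ N) (c : ℝ) :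
    A.pathProb 1 (A.run T (scale 0 l) c) 0 ≤
      Real.exp (d * (N + 1 : ℕ)) * A.pathProb 1 (A.run T l c) 0 := by
  have key : ∀ k : ℕ, A.pathProb 1 (A.run T (scale 0 l) c) 0 ≤
      Real.exp (d * k) * A.pathProb 1 (A.run T (scale (k / (N + 1 : ℕ)) l) c) 0 := by
    intro k
    induction k with
    | zero => simp
    | succ k ih =>
      refine ih.trans ?_
      have := hd _ _ q q (isExecution_run (T := T) (c := c)
          (by rwa [map_fst_scale]) : A.IsExecution A.init (A.run T (scale (k / (N + 1 : ℕ)) l) c) q)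
        (isExecution_run (T := T) (c := c) (by rwa [map_fst_scale]) :
          A.IsExecution A.init (A.run T (scale ((k + 1 : ℕ) / (N + 1 : ℕ)) l) c) q)
        (equivalent_run_scale _ _ _ _ _) (adjacent_run_scale (fun u hu => ?_) c)
      · calc _ ≤ Real.exp (d * k) * (Real.exp (d * 1) * _) :=
              mul_le_mul_of_nonneg_left this (Real.exp_pos _).le
          _ = _ := by
              rw [← mul_assoc, ← Real.exp_add]; congr 2; push_cast; ring
      · have h1 := hN u hu
        rw [← sub_div, abs_div, div_mul_eq_mul_div, div_le_one (abs_pos.2 (by positivity))]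
        have h2 : |((k : ℕ) : ℝ) - ((k + 1 : ℕ) : ℝ)| = 1 := by push_cast; simp
        rw [h2, one_mul]
        refine h1.trans (le_trans ?_ (le_abs_self _))
        push_cast; linarith
  have := key (N + 1)
  rw [div_self (by positivity)] at this
  have h1 : scale 1 l = l := by simp [scale]
  rwa [h1] at this

/-- The centres are 2T apart, so the two windows of radius T are disjoint and lie in the order that
the guard demands. -/
theorem Guard.window_holds {g : Guard} {x z c T : ℝ} (hx : |x - c| < T)
    (hz : |z - (c - 2 * T * g.sgn)| < T) : g.Holds x z := by
  rw [abs_lt] at hx hz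
  cases g <;> simp [Guard.Holds, Guard.sgn] at * <;> linarith

theorem windowStep_mean_of_isInput {T r c : ℝ} {t : Transition Q Γ} (h : A.isInput t.src = true) :
    (A.μ t.src : ℝ) + (A.windowStep T r c t).inp.getD 0 = A.center T t c + r := by
  simp [windowStep, h]; ring

theorem windowStep_mean_zero {T c : ℝ} {t : Transition Q Γ} :
    (A.μ t.src : ℝ) + (A.windowStep T 0 c t).inp.getD 0 = A.center T t c := by
  by_cases h : A.isInput t.src = true
  · rw [windowStep_mean_of_isInput h, add_zero]
  · simp [windowStep, h, center]

theorem windowStep_admits {T r c : ℝ} {t : Transition Q Γ} (z : ℝ) :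
    (A.windowStep T r c t).lab.Admits z ↔ (t.out = .svar → |z - A.center T t c| < T) := by
  simp only [windowStep]
  cases t.out with
  | sym g => simp [Label.Admits]
  | svar' => simp [Label.Admits]
  | svar =>
    simp only [Label.Admits, openInterval, Set.mem_ofPred_eq, EReal.coe_lt_coe_iff, abs_lt, forall_const]
    constructor <;> rintro ⟨h1, h2⟩ <;> constructor <;> linarith

/-- In an input state the input places the mean where the guard holds for the whole window. In a
non-input state the mean cannot be influenced, but the guard is `true`. -/
theorem window_subset_sampleSet {T c x : ℝ} {t : Transition Q Γ} (ht : A.IsTransition t)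
    (hx : |x - c| < T) {r : ℝ} : Set.Ioo (A.center T t c - T) (A.center T t c + T) ⊆
      (A.windowStep T r c t).sampleSet x := by
  intro z hz
  have hz' : |z - A.center T t c| < T := by rw [abs_lt]; constructor <;> linarith [hz.1, hz.2]
  refine ⟨?_, (windowStep_admits z).2 fun _ => hz'⟩
  simp only [windowStep]
  by_cases hi : A.isInput t.src = true
  · simp only [center, hi, if_true] at hz'
    exact Guard.window_holds hx hz'
  · rw [guard_tt_of_isInput_eq_false ht (by simpa using hi)]; trivial

theorem primeFactor_windowStep {T η c : ℝ} {t : Transition Q Γ} (hA : A.Alive)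
    (ht : A.IsTransition t) (hT : A.WindowBound T η) (hη : 0 ≤ η) :
    1 - η ≤ A.primeFactor 1 (A.windowStep T 0 c t) := by
  unfold primeFactor
  cases ho : t.out with
  | sym g => simp [windowStep, ho, hη]
  | svar => simp [windowStep, ho, hη]
  | svar' =>
    have hd := (hA t ht).2 ho
    have hd' : (0 : ℝ) < A.d' t.src * 1 := by rw [mul_one]; exact_mod_cast hd
    have h := (hT.2 t.src).2 hd
    have hc : (A.windowStep T 0 c t).inp.getD 0 = A.center T t c - A.μ t.src := by
      have := windowStep_mean_zero (A := A) (T := T) (c := c) (t := t); linarith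
    have htr : (A.windowStep T 0 c t).tr = t := rfl
    have hl : (A.windowStep T 0 c t).lab = .real true
        ((A.μ' t.src + (A.center T t c - A.μ t.src) - T : ℝ) : EReal)
        ((A.μ' t.src + (A.center T t c - A.μ t.src) + T : ℝ) : EReal) := by
      simp [windowStep, ho]
    rw [hl, htr, hc]
    refine le_trans (by linarith) (setIntegral_lapDensity_window hd' _ hT.1
      (measurableSet_openInterval _ _) ?_)
    intro z hz
    simp only [openInterval, Set.mem_ofPred_eq, EReal.coe_lt_coe_iff]
    exact hz

/-- Each step contributes at most two factors, for σ and σ', each at least 1 - η. Inductively the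
stored value stays within T of its centre, which keeps the next guard satisfied on the whole window.
-/
theorem le_pathProb_run {T η : ℝ} (hA : A.Alive) (hT : A.WindowBound T η) (hη : 0 ≤ η) (hη1 : η ≤ 1)
    {l : List (Transition Q Γ × ℝ)} (hl : ∀ u ∈ l, A.IsTransition u.1) {c x : ℝ} (hx : |x - c| < T) :
    ((1 - η) * (1 - η)) ^ l.length ≤ A.pathProb 1 (A.run T (scale 0 l) c) x := by
  induction l generalizing c x with
  | nil => simp [scale, run, pathProb]
  | cons u l ih =>
    simp only [List.mem_cons, forall_eq_or_imp] at hl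
    have hcons : A.run T (scale 0 (u :: l)) c =
        A.windowStep T 0 c u.1 :: A.run T (scale 0 l) (A.nextCenter T u.1 c) := by
      simp [scale, run]
    have hp := primeFactor_windowStep (c := c) hA hl.1 hT hη
    have h1η : 0 ≤ 1 - η := by linarith
    have hsub := window_subset_sampleSet (r := 0) hl.1 hx
    have hwin : (u.1.asg = true ∨ u.1.guard ≠ .tt ∨ u.1.out = .svar) → ∀ I : Set ℝ, MeasurableSet I →
        Set.Ioo (A.center T u.1 c - T) (A.center T u.1 c + T) ⊆ I →
        1 - η ≤ ∫ z in I, A.dens 1 (A.windowStep T 0 c u.1) z := by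
      intro hu I hI hs
      have hd := (hA u.1 hl.1).1 hu
      have hd' : (0 : ℝ) < A.d u.1.src * 1 := by rw [mul_one]; exact_mod_cast hd
      have h := (hT.2 u.1.src).1 hd
      have := setIntegral_lapDensity_window hd' (A.center T u.1 c) hT.1 hI hs
      unfold dens
      rw [show (A.windowStep T 0 c u.1).tr = u.1 from rfl, windowStep_mean_zero]
      linarith
    have hP0 : 0 ≤ ((1 - η) * (1 - η)) ^ l.length := by positivity
    have hp0 := h1η.trans hp
    rw [hcons, List.length_cons, pow_succ]
    cases hasg : u.1.asg
    · rw [pathProb_cons_of_not_asg _ _ _ _ _ hasg]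
      have hr := ih hl.2 (c := A.nextCenter T u.1 c) (x := x) (by simpa [nextCenter, hasg] using hx)
      have hg : 1 - η ≤ A.guardFactor 1 (A.windowStep T 0 c u.1) x := by
        by_cases hc : (A.windowStep T 0 c u.1).tr.guard = .tt ∧
            (A.windowStep T 0 c u.1).lab.out ≠ .svar
        · rw [guardFactor_eq_one hc]; linarith
        · rw [guardFactor_eq_integral hc]
          refine hwin ?_ _ (Step.measurableSet_sampleSet _ _) hsub
          by_contra hcc
          push Not at hcc
          refine hc ⟨hcc.2.1, ?_⟩
          have : (A.windowStep T 0 c u.1).lab.out = u.1.out := by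
            simp only [windowStep]; cases u.1.out <;> rfl
          rw [this]; exact hcc.2.2
      have hg0 := h1η.trans hg
      calc _ = ((1 - η) * (1 - η)) * ((1 - η) * (1 - η)) ^ l.length := by ring
        _ ≤ _ := by gcongr
    · rw [pathProb_cons_asg _ _ _ _ _ hasg]
      have h1 : (1 - η) * ((1 - η) * (1 - η)) ^ l.length ≤
          ∫ z in (A.windowStep T 0 c u.1).sampleSet x, A.dens 1 (A.windowStep T 0 c u.1) z *
            A.pathProb 1 (A.run T (scale 0 l) (A.nextCenter T u.1 c)) z := by
        have hint := integrable_dens_mul_pathProb (A := A) zero_le_one (A.windowStep T 0 c u.1)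
          (A.run T (scale 0 l) (A.nextCenter T u.1 c))
        -- Restricting to samples in the window loses only the factor 1 - η, and there the induction
        -- hypothesis applies with the new centre.
        calc _ ≤ (∫ z in Set.Ioo (A.center T u.1 c - T) (A.center T u.1 c + T),
              A.dens 1 (A.windowStep T 0 c u.1) z) * ((1 - η) * (1 - η)) ^ l.length :=
              mul_le_mul_of_nonneg_right (hwin (Or.inl hasg) _ measurableSet_Ioo subset_rfl) hP0
          _ = ∫ z in Set.Ioo (A.center T u.1 c - T) (A.center T u.1 c + T),
              A.dens 1 (A.windowStep T 0 c u.1) z * ((1 - η) * (1 - η)) ^ l.length :=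
              (integral_mul_const _ _).symm
          _ ≤ ∫ z in Set.Ioo (A.center T u.1 c - T) (A.center T u.1 c + T),
              A.dens 1 (A.windowStep T 0 c u.1) z *
                A.pathProb 1 (A.run T (scale 0 l) (A.nextCenter T u.1 c)) z := by
              refine setIntegral_mono_on ?_ hint.integrableOn measurableSet_Ioo fun z hz => ?_
              · exact ((integrable_lapDensity (scale_nonneg zero_le_one _) _).mul_const _).integrableOn
              · refine mul_le_mul_of_nonneg_left (ih hl.2 ?_) (dens_nonneg zero_le_one _ _)
                rw [nextCenter, if_pos hasg, abs_lt]
                constructor <;> linarith [hz.1, hz.2]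
          _ ≤ _ := setIntegral_mono_set hint.integrableOn
              (ae_of_all _ fun z => mul_nonneg (dens_nonneg zero_le_one _ _)
                (pathProb_nonneg zero_le_one _ _)) (ae_of_all _ hsub)
      calc _ = (1 - η) * ((1 - η) * ((1 - η) * (1 - η)) ^ l.length) := by ring
        _ ≤ _ := by gcongr

/-! ### Upper bounds for path probabilities -/

section UpperBounds

variable {ε : ℝ} {s : Step Q Γ} {ρ ρ₁ ρ₂ : List (Step Q Γ)} {B x : ℝ}

/-- A step is an average with total weight at most 1 over the stored values that it can leave
behind, so a bound for those suffices. -/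
theorem pathProb_cons_le (hε : 0 ≤ ε) (hB : 0 ≤ B)
    (h : ∀ z ∈ s.sampleSet x, A.pathProb ε ρ (if s.tr.asg = true then z else x) ≤ B) :
    A.pathProb ε (s :: ρ) x ≤ B := by
  cases hs : s.tr.asg
  · rw [pathProb_cons_of_not_asg _ _ _ _ _ hs]
    simp only [hs, Bool.false_eq_true, if_false] at h
    have hpg := mul_le_one₀ (primeFactor_le_one (A := A) hε s) (guardFactor_nonneg hε s x)
      (guardFactor_le_one (A := A) hε s x)
    have hpg0 := mul_nonneg (primeFactor_nonneg (A := A) hε s) (guardFactor_nonneg (A := A) hε s x)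
    -- Without an admissible sample the hypothesis is vacuous, but then the guard factor is an
    -- integral over the empty set. It cannot be the constant 1, because a step whose guard is
    -- `true` and which does not output σ admits every sample.
    rcases (s.sampleSet x).eq_empty_or_nonempty with he | ⟨z, hz⟩
    · have hg : A.guardFactor ε s x = 0 := by
        rw [guardFactor_eq_integral, he]
        · simp
        · rintro ⟨h1, h2⟩
          have : (0 : ℝ) ∈ s.sampleSet x := ⟨by rw [h1]; trivial, Label.admits_of_out_ne h2 _⟩
          rw [he] at this; exact this
      rw [hg]; simpa using hB
    · calc _ ≤ 1 * B := mul_le_mul hpg (h z hz) (pathProb_nonneg hε _ _) zero_le_one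
        _ = B := one_mul B
  · rw [pathProb_cons_asg _ _ _ _ _ hs]
    simp only [hs, if_true] at h
    have hi := integrable_lapDensity (scale_nonneg (A := A) hε s.tr.src) (A.μ s.tr.src + s.inp.getD 0)
    have h1 : ∫ z in s.sampleSet x, A.dens ε s z * A.pathProb ε ρ z ≤ 1 * B := by
      calc _ ≤ ∫ z in s.sampleSet x, A.dens ε s z * B :=
            setIntegral_mono_on (integrable_dens_mul_pathProb hε s ρ).integrableOn
              (hi.mul_const B).integrableOn (s.measurableSet_sampleSet x) fun z hz =>
              mul_le_mul_of_nonneg_left (h z hz) (dens_nonneg hε s z)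
        _ = (∫ z in s.sampleSet x, A.dens ε s z) * B := integral_mul_const _ _
        _ ≤ 1 * B := mul_le_mul_of_nonneg_right
              (setIntegral_lapDensity_le_one (scale_nonneg hε _) _ _) hB
    calc _ ≤ 1 * (1 * B) := mul_le_mul (primeFactor_le_one hε s) h1
          (integral_nonneg fun z => mul_nonneg (dens_nonneg hε s z) (pathProb_nonneg hε _ _)) zero_le_one
      _ = B := by ring

/-- It suffices that one of the factors for σ and σ' is small. The side condition in the second
alternative ensures that σ is integrated at all. -/
theorem pathProb_cons_le_mul (hε : 0 ≤ ε) (hB : 0 ≤ B) (h : ∀ y, A.pathProb ε ρ y ≤ B) {κ : ℝ}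
    (hκ : 0 ≤ κ) (hs : A.primeFactor ε s ≤ κ ∨
      ((s.tr.asg = true ∨ s.tr.guard ≠ .tt ∨ s.lab.out = .svar) ∧
        ∫ z in s.sampleSet x, A.dens ε s z ≤ κ)) :
    A.pathProb ε (s :: ρ) x ≤ κ * B := by
  have hi := integrable_lapDensity (scale_nonneg (A := A) hε s.tr.src) (A.μ s.tr.src + s.inp.getD 0)
  have h0 := setIntegral_lapDensity_nonneg (scale_nonneg (A := A) hε s.tr.src)
    (A.μ s.tr.src + s.inp.getD 0) (s.sampleSet x)
  have h1 := setIntegral_lapDensity_le_one (scale_nonneg (A := A) hε s.tr.src)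
    (A.μ s.tr.src + s.inp.getD 0) (s.sampleSet x)
  have hp := primeFactor_le_one (A := A) hε s
  have hp0 := primeFactor_nonneg (A := A) hε s
  cases hasg : s.tr.asg
  · rw [pathProb_cons_of_not_asg _ _ _ _ _ hasg]
    refine mul_le_mul ?_ (h x) (pathProb_nonneg hε _ _) hκ
    rcases hs with hs | ⟨h2, hs⟩
    · calc _ ≤ κ * 1 := mul_le_mul hs (guardFactor_le_one hε s x) (guardFactor_nonneg hε s x) hκ
        _ = κ := mul_one κ
    · rw [guardFactor_eq_integral (by simp [hasg] at h2; tauto)]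
      calc _ ≤ 1 * κ := mul_le_mul hp hs h0 zero_le_one
        _ = κ := one_mul κ
  · rw [pathProb_cons_asg _ _ _ _ _ hasg]
    have h3 : ∫ z in s.sampleSet x, A.dens ε s z * A.pathProb ε ρ z ≤
        (∫ z in s.sampleSet x, A.dens ε s z) * B := by
      calc _ ≤ ∫ z in s.sampleSet x, A.dens ε s z * B :=
            setIntegral_mono (integrable_dens_mul_pathProb hε s ρ).integrableOn
              (hi.mul_const B).integrableOn fun z =>
              mul_le_mul_of_nonneg_left (h z) (dens_nonneg hε s z)
        _ = _ := integral_mul_const _ _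
    calc _ ≤ A.primeFactor ε s * ((∫ z in s.sampleSet x, A.dens ε s z) * B) :=
          mul_le_mul_of_nonneg_left h3 hp0
      _ = (A.primeFactor ε s * ∫ z in s.sampleSet x, A.dens ε s z) * B := by ring
      _ ≤ κ * B := by
          refine mul_le_mul_of_nonneg_right ?_ hB
          rcases hs with hs | ⟨-, hs⟩
          · calc _ ≤ κ * 1 := mul_le_mul hs h1 h0 hκ
              _ = κ := mul_one κ
          · calc _ ≤ 1 * κ := mul_le_mul hp hs h0 zero_le_one
              _ = κ := one_mul κ

theorem pathProb_append_le (hε : 0 ≤ ε) (hB : 0 ≤ B) (h : ∀ y, A.pathProb ε ρ₂ y ≤ B) (x : ℝ) :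
    A.pathProb ε (ρ₁ ++ ρ₂) x ≤ B := by
  induction ρ₁ generalizing x with
  | nil => exact h x
  | cons s ρ ih => exact pathProb_cons_le hε hB fun z _ => ih _

theorem Guard.Holds.sgn_le {g : Guard} (hg : g ≠ .tt) {z : ℝ} (h : g.Holds x z) :
    g.sgn * z ≤ g.sgn * x := by
  cases g <;> simp [Guard.Holds, Guard.sgn] at * <;> linarith

/-- Along an AG-path (AL-path), the stored value moves only upwards (downwards). -/
theorem pathProb_append_le_of_assignsOnly (hε : 0 ≤ ε) (hB : 0 ≤ B) {g : Guard} (hg : g ≠ .tt)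
    (ha : AssignsOnly g (ρ₁.map Step.tr))
    (h : ∀ y, g.sgn * y ≤ g.sgn * x → A.pathProb ε ρ₂ y ≤ B) :
    A.pathProb ε (ρ₁ ++ ρ₂) x ≤ B := by
  induction ρ₁ generalizing x with
  | nil => exact h x le_rfl
  | cons s ρ ih =>
    refine pathProb_cons_le hε hB fun z hz => ih (fun t ht => ha t ?_) fun y hy => h y ?_
    · simp only [List.map_cons, List.mem_cons]; exact Or.inr ht
    · refine hy.trans ?_
      split_ifs with hs
      · have := ha s.tr (by simp) hs
        have h1 := hz.1
        rw [this] at h1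
        exact Guard.Holds.sgn_le hg h1
      · exact le_rfl

theorem pathProb_append_le_of_not_asg (hε : 0 ≤ ε) (h : ∀ s ∈ ρ₁, s.tr.asg = false) :
    A.pathProb ε (ρ₁ ++ ρ₂) x ≤ A.pathProb ε ρ₂ x := by
  induction ρ₁ with
  | nil => exact le_rfl
  | cons s ρ ih =>
    simp only [List.mem_cons, forall_eq_or_imp] at h
    refine (pathProb_cons_le hε (pathProb_nonneg hε _ _) fun z _ => ?_ :
      A.pathProb ε (s :: (ρ ++ ρ₂)) x ≤ _)
    simpa [h.1] using ih h.2

end UpperBounds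

end DiPA

namespace DiPA

variable {Q Γ : Type*} {A : DiPA Q Γ}

/-! ### Ill-formed automata are not differentially private -/

/-- The unshifted run has probability at least β^(n₀ + n₁ℓ) with β = (1 - η)^2, the shifted one at
most (2η)^ℓ, and privacy bounds their ratio by a constant. It matters that n₀ and n₁ do not depend
on η, and that N does not depend on ℓ. -/
theorem not_differentiallyPrivate_of_runs [Finite Q] (hA : A.Alive) (n₀ n₁ : ℕ)
    (h : ∀ T η, 0 < η → A.WindowBound T η → ∃ N : ℕ, ∀ ℓ : ℕ, ∃ l q,
      A.IsPath A.init (l.map Prod.fst) q ∧ l.length ≤ n₀ + n₁ * ℓ ∧ (∀ u ∈ l, |u.2| ≤ (N : ℝ)) ∧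
        A.pathProb 1 (A.run T l 0) 0 ≤ (2 * η) ^ ℓ) : ¬ A.DifferentiallyPrivate := by
  rintro ⟨d, -, hd⟩
  -- By Bernoulli's inequality, (1 - η)^(2n₁) ≥ 1 - 2n₁η. This exceeds 2η as soon as η(2n₁ + 2) < 1.
  obtain ⟨η, hη⟩ : ∃ η : ℝ, η = 1 / (2 * n₁ + 4) := ⟨_, rfl⟩
  have hη0 : 0 < η := by rw [hη]; positivity
  have hη1 : η * (2 * n₁ + 4) = 1 := by rw [hη]; field_simp
  have hη2 : η ≤ 1 := by nlinarith [(Nat.cast_nonneg n₁ : (0 : ℝ) ≤ n₁)]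
  obtain ⟨T, hT⟩ := A.exists_windowBound hη0
  obtain ⟨N, hN⟩ := h T η hη0 hT
  obtain ⟨β, hβ⟩ : ∃ β : ℝ, β = (1 - η) * (1 - η) := ⟨_, rfl⟩
  have hβ0 : 0 < β := by
    have : η < 1 := by nlinarith [(Nat.cast_nonneg n₁ : (0 : ℝ) ≤ n₁)]
    rw [hβ]; exact mul_pos (by linarith) (by linarith)
  have hβ1 : β ≤ 1 := by rw [hβ]; nlinarith
  have hlt : 2 * η < β ^ n₁ := by
    have := one_add_mul_le_pow (a := -η) (by linarith) (2 * n₁)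
    have e : β ^ n₁ = (1 + -η) ^ (2 * n₁) := by rw [hβ, pow_mul]; ring
    rw [e]
    push_cast at this
    nlinarith
  have key : ∀ ℓ : ℕ, (β ^ n₁ / (2 * η)) ^ ℓ ≤ Real.exp (d * (N + 1 : ℕ)) / β ^ n₀ := by
    intro ℓ
    obtain ⟨l, q, hl, hlen, hsh, hp⟩ := hN ℓ
    have h1 := le_pathProb_run (c := 0) (x := 0) hA hT hη0.le hη2 (l := l)
      (fun u hu => hl.isTransition _ (List.mem_map_of_mem hu)) (by simpa using hT.1)
    have h2 := pathProb_run_le (hd 1 one_pos) (T := T) hl hsh 0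
    rw [← hβ] at h1
    have h3 : β ^ (n₀ + n₁ * ℓ) ≤ β ^ l.length := pow_le_pow_of_le_one hβ0.le hβ1 hlen
    have h4 : β ^ n₀ * (β ^ n₁) ^ ℓ ≤ Real.exp (d * (N + 1 : ℕ)) * (2 * η) ^ ℓ := by
      rw [← pow_mul, ← pow_add]
      exact (h3.trans h1).trans (h2.trans (mul_le_mul_of_nonneg_left hp (Real.exp_pos _).le))
    rw [div_pow, div_le_div_iff₀ (by positivity) (by positivity)]
    linarith
  have hgt : 1 < β ^ n₁ / (2 * η) := by rw [one_lt_div (by positivity)]; exact hlt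
  obtain ⟨ℓ, hℓ⟩ := ((tendsto_pow_atTop_atTop_of_one_lt hgt).eventually_gt_atTop
    (Real.exp (d * (N + 1 : ℕ)) / β ^ n₀)).exists
  exact absurd (key ℓ) (not_le.2 hℓ)

/-- `ℓ` copies of a list. -/
def copies {α : Type*} (ℓ : ℕ) (l : List α) : List α := (List.replicate ℓ l).flatten

theorem copies_succ {α : Type*} (ℓ : ℕ) (l : List α) : copies (ℓ + 1) l = l ++ copies ℓ l := by
  simp [copies, List.replicate_succ]

theorem length_copies {α : Type*} (ℓ : ℕ) (l : List α) : (copies ℓ l).length = ℓ * l.length := by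
  simp [copies]

theorem mem_of_mem_copies {α : Type*} {ℓ : ℕ} {l : List α} {u : α} (h : u ∈ copies ℓ l) : u ∈ l := by
  simp only [copies, List.mem_flatten, List.mem_replicate] at h
  obtain ⟨l', ⟨-, rfl⟩, h⟩ := h
  exact h

theorem isPath_copies {q : Q} {l : List (Transition Q Γ × ℝ)} (h : A.IsPath q (l.map Prod.fst) q)
    (ℓ : ℕ) : A.IsPath q ((copies ℓ l).map Prod.fst) q := by
  induction ℓ with
  | zero => rfl
  | succ ℓ ih => rw [copies_succ, List.map_append]; exact isPath_append.2 ⟨q, h, ih⟩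

/-- Transitions without shifts. -/
def unshifted (ts : List (Transition Q Γ)) : List (Transition Q Γ × ℝ) := ts.map fun t => (t, 0)

theorem map_fst_unshifted (ts : List (Transition Q Γ)) : (unshifted ts).map Prod.fst = ts := by
  simp [unshifted, Function.comp_def]

theorem length_unshifted (ts : List (Transition Q Γ)) : (unshifted ts).length = ts.length := by
  simp [unshifted]

theorem not_asg_of_mem_unshifted {ts : List (Transition Q Γ)} (h : ∀ t ∈ ts, t.asg = false) :
    ∀ u ∈ unshifted ts, u.1.asg = false := by
  intro u hu
  simp only [unshifted, List.mem_map] at hu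
  obtain ⟨t, ht, rfl⟩ := hu
  exact h t ht

theorem not_asg_run {T : ℝ} {l : List (Transition Q Γ × ℝ)} (h : ∀ u ∈ l, u.1.asg = false) (c : ℝ) :
    ∀ s ∈ A.run T l c, s.tr.asg = false := by
  intro s hs
  have := List.mem_map_of_mem (f := Step.tr) hs
  rw [map_tr_run, List.mem_map] at this
  obtain ⟨u, hu, he⟩ := this
  rw [← he]; exact h u hu

theorem exists_nat_bound (l : List (Transition Q Γ × ℝ)) : ∃ N : ℕ, ∀ u ∈ l, |u.2| ≤ N := by
  induction l with
  | nil => exact ⟨0, by simp⟩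
  | cons u l ih =>
    obtain ⟨N, hN⟩ := ih
    obtain ⟨M, hM⟩ := exists_nat_ge |u.2|
    refine ⟨max N M, fun v hv => ?_⟩
    rcases List.mem_cons.1 hv with rfl | hv
    · exact hM.trans (by exact_mod_cast le_max_right _ _)
    · exact (hN v hv).trans (by exact_mod_cast le_max_left _ _)

theorem setIntegral_dens_windowStep_far {T η r c : ℝ} {t : Transition Q Γ} (hT : A.WindowBound T η)
    (hi : A.isInput t.src = true) (hd : 0 < A.d t.src) {I : Set ℝ}
    (hI : I ⊆ Set.Ici (A.center T t c + r + T) ∨ I ⊆ Set.Iic (A.center T t c + r - T)) :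
    ∫ z in I, A.dens 1 (A.windowStep T r c t) z ≤ η := by
  have hd' : (0 : ℝ) < A.d t.src * 1 := by rw [mul_one]; exact_mod_cast hd
  unfold dens
  rw [show (A.windowStep T r c t).tr = t from rfl, windowStep_mean_of_isInput hi]
  exact (setIntegral_lapDensity_far hd' hT.1.le hI).trans ((hT.2 t.src).1 hd)

theorem windowStep_out {T r c : ℝ} {t : Transition Q Γ} : (A.windowStep T r c t).lab.out = t.out := by
  simp only [windowStep]; cases t.out <;> rfl

theorem isInput_of_guard_ne_tt {t : Transition Q Γ} (ht : A.IsTransition t) (h : t.guard ≠ .tt) :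
    A.isInput t.src = true := by
  by_contra hc
  exact h (guard_tt_of_isInput_eq_false ht (by simpa using hc))

/-- A cycle each copy of which can be made improbable. -/
theorem not_differentiallyPrivate_of_cycle [Finite Q] (hA : A.Alive) {q : Q}
    {C : List (Transition Q Γ)} (hq : A.Reachable q) (hC : A.IsCycle q C)
    (h : ∀ T η, 0 < η → A.WindowBound T η → ∃ lC : List (Transition Q Γ × ℝ), lC.map Prod.fst = C ∧
      ∀ c ρ B, 0 ≤ B → (∀ y, A.pathProb 1 ρ y ≤ B) →
        ∀ x, A.pathProb 1 (A.run T lC c ++ ρ) x ≤ 2 * η * B) : ¬ A.DifferentiallyPrivate := by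
  obtain ⟨pre, hpre⟩ := hq
  refine not_differentiallyPrivate_of_runs hA pre.length C.length fun T η hη hT => ?_
  obtain ⟨lC, rfl, hlC⟩ := h T η hη hT
  obtain ⟨N, hN⟩ := exists_nat_bound lC
  refine ⟨N, fun ℓ => ⟨unshifted pre ++ copies ℓ lC, q, ?_, ?_, ?_, ?_⟩⟩
  · rw [List.map_append, map_fst_unshifted]
    exact isPath_append.2 ⟨q, hpre, isPath_copies hC.2 ℓ⟩
  · simp [length_unshifted, length_copies, mul_comm]
  · intro u hu
    rcases List.mem_append.1 hu with hu | hu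
    · simp only [unshifted, List.mem_map] at hu
      obtain ⟨t, -, rfl⟩ := hu
      simp
    · exact hN u (mem_of_mem_copies hu)
  · rw [run_append]
    refine pathProb_append_le zero_le_one (by positivity) ?_ 0
    have key : ∀ (ℓ : ℕ) (c y : ℝ), A.pathProb 1 (A.run T (copies ℓ lC) c) y ≤ (2 * η) ^ ℓ := by
      intro ℓ
      induction ℓ with
      | zero => intro c y; exact le_rfl
      | succ ℓ ih =>
        intro c y
        rw [copies_succ, run_append, pow_succ']
        exact hlC c _ _ (by positivity) (ih _) y
    exact key ℓ _

/-- Adding 2T to the input of the disclosing transition leaves the interval in place but moves the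
mean to a distance at least T from it. Every traversal of the cycle then gains a factor η. -/
theorem not_differentiallyPrivate_of_disclosing [Finite Q] (hA : A.Alive) {q : Q}
    {C : List (Transition Q Γ)} (hq : A.Reachable q) (hC : A.IsCycle q C) (hd : A.Disclosing C) :
    ¬ A.DifferentiallyPrivate := by
  obtain ⟨t, ht, hi, ho⟩ := hd
  have htr := hC.2.isTransition t ht
  obtain ⟨c₁, c₂, rfl⟩ := List.append_of_mem ht
  refine not_differentiallyPrivate_of_cycle hA hq hC fun T η hη hT =>
    ⟨unshifted c₁ ++ (t, 2 * T) :: unshifted c₂, by simp [map_fst_unshifted], ?_⟩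
  intro c ρ B hB hρ x
  rw [run_append, List.append_assoc]
  refine pathProb_append_le zero_le_one (by positivity) (fun y => ?_) x
  simp only [run, List.cons_append]
  refine pathProb_cons_le_mul zero_le_one hB
    (fun y => pathProb_append_le zero_le_one hB hρ y) (by positivity) ?_
  generalize A.endCenter T (unshifted c₁) c = c
  rcases ho with ho | ho
  · right
    refine ⟨Or.inr (Or.inr (by rw [windowStep_out, ho])),
      (setIntegral_dens_windowStep_far hT hi ((hA t htr).1 (by simp [ho])) (Or.inr ?_)).trans
        (by linarith)⟩
    rintro z ⟨-, hz⟩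
    have := (abs_lt.1 ((windowStep_admits z).1 hz ho)).2
    have h0 := hT.1
    simp only [Set.mem_Iic]; linarith
  · left
    have hd := (hA t htr).2 ho
    have hd' : (0 : ℝ) < A.d' t.src * 1 := by rw [mul_one]; exact_mod_cast hd
    unfold primeFactor
    have hl : (A.windowStep T (2 * T) c t).lab = .real true
        ((A.μ' t.src + (A.center T t c - A.μ t.src) - T : ℝ) : EReal)
        ((A.μ' t.src + (A.center T t c - A.μ t.src) + T : ℝ) : EReal) := by
      simp [windowStep, ho]
    have hc : (A.windowStep T (2 * T) c t).inp.getD 0 = A.center T t c - A.μ t.src + 2 * T := by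
      simp [windowStep, hi]
    rw [hl, show (A.windowStep T (2 * T) c t).tr = t from rfl, hc]
    refine ((setIntegral_lapDensity_far hd' hT.1.le (Or.inr ?_)).trans ((hT.2 t.src).2 hd)).trans
      (by linarith)
    rintro z ⟨-, hz⟩
    rw [EReal.coe_lt_coe_iff] at hz
    simp only [Set.mem_Iic]; linarith

theorem exists_last_asg {t : Transition Q Γ} (ht : t.asg = true) (ts : List (Transition Q Γ)) :
    ∃ pre t' mid, t :: ts = pre ++ t' :: mid ∧ t'.asg = true ∧ ∀ u ∈ mid, u.asg = false := by
  induction ts using List.reverseRecOn with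
  | nil => exact ⟨[], t, [], rfl, ht, by simp⟩
  | append_singleton ts u ih =>
    cases hu : u.asg
    · obtain ⟨pre, t', mid, he, h1, h2⟩ := ih
      refine ⟨pre, t', mid ++ [u], ?_, h1, ?_⟩
      · rw [← List.cons_append, he]; simp
      · intro v hv
        rcases List.mem_append.1 hv with hv | hv
        · exact h2 v hv
        · rw [List.mem_singleton.1 hv]; exact hu
    · exact ⟨t :: ts, u, [], by simp, hu, by simp⟩

/-- Take the last assignment before the guarded transition; the stored value is then unchanged in
between. -/
theorem Leaking.exists_decomposition {C : List (Transition Q Γ)} (h : Leaking C) :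
    ∃ c₁ t c₂ t' c₃, C = c₁ ++ t :: (c₂ ++ t' :: c₃) ∧ t.asg = true ∧ t'.guard ≠ .tt ∧
      ∀ u ∈ c₂, u.asg = false := by
  obtain ⟨i, j, hij, hj, h1, h2⟩ := h
  have hi := hij.trans hj
  obtain ⟨pre, t, mid, he, h3, h4⟩ := exists_last_asg h1 ((C.take j).drop (i + 1))
  refine ⟨C.take i ++ pre, t, mid, C[j], C.drop (j + 1), ?_, h3, h2, h4⟩
  have e1 : C = C.take j ++ C[j] :: C.drop (j + 1) := by simp
  have e2 : C.take j = C.take i ++ C[i] :: (C.take j).drop (i + 1) := by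
    have hlen : i < (C.take j).length := by simp; omega
    have e3 : C.take j = (C.take j).take i ++ (C.take j)[i] :: (C.take j).drop (i + 1) := by
      rw [← List.drop_eq_getElem_cons, List.take_append_drop]
    rw [List.take_take, min_eq_left hij.le, List.getElem_take] at e3
    exact e3
  rw [he] at e2
  calc C = C.take j ++ C[j] :: C.drop (j + 1) := e1
    _ = _ := by rw [e2]; simp

/-- In every traversal, the assigned sample leaves its window with probability at most η. If it
stays, the guarded transition is improbable after the shift. Together these give 2η per traversal,
uniformly in the value stored before it. -/
theorem not_differentiallyPrivate_of_leaking [Finite Q] (hA : A.Alive) {q : Q}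
    {C : List (Transition Q Γ)} (hq : A.Reachable q) (hC : A.IsCycle q C) (hl : Leaking C) :
    ¬ A.DifferentiallyPrivate := by
  obtain ⟨c₁, t, c₂, t', c₃, rfl, ht, ht', hc₂⟩ := hl.exists_decomposition
  have htr := hC.2.isTransition t (by simp)
  have htr' := hC.2.isTransition t' (by simp)
  refine not_differentiallyPrivate_of_cycle hA hq hC fun T η hη hT =>
    -- The centre for t' is 2T to the right side of the stored value's centre; a shift of 4T puts
    -- the mean 2T to the wrong side, at distance T from the window of stored values.
    ⟨unshifted c₁ ++ (t, 0) :: (unshifted c₂ ++ (t', 4 * T * t'.guard.sgn) :: unshifted c₃),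
      by simp [map_fst_unshifted], ?_⟩
  intro c ρ B hB hρ x
  rw [run_append, List.append_assoc]
  refine pathProb_append_le zero_le_one (by positivity) (fun y => ?_) x
  clear x
  generalize A.endCenter T (unshifted c₁) c = c
  have hd := (hA t htr).1 (Or.inl ht)
  have hd1 : (0 : ℝ) < A.d t.src * 1 := by rw [mul_one]; exact_mod_cast hd
  have hd' := (hA t' htr').1 (Or.inr (Or.inl ht'))
  have hi' := isInput_of_guard_ne_tt htr' ht'
  simp only [run, run_append, List.cons_append, List.append_assoc]
  have hnc : A.nextCenter T t c = A.center T t c := if_pos ht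
  rw [endCenter_of_not_asg (not_asg_of_mem_unshifted hc₂), hnc]
  obtain ⟨c', hc'⟩ : ∃ c', c' = A.center T t c := ⟨_, rfl⟩
  rw [← hc']
  obtain ⟨ρ', hρ'⟩ : ∃ ρ', ρ' = A.run T (unshifted c₂) c' ++
      A.windowStep T (4 * T * t'.guard.sgn) c' t' ::
        (A.run T (unshifted c₃) (A.nextCenter T t' c') ++ ρ) := ⟨_, rfl⟩
  rw [← hρ', pathProb_cons_asg _ _ _ _ _ ht]
  have hP : ∀ z, A.pathProb 1 ρ' z ≤ B := by
    rw [hρ']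
    exact pathProb_append_le zero_le_one hB (pathProb_append_le (ρ₁ := _ :: _) zero_le_one hB hρ)
  have hPw : ∀ z ∈ Set.Ioo (c' - T) (c' + T), A.pathProb 1 ρ' z ≤ η * B := by
    intro z hz
    rw [hρ']
    refine (pathProb_append_le_of_not_asg zero_le_one
      (not_asg_run (not_asg_of_mem_unshifted hc₂) _)).trans ?_
    refine pathProb_cons_le_mul zero_le_one hB (pathProb_append_le zero_le_one hB hρ) hη.le
      (Or.inr ⟨Or.inr (Or.inl ht'), setIntegral_dens_windowStep_far hT hi' hd' ?_⟩)
    simp only [center, hi', if_true]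
    have h0 := hT.1
    cases hg : t'.guard with
    | tt => exact absurd hg ht'
    | ge =>
      left
      rintro y ⟨hy, -⟩
      rw [show (A.windowStep T (4 * T * Guard.ge.sgn) c' t').tr = t' from rfl, hg] at hy
      simp only [Guard.Holds] at hy
      simp only [Guard.sgn, Set.mem_Ici]
      linarith [hz.1]
    | lt =>
      right
      rintro y ⟨hy, -⟩
      rw [show (A.windowStep T (4 * T * Guard.lt.sgn) c' t').tr = t' from rfl, hg] at hy
      simp only [Guard.Holds] at hy
      simp only [Guard.sgn, Set.mem_Iic]
      linarith [hz.2]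
  have hdens : A.dens 1 (A.windowStep T 0 c t) = lapDensity (A.d t.src * 1) c' := by
    unfold dens
    rw [show (A.windowStep T 0 c t).tr = t from rfl, windowStep_mean_zero, hc']
  have hf0 := lapDensity_nonneg hd1.le c'
  have hfi := integrable_lapDensity hd1.le c'
  have hint := integrable_dens_mul_pathProb (A := A) zero_le_one (A.windowStep T 0 c t) ρ'
  have hp0 := fun z => pathProb_nonneg (A := A) zero_le_one ρ' z
  rw [hdens] at hint ⊢
  have hw := setIntegral_lapDensity_window hd1 c' hT.1 measurableSet_Ioo subset_rfl
  have hsum := integral_add_compl (measurableSet_Ioo (a := c' - T) (b := c' + T)) hfi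
  have hsum' := integral_add_compl (measurableSet_Ioo (a := c' - T) (b := c' + T)) hint
  rw [integral_lapDensity hd1] at hsum
  have hη' := (hT.2 t.src).1 hd
  have h1 : ∫ z in Set.Ioo (c' - T) (c' + T), lapDensity (A.d t.src * 1) c' z * A.pathProb 1 ρ' z ≤
      1 * (η * B) := by
    calc _ ≤ ∫ z in Set.Ioo (c' - T) (c' + T), lapDensity (A.d t.src * 1) c' z * (η * B) :=
          setIntegral_mono_on hint.integrableOn (hfi.mul_const _).integrableOn measurableSet_Ioo
            fun z hz => mul_le_mul_of_nonneg_left (hPw z hz) (hf0 z)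
      _ = _ := integral_mul_const _ _
      _ ≤ _ := mul_le_mul_of_nonneg_right (setIntegral_lapDensity_le_one hd1.le _ _) (by positivity)
  have h2 : ∫ z in (Set.Ioo (c' - T) (c' + T))ᶜ, lapDensity (A.d t.src * 1) c' z * A.pathProb 1 ρ' z ≤
      η * B := by
    calc _ ≤ ∫ z in (Set.Ioo (c' - T) (c' + T))ᶜ, lapDensity (A.d t.src * 1) c' z * B :=
          setIntegral_mono hint.integrableOn (hfi.mul_const _).integrableOn
            fun z => mul_le_mul_of_nonneg_left (hP z) (hf0 z)
      _ = (∫ z in (Set.Ioo (c' - T) (c' + T))ᶜ, lapDensity (A.d t.src * 1) c' z) * B :=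
          integral_mul_const _ _
      _ ≤ _ := mul_le_mul_of_nonneg_right (by linarith) hB
  have h3 : ∫ z in (A.windowStep T 0 c t).sampleSet y,
      lapDensity (A.d t.src * 1) c' z * A.pathProb 1 ρ' z ≤ 2 * η * B := by
    refine (setIntegral_le_integral hint
      (ae_of_all _ fun z => mul_nonneg (hf0 z) (hp0 z))).trans ?_
    rw [← hsum']; linarith
  calc _ ≤ 1 * (2 * η * B) := mul_le_mul (primeFactor_le_one zero_le_one _) h3
        (integral_nonneg fun z => mul_nonneg (hf0 z) (hp0 z)) zero_le_one
    _ = _ := one_mul _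

/-- An assignment on a cycle forces all guards of the cycle to be `true`. Hence the stored value
stays fixed through all traversals of a G-cycle or L-cycle. -/
theorem not_asg_of_not_leaking (h : ∀ q C, A.Reachable q → A.IsCycle q C → ¬ Leaking C) {q : Q}
    {C : List (Transition Q Γ)} (hq : A.Reachable q) (hC : A.IsCycle q C) {g : Guard} (hg : g ≠ .tt)
    (hC' : HasGuard g C) : ∀ t ∈ C, t.asg = false := by
  intro t ht
  by_contra hc
  obtain ⟨u, hu, rfl⟩ := hC'
  obtain ⟨D, hD, hm⟩ := hC.rotate ht
  have hr : A.Reachable t.src := by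
    obtain ⟨c₁, c₂, rfl⟩ := List.append_of_mem ht
    obtain ⟨r, h1, h2⟩ := isPath_append.1 hC.2
    rw [h2.2.1]
    exact hq.trans h1
  exact hg (guard_eq_tt_of_not_leaking h hr hD (by simpa using hc) u ((hm u).1 hu))

/-- A cycle without assignments, annotated such that the mean of `svar` is `m` in a transition with
guard `g`; its copies are improbable if the stored value is far on the wrong side of `m`. -/
theorem exists_loop (hA : A.Alive) {q : Q} {C : List (Transition Q Γ)} (hC : A.IsCycle q C)
    {g : Guard} (hg : g ≠ .tt) (hgC : HasGuard g C) (ha : ∀ t ∈ C, t.asg = false) {T η : ℝ}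
    (hη : 0 < η) (hT : A.WindowBound T η) (c m : ℝ) :
    ∃ lC : List (Transition Q Γ × ℝ), lC.map Prod.fst = C ∧
      (∀ (ℓ : ℕ) (ρ : List (Step Q Γ)) (x : ℝ), g.sgn * x ≤ g.sgn * m - T →
        A.pathProb 1 (A.run T (copies ℓ lC) c ++ ρ) x ≤ η ^ ℓ * A.pathProb 1 ρ x) ∧
      (∀ (ℓ : ℕ) (ρ : List (Step Q Γ)) (x : ℝ),
        A.pathProb 1 (A.run T (copies ℓ lC) c ++ ρ) x ≤ A.pathProb 1 ρ x) ∧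
      ∀ ℓ, A.endCenter T (copies ℓ lC) c = c := by
  obtain ⟨t, ht, rfl⟩ := hgC
  have htr := hC.2.isTransition t ht
  obtain ⟨c₁, c₂, rfl⟩ := List.append_of_mem ht
  simp only [List.mem_append, List.mem_cons] at ha
  have hi := isInput_of_guard_ne_tt htr hg
  have hd := (hA t htr).1 (Or.inr (Or.inl hg))
  -- Without a shift the mean would be c - 2T · sgn; the annotation moves it to m.
  obtain ⟨lC, hlC⟩ : ∃ lC : List (Transition Q Γ × ℝ), lC =
    unshifted c₁ ++ (t, m - c + 2 * T * t.guard.sgn) :: unshifted c₂ := ⟨_, rfl⟩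
  have hfst : lC.map Prod.fst = c₁ ++ t :: c₂ := by simp [hlC, map_fst_unshifted]
  have hna : ∀ u ∈ lC, u.1.asg = false := by
    intro u hu
    have : u.1 ∈ lC.map Prod.fst := List.mem_map_of_mem hu
    rw [hfst] at this
    simp only [List.mem_append, List.mem_cons] at this
    exact ha _ this
  have hnc : ∀ ℓ, ∀ u ∈ copies ℓ lC, u.1.asg = false := fun ℓ u hu => hna u (mem_of_mem_copies hu)
  refine ⟨lC, hfst, fun ℓ ρ x hx => ?_, fun ℓ ρ x => ?_, fun ℓ => endCenter_of_not_asg (hnc ℓ) c⟩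
  · induction ℓ with
    | zero => simp [copies, run]
    | succ ℓ ih =>
      rw [copies_succ, run_append, endCenter_of_not_asg hna, List.append_assoc]
      obtain ⟨ρ', hρ'⟩ : ∃ ρ', ρ' = A.run T (copies ℓ lC) c ++ ρ := ⟨_, rfl⟩
      rw [← hρ'] at ih ⊢
      rw [hlC, run_append, List.append_assoc]
      have hn₁ := not_asg_of_mem_unshifted (ts := c₁) fun u hu => ha u (Or.inl hu)
      have hn₂ := not_asg_of_mem_unshifted (ts := c₂) fun u hu => ha u (Or.inr (Or.inr hu))
      refine (pathProb_append_le_of_not_asg zero_le_one (not_asg_run hn₁ _)).trans ?_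
      rw [endCenter_of_not_asg hn₁]
      simp only [run, List.cons_append]
      rw [pathProb_cons_of_not_asg _ _ _ _ _ (ha t (Or.inr (Or.inl rfl))),
        guardFactor_eq_integral (by simp [windowStep, hg]), pow_succ']
      have h1 : ∫ z in (A.windowStep T (m - c + 2 * T * t.guard.sgn) c t).sampleSet x,
          A.dens 1 (A.windowStep T (m - c + 2 * T * t.guard.sgn) c t) z ≤ η := by
        refine setIntegral_dens_windowStep_far hT hi hd ?_
        simp only [center, hi, if_true]
        cases hgd : t.guard with
        | tt => exact absurd hgd hg
        | ge =>
          left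
          rintro y ⟨hy, -⟩
          rw [show (A.windowStep T (m - c + 2 * T * Guard.ge.sgn) c t).tr = t from rfl, hgd] at hy
          rw [hgd] at hx
          simp only [Guard.Holds, Guard.sgn] at hy hx
          simp only [Guard.sgn, Set.mem_Ici]
          linarith
        | lt =>
          right
          rintro y ⟨hy, -⟩
          rw [show (A.windowStep T (m - c + 2 * T * Guard.lt.sgn) c t).tr = t from rfl, hgd] at hy
          rw [hgd] at hx
          simp only [Guard.Holds, Guard.sgn] at hy hx
          simp only [Guard.sgn, Set.mem_Iic]
          linarith
      have h2 := pathProb_append_le_of_not_asg (A := A) (ε := 1) (x := x) (ρ₂ := ρ') zero_le_one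
        (not_asg_run (A := A) (T := T) hn₂ (A.nextCenter T t c))
      have h0 := setIntegral_lapDensity_nonneg
        (scale_nonneg (A := A) zero_le_one (A.windowStep T (m - c + 2 * T * t.guard.sgn) c t).tr.src)
      calc _ ≤ (1 * η) * (η ^ ℓ * A.pathProb 1 ρ x) := by
            refine mul_le_mul (mul_le_mul (primeFactor_le_one zero_le_one _) h1 (h0 _ _) zero_le_one)
              (h2.trans ih) (pathProb_nonneg zero_le_one _ _) (by positivity)
        _ = _ := by ring
  · exact pathProb_append_le_of_not_asg zero_le_one (not_asg_run (hnc ℓ) c)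

theorem shift_unshifted {ts : List (Transition Q Γ)} {u : Transition Q Γ × ℝ}
    (hu : u ∈ unshifted ts) (N : ℕ) : |u.2| ≤ N := by
  simp only [unshifted, List.mem_map] at hu
  obtain ⟨t, -, rfl⟩ := hu
  simp

theorem pathProb_le_pow {η y : ℝ} (hη : 0 < η) {ℓ : ℕ} {ρ : List (Step Q Γ)} {P : ℝ}
    (h : P ≤ η ^ ℓ * A.pathProb 1 ρ y) : P ≤ (2 * η) ^ ℓ := by
  calc P ≤ η ^ ℓ * 1 := h.trans (mul_le_mul_of_nonneg_left (pathProb_le_one zero_le_one _ _)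
        (by positivity))
    _ ≤ _ := by rw [mul_one]; exact pow_le_pow_left₀ hη.le (by linarith) ℓ

/-! ### Leaking pairs and violating paths, when no reachable cycle is leaking. -/

section NonLeaking

variable [Finite Q] (hA : A.Alive) (hleak : ∀ q C, A.Reachable q → A.IsCycle q C → ¬ Leaking C)
  {g : Guard} (hg : g ≠ .tt)

include hA hleak hg

/-- The first cycle pushes the stored value to one side of 0, the path in between can only move it
further to that side, and the second cycle wants it on the other side. So one of the two groups of ℓ
traversals is always improbable. -/
theorem not_differentiallyPrivate_of_leakingPair {p q : Q} {C C' ts : List (Transition Q Γ)}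
    (hp : A.Reachable p) (hC : A.IsCycle p C) (hgC : HasGuard g.dual C) (hts : A.IsPath p ts q)
    (hts' : AssignsOnly g ts) (hC' : A.IsCycle q C') (hgC' : HasGuard g C') :
    ¬ A.DifferentiallyPrivate := by
  have hna := not_asg_of_not_leaking hleak hp hC (Guard.dual_ne_tt hg) hgC
  have hna' := not_asg_of_not_leaking hleak (hp.trans hts) hC' hg hgC'
  obtain ⟨pre, hpre⟩ := hp
  refine not_differentiallyPrivate_of_runs hA (pre.length + ts.length) (C.length + C'.length)
    fun T η hη hT => ?_
  obtain ⟨lC, rfl, hb, hle, hend⟩ := exists_loop hA hC (Guard.dual_ne_tt hg) hgC hna hη hT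
    (A.endCenter T (unshifted pre) 0) 0
  obtain ⟨lC', rfl, hb', -, -⟩ := exists_loop hA hC' hg hgC' hna' hη hT
    (A.endCenter T (unshifted ts) (A.endCenter T (unshifted pre) 0)) (2 * T * g.sgn)
  obtain ⟨N, hN⟩ := exists_nat_bound (lC ++ lC')
  refine ⟨N, fun ℓ => ⟨unshifted pre ++ (copies ℓ lC ++ (unshifted ts ++ copies ℓ lC')), q,
    ?_, ?_, ?_, ?_⟩⟩
  · simp only [List.map_append, map_fst_unshifted]
    exact isPath_append.2 ⟨p, hpre, isPath_append.2 ⟨p, isPath_copies hC.2 ℓ,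
      isPath_append.2 ⟨q, hts, isPath_copies hC'.2 ℓ⟩⟩⟩
  · simp only [List.length_append, length_unshifted, length_copies, List.length_map]
    apply le_of_eq; ring
  · intro u hu
    simp only [List.mem_append] at hu
    rcases hu with hu | hu | hu | hu
    · exact shift_unshifted hu N
    · exact hN u (List.mem_append_left _ (mem_of_mem_copies hu))
    · exact shift_unshifted hu N
    · exact hN u (List.mem_append_right _ (mem_of_mem_copies hu))
  · rw [run_append, run_append, run_append, hend]
    refine pathProb_append_le zero_le_one (by positivity) (fun x => ?_) 0
    -- Either x lies at distance T on the wrong side for the first loop, or x, and with it every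
    -- later stored value, is at least T away from the mean 2T · sgn of the second loop.
    by_cases hx : g.dual.sgn * x ≤ g.dual.sgn * 0 - T
    · exact pathProb_le_pow hη (hb ℓ _ x hx)
    · refine (hle ℓ _ x).trans (pathProb_append_le_of_assignsOnly zero_le_one (by positivity) hg
        (by rwa [map_tr_run, map_fst_unshifted]) fun y hy => ?_)
      have := hb' ℓ [] y ?_
      · rw [List.append_nil] at this
        exact pathProb_le_pow hη this
      · rw [Guard.sgn_dual] at hx
        have := Guard.sgn_mul_sgn hg
        rw [show g.sgn * (2 * T * g.sgn) = 2 * T * (g.sgn * g.sgn) by ring, this]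
        linarith

/-- The first transition outputs a value that bounds the stored value, which then bounds the values
sampled in a cycle. -/
theorem not_differentiallyPrivate_of_out_loop {p q : Q} {t : Transition Q Γ}
    {C ts : List (Transition Q Γ)} (hp : A.Reachable p) (hts : A.IsPath p (t :: ts) q)
    (hts' : AssignsOnly g ts) (ho : t.out = .svar) (ht : t.asg = true ∨ t.guard = g.dual)
    (hC : A.IsCycle q C) (hgC : HasGuard g C) : ¬ A.DifferentiallyPrivate := by
  have hna := not_asg_of_not_leaking hleak (hp.trans hts) hC hg hgC
  obtain ⟨pre, hpre⟩ := hp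
  refine not_differentiallyPrivate_of_runs hA (pre.length + (t :: ts).length) C.length
    fun T η hη hT => ?_
  obtain ⟨c, hc⟩ : ∃ c, c = A.endCenter T (unshifted pre) 0 := ⟨_, rfl⟩
  -- The output confines σ to distance T from its centre. A mean 2T beyond this centre leaves a gap
  -- of T to every stored value that σ bounds.
  obtain ⟨lC, rfl, hb, -, -⟩ := exists_loop hA hC hg hgC hna hη hT
    (A.endCenter T (unshifted ts) (A.nextCenter T t c)) (A.center T t c + 2 * T * g.sgn)
  obtain ⟨N, hN⟩ := exists_nat_bound lC
  refine ⟨N, fun ℓ => ⟨unshifted pre ++ (unshifted (t :: ts) ++ copies ℓ lC), q,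
    ?_, ?_, ?_, ?_⟩⟩
  · simp only [List.map_append, map_fst_unshifted]
    exact isPath_append.2 ⟨p, hpre, isPath_append.2 ⟨q, hts, isPath_copies hC.2 ℓ⟩⟩
  · simp only [List.length_append, length_unshifted, length_copies, List.length_map]
    apply le_of_eq; ring
  · intro u hu
    simp only [List.mem_append] at hu
    rcases hu with hu | hu | hu
    · exact shift_unshifted hu N
    · exact shift_unshifted hu N
    · exact hN u (mem_of_mem_copies hu)
  · rw [run_append, run_append, ← hc]
    refine pathProb_append_le zero_le_one (by positivity) (fun x => ?_) 0
    have hT0 := hT.1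
    have hgg := Guard.sgn_mul_sgn hg
    simp only [unshifted, List.map_cons, run, List.cons_append, endCenter]
    refine pathProb_cons_le zero_le_one (by positivity) fun z hz => ?_
    have hw := (windowStep_admits z).1 hz.2 ho
    have hz1 := hz.1
    rw [show (A.windowStep T 0 c t).tr = t from rfl] at hz1 ⊢
    have hwg : g.sgn * z ≤ g.sgn * A.center T t c + T := by
      rw [abs_lt] at hw
      cases g <;> simp [Guard.sgn] at * <;> linarith
    refine pathProb_append_le_of_assignsOnly zero_le_one (by positivity) hg
        (by rw [map_tr_run]; simpa [Function.comp_def] using hts') fun y hy => ?_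
    have := hb ℓ [] y ?_
    · rw [List.append_nil] at this
      exact pathProb_le_pow hη this
    · rw [mul_add, show g.sgn * (2 * T * g.sgn) = 2 * T * (g.sgn * g.sgn) by ring, hgg]
      -- Either σ itself is stored, or the dual guard compares σ with the stored value; both bound
      -- the stored value by σ on the side that matters.
      have : g.sgn * (if t.asg = true then z else x) ≤ g.sgn * z := by
        split_ifs with hasg
        · exact le_rfl
        · have hgd : t.guard = g.dual := by tauto
          rw [hgd] at hz1
          have := Guard.Holds.sgn_le (Guard.dual_ne_tt hg) hz1
          rw [Guard.sgn_dual] at this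
          linarith
      linarith

/-- The loop is improbable unless the stored value lies on a particular side of the output window.
The path can only move the value further away, and then no sample in the window satisfies the last
guard. -/
theorem not_differentiallyPrivate_of_loop_out {p q : Q} {t : Transition Q Γ}
    {C hd : List (Transition Q Γ)} (hp : A.Reachable p) (hts : A.IsPath p (hd ++ [t]) q)
    (hts' : AssignsOnly g (hd ++ [t])) (ho : t.out = .svar) (ht : t.guard = g)
    (hC : A.IsCycle p C) (hgC : HasGuard g.dual C) : ¬ A.DifferentiallyPrivate := by
  have hna := not_asg_of_not_leaking hleak hp hC (Guard.dual_ne_tt hg) hgC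
  obtain ⟨pre, hpre⟩ := hp
  refine not_differentiallyPrivate_of_runs hA (pre.length + (hd ++ [t]).length) C.length
    fun T η hη hT => ?_
  obtain ⟨c, hc⟩ : ∃ c, c = A.endCenter T (unshifted pre) 0 := ⟨_, rfl⟩
  obtain ⟨z₀, hz₀⟩ : ∃ z₀, z₀ = A.center T t (A.endCenter T (unshifted hd) c) := ⟨_, rfl⟩
  obtain ⟨lC, rfl, hb, hle, hend⟩ := exists_loop hA hC (Guard.dual_ne_tt hg) hgC hna hη hT
    c (z₀ - 2 * T * g.sgn)
  obtain ⟨N, hN⟩ := exists_nat_bound lC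
  refine ⟨N, fun ℓ => ⟨unshifted pre ++ (copies ℓ lC ++ unshifted (hd ++ [t])), q,
    ?_, ?_, ?_, ?_⟩⟩
  · simp only [List.map_append, map_fst_unshifted]
    exact isPath_append.2 ⟨p, hpre, isPath_append.2 ⟨p, isPath_copies hC.2 ℓ, hts⟩⟩
  · simp only [List.length_append, length_unshifted, length_copies, List.length_map]
    apply le_of_eq; ring
  · intro u hu
    simp only [List.mem_append] at hu
    rcases hu with hu | hu | hu
    · exact shift_unshifted hu N
    · exact hN u (mem_of_mem_copies hu)
    · exact shift_unshifted hu N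
  · rw [run_append, run_append, ← hc, hend]
    refine pathProb_append_le zero_le_one (by positivity) (fun x => ?_) 0
    have hT0 := hT.1
    have hgg := Guard.sgn_mul_sgn hg
    by_cases hx : g.dual.sgn * x ≤ g.dual.sgn * (z₀ - 2 * T * g.sgn) - T
    · exact pathProb_le_pow hη (hb ℓ _ x hx)
    · refine (hle ℓ _ x).trans ?_
      rw [unshifted, List.map_append, ← unshifted, run_append]
      refine pathProb_append_le_of_assignsOnly zero_le_one (by positivity) hg ?_ fun y hy => ?_
      · rw [map_tr_run, map_fst_unshifted]
        exact fun u hu => hts' u (List.mem_append_left _ hu)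
      · simp only [List.map_cons, List.map_nil, run]
        refine pathProb_cons_le zero_le_one (by positivity) fun z hz => ?_
        -- The guard puts z beyond the stored value and the interval keeps z within T of z₀, so the
        -- set of samples is empty and the bound for the last step is vacuous.
        exfalso
        have hw := (windowStep_admits z).1 hz.2 ho
        have hz1 := hz.1
        rw [← hz₀] at hw
        rw [show (A.windowStep T 0 (A.endCenter T (unshifted hd) c) t).tr = t from rfl, ht] at hz1
        have h1 := Guard.Holds.sgn_le hg hz1
        rw [Guard.sgn_dual, mul_sub,
          show -g.sgn * (2 * T * g.sgn) = -(2 * T) * (g.sgn * g.sgn) by ring, hgg] at hx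
        have hwg : g.sgn * z₀ - T < g.sgn * z := by
          rw [abs_lt] at hw
          cases g <;> simp [Guard.sgn] at * <;> linarith
        linarith

end NonLeaking

/-- Leaking cycles are excluded first: the arguments for leaking pairs and violating paths rely on
cycles with guards being free of assignments. -/
theorem DifferentiallyPrivate.wellFormed [Finite Q] (hA : A.Alive) (h : A.DifferentiallyPrivate) :
    A.WellFormed := by
  have h1 : ∀ q C, A.Reachable q → A.IsCycle q C → ¬ Leaking C :=
    fun q C hq hC hl => not_differentiallyPrivate_of_leaking hA hq hC hl h
  have reach : ∀ {q C t}, A.Reachable q → A.IsCycle q C → t ∈ C → A.Reachable t.src := by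
    intro q C t hq hC ht
    obtain ⟨c₁, c₂, rfl⟩ := List.append_of_mem ht
    obtain ⟨r, h1, h2⟩ := isPath_append.1 hC.2
    rw [h2.2.1]
    exact hq.trans h1
  have h2 : ∀ g : Guard, g ≠ .tt → ∀ q C q' C', A.Reachable q → A.IsCycle q C → A.IsCycle q' C' →
      HasGuard g.dual C → HasGuard g C' → ∀ t ∈ C, ∀ t' ∈ C', ∀ ts, A.IsPath t.src ts t'.src →
        AssignsOnly g ts → False := by
    intro g hg q C q' C' hq hC hC' hgC hgC' t ht t' ht' ts hts ha
    obtain ⟨D, hD, hgD⟩ := inCycle_iff.1 ⟨q, C, hC, hgC, t, ht, rfl⟩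
    obtain ⟨D', hD', hgD'⟩ := inCycle_iff.1 ⟨q', C', hC', hgC', t', ht', rfl⟩
    exact not_differentiallyPrivate_of_leakingPair hA h1 hg (reach hq hC ht) hD hgD hts ha hD' hgD' h
  have h3 : ∀ g : Guard, g ≠ .tt → ∀ p ts q, A.Reachable p → A.IsPath p ts q →
      ¬ A.ViolatingFor g g.dual p ts q := by
    rintro g hg p ts q hp hts (⟨t, tl, rfl, ha, hc, ht, ho⟩ | ⟨t, tl, rfl, ha, hc, ht, ho⟩ |
      ⟨t, hd, rfl, ha, hc, ht, ho⟩)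
    · obtain ⟨C, hC, hgC⟩ := inCycle_iff.1 hc
      exact not_differentiallyPrivate_of_out_loop hA h1 hg hp hts ha ho (Or.inl ht) hC hgC h
    · obtain ⟨C, hC, hgC⟩ := inCycle_iff.1 hc
      exact not_differentiallyPrivate_of_out_loop hA h1 hg hp hts
        (fun u hu => ha u (List.mem_cons_of_mem _ hu)) ho (Or.inr ht) hC hgC h
    · obtain ⟨C, hC, hgC⟩ := inCycle_iff.1 hc
      exact not_differentiallyPrivate_of_loop_out hA h1 hg hp hts ha ho ht hC hgC h
  refine ⟨h1, ?_, fun q C hq hC hd => not_differentiallyPrivate_of_disclosing hA hq hC hd h,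
    fun p ts q hp hts => ⟨h3 .ge (by simp) p ts q hp hts, h3 .lt (by simp) p ts q hp hts⟩⟩
  rintro q C q' C' hq hC hC' (⟨hg, hg', t, ht, t', ht', ts, hts, ha⟩ |
    ⟨hg, hg', t, ht, t', ht', ts, hts, ha⟩)
  · exact h2 .ge (by simp) q C q' C' hq hC hC' hg hg' t ht t' ht' ts hts ha
  · exact h2 .lt (by simp) q C q' C' hq hC hC' hg hg' t ht t' ht' ts hts ha

end DiPA

/-! ### Reasoning about programs -/

namespace RAM

@[simp] theorem Mem.word_setWord_self (M : Mem) (a i v : ℕ) :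
    (M.setWord a i v).word a = Function.update (M.word a) i v := by
  simp [Mem.setWord]

@[simp] theorem Mem.word_setWord_of_ne (M : Mem) {a b : ℕ} (i v : ℕ) (h : b ≠ a) :
    (M.setWord a i v).word b = M.word b := by
  simp [Mem.setWord, h]

@[simp] theorem Mem.num_setWord (M : Mem) (a i v : ℕ) : (M.setWord a i v).num = M.num := rfl

@[simp] theorem Mem.num_setNum_self (M : Mem) (a i : ℕ) (v : ℚ) :
    (M.setNum a i v).num a = Function.update (M.num a) i v := by
  simp [Mem.setNum]

@[simp] theorem Mem.num_setNum_of_ne (M : Mem) {a b : ℕ} (i : ℕ) (v : ℚ) (h : b ≠ a) :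
    (M.setNum a i v).num b = M.num b := by
  simp [Mem.setNum, h]

@[simp] theorem Mem.word_setNum (M : Mem) (a i : ℕ) (v : ℚ) : (M.setNum a i v).word = M.word := rfl

/-- The time for a test that handles no numbers, or if handling numbers is free. -/
def Test.size : Test → ℕ
  | .eq _ _ => 1
  | .lt _ _ => 1
  | .numLt _ _ _ _ => 1
  | .not t => 1 + t.size
  | .and t₁ t₂ => 1 + t₁.size + t₂.size

/-- The test compares no numbers. -/
def Test.wordOnly : Test → Bool
  | .eq _ _ => true
  | .lt _ _ => true
  | .numLt _ _ _ _ => false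
  | .not t => t.wordOnly
  | .and t₁ t₂ => t₁.wordOnly && t₂.wordOnly

/-- The program handles no numbers. -/
def Prog.wordOnly : Prog → Bool
  | .skip => true
  | .set _ _ _ => true
  | .numCopy _ _ _ _ => false
  | .numAdd _ _ _ _ _ _ => false
  | .seq P Q => P.wordOnly && Q.wordOnly
  | .ite t P Q => t.wordOnly && P.wordOnly && Q.wordOnly
  | .while t P => t.wordOnly && P.wordOnly

/-- The program has no loops. -/
def Prog.loopFree : Prog → Bool
  | .seq P Q => P.loopFree && Q.loopFree
  | .ite _ P Q => P.loopFree && Q.loopFree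
  | .while _ _ => false
  | _ => true

/-- A bound for the running time of a loop-free program. -/
def Prog.size : Prog → ℕ
  | .seq P Q => P.size + Q.size
  | .ite t P Q => t.size + P.size + Q.size
  | .while t P => t.size + P.size
  | _ => 1

/-- The word arrays a program may change. -/
def Prog.writes : Prog → List ℕ
  | .set a _ _ => [a]
  | .seq P Q => P.writes ++ Q.writes
  | .ite _ P Q => P.writes ++ Q.writes
  | .while _ P => P.writes
  | _ => []

/-- The number arrays a program may change. -/
def Prog.numWrites : Prog → List ℕ
  | .numCopy c _ _ _ => [c]
  | .numAdd c _ _ _ _ _ => [c]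
  | .seq P Q => P.numWrites ++ Q.numWrites
  | .ite _ P Q => P.numWrites ++ Q.numWrites
  | .while _ P => P.numWrites
  | _ => []

open Classical in
/-- The effect of a loop-free program. -/
noncomputable def Prog.exec : Prog → Mem → Mem
  | .skip, M => M
  | .set a i e, M => M.setWord a (i.eval M) (e.eval M)
  | .numCopy c k a i, M => M.setNum c (k.eval M) (M.num a (i.eval M))
  | .numAdd c k a i b j, M => M.setNum c (k.eval M) (M.num a (i.eval M) + M.num b (j.eval M))
  | .seq P Q, M => Q.exec (P.exec M)
  | .ite t P Q, M => if t.Holds M then P.exec M else Q.exec M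
  | .while _ _, M => M

/-- Two situations allow time bounds that ignore the sizes of numbers: the code touches no numbers,
or numbers are free. The same alternative recurs in the rules below. -/
theorem Test.time_le {κ : ℚ → ℕ} {t : Test} (h : t.wordOnly = true ∨ κ = unitCost) (M : Mem) :
    t.time κ M ≤ t.size := by
  induction t with
  | eq | lt => exact le_rfl
  | numLt =>
    rcases h with h | rfl
    · simp [Test.wordOnly] at h
    · simp [Test.time, Test.size, unitCost]
  | not t ih =>
    simp only [Test.time, Test.size, Test.wordOnly] at *
    have := ih h; omega
  | and t₁ t₂ ih₁ ih₂ =>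
    simp only [Test.time, Test.size, Test.wordOnly, Bool.and_eq_true] at *
    have h1 := ih₁ (by tauto)
    have h2 := ih₂ (by tauto)
    omega

/-- Since the array names in commands are constants, what a run may change can be read off the
program, and such frame conditions can be decided. -/
theorem Runs.frame {κ : ℚ → ℕ} {P : Prog} {M M' : Mem} {n : ℕ} (h : Runs κ P M n M') :
    (∀ a, a ∉ P.writes → M'.word a = M.word a) ∧ ∀ a, a ∉ P.numWrites → M'.num a = M.num a := by
  induction h with
  | skip => exact ⟨fun _ _ => rfl, fun _ _ => rfl⟩
  | set M a i e =>
    exact ⟨fun b hb => Mem.word_setWord_of_ne _ _ _ (by simpa [Prog.writes] using hb), fun _ _ => rfl⟩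
  | numCopy | numAdd =>
    exact ⟨fun _ _ => rfl, fun b hb => Mem.num_setNum_of_ne _ _ _ (by simpa [Prog.numWrites] using hb)⟩
  | seq _ _ ih₁ ih₂ =>
    simp only [Prog.writes, Prog.numWrites, List.mem_append, not_or]
    exact ⟨fun b hb => (ih₂.1 b hb.2).trans (ih₁.1 b hb.1), fun b hb => (ih₂.2 b hb.2).trans (ih₁.2 b hb.1)⟩
  | iteTrue _ _ ih =>
    simp only [Prog.writes, Prog.numWrites, List.mem_append, not_or]
    exact ⟨fun b hb => ih.1 b hb.1, fun b hb => ih.2 b hb.1⟩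
  | iteFalse _ _ ih =>
    simp only [Prog.writes, Prog.numWrites, List.mem_append, not_or]
    exact ⟨fun b hb => ih.1 b hb.2, fun b hb => ih.2 b hb.2⟩
  | whileTrue _ _ _ ih₁ ih₂ =>
    simp only [Prog.writes, Prog.numWrites] at *
    exact ⟨fun b hb => (ih₂.1 b hb).trans (ih₁.1 b hb), fun b hb => (ih₂.2 b hb).trans (ih₁.2 b hb)⟩
  | whileFalse => exact ⟨fun _ _ => rfl, fun _ _ => rfl⟩

/-- `P` halts from `M` after at most `T` steps, in a memory that satisfies `R`. -/
def Ensures (κ : ℚ → ℕ) (P : Prog) (M : Mem) (T : ℕ) (R : Mem → Prop) : Prop :=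
  ∃ t M', Runs κ P M t M' ∧ t ≤ T ∧ R M'

variable {κ : ℚ → ℕ} {P P₁ P₂ : Prog} {M : Mem} {T T₁ T₂ : ℕ} {R R' : Mem → Prop}

theorem Ensures.mono (h : Ensures κ P M T₁ R) (hT : T₁ ≤ T₂) (hR : ∀ M', R M' → R' M') :
    Ensures κ P M T₂ R' := by
  obtain ⟨t, M', h1, h2, h3⟩ := h
  exact ⟨t, M', h1, h2.trans hT, hR _ h3⟩

theorem Ensures.frame (h : Ensures κ P M T R) : Ensures κ P M T fun M' => R M' ∧
    (∀ a, a ∉ P.writes → M'.word a = M.word a) ∧ ∀ a, a ∉ P.numWrites → M'.num a = M.num a := by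
  obtain ⟨t, M', h1, h2, h3⟩ := h
  exact ⟨t, M', h1, h2, h3, h1.frame⟩

theorem Ensures.seq (h₁ : Ensures κ P₁ M T₁ fun M' => Ensures κ P₂ M' T₂ R) :
    Ensures κ (.seq P₁ P₂) M (T₁ + T₂) R := by
  obtain ⟨t, M', h1, h2, t', M'', h3, h4, h5⟩ := h₁
  exact ⟨_, _, .seq h1 h3, by omega, h5⟩

theorem Ensures.ite {t : Test} (ht : t.wordOnly = true ∨ κ = unitCost)
    (h₁ : t.Holds M → Ensures κ P₁ M T R) (h₂ : ¬ t.Holds M → Ensures κ P₂ M T R) :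
    Ensures κ (.ite t P₁ P₂) M (t.size + T) R := by
  have hs := Test.time_le ht M
  by_cases h : t.Holds M
  · obtain ⟨n, M', h1, h2, h3⟩ := h₁ h
    exact ⟨_, _, .iteTrue h h1, by omega, h3⟩
  · obtain ⟨n, M', h1, h2, h3⟩ := h₂ h
    exact ⟨_, _, .iteFalse h h1, by omega, h3⟩

/-- For loop-free programs the final memory is a function of the initial one that can be computed by
simplification, so no rules for single commands are needed. -/
theorem runs_exec (hl : P.loopFree = true) (hw : P.wordOnly = true ∨ κ = unitCost) (M : Mem) :
    ∃ t, Runs κ P M t (P.exec M) ∧ t ≤ P.size := by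
  induction P generalizing M with
  | skip => exact ⟨1, .skip M, le_rfl⟩
  | set a i e => exact ⟨1, .set M a i e, le_rfl⟩
  | numCopy c k a i =>
    rcases hw with hw | rfl
    · simp [Prog.wordOnly] at hw
    · exact ⟨_, .numCopy M c k a i, le_rfl⟩
  | numAdd c k a i b j =>
    rcases hw with hw | rfl
    · simp [Prog.wordOnly] at hw
    · exact ⟨_, .numAdd M c k a i b j, le_rfl⟩
  | seq P Q ihP ihQ =>
    simp only [Prog.loopFree, Prog.wordOnly, Bool.and_eq_true] at hl hw
    obtain ⟨t, h1, h2⟩ := ihP hl.1 (by tauto) M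
    obtain ⟨t', h3, h4⟩ := ihQ hl.2 (by tauto) (P.exec M)
    exact ⟨_, .seq h1 h3, by simp only [Prog.size]; omega⟩
  | ite t P Q ihP ihQ =>
    simp only [Prog.loopFree, Prog.wordOnly, Bool.and_eq_true] at hl hw
    have ht := Test.time_le (κ := κ) (t := t) (by tauto) M
    simp only [Prog.exec, Prog.size]
    split_ifs with h
    · obtain ⟨n, h1, h2⟩ := ihP hl.1 (by tauto) M
      exact ⟨_, .iteTrue h h1, by omega⟩
    · obtain ⟨n, h1, h2⟩ := ihQ hl.2 (by tauto) M
      exact ⟨_, .iteFalse h h1, by omega⟩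
  | _ => simp [Prog.loopFree] at hl

theorem Ensures.exec (hl : P.loopFree = true) (hw : P.wordOnly = true ∨ κ = unitCost)
    (h : R (P.exec M)) : Ensures κ P M P.size R := by
  obtain ⟨t, h1, h2⟩ := runs_exec hl hw M
  exact ⟨t, _, h1, h2, h⟩

/-- The rule for loops, with an invariant and a potential that pays for the running time. -/
theorem Ensures.while {t : Test} (ht : t.wordOnly = true ∨ κ = unitCost) (I : Mem → Prop) (φ : Mem → ℕ)
    (hI : I M) (hstep : ∀ M, I M → t.Holds M →
      ∃ T, Ensures κ P M T fun M' => I M' ∧ φ M' + T + t.size ≤ φ M) :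
    Ensures κ (.while t P) M (φ M + t.size) fun M' => I M' ∧ ¬ t.Holds M' := by
  obtain ⟨N, hN⟩ : ∃ N, φ M = N := ⟨_, rfl⟩
  rw [hN]
  induction N using Nat.strong_induction_on generalizing M with
  | _ N ih =>
    have hs := Test.time_le ht M
    by_cases h : t.Holds M
    · obtain ⟨T, n, M', h1, h2, h3, h4⟩ := hstep M hI h
      -- Each test takes at least one step, so the potential strictly decreases; this gives
      -- termination as well as the time bound.
      have hpos : 1 ≤ t.size := by cases t <;> (simp [Test.size]; try omega)
      obtain ⟨n', M'', k1, k2, k3⟩ := ih (φ M') (by omega) h3 rfl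
      exact ⟨_, _, .whileTrue h h1 k1, by omega, k3⟩
    · exact ⟨_, _, .whileFalse h, by omega, hI, h⟩

/-- Reads a register. -/
@[reducible] def reg (a : ℕ) : Expr := .get a (.lit 0)

/-- `for i < N do P`, with registers `i` and `N`. -/
def forLoop (i N : ℕ) (P : Prog) : Prog :=
  .seq (.set i (.lit 0) (.lit 0))
    (.while (.lt (reg i) (reg N)) (.seq P (.set i (.lit 0) (.succ (reg i)))))

/-- The invariant is stated for the memory in which the counter already has its next value. Each
round pays 2 for the test and the increment; the final 2 pays for the initialization and the failing
test. -/
theorem forLoop_rule {i N : ℕ} {P : Prog} {M₀ : Mem} (hi : i ∉ P.writes) (hN : N ∉ P.writes)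
    (hiN : N ≠ i) (Inv : ℕ → Mem → Prop) (T : ℕ → ℕ) (h0 : Inv 0 (M₀.setWord i 0 0))
    (hstep : ∀ k M, k < M₀.word N 0 → M.word i 0 = k → Inv k M →
      (∀ a, a ≠ i → a ∉ P.writes → M.word a = M₀.word a) →
      (∀ a, a ∉ P.numWrites → M.num a = M₀.num a) →
      Ensures κ P M (T k) fun M' => Inv (k + 1) (M'.setWord i 0 (k + 1))) :
    Ensures κ (forLoop i N P) M₀ (∑ k ∈ Finset.range (M₀.word N 0), (T k + 2) + 2)
      (Inv (M₀.word N 0)) := by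
  obtain ⟨n, hn⟩ : ∃ n, n = M₀.word N 0 := ⟨_, rfl⟩
  rw [← hn] at hstep ⊢
  have hN' : ∀ M : Mem, (∀ a, a ≠ i → a ∉ P.writes → M.word a = M₀.word a) → M.word N 0 = n :=
    fun M h => by rw [h N hiN hN, hn]
  have key := Ensures.while (κ := κ) (t := .lt (reg i) (reg N))
    (P := .seq P (.set i (.lit 0) (.succ (reg i)))) (M := M₀.setWord i 0 0) (Or.inl rfl)
    (fun M => M.word i 0 ≤ n ∧ Inv (M.word i 0) M ∧
      (∀ a, a ≠ i → a ∉ P.writes → M.word a = M₀.word a) ∧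
      (∀ a, a ∉ P.numWrites → M.num a = M₀.num a))
    (fun M => ∑ k ∈ Finset.Ico (M.word i 0) n, (T k + 2)) ?_ ?_
  · have h1 : Ensures κ (.set i (.lit 0) (.lit 0)) M₀ 1 fun M => M = M₀.setWord i 0 0 :=
      ⟨1, _, .set M₀ i (.lit 0) (.lit 0), le_rfl, rfl⟩
    refine Ensures.mono (T₁ := 1 + (∑ k ∈ Finset.range n, (T k + 2) + 1)) (R := Inv n)
      (Ensures.seq (h1.mono le_rfl fun M' hM' => ?_)) ?_ fun _ h => h
    · subst hM'
      refine key.mono ?_ fun M' hM' => ?_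
      · simp [Test.size]
      · obtain ⟨⟨k1, k2, k3, -⟩, k4⟩ := hM'
        simp only [Test.Holds, Expr.eval] at k4
        rw [hN' _ k3] at k4
        have : M'.word i 0 = n := by omega
        rwa [this] at k2
    · omega
  · refine ⟨by simp, by simpa using h0, fun a ha _ => by simp [ha], fun a _ => rfl⟩
  · rintro M ⟨k1, k2, k3, k4⟩ hlt
    simp only [Test.Holds, Expr.eval] at hlt
    rw [hN' _ k3] at hlt
    refine ⟨T (M.word i 0) + 1, Ensures.seq ((hstep _ M hlt rfl k2 k3 k4).frame.mono le_rfl ?_)⟩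
    rintro M' ⟨m1, m2, m3⟩
    have hi' : M'.word i 0 = M.word i 0 := by rw [m2 i hi]
    refine ⟨1, _, .set M' i (.lit 0) (.succ (reg i)), le_rfl, ?_, ?_⟩
    · simp only [Expr.eval, hi', Mem.word_setWord_self, Function.update_self]
      refine ⟨by omega, m1, fun a ha ha' => ?_, fun a ha => ?_⟩
      · rw [Mem.word_setWord_of_ne _ _ _ ha, m2 a ha', k3 a ha ha']
      · rw [Mem.num_setWord, m3 a ha, k4 a ha]
    · simp only [Expr.eval, hi', Mem.word_setWord_self, Function.update_self]
      rw [Finset.sum_eq_sum_Ico_succ_bot hlt (fun k => T k + 2)]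
      simp only [Test.size]
      omega

/-- The rule for loops whose body takes constant time. -/
theorem forLoop_const_rule {i N : ℕ} {P : Prog} {M₀ : Mem} (hi : i ∉ P.writes)
    (hN : N ∉ P.writes) (hiN : N ≠ i) (Inv : ℕ → Mem → Prop) (c : ℕ)
    (h0 : Inv 0 (M₀.setWord i 0 0))
    (hstep : ∀ k M, k < M₀.word N 0 → M.word i 0 = k → Inv k M →
      (∀ a, a ≠ i → a ∉ P.writes → M.word a = M₀.word a) →
      (∀ a, a ∉ P.numWrites → M.num a = M₀.num a) →
      Ensures κ P M c fun M' => Inv (k + 1) (M'.setWord i 0 (k + 1))) :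
    Ensures κ (forLoop i N P) M₀ ((c + 2) * M₀.word N 0 + 2) (Inv (M₀.word N 0)) :=
  (forLoop_rule hi hN hiN Inv (fun _ => c) h0 hstep).mono (by simp [mul_comm]) fun _ h => h

/-- `for i < N do a[i] := if t then 1 else 0`. -/
def fillLoop (i N a : ℕ) (t : Test) : Prog :=
  forLoop i N (.ite t (.set a (reg i) (.lit 1)) (.set a (reg i) (.lit 0)))

/-- The time of the test may depend on k, so that the bit lengths of the parameters can be added up.
-/
theorem fillLoop_time_rule {i N a : ℕ} {t : Test} (C : ℕ → Prop) (τ : ℕ → ℕ) {M₀ : Mem} (hi : i ≠ a)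
    (hN : N ≠ a) (hiN : N ≠ i)
    (hC : ∀ k M, k < M₀.word N 0 → M.word i 0 = k → (∀ b, b ≠ i → b ≠ a → M.word b = M₀.word b) →
      M.num = M₀.num → (t.Holds M ↔ C k) ∧ t.time κ M ≤ τ k) :
    Ensures κ (fillLoop i N a t) M₀ (∑ k ∈ Finset.range (M₀.word N 0), (τ k + 3) + 2) fun M =>
      (∀ k < M₀.word N 0, M.word a k = 1 ↔ C k) ∧
      (∀ k < M₀.word N 0, M.word a k ≤ 1) ∧
      (∀ b, b ≠ i → b ≠ a → M.word b = M₀.word b) ∧ M.num = M₀.num := by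
  have := forLoop_rule (κ := κ) (i := i) (N := N) (M₀ := M₀)
    (P := .ite t (.set a (reg i) (.lit 1)) (.set a (reg i) (.lit 0)))
    (by simp [Prog.writes, hi]) (by simp [Prog.writes, hN]) hiN
    (fun k M => (∀ j < k, M.word a j = 1 ↔ C j) ∧ ∀ j < k, M.word a j ≤ 1) (fun k => τ k + 1) (by simp) ?_
  · refine this.frame.mono le_rfl fun M hM => ⟨hM.1.1, hM.1.2, fun b hb hb' => ?_,
      funext fun b => ?_⟩
    · exact hM.2.1 b (by simp [RAM.forLoop, Prog.writes, hb, hb'])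
    · exact hM.2.2 b (by simp [RAM.forLoop, Prog.numWrites])
  · intro k M hk hik hInv hfr hfn
    obtain ⟨hCk, hτ⟩ := hC k M hk hik (fun b hb hb' => hfr b hb (by simp [Prog.writes, hb']))
      (funext fun b => hfn b (by simp [Prog.numWrites]))
    by_cases hc : t.Holds M
    on_goal 1 => refine ⟨_, _, .iteTrue hc (.set M a (reg i) (.lit 1)), by omega, ?_⟩
    on_goal 2 => refine ⟨_, _, .iteFalse hc (.set M a (reg i) (.lit 0)), by omega, ?_⟩
    all_goals
      simp only [Expr.eval, hik]
      rw [Mem.word_setWord_of_ne _ _ _ hi.symm, Mem.word_setWord_self]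
      constructor <;> intro j hj
      · rcases Nat.lt_succ_iff_lt_or_eq.1 hj with hj | rfl
        · rw [Function.update_of_ne hj.ne]; exact hInv.1 j hj
        · simp only [Function.update_self]; rw [← hCk]; simp [hc]
      · rcases Nat.lt_succ_iff_lt_or_eq.1 hj with hj | rfl
        · rw [Function.update_of_ne hj.ne]; exact hInv.2 j hj
        · simp

theorem fillLoop_rule {i N a : ℕ} {t : Test} (ht : t.wordOnly = true ∨ κ = unitCost)
    (C : ℕ → Prop) {M₀ : Mem} (hi : i ≠ a) (hN : N ≠ a) (hiN : N ≠ i)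
    (hC : ∀ k M, k < M₀.word N 0 → M.word i 0 = k → (∀ b, b ≠ i → b ≠ a → M.word b = M₀.word b) →
      M.num = M₀.num → (t.Holds M ↔ C k)) :
    Ensures κ (fillLoop i N a t) M₀ ((t.size + 3) * M₀.word N 0 + 2) fun M =>
      (∀ k < M₀.word N 0, M.word a k = 1 ↔ C k) ∧
      (∀ k < M₀.word N 0, M.word a k ≤ 1) ∧
      (∀ b, b ≠ i → b ≠ a → M.word b = M₀.word b) ∧ M.num = M₀.num :=
  (fillLoop_time_rule C (fun _ => t.size) hi hN hiN fun k M h1 h2 h3 h4 =>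
    ⟨hC k M h1 h2 h3 h4, Test.time_le ht M⟩).mono (by simp [mul_comm]) fun _ h => h

/-- `for i < N do if t then a[e] := 1`. -/
def markLoop (i N a : ℕ) (e : Expr) (t : Test) : Prog :=
  forLoop i N (.ite t (.set a e (.lit 1)) .skip)

/-- Marks are only ever set. The index expression has to be meaningful only where the test succeeds,
so the head of an absent edge is never used. -/
theorem markLoop_rule {i N a : ℕ} {e : Expr} {t : Test} (ht : t.wordOnly = true ∨ κ = unitCost)
    (C : ℕ → Prop) (f : ℕ → ℕ) {M₀ : Mem} (hi : i ≠ a) (hN : N ≠ a) (hiN : N ≠ i)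
    (hC : ∀ k M, k < M₀.word N 0 → M.word i 0 = k → (∀ b, b ≠ i → b ≠ a → M.word b = M₀.word b) →
      M.num = M₀.num → (t.Holds M ↔ C k) ∧ (C k → e.eval M = f k)) :
    Ensures κ (markLoop i N a e t) M₀ ((t.size + 3) * M₀.word N 0 + 2) fun M =>
      (∀ v, M.word a v = 1 ↔ M₀.word a v = 1 ∨ ∃ k < M₀.word N 0, C k ∧ f k = v) ∧
      (∀ v, M₀.word a v ≤ 1 → M.word a v ≤ 1) ∧
      (∀ b, b ≠ i → b ≠ a → M.word b = M₀.word b) ∧ M.num = M₀.num := by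
  have := forLoop_const_rule (κ := κ) (i := i) (N := N) (M₀ := M₀)
    (P := .ite t (.set a e (.lit 1)) .skip)
    (by simp [Prog.writes, hi]) (by simp [Prog.writes, hN]) hiN
    (fun k M => (∀ v, M.word a v = 1 ↔ M₀.word a v = 1 ∨ ∃ j < k, C j ∧ f j = v) ∧
      ∀ v, M₀.word a v ≤ 1 → M.word a v ≤ 1) (t.size + 1)
    (by simp [Mem.word_setWord_of_ne _ _ _ hi.symm]) ?_
  · refine this.frame.mono (by ring_nf; omega) fun M hM => ⟨hM.1.1, hM.1.2, fun b hb hb' => ?_,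
      funext fun b => ?_⟩
    · exact hM.2.1 b (by simp [RAM.forLoop, Prog.writes, hb, hb'])
    · exact hM.2.2 b (by simp [RAM.forLoop, Prog.numWrites])
  · intro k M hk hik hInv hfr hfn
    obtain ⟨hCk, hf⟩ := hC k M hk hik (fun b hb hb' => hfr b hb (by simp [Prog.writes, hb']))
      (funext fun b => hfn b (by simp [Prog.numWrites]))
    have hex : ∀ v, (∃ j < k + 1, C j ∧ f j = v) ↔ (∃ j < k, C j ∧ f j = v) ∨ (C k ∧ f k = v) := by
      intro v
      constructor
      · rintro ⟨j, hj, h⟩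
        rcases Nat.lt_succ_iff_lt_or_eq.1 hj with hj | rfl
        · exact Or.inl ⟨j, hj, h⟩
        · exact Or.inr h
      · rintro (⟨j, hj, h⟩ | h)
        · exact ⟨j, by omega, h⟩
        · exact ⟨k, by omega, h⟩
    refine Ensures.ite ht (fun hc => ⟨1, _, .set M a e (.lit 1), le_rfl, ?_⟩)
      (fun hc => ⟨1, _, .skip M, le_rfl, ?_⟩)
    · beta_reduce
      rw [hf (hCk.1 hc), Mem.word_setWord_of_ne _ _ _ hi.symm, Mem.word_setWord_self]
      refine ⟨fun v => ?_, fun v hv => ?_⟩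
      · rw [hex]
        by_cases hv : v = f k
        · subst hv; simp [Expr.eval, hCk.1 hc]
        · rw [Function.update_of_ne hv, hInv.1 v]
          have : ¬ (C k ∧ f k = v) := fun h => hv h.2.symm
          simp only [this, or_false]
      · by_cases hv' : v = f k
        · subst hv'; simp [Expr.eval]
        · rw [Function.update_of_ne hv']; exact hInv.2 v hv
    · beta_reduce
      rw [Mem.word_setWord_of_ne _ _ _ hi.symm]
      refine ⟨fun v => ?_, hInv.2⟩
      rw [hex, hInv.1 v]
      have : ¬ (C k ∧ f k = v) := fun h => hc (hCk.2 h.1)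
      simp only [this, or_false]

end RAM

/-! ### Well-formedness in terms of connections -/

namespace DiPA

variable {Q Γ : Type*} {A : DiPA Q Γ}

/-- There is a path from `p` to `q` with transitions in `S`. -/
def Conn (A : DiPA Q Γ) (S : Transition Q Γ → Prop) (p q : Q) : Prop :=
  ∃ ts, A.IsPath p ts q ∧ ∀ t ∈ ts, S t

/-- Transitions on AG-paths (AL-paths). -/
def Assigns (g : Guard) (t : Transition Q Γ) : Prop := t.asg = true → t.guard = g

theorem conn_true_of_isPath {p q : Q} {ts : List (Transition Q Γ)} (h : A.IsPath p ts q) :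
    A.Conn (fun _ => True) p q := ⟨ts, h, fun _ _ => trivial⟩

theorem inCycle_iff_conn {g : Guard} {q : Q} : A.InCycle g q ↔ ∃ t, A.IsTransition t ∧ t.guard = g ∧
    A.Conn (fun _ => True) q t.src ∧ A.Conn (fun _ => True) t.dst q := by
  constructor
  · intro h
    obtain ⟨C, hC, t, ht, hg⟩ := inCycle_iff.1 h
    obtain ⟨c₁, c₂, rfl⟩ := List.append_of_mem ht
    obtain ⟨r, h1, h2⟩ := isPath_append.1 hC.2
    have hr : t.src = r := h2.2.1
    subst hr
    exact ⟨t, h2.1, hg, conn_true_of_isPath h1, conn_true_of_isPath h2.2.2⟩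
  · rintro ⟨t, ht, hg, ⟨c₁, h1, -⟩, c₂, h2, -⟩
    exact inCycle_iff.2 ⟨c₁ ++ t :: c₂, ⟨by simp, isPath_append.2 ⟨_, h1, ht, rfl, h2⟩⟩, t, by simp, hg⟩

/-- Well-formedness without mention of cycles. -/
structure ConnWellFormed (A : DiPA Q Γ) : Prop where
  leaking : ∀ t t', A.IsTransition t → A.IsTransition t' → A.Reachable t.src →
    A.Conn (fun _ => True) t.dst t'.src → A.Conn (fun _ => True) t'.dst t.src →
    t.asg = true → t'.guard = .tt
  disclosing : ∀ t, A.IsTransition t → A.Reachable t.src → A.Conn (fun _ => True) t.dst t.src →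
    A.isInput t.src = true → ∃ g, t.out = .sym g
  loop : ∀ g : Guard, g ≠ .tt → ∀ p q, A.Reachable p → A.InCycle g.dual p → A.Conn (Assigns g) p q →
    ¬ A.InCycle g q ∧ ∀ t, A.IsTransition t → t.src = q → t.guard = g → t.out ≠ .svar
  out : ∀ g : Guard, g ≠ .tt → ∀ t q, A.IsTransition t → A.Reachable t.src → t.out = .svar →
    (t.asg = true ∨ t.guard = g.dual) → A.Conn (Assigns g) t.dst q → ¬ A.InCycle g q

/-- The conditions are regrouped by where their paths begin. `loop` treats AG-paths that start on an
L-cycle and lead to a G-cycle or to an output; `out` treats those that start with an output and lead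
to a G-cycle. Each becomes a single search. -/
theorem WellFormed.connWellFormed (h : A.WellFormed) : A.ConnWellFormed where
  leaking := by
    rintro t t' ht ht' hr ⟨c₁, h1, -⟩ ⟨c₂, h2, -⟩ ha
    have hC : A.IsCycle t.src (t :: (c₁ ++ t' :: c₂)) :=
      ⟨by simp, ht, rfl, isPath_append.2 ⟨_, h1, ht', rfl, h2⟩⟩
    exact guard_eq_tt_of_not_leaking h.1 hr hC ha t' (by simp)
  disclosing := by
    rintro t ht hr ⟨c, h1, -⟩ hi
    exact h.out_of_mem (C := t :: c) hr ⟨by simp, ht, rfl, h1⟩ (by simp) hi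
  loop := by
    rintro g hg p q hr hp ⟨ts, h1, h2⟩
    refine ⟨fun hq => h.not_leakingPair hg hr hp h1 h2 hq, fun t ht hs htg ho => ?_⟩
    subst hs
    refine h.not_violatingFor hg hr (isPath_append.2 ⟨_, h1, isPath_singleton ht rfl⟩)
      (Or.inr (Or.inr ⟨t, ts, rfl, AssignsOnly.append h2 ?_, hp, htg, ho⟩))
    intro u hu _
    rw [List.mem_singleton.1 hu, htg]
  out := by
    rintro g hg t q ht hr ho hor ⟨ts, h1, h2⟩ hq
    refine h.not_violatingFor hg hr (ts := t :: ts) ⟨ht, rfl, h1⟩ ?_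
    by_cases ha : t.asg = true
    · exact Or.inl ⟨t, ts, rfl, h2, hq, ha, ho⟩
    · exact Or.inr (Or.inl ⟨t, ts, rfl, AssignsOnly.cons (fun h => absurd h ha) h2, hq, by tauto, ho⟩)

theorem IsCycle.conn_of_mem {q : Q} {C : List (Transition Q Γ)} {t : Transition Q Γ}
    (hq : A.Reachable q) (hC : A.IsCycle q C) (ht : t ∈ C) :
    A.IsTransition t ∧ A.Reachable t.src ∧ A.Conn (fun _ => True) t.dst t.src := by
  obtain ⟨c₁, c₂, rfl⟩ := List.append_of_mem ht
  obtain ⟨r, h1, h2⟩ := isPath_append.1 hC.2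
  have hr : t.src = r := h2.2.1
  subst hr
  exact ⟨h2.1, hq.trans h1, conn_true_of_isPath (isPath_append.2 ⟨_, h2.2.2, h1⟩)⟩

theorem ConnWellFormed.wellFormed (h : A.ConnWellFormed) : A.WellFormed := by
  have hv : ∀ g : Guard, g ≠ .tt → ∀ p ts q, A.Reachable p → A.IsPath p ts q →
      ¬ A.ViolatingFor g g.dual p ts q := by
    rintro g hg p ts q hp hts (⟨t, tl, rfl, ha, hc, ht, ho⟩ | ⟨t, tl, rfl, ha, hc, ht, ho⟩ |
      ⟨t, hd, rfl, ha, hc, ht, ho⟩)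
    · have hs : t.src = p := hts.2.1
      subst hs
      exact h.out g hg t q hts.1 hp ho (Or.inl ht) ⟨tl, hts.2.2, ha⟩ hc
    · have hs : t.src = p := hts.2.1
      subst hs
      exact h.out g hg t q hts.1 hp ho (Or.inr ht)
        ⟨tl, hts.2.2, fun u hu => ha u (List.mem_cons_of_mem _ hu)⟩ hc
    · obtain ⟨r, h1, h2⟩ := isPath_append.1 hts
      exact (h.loop g hg p r hp hc ⟨hd, h1, fun u hu => ha u (List.mem_append_left _ hu)⟩).2 t h2.1
        h2.2.1 ht ho
  refine ⟨?_, ?_, ?_, fun p ts q hp hts => ⟨hv .ge (by simp) p ts q hp hts,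
    hv .lt (by simp) p ts q hp hts⟩⟩
  · intro q C hq hCy hl
    obtain ⟨c₁, t, c₂, t', c₃, rfl, ht, ht', -⟩ := hl.exists_decomposition
    obtain ⟨r, h1, h2⟩ := isPath_append.1 hCy.2
    obtain ⟨r', h3, h4⟩ := isPath_append.1 h2.2.2
    have hr : t.src = r := h2.2.1
    have hr' : t'.src = r' := h4.2.1
    subst hr hr'
    exact ht' (h.leaking t t' h2.1 h4.1 (hq.trans h1) (conn_true_of_isPath h3)
      (conn_true_of_isPath (isPath_append.2 ⟨_, h4.2.2, h1⟩)) ht)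
  · have key : ∀ g : Guard, g ≠ .tt → ∀ q C q' C', A.Reachable q → A.IsCycle q C → A.IsCycle q' C' →
        HasGuard g.dual C → HasGuard g C' → ∀ t ∈ C, ∀ t' ∈ C', ∀ ts, A.IsPath t.src ts t'.src →
          AssignsOnly g ts → False := by
      intro g hg q C q' C' hq hCy hCy' hgC hgC' t ht t' ht' ts hts ha
      exact (h.loop g hg _ _ (hCy.conn_of_mem hq ht).2.1 ⟨q, C, hCy, hgC, t, ht, rfl⟩ ⟨ts, hts, ha⟩).1
        ⟨q', C', hCy', hgC', t', ht', rfl⟩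
    rintro q C q' C' hq hCy hCy' (⟨hg, hg', t, ht, t', ht', ts, hts, ha⟩ |
      ⟨hg, hg', t, ht, t', ht', ts, hts, ha⟩)
    · exact key .ge (by simp) q C q' C' hq hCy hCy' hg hg' t ht t' ht' ts hts ha
    · exact key .lt (by simp) q C q' C' hq hCy hCy' hg hg' t ht t' ht' ts hts ha
  · rintro q C hq hCy ⟨t, ht, hi, ho⟩
    obtain ⟨h1, h2, h3⟩ := hCy.conn_of_mem hq ht
    obtain ⟨g, hg⟩ := h.disclosing t h1 h2 h3 hi
    rw [hg] at ho
    simp at ho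

end DiPA

/-! ### Automata as graphs -/

/-- A graph with vertices `0, …, n - 1` and edges `0, …, 3n - 1`, where `3v`, `3v + 1`, `3v + 2` are
the edges from `v`. The head of an edge `e` is `dst e - 1`; the edge is absent if `dst e = 0`. -/
structure FlatGraph where
  n : ℕ
  init : ℕ
  dst : ℕ → ℕ
  gd : ℕ → ℕ
  out : ℕ → ℕ
  asg : ℕ → ℕ
  inp : ℕ → ℕ

/-- Guards as words. -/
def Guard.code : Guard → ℕ
  | .tt => 0
  | .ge => 1
  | .lt => 2

theorem Guard.code_injective : Function.Injective Guard.code := by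
  intro g h; cases g <;> cases h <;> simp [Guard.code]

theorem Guard.code_lt (g : Guard) : g.code < 3 := by cases g <;> simp [Guard.code]

theorem Out.code_eq_zero {m : ℕ} {o : Out (Fin m)} : o.code = 0 ↔ o = .svar := by
  cases o <;> simp [Out.code]

theorem Out.code_eq_one {m : ℕ} {o : Out (Fin m)} : o.code = 1 ↔ o = .svar' := by
  cases o <;> simp [Out.code]

theorem Out.two_le_code {m : ℕ} {o : Out (Fin m)} : 2 ≤ o.code ↔ ∃ g, o = .sym g := by
  cases o <;> simp [Out.code]

namespace FlatGraph

variable (G : FlatGraph)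

/-- `e` is an edge from `u` to `v`. -/
def IsEdge (e u v : ℕ) : Prop := e < 3 * G.n ∧ e / 3 = u ∧ G.dst e = v + 1

/-- Adjacency by an edge in `S`. -/
def AdjOn (S : ℕ → Prop) (u v : ℕ) : Prop := ∃ e, G.IsEdge e u v ∧ S e

/-- Reachability by edges in `S`. -/
def Reach (S : ℕ → Prop) : ℕ → ℕ → Prop := Relation.ReflTransGen (G.AdjOn S)

/-- Reachability. -/
abbrev Conn : ℕ → ℕ → Prop := G.Reach fun _ => True

/-- Some edge with guard `g` lies on a cycle through `q`. -/
def Loop (g q : ℕ) : Prop := ∃ e u v, G.IsEdge e u v ∧ G.gd e = g ∧ G.Conn q u ∧ G.Conn v q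

/-- Edges on AG-paths (AL-paths). -/
def Assigns (g e : ℕ) : Prop := G.asg e ≠ 1 ∨ G.gd e = g

/-- The parts of well-formedness for a guard `g` and its dual `g'`. -/
structure WellFormedFor (g g' : ℕ) : Prop where
  loop : ∀ p q, G.Conn G.init p → G.Loop g' p → G.Reach (G.Assigns g) p q →
    ¬ G.Loop g q ∧ ∀ e v, G.IsEdge e q v → G.gd e = g → G.out e ≠ 0
  out : ∀ e u v q, G.IsEdge e u v → G.Conn G.init u → G.out e = 0 → (G.asg e = 1 ∨ G.gd e = g') →
    G.Reach (G.Assigns g) v q → ¬ G.Loop g q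

/-- Well-formedness, in terms of edges. -/
structure WellFormed : Prop where
  leaking : ∀ e u v e' u' v', G.IsEdge e u v → G.IsEdge e' u' v' → G.Conn G.init u → G.Conn v u' →
    G.Conn v' u → G.asg e = 1 → G.gd e' = 0
  disclosing : ∀ e u v, G.IsEdge e u v → G.Conn G.init u → G.Conn v u → G.inp u = 1 → 2 ≤ G.out e
  ge : G.WellFormedFor 1 2
  lt : G.WellFormedFor 2 1

/-- Heads of edges are vertices. -/
def Valid : Prop := G.init < G.n ∧ ∀ e < 3 * G.n, G.dst e ≤ G.n

variable {G}

theorem IsEdge.lt_left {e u v : ℕ} (h : G.IsEdge e u v) : u < G.n := by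
  obtain ⟨h1, h2, -⟩ := h; omega

theorem IsEdge.lt_right {e u v : ℕ} (hG : G.Valid) (h : G.IsEdge e u v) : v < G.n := by
  have := hG.2 e h.1
  rw [h.2.2] at this; omega

theorem Reach.lt {S : ℕ → Prop} (hG : G.Valid) {u v : ℕ} (hr : G.Reach S u v) (hu : u < G.n) :
    v < G.n := by
  induction hr with
  | refl => exact hu
  | tail _ h _ => obtain ⟨e, he, -⟩ := h; exact he.lt_right hG

theorem IsEdge.conn {e u v : ℕ} (h : G.IsEdge e u v) : G.Conn u v :=
  Relation.ReflTransGen.single ⟨e, h, trivial⟩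

/-- `G` has exactly the transitions of `A`. -/
structure Represents {n m : ℕ} (G : FlatGraph) (A : DiPA (Fin n) (Fin m)) : Prop where
  n_eq : G.n = n
  init_eq : G.init = A.init
  gd_eq : ∀ (p : Fin n) (c : Guard), G.gd (3 * p + c.code) = c.code
  inp_eq : ∀ p : Fin n, G.inp p = (A.isInput p).toNat
  edge : ∀ (p : Fin n) (c : Guard) (q : Fin n) (o : Out (Fin m)) (b : Bool),
    A.δ p c = some (q, o, b) → G.dst (3 * p + c.code) = q + 1 ∧ G.out (3 * p + c.code) = o.code ∧
      G.asg (3 * p + c.code) = b.toNat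
  no_edge : ∀ (p : Fin n) (c : Guard), A.δ p c = none → G.dst (3 * p + c.code) = 0

namespace Represents

variable {n m : ℕ} {A : DiPA (Fin n) (Fin m)} (hG : G.Represents A)

/-- The edge of a transition. -/
def edgeOf (t : Transition (Fin n) (Fin m)) : ℕ := 3 * t.src + t.guard.code

include hG

theorem isEdge {t : Transition (Fin n) (Fin m)} (h : A.IsTransition t) :
    G.IsEdge (edgeOf t) t.src t.dst ∧ G.gd (edgeOf t) = t.guard.code ∧
      G.out (edgeOf t) = t.out.code ∧ G.asg (edgeOf t) = t.asg.toNat := by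
  obtain ⟨h1, h2, h3⟩ := hG.edge _ _ _ _ _ h
  have := t.guard.code_lt
  have := t.src.2
  refine ⟨⟨?_, ?_, h1⟩, hG.gd_eq _ _, h2, h3⟩
  · rw [hG.n_eq, edgeOf]; omega
  · rw [edgeOf]; omega

theorem exists_transition {e u v : ℕ} (h : G.IsEdge e u v) :
    ∃ t : Transition (Fin n) (Fin m), A.IsTransition t ∧ edgeOf t = e ∧ (t.src : ℕ) = u ∧
      (t.dst : ℕ) = v := by
  obtain ⟨h1, h2, h3⟩ := h
  rw [hG.n_eq] at h1
  obtain ⟨c, hc⟩ : ∃ c : Guard, c.code = e % 3 := by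
    have : e % 3 < 3 := Nat.mod_lt _ (by omega)
    interval_cases e % 3
    exacts [⟨.tt, rfl⟩, ⟨.ge, rfl⟩, ⟨.lt, rfl⟩]
  have hu : u < n := by omega
  have he : 3 * u + c.code = e := by omega
  cases hd : A.δ ⟨u, hu⟩ c with
  | none =>
    have := hG.no_edge _ _ hd
    simp only [he, h3] at this
    omega
  | some x =>
    obtain ⟨q, o, b⟩ := x
    have := (hG.edge _ _ _ _ _ hd).1
    simp only [he, h3] at this
    exact ⟨⟨⟨u, hu⟩, c, q, o, b⟩, hd, he, rfl, by simpa using this.symm⟩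

theorem valid : G.Valid := by
  refine ⟨by rw [hG.init_eq, hG.n_eq]; exact A.init.2, fun e he => ?_⟩
  by_cases h : G.dst e = 0
  · omega
  · obtain ⟨t, -, -, -, h4⟩ := hG.exists_transition (e := e) (u := e / 3) (v := G.dst e - 1)
      ⟨he, rfl, by omega⟩
    have := t.dst.2
    rw [hG.n_eq]; omega

/-- One lemma serves for plain reachability and for AG-paths and AL-paths; S and S' need to agree
only on actual transitions. -/
theorem reach_iff {S : Transition (Fin n) (Fin m) → Prop} {S' : ℕ → Prop}
    (hS : ∀ t, A.IsTransition t → (S t ↔ S' (edgeOf t))) {p q : Fin n} :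
    A.Conn S p q ↔ G.Reach S' p q := by
  constructor
  · rintro ⟨ts, h1, h2⟩
    induction ts generalizing p with
    | nil => rw [show p = q from h1]; exact .refl
    | cons t ts ih =>
      simp only [List.mem_cons, forall_eq_or_imp] at h2
      obtain ⟨k1, rfl, k3⟩ := h1
      exact .head ⟨_, (hG.isEdge k1).1, (hS t k1).1 h2.1⟩ (ih k3 h2.2)
  · intro h
    obtain ⟨r, hr⟩ : ∃ r, r = (q : ℕ) := ⟨_, rfl⟩
    rw [← hr] at h
    induction h generalizing q with
    | refl => exact ⟨[], Fin.ext hr, by simp⟩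
    | @tail b c hb hbc ih =>
      obtain ⟨e, he, hs⟩ := hbc
      obtain ⟨t, h1, rfl, h3, h4⟩ := hG.exists_transition he
      obtain ⟨ts, k1, k2⟩ := ih (q := t.src) h3.symm
      have : t.dst = q := Fin.ext (h4.trans hr)
      subst this
      refine ⟨ts ++ [t], DiPA.isPath_append.2 ⟨_, k1, DiPA.isPath_singleton h1 rfl⟩, ?_⟩
      intro u hu
      rcases List.mem_append.1 hu with hu | hu
      · exact k2 u hu
      · rw [List.mem_singleton.1 hu]; exact (hS t h1).2 hs

theorem conn_iff {p q : Fin n} : A.Conn (fun _ => True) p q ↔ G.Conn p q :=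
  hG.reach_iff (S' := fun _ => True) fun _ _ => Iff.rfl

theorem reachable_iff {q : Fin n} : A.Reachable q ↔ G.Conn G.init q := by
  rw [hG.init_eq, ← hG.conn_iff]
  exact ⟨fun ⟨ts, h⟩ => DiPA.conn_true_of_isPath h, fun ⟨ts, h, _⟩ => ⟨ts, h⟩⟩

theorem inCycle_iff {g : Guard} {q : Fin n} : A.InCycle g q ↔ G.Loop g.code q := by
  rw [DiPA.inCycle_iff_conn]
  constructor
  · rintro ⟨t, h1, h2, h3, h4⟩
    exact ⟨_, _, _, (hG.isEdge h1).1, by rw [(hG.isEdge h1).2.1, h2], hG.conn_iff.1 h3,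
      hG.conn_iff.1 h4⟩
  · rintro ⟨e, u, v, h1, h2, h3, h4⟩
    obtain ⟨t, k1, rfl, rfl, rfl⟩ := hG.exists_transition h1
    refine ⟨t, k1, Guard.code_injective ?_, hG.conn_iff.2 h3, hG.conn_iff.2 h4⟩
    rw [← h2, (hG.isEdge k1).2.1]

theorem assigns_iff {g : Guard} {t : Transition (Fin n) (Fin m)} (ht : A.IsTransition t) :
    DiPA.Assigns g t ↔ G.Assigns g.code (edgeOf t) := by
  obtain ⟨-, h1, -, h2⟩ := hG.isEdge ht
  unfold DiPA.Assigns FlatGraph.Assigns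
  rw [h1, h2, Guard.code_injective.eq_iff]
  cases t.asg <;> simp

theorem wellFormedFor (g : Guard) (hg : g ≠ .tt) (h : A.ConnWellFormed) :
    G.WellFormedFor g.code g.dual.code where
  loop := by
    intro p q h1 h2 h3
    have hp := Reach.lt hG.valid h1 hG.valid.1
    have hq := Reach.lt hG.valid h3 hp
    rw [hG.n_eq] at hp hq
    have := h.loop g hg ⟨p, hp⟩ ⟨q, hq⟩ (hG.reachable_iff.2 h1) (hG.inCycle_iff.2 h2)
      ((hG.reach_iff fun t ht => hG.assigns_iff ht).2 h3)
    refine ⟨fun hl => this.1 (hG.inCycle_iff.2 hl), fun e v he hge ho => ?_⟩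
    obtain ⟨t, k1, rfl, k3, rfl⟩ := hG.exists_transition he
    obtain ⟨-, k4, k5, -⟩ := hG.isEdge k1
    rw [k4] at hge
    rw [k5] at ho
    exact this.2 t k1 (Fin.ext k3) (Guard.code_injective hge) (Out.code_eq_zero.1 ho)
  out := by
    intro e u v q he h1 ho hor h2 hl
    have hq := Reach.lt hG.valid h2 (he.lt_right hG.valid)
    rw [hG.n_eq] at hq
    obtain ⟨t, k1, rfl, rfl, rfl⟩ := hG.exists_transition he
    obtain ⟨-, k4, k5, k6⟩ := hG.isEdge k1
    rw [k5] at ho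
    rw [k4, k6, Guard.code_injective.eq_iff] at hor
    exact h.out g hg t ⟨q, hq⟩ k1 (hG.reachable_iff.2 h1) (Out.code_eq_zero.1 ho)
      (hor.imp (fun h => by simpa using h) id) ((hG.reach_iff fun t ht => hG.assigns_iff ht).2 h2)
      (hG.inCycle_iff.2 hl)

theorem wellFormed_iff : A.WellFormed ↔ G.WellFormed := by
  constructor
  · intro h
    have h := h.connWellFormed
    refine ⟨?_, ?_, hG.wellFormedFor .ge (by simp) h, hG.wellFormedFor .lt (by simp) h⟩
    · intro e u v e' u' v' he he' h1 h2 h3 ha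
      obtain ⟨t, k1, rfl, rfl, rfl⟩ := hG.exists_transition he
      obtain ⟨t', k1', rfl, rfl, rfl⟩ := hG.exists_transition he'
      rw [(hG.isEdge k1').2.1]
      rw [(hG.isEdge k1).2.2.2] at ha
      rw [h.leaking t t' k1 k1' (hG.reachable_iff.2 h1) (hG.conn_iff.2 h2) (hG.conn_iff.2 h3)
        (by simpa using ha)]
      rfl
    · intro e u v he h1 h2 hi
      obtain ⟨t, k1, rfl, rfl, rfl⟩ := hG.exists_transition he
      rw [(hG.isEdge k1).2.2.1, Out.two_le_code]
      rw [hG.inp_eq] at hi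
      exact h.disclosing t k1 (hG.reachable_iff.2 h1) (hG.conn_iff.2 h2) (by simpa using hi)
  · intro h
    have hfor : ∀ g : Guard, g ≠ .tt → G.WellFormedFor g.code g.dual.code := by
      intro g hg
      cases g with
      | tt => exact absurd rfl hg
      | ge => exact h.ge
      | lt => exact h.lt
    refine DiPA.ConnWellFormed.wellFormed ⟨?_, ?_, ?_, ?_⟩
    · intro t t' ht ht' h1 h2 h3 ha
      have := h.leaking _ _ _ _ _ _ (hG.isEdge ht).1 (hG.isEdge ht').1 (hG.reachable_iff.1 h1)
        (hG.conn_iff.1 h2) (hG.conn_iff.1 h3) (by rw [(hG.isEdge ht).2.2.2, ha]; rfl)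
      rw [(hG.isEdge ht').2.1] at this
      exact Guard.code_injective this
    · intro t ht h1 h2 hi
      have := h.disclosing _ _ _ (hG.isEdge ht).1 (hG.reachable_iff.1 h1) (hG.conn_iff.1 h2)
        (by rw [hG.inp_eq, hi]; rfl)
      rwa [(hG.isEdge ht).2.2.1, Out.two_le_code] at this
    · intro g hg p q h1 h2 h3
      have := (hfor g hg).loop p q (hG.reachable_iff.1 h1) (hG.inCycle_iff.1 h2)
        ((hG.reach_iff fun t ht => hG.assigns_iff ht).1 h3)
      refine ⟨fun hl => this.1 (hG.inCycle_iff.1 hl), ?_⟩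
      rintro t ht rfl htg ho
      refine this.2 _ _ (hG.isEdge ht).1 (by rw [(hG.isEdge ht).2.1, htg]) ?_
      rw [(hG.isEdge ht).2.2.1, Out.code_eq_zero.2 ho]
    · intro g hg t q ht h1 ho hor h2 hl
      refine (hfor g hg).out _ _ _ q (hG.isEdge ht).1 (hG.reachable_iff.1 h1)
        (by rw [(hG.isEdge ht).2.2.1, Out.code_eq_zero.2 ho]) ?_
        ((hG.reach_iff fun t ht => hG.assigns_iff ht).1 h2) (hG.inCycle_iff.1 hl)
      rw [(hG.isEdge ht).2.1, (hG.isEdge ht).2.2.2, Guard.code_injective.eq_iff]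
      exact hor.imp (fun h => by rw [h]; rfl) id

end Represents

end FlatGraph

/-! ### Graph search on a machine -/

notation "rI" => (11 : ℕ)
notation "rN" => (12 : ℕ)
notation "rE" => (13 : ℕ)
notation "rP" => (14 : ℕ)
notation "rX" => (15 : ℕ)
notation "rY" => (16 : ℕ)
notation "aInp" => (1 : ℕ)
notation "aSrc" => (30 : ℕ)
notation "aDst" => (31 : ℕ)
notation "aGd" => (32 : ℕ)
notation "aOut" => (33 : ℕ)
notation "aAsg" => (34 : ℕ)
notation "aTri" => (35 : ℕ)
notation "aOk" => (36 : ℕ)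
notation "aMk" => (37 : ℕ)
notation "aStk" => (38 : ℕ)

namespace RAM

variable {κ : ℚ → ℕ}

/-- The rule for loops with a loop-free body. -/
theorem Ensures.while_exec {t : Test} {P : Prog} {M₀ : Mem} (ht : t.wordOnly = true ∨ κ = unitCost)
    (hl : P.loopFree = true) (hw : P.wordOnly = true ∨ κ = unitCost) (I : Mem → Prop) (φ : Mem → ℕ)
    (hI : I M₀) (hstep : ∀ M, I M → t.Holds M → (∀ a, a ∉ P.writes → M.word a = M₀.word a) →
      (∀ a, a ∉ P.numWrites → M.num a = M₀.num a) → I (P.exec M) ∧ φ (P.exec M) < φ M) :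
    Ensures κ (.while t P) M₀ ((P.size + t.size) * φ M₀ + t.size) fun M' => I M' ∧ ¬ t.Holds M' := by
  have := Ensures.while (κ := κ) (t := t) (P := P) (M := M₀) ht
    (fun M => I M ∧ (∀ a, a ∉ P.writes → M.word a = M₀.word a) ∧
      ∀ a, a ∉ P.numWrites → M.num a = M₀.num a)
    (fun M => (P.size + t.size) * φ M) ⟨hI, fun _ _ => rfl, fun _ _ => rfl⟩ ?_
  · exact this.mono le_rfl fun M' h => ⟨h.1.1, h.2⟩
  · rintro M ⟨h1, h2, h3⟩ hM
    obtain ⟨k1, k2⟩ := hstep M h1 hM h2 h3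
    refine ⟨P.size, (Ensures.exec hl hw (R := fun M' => M' = P.exec M) rfl).frame.mono le_rfl ?_⟩
    rintro M' ⟨rfl, m2, m3⟩
    refine ⟨⟨k1, fun a ha => (m2 a ha).trans (h2 a ha), fun a ha => (m3 a ha).trans (h3 a ha)⟩, ?_⟩
    calc (P.size + t.size) * φ (P.exec M) + P.size + t.size
        = (P.size + t.size) * (φ (P.exec M) + 1) := by ring
      _ ≤ _ := Nat.mul_le_mul_left _ k2

theorem Ensures.then {P₁ P₂ : Prog} {M : Mem} {T₁ T₂ : ℕ} {R R' : Mem → Prop}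
    (h₁ : Ensures κ P₁ M T₁ R') (h₂ : ∀ M', R' M' → (∀ a, a ∉ P₁.writes → M'.word a = M.word a) →
      (∀ a, a ∉ P₁.numWrites → M'.num a = M.num a) → Ensures κ P₂ M' T₂ R) :
    Ensures κ (.seq P₁ P₂) M (T₁ + T₂) R :=
  Ensures.seq (h₁.frame.mono le_rfl fun M' h => h₂ M' h.1 h.2.1 h.2.2)

theorem Ensures.set_seq {P : Prog} {M : Mem} {T : ℕ} {R : Mem → Prop} {a : ℕ} {i e : Expr}
    (h : Ensures κ P (M.setWord a (i.eval M) (e.eval M)) T R) :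
    Ensures κ (.seq (.set a i e) P) M (1 + T) R :=
  Ensures.seq ⟨1, _, .set M a i e, le_rfl, h⟩

/-- Programs that run one after another. -/
def block : List Prog → Prog
  | [] => .skip
  | [P] => P
  | P :: Ps => .seq P (block Ps)

/-- The memory holds the graph `G`. -/
structure Holds (G : FlatGraph) (M : Mem) : Prop where
  n : M.word rN 0 = G.n
  e : M.word rE 0 = 3 * G.n
  src : ∀ e < 3 * G.n, M.word aSrc e = e / 3
  dst : ∀ e < 3 * G.n, M.word aDst e = G.dst e
  gd : ∀ e < 3 * G.n, M.word aGd e = G.gd e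
  out : ∀ e < 3 * G.n, M.word aOut e = G.out e
  asg : ∀ e < 3 * G.n, M.word aAsg e = G.asg e
  tri : ∀ v < G.n, M.word aTri v = 3 * v
  inp : ∀ v < G.n, M.word aInp v = G.inp v
  init : M.word 0 2 = G.init

theorem Holds.congr {G : FlatGraph} {M M' : Mem} (h : Holds G M)
    (hM : ∀ a ∈ [0, aInp, rN, rE, aSrc, aDst, aGd, aOut, aAsg, aTri], M'.word a = M.word a) :
    Holds G M' := by
  simp only [List.mem_cons, List.not_mem_nil, or_false, forall_eq_or_imp, forall_eq] at hM
  obtain ⟨h0, h1, h2, h3, h4, h5, h6, h7, h8, h9⟩ := hM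
  constructor
  · rw [h2]; exact h.n
  · rw [h3]; exact h.e
  · rw [h4]; exact h.src
  · rw [h5]; exact h.dst
  · rw [h6]; exact h.gd
  · rw [h7]; exact h.out
  · rw [h8]; exact h.asg
  · rw [h9]; exact h.tri
  · rw [h1]; exact h.inp
  · rw [h0]; exact h.init

/-- Push the edge `e`. -/
def push (e : Expr) : Prog :=
  .seq (.set aStk (reg rP) e) (.set rP (.lit 0) (.succ (reg rP)))

/-- Push the edges from marked vertices. -/
def searchInit : Prog :=
  .seq (.set rP (.lit 0) (.lit 0))
    (forLoop rI rE (.ite (.eq (.get aMk (.get aSrc (reg rI))) (.lit 1)) (push (reg rI)) .skip))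

/-- Pop an edge, and mark its head and push the edges from there if it is new. -/
def searchBody : Prog :=
  block [.set rP (.lit 0) (.pred (reg rP)), .set rX (.lit 0) (.get aStk (reg rP)),
    .ite (.and (.eq (.get aOk (reg rX)) (.lit 1))
        (.eq (.get aMk (.pred (.get aDst (reg rX)))) (.lit 0)))
      (block [.set rY (.lit 0) (.pred (.get aDst (reg rX))), .set aMk (reg rY) (.lit 1),
        push (.get aTri (reg rY)), push (.succ (.get aTri (reg rY))),
        push (.succ (.succ (.get aTri (reg rY))))])
      .skip]

/-- Mark what can be reached from the marked vertices by edges in `aOk`. -/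
def search : Prog :=
  .seq searchInit (.while (.lt (.lit 0) (reg rP)) searchBody)

/-- The invariant of the search from the vertices marked in `mk₀`. -/
structure SearchInv (G : FlatGraph) (S : ℕ → Prop) (mk₀ mk stk : ℕ → ℕ) (p : ℕ) : Prop where
  stk_lt : ∀ i < p, stk i < 3 * G.n ∧ mk (stk i / 3) = 1
  sound : ∀ v < G.n, mk v = 1 → ∃ u < G.n, mk₀ u = 1 ∧ G.Reach S u v
  mono : ∀ v < G.n, mk₀ v = 1 → mk v = 1
  complete : ∀ e < 3 * G.n, mk (e / 3) = 1 → S e → mk (G.dst e - 1) = 1 ∨ ∃ i < p, stk i = e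
  le_one : ∀ v < G.n, mk v ≤ 1

/-- An edge may leave the stack once it has been honoured: it is not in S, or its head is marked. -/
theorem SearchInv.pop {G : FlatGraph} {S : ℕ → Prop} {mk₀ mk stk : ℕ → ℕ} {p : ℕ}
    (h : SearchInv G S mk₀ mk stk (p + 1)) (hs : S (stk p) → mk (G.dst (stk p) - 1) = 1) :
    SearchInv G S mk₀ mk stk p := by
  refine ⟨fun i hi => h.stk_lt i (by omega), h.sound, h.mono, fun e he h1 h2 => ?_, h.le_one⟩
  rcases h.complete e he h1 h2 with h3 | ⟨i, hi, rfl⟩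
  · exact Or.inl h3
  · rcases Nat.lt_succ_iff_lt_or_eq.1 hi with hi | rfl
    · exact Or.inr ⟨i, hi, rfl⟩
    · exact Or.inl (hs h2)

/-- The first of the three edges of the new vertex overwrites the slot of the popped edge. Marking a
vertex and pushing its edges together preserves `complete`. -/
theorem SearchInv.mark {G : FlatGraph} {S : ℕ → Prop} {mk₀ mk stk : ℕ → ℕ} {p : ℕ} (hG : G.Valid)
    (h : SearchInv G S mk₀ mk stk (p + 1)) (hS : S (stk p)) (hd : G.dst (stk p) ≠ 0) {v : ℕ}
    (hv : v = G.dst (stk p) - 1) :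
    SearchInv G S mk₀ (Function.update mk v 1)
      (Function.update (Function.update (Function.update stk p (3 * v)) (p + 1) (3 * v + 1)) (p + 2)
        (3 * v + 2)) (p + 3) := by
  obtain ⟨h1, h2⟩ := h.stk_lt p (by omega)
  have hvn : v < G.n := by have := hG.2 _ h1; omega
  have hmk : ∀ u, mk u = 1 → Function.update mk v 1 u = 1 := by
    intro u hu
    by_cases huv : u = v
    · subst huv; simp
    · rwa [Function.update_of_ne huv]
  refine ⟨?_, ?_, fun u hu hu' => hmk _ (h.mono u hu hu'), ?_, ?_⟩
  · intro i hi
    by_cases e2 : i = p + 2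
    · subst e2; simp only [Function.update_self]
      rw [show (3 * v + 2) / 3 = v by omega, Function.update_self]; exact ⟨by omega, rfl⟩
    rw [Function.update_of_ne e2]
    by_cases e1 : i = p + 1
    · subst e1; simp only [Function.update_self]
      rw [show (3 * v + 1) / 3 = v by omega, Function.update_self]; exact ⟨by omega, rfl⟩
    rw [Function.update_of_ne e1]
    by_cases e0 : i = p
    · subst e0; simp only [Function.update_self]
      rw [show (3 * v) / 3 = v by omega, Function.update_self]; exact ⟨by omega, rfl⟩
    rw [Function.update_of_ne e0]
    have := h.stk_lt i (by omega)
    exact ⟨this.1, hmk _ this.2⟩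
  · intro u hu hmu
    by_cases huv : u = v
    · subst huv
      obtain ⟨w, hw, hw1, hw2⟩ := h.sound _ (by omega) h2
      exact ⟨w, hw, hw1, hw2.tail ⟨_, ⟨h1, rfl, by omega⟩, hS⟩⟩
    · rw [Function.update_of_ne huv] at hmu
      exact h.sound u hu hmu
  · intro e he h1' h2'
    by_cases hev : e / 3 = v
    · right
      have : e = 3 * v ∨ e = 3 * v + 1 ∨ e = 3 * v + 2 := by omega
      rcases this with rfl | rfl | rfl
      · exact ⟨p, by omega, by simp⟩
      · exact ⟨p + 1, by omega, by simp⟩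
      · exact ⟨p + 2, by omega, by simp⟩
    · rw [Function.update_of_ne hev] at h1'
      rcases h.complete e he h1' h2' with h3 | ⟨i, hi, rfl⟩
      · exact Or.inl (hmk _ h3)
      · rcases Nat.lt_succ_iff_lt_or_eq.1 hi with hi | rfl
        · right
          refine ⟨i, by omega, ?_⟩
          rw [Function.update_of_ne (by omega), Function.update_of_ne (by omega),
            Function.update_of_ne (by omega)]
        · left; rw [← hv]; simp
  · intro u hu
    by_cases huv : u = v
    · subst huv; simp
    · rw [Function.update_of_ne huv]; exact h.le_one u hu

/-- With an empty stack, `complete` says that the marked vertices are closed under edges in S. -/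
theorem SearchInv.mk_iff {G : FlatGraph} {S : ℕ → Prop} {mk₀ mk stk : ℕ → ℕ} 
    (h : SearchInv G S mk₀ mk stk 0) {v : ℕ} (hv : v < G.n) :
    mk v = 1 ↔ ∃ u < G.n, mk₀ u = 1 ∧ G.Reach S u v := by
  refine ⟨h.sound v hv, ?_⟩
  rintro ⟨u, hu, h1, h2⟩
  clear hv
  induction h2 with
  | refl => exact h.mono u hu h1
  | tail _ h2 ih =>
    obtain ⟨e, he, hs⟩ := h2
    have h3 : mk (e / 3) = 1 := by rw [he.2.1]; exact ih
    rcases h.complete e he.1 h3 hs with h4 | ⟨i, hi, -⟩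
    · rwa [he.2.2, Nat.add_sub_cancel] at h4
    · omega

/-- The number of unmarked vertices. -/
def unmarked (n : ℕ) (mk : ℕ → ℕ) : ℕ := ((Finset.range n).filter fun v => mk v = 0).card

theorem unmarked_update {n : ℕ} {mk : ℕ → ℕ} {v : ℕ} (hv : v < n) (h : mk v = 0) {x : ℕ}
    (hx : x ≠ 0) : unmarked n (Function.update mk v x) + 1 = unmarked n mk := by
  have : (Finset.range n).filter (fun u => mk u = 0) =
      insert v ((Finset.range n).filter fun u => Function.update mk v x u = 0) := by
    ext u
    simp only [Finset.mem_filter, Finset.mem_range, Finset.mem_insert]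
    by_cases huv : u = v
    · subst huv; simp [hv, h]
    · simp [huv]
  rw [unmarked, unmarked, this, Finset.card_insert_of_notMem (by simp [hx])]

theorem unmarked_le (n : ℕ) (mk : ℕ → ℕ) : unmarked n mk ≤ n :=
  (Finset.card_filter_le _ _).trans (by simp)

theorem searchInit_rule {G : FlatGraph} {S : ℕ → Prop} {M₀ : Mem} (hM : Holds G M₀)
    (h1 : ∀ v < G.n, M₀.word aMk v ≤ 1) :
    Ensures κ searchInit M₀ (36 * G.n + 3) fun M =>
      SearchInv G S (M₀.word aMk) (M.word aMk) (M.word aStk) (M.word rP 0) ∧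
        M.word rP 0 ≤ 3 * G.n := by
  refine (Ensures.set_seq (T := 10 * (3 * G.n) + 2) ?_).mono (by omega) fun M h => h
  simp only [Expr.eval]
  have hE : (M₀.setWord rP 0 0).word rE 0 = 3 * G.n := by simp [hM.e]
  have := forLoop_const_rule (κ := κ) (i := rI) (N := rE) (M₀ := M₀.setWord rP 0 0)
    (P := .ite (.eq (.get aMk (.get aSrc (reg rI))) (.lit 1)) (push (reg rI)) .skip)
    (by simp [push, Prog.writes]) (by simp [push, Prog.writes]) (by simp)
    (fun k M => M.word rP 0 ≤ k ∧ (∀ i < M.word rP 0, M.word aStk i < 3 * G.n ∧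
      M₀.word aMk (M.word aStk i / 3) = 1) ∧
      ∀ e < k, M₀.word aMk (e / 3) = 1 → ∃ i < M.word rP 0, M.word aStk i = e) 8 (by simp) ?_
  · rw [hE] at this
    refine this.frame.mono (by omega) fun M ⟨⟨k1, k2, k3⟩, k4, _⟩ => ⟨?_, k1⟩
    have hmk : M.word aMk = M₀.word aMk := by
      rw [k4 _ (by simp [forLoop, push, Prog.writes])]; simp
    rw [hmk]
    exact ⟨k2, fun v hv h => ⟨v, hv, h, .refl⟩, fun _ _ h => h,
      fun e he h _ => Or.inr (k3 e he h), h1⟩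
  · rintro k M hk hki ⟨i1, i2, i3⟩ hfr -
    rw [hE] at hk
    have hmk : M.word aMk = M₀.word aMk := by
      rw [hfr _ (by simp) (by simp [push, Prog.writes])]; simp
    have hsrc : M.word aSrc k = k / 3 := by
      rw [hfr _ (by simp) (by simp [push, Prog.writes])]; simp [hM.src k hk]
    refine (Ensures.exec (by simp [push, Prog.loopFree]) (Or.inl (by simp [push, Prog.wordOnly, Test.wordOnly])) ?_).mono
      (by simp [Prog.size, push, Test.size]) fun _ h => h
    by_cases hc : M₀.word aMk (k / 3) = 1
    · simp only [Prog.exec, Test.Holds, Expr.eval, hki, hsrc, hmk, hc, push, if_true]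
      simp only [ne_eq, Nat.reduceEqDiff, not_false_eq_true,
        Mem.word_setWord_self, Mem.word_setWord_of_ne, Function.update_self]
      refine ⟨by omega, fun i hi => ?_, fun e he h => ?_⟩
      · rcases Nat.lt_succ_iff_lt_or_eq.1 hi with hi | rfl
        · rw [Function.update_of_ne hi.ne]; exact i2 i hi
        · simp [hk, hc]
      · rcases Nat.lt_succ_iff_lt_or_eq.1 he with he | rfl
        · obtain ⟨i, hi, h'⟩ := i3 e he h
          exact ⟨i, by omega, by rw [Function.update_of_ne hi.ne, h']⟩
        · exact ⟨M.word rP 0, by omega, by simp⟩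
    · simp only [Prog.exec, Test.Holds, Expr.eval, hki, hsrc, hmk, hc, push, if_false]
      simp only [ne_eq, Nat.reduceEqDiff, not_false_eq_true,
        Mem.word_setWord_of_ne]
      refine ⟨by omega, i2, fun e he h => ?_⟩
      rcases Nat.lt_succ_iff_lt_or_eq.1 he with he | rfl
      · exact i3 e he h
      · exact absurd h hc

/-- The potential is the height of the stack plus four times the number of unmarked vertices. A new
vertex raises the stack by 2 but frees 4, and any other step pops an edge. Absent edges are pushed
too, but the hypothesis on `aOk` makes the search discard them. -/
theorem search_rule {G : FlatGraph} (hG : G.Valid) {M₀ : Mem} (hM : Holds G M₀)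
    (h1 : ∀ v < G.n, M₀.word aMk v ≤ 1)
    (hok : ∀ e < 3 * G.n, M₀.word aOk e = 1 → G.dst e ≠ 0) :
    Ensures κ search M₀ (400 * G.n + 10) fun M =>
      (∀ v < G.n, M.word aMk v = 1 ↔
        ∃ u < G.n, M₀.word aMk u = 1 ∧ G.Reach (fun e => M₀.word aOk e = 1) u v) ∧
      ∀ v < G.n, M.word aMk v ≤ 1 := by
  refine (Ensures.then (T₂ := 300 * G.n + 5) (searchInit_rule hM h1
    (S := fun e => M₀.word aOk e = 1)) ?_).mono (by omega) fun _ h => h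
  rintro M₁ ⟨hI, hp⟩ hfr -
  have hH : Holds G M₁ := hM.congr fun a ha => hfr a (by
    revert a; simp [searchInit, forLoop, push, Prog.writes])
  have hokM : M₁.word aOk = M₀.word aOk := hfr _ (by simp [searchInit, forLoop, push, Prog.writes])
  have := Ensures.while_exec (κ := κ) (t := .lt (.lit 0) (reg rP)) (P := searchBody) (M₀ := M₁)
    (Or.inl rfl) (by simp [searchBody, block, push, Prog.loopFree])
    (Or.inl (by simp [searchBody, block, push, Prog.wordOnly, Test.wordOnly]))
    (fun M => SearchInv G (fun e => M₀.word aOk e = 1) (M₀.word aMk) (M.word aMk) (M.word aStk)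
      (M.word rP 0)) (fun M => M.word rP 0 + 4 * unmarked G.n (M.word aMk)) hI ?_
  · refine this.mono ?_ ?_
    · have hu := unmarked_le G.n (M₁.word aMk)
      have : (searchBody.size + (Test.lt (.lit 0) (reg rP)).size) ≤ 20 := by
        simp [searchBody, block, push, Prog.size, Test.size]
      have h2 := Nat.mul_le_mul this (show M₁.word rP 0 + 4 * unmarked G.n (M₁.word aMk) ≤ 7 * G.n by omega)
      refine (Nat.add_le_add_right h2 _).trans ?_
      simp only [Test.size]; omega
    · rintro M ⟨k1, k2⟩
      simp only [Test.Holds, Expr.eval, not_lt, Nat.le_zero] at k2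
      rw [k2] at k1
      exact ⟨fun v hv => k1.mk_iff hv, k1.le_one⟩
  · intro M hI hlt hfr' _
    have hH' : Holds G M := hH.congr fun a ha => hfr' a (by
      revert a; simp [searchBody, block, push, Prog.writes])
    have hok' : M.word aOk = M₀.word aOk :=
      (hfr' _ (by simp [searchBody, block, push, Prog.writes])).trans hokM
    simp only [Test.Holds, Expr.eval] at hlt
    obtain ⟨p, hp⟩ : ∃ p, M.word rP 0 = p + 1 := ⟨M.word rP 0 - 1, by omega⟩
    rw [hp] at hI
    obtain ⟨h1, h2⟩ := hI.stk_lt p (by omega)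
    have hd := hH'.dst _ h1
    by_cases hs : M₀.word aOk (M.word aStk p) = 1
    · have hd0 := hok _ h1 hs
      obtain ⟨v, hv⟩ : ∃ v, v = G.dst (M.word aStk p) - 1 := ⟨_, rfl⟩
      have hvn : v < G.n := by have := hG.2 _ h1; omega
      by_cases hm : M.word aMk v = 0
      · have hI' := hI.mark hG hs hd0 hv
        have ht := hH'.tri v hvn
        have hu := unmarked_update hvn hm one_ne_zero
        have e1 : (searchBody.exec M).word rP 0 = p + 3 := by
          simp [searchBody, block, push, Prog.exec, Test.Holds, Expr.eval, hp, hok', hd, ← hv, hm, hs]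
        have e2 : (searchBody.exec M).word aMk = Function.update (M.word aMk) v 1 := by
          simp [searchBody, block, push, Prog.exec, Test.Holds, Expr.eval, hp, hok', hd, ← hv, hm, hs]
        have e3 : (searchBody.exec M).word aStk = Function.update (Function.update (Function.update
            (M.word aStk) p (3 * v)) (p + 1) (3 * v + 1)) (p + 2) (3 * v + 2) := by
          simp [searchBody, block, push, Prog.exec, Test.Holds, Expr.eval, hp, hok', hd, ← hv, hm, hs, ht]
        rw [e1, e2, e3]
        exact ⟨hI', by omega⟩
      · have e1 : (searchBody.exec M).word rP 0 = p := by
          simp [searchBody, block, push, Prog.exec, Test.Holds, Expr.eval, hp, hok', hd, ← hv, hm, hs]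
        have e2 : (searchBody.exec M).word aMk = M.word aMk := by
          simp [searchBody, block, push, Prog.exec, Test.Holds, Expr.eval, hp, hok', hd, ← hv, hm, hs]
        have e3 : (searchBody.exec M).word aStk = M.word aStk := by
          simp [searchBody, block, push, Prog.exec, Test.Holds, Expr.eval, hp, hok', hd, ← hv, hm, hs]
        rw [e1, e2, e3]
        have := hI.le_one v hvn
        exact ⟨hI.pop fun _ => by rw [← hv]; omega, by omega⟩
    · have e1 : (searchBody.exec M).word rP 0 = p := by
        simp [searchBody, block, push, Prog.exec, Test.Holds, Expr.eval, hp, hok', hs]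
      have e2 : (searchBody.exec M).word aMk = M.word aMk := by
        simp [searchBody, block, push, Prog.exec, Test.Holds, Expr.eval, hp, hok', hs]
      have e3 : (searchBody.exec M).word aStk = M.word aStk := by
        simp [searchBody, block, push, Prog.exec, Test.Holds, Expr.eval, hp, hok', hs]
      rw [e1, e2, e3]
      exact ⟨hI.pop fun h => absurd h hs, by omega⟩

end RAM

/-! ### Strongly connected components -/

notation "rH" => (17 : ℕ)
notation "rK" => (18 : ℕ)
notation "rV" => (19 : ℕ)
notation "rB" => (20 : ℕ)
notation "rId" => (21 : ℕ)
notation "rCnt" => (22 : ℕ)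
notation "rR" => (23 : ℕ)
notation "aS" => (40 : ℕ)
notation "aB" => (41 : ℕ)
notation "aPos" => (42 : ℕ)
notation "aComp" => (43 : ℕ)
notation "aOrd" => (44 : ℕ)

namespace RAM

/-- The state of the path-based algorithm for strongly connected components: a stack `S` of `h`
vertices, cut into segments by a stack `B` of `k` boundaries, a stack `P` of `p` pending edges, the
positions of the vertices in `S` (from `1` on; `0` for new vertices), the components of the finished
vertices, the number `id` of components, a list `ord` of the `cnt` finished vertices, and a vertex
`r` with no new vertices before it. -/
structure SccState where
  S : ℕ → ℕ
  B : ℕ → ℕ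
  P : ℕ → ℕ
  pos : ℕ → ℕ
  comp : ℕ → ℕ
  ord : ℕ → ℕ
  h : ℕ
  k : ℕ
  p : ℕ
  id : ℕ
  cnt : ℕ
  r : ℕ

/-- The invariant of the algorithm; the edges in `X` are excepted. -/
structure SccInv (G : FlatGraph) (X : ℕ → Prop) (s : SccState) : Prop where
  stack : ∀ i < s.h, s.S i < G.n ∧ s.pos (s.S i) = i + 1 ∧ s.comp (s.S i) = 0
  active : ∀ v < G.n, s.comp v = 0 → s.pos v ≠ 0 → s.pos v ≤ s.h ∧ s.S (s.pos v - 1) = v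
  seen : ∀ v < G.n, s.comp v ≠ 0 → s.pos v ≠ 0
  bound_strictMono : ∀ i j, i < j → j < s.k → s.B i < s.B j
  bound_lt : ∀ i < s.k, s.B i < s.h
  bound_zero : 0 < s.h → 0 < s.k ∧ s.B 0 = 0
  up : ∀ i j, i ≤ j → j < s.h → G.Conn (s.S i) (s.S j)
  down : ∀ i j, i ≤ j → j < s.h → (∀ b < s.k, ¬ (i < s.B b ∧ s.B b ≤ j)) → G.Conn (s.S j) (s.S i)
  pending : ∀ a < s.p, s.P a < 3 * G.n ∧ s.pos (s.P a / 3) ≠ 0 ∧ s.comp (s.P a / 3) = 0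
  sorted : ∀ a b, a ≤ b → b < s.p → s.pos (s.P a / 3) ≤ s.pos (s.P b / 3)
  edge : ∀ e u v, G.IsEdge e u v → s.pos u ≠ 0 → (∃ a < s.p, s.P a = e) ∨ X e ∨
    (s.pos v ≠ 0 ∧ (s.comp v ≠ 0 ∨ s.comp u = 0 ∧ ∀ b < s.k, ¬ (s.pos v ≤ s.B b ∧ s.B b < s.pos u)))
  done : ∀ e u v, G.IsEdge e u v → s.comp u ≠ 0 → s.comp v ≠ 0 ∧ s.comp v ≤ s.comp u
  comp_conn : ∀ u v, u < G.n → v < G.n → s.comp u ≠ 0 → s.comp u = s.comp v → G.Conn u v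
  comp_le : ∀ v < G.n, s.comp v ≤ s.id
  ord_lt : ∀ i < s.cnt, s.ord i < G.n ∧ s.comp (s.ord i) ≠ 0
  ord_inj : ∀ i j, i < s.cnt → j < s.cnt → s.ord i = s.ord j → i = j
  ord_surj : ∀ v < G.n, s.comp v ≠ 0 → ∃ i < s.cnt, s.ord i = v
  ord_mono : ∀ i j, i ≤ j → j < s.cnt → s.comp (s.ord i) ≤ s.comp (s.ord j)
  root : ∀ v < s.r, s.pos v ≠ 0
  root_le : s.r ≤ G.n

/-- Put a new vertex on the stack. -/
def SccState.visit (s : SccState) (v : ℕ) : SccState :=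
  { s with
    S := Function.update s.S s.h v
    pos := Function.update s.pos v (s.h + 1)
    B := Function.update s.B s.k s.h
    P := Function.update (Function.update (Function.update s.P s.p (3 * v)) (s.p + 1) (3 * v + 1))
      (s.p + 2) (3 * v + 2)
    h := s.h + 1
    k := s.k + 1
    p := s.p + 3 }

namespace SccInv

variable {G : FlatGraph} {X : ℕ → Prop} {s : SccState}

theorem init (h1 : s.pos = 0) (h2 : s.comp = 0) (h3 : s.h = 0) (h4 : s.k = 0) (h5 : s.p = 0)
    (h6 : s.cnt = 0) (h7 : s.r = 0) : SccInv G X s := by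
  constructor <;> simp [h1, h2, h3, h4, h5, h6, h7]

theorem pos_index (hs : SccInv G X s) {v : ℕ} (hv : v < G.n) (h1 : s.comp v = 0)
    (h2 : s.pos v ≠ 0) : ∃ i < s.h, s.S i = v ∧ s.pos v = i + 1 := by
  obtain ⟨k1, k2⟩ := hs.active v hv h1 h2
  exact ⟨s.pos v - 1, by omega, k2, by omega⟩

theorem skip_root (hs : SccInv G X s) (h : s.r < G.n) (h1 : s.pos s.r ≠ 0) :
    SccInv G X { s with r := s.r + 1 } :=
  { hs with
    root := fun v hv => by
      rcases Nat.lt_succ_iff_lt_or_eq.1 hv with hv | rfl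
      · exact hs.root v hv
      · exact h1
    root_le := h }

/-- Popping an edge suspends its clause in the invariant. The exception ends once the clause has
been verified for that edge. -/
theorem excuse (hs : SccInv G X s) (h : ∀ e u v, G.IsEdge e u v → X e → s.pos u ≠ 0 →
    (s.pos v ≠ 0 ∧ (s.comp v ≠ 0 ∨ s.comp u = 0 ∧
      ∀ b < s.k, ¬ (s.pos v ≤ s.B b ∧ s.B b < s.pos u)))) : SccInv G (fun _ => False) s :=
  { hs with
    edge := fun e u v he hu => by
      rcases hs.edge e u v he hu with h1 | h1 | h1
      · exact Or.inl h1
      · exact Or.inr (Or.inr (h e u v he h1 hu))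
      · exact Or.inr (Or.inr h1) }

theorem pop (hs : SccInv G (fun _ => False) s) {p : ℕ} (hp : s.p = p + 1) :
    SccInv G (fun e => e = s.P p) { s with p := p } :=
  { hs with
    pending := fun a ha => hs.pending a (by simp only at ha; omega)
    sorted := fun a b hab hb => hs.sorted a b hab (by simp only at hb; omega)
    edge := fun e u v he hu => by
      rcases hs.edge e u v he hu with ⟨a, ha, rfl⟩ | h1 | h1
      · rw [hp] at ha
        rcases Nat.lt_succ_iff_lt_or_eq.1 ha with ha | rfl
        · exact Or.inl ⟨a, ha, rfl⟩
        · exact Or.inr (Or.inl rfl)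
      · exact h1.elim
      · exact Or.inr (Or.inr h1) }

/-- The new vertex forms a segment of its own on top of the stack. Its position is the largest, so
pushing its edges keeps the pending edges sorted, and an excepted edge into it is now honoured. -/
theorem visit (hs : SccInv G X s) {v : ℕ} (hv : v < G.n) (h0 : s.pos v = 0)
    (hr : ∀ i < s.h, G.Conn (s.S i) v)
    (hX : ∀ e u w, G.IsEdge e u w → X e → w = v ∧ s.comp u = 0) :
    SccInv G (fun _ => False) (s.visit v) := by
  have hc0 : s.comp v = 0 := by
    by_contra h
    exact hs.seen v hv h h0
  have hpos : ∀ u, s.pos u ≠ 0 → u ≠ v := fun u h h' => h (h' ▸ h0)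
  have hP : ∀ a < s.p, (s.visit v).P a = s.P a := by
    intro a ha
    simp only [SccState.visit]
    rw [Function.update_of_ne (by omega), Function.update_of_ne (by omega),
      Function.update_of_ne (by omega)]
  have hPnew : ∀ a, s.p ≤ a → a < s.p + 3 → (s.visit v).P a = 3 * v + (a - s.p) := by
    intro a h1 h2
    obtain rfl | rfl | rfl : a = s.p ∨ a = s.p + 1 ∨ a = s.p + 2 := by omega
    all_goals simp [SccState.visit]
  have hS : ∀ i < s.h, (s.visit v).S i = s.S i := fun i hi => Function.update_of_ne hi.ne _ _
  have hSh : (s.visit v).S s.h = v := Function.update_self ..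
  have hpv : (s.visit v).pos v = s.h + 1 := Function.update_self ..
  have hpu : ∀ u, u ≠ v → (s.visit v).pos u = s.pos u := fun u hu => Function.update_of_ne hu _ _
  have hB : ∀ b < s.k, (s.visit v).B b = s.B b := fun i hi => Function.update_of_ne hi.ne _ _
  have hBk : (s.visit v).B s.k = s.h := Function.update_self ..
  have hc : (s.visit v).comp = s.comp := rfl
  have hh : (s.visit v).h = s.h + 1 := rfl
  have hk : (s.visit v).k = s.k + 1 := rfl
  have hp : (s.visit v).p = s.p + 3 := rfl
  have hposle : ∀ u < G.n, s.comp u = 0 → s.pos u ≤ s.h := by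
    intro u hu h
    by_cases h' : s.pos u = 0
    · omega
    · exact (hs.active u hu h h').1
  have hpm : ∀ u, s.pos u ≠ 0 → (s.visit v).pos u ≠ 0 := fun u hu => by
    rwa [hpu u (hpos u hu)]
  refine ⟨?_, ?_, ?_, ?_, ?_, ?_, ?_, ?_, ?_, ?_, ?_, hs.done, hs.comp_conn, hs.comp_le, hs.ord_lt,
    hs.ord_inj, hs.ord_surj, hs.ord_mono, ?_, hs.root_le⟩
  · intro i hi
    rw [hc]
    rcases Nat.lt_succ_iff_lt_or_eq.1 hi with hi | rfl
    · obtain ⟨h1, h2, h3⟩ := hs.stack i hi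
      rw [hS i hi, hpu _ (hpos _ (by omega))]
      exact ⟨h1, h2, h3⟩
    · rw [hSh, hpv]; exact ⟨hv, rfl, hc0⟩
  · intro u hu h1 h2
    by_cases huv : u = v
    · subst huv; rw [hpv, hh, Nat.add_sub_cancel]; exact ⟨le_rfl, hSh⟩
    · rw [hpu u huv] at h2 ⊢
      obtain ⟨k1, k2⟩ := hs.active u hu h1 h2
      rw [hS _ (by omega)]
      exact ⟨by omega, k2⟩
  · intro u hu h
    exact hpm u (hs.seen u hu h)
  · intro i j hij hj
    rcases Nat.lt_succ_iff_lt_or_eq.1 hj with hj | rfl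
    · rw [hB i (by omega), hB j hj]; exact hs.bound_strictMono i j hij hj
    · rw [hB i hij, hBk]; exact hs.bound_lt i hij
  · intro i hi
    rw [hh]
    rcases Nat.lt_succ_iff_lt_or_eq.1 hi with hi | rfl
    · rw [hB i hi]; have := hs.bound_lt i hi; omega
    · rw [hBk]; omega
  · intro _
    rw [hk]
    refine ⟨by omega, ?_⟩
    by_cases h : 0 < s.h
    · obtain ⟨h1, h2⟩ := hs.bound_zero h
      rw [hB 0 h1, h2]
    · have hk0 : s.k = 0 := by
        by_contra hk0
        have := hs.bound_lt 0 (by omega)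
        omega
      rw [hk0] at hBk
      rw [hBk]; omega
  · intro i j hij hj
    rcases Nat.lt_succ_iff_lt_or_eq.1 hj with hj | rfl
    · rw [hS i (by omega), hS j hj]; exact hs.up i j hij hj
    · rw [hSh]
      rcases hij.lt_or_eq with hij | rfl
      · rw [hS i hij]; exact hr i hij
      · rw [hSh]; exact .refl
  · intro i j hij hj hb
    rcases Nat.lt_succ_iff_lt_or_eq.1 hj with hj | rfl
    · rw [hS i (by omega), hS j hj]
      refine hs.down i j hij hj fun b hb' => ?_
      have := hb b (by omega)
      rwa [hB b hb'] at this
    · have := hb s.k (by omega)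
      rw [hBk] at this
      have : i = s.h := by omega
      subst this; exact .refl
  · intro a ha
    rw [hc]
    by_cases h : a < s.p
    · rw [hP a h]
      obtain ⟨h1, h2, h3⟩ := hs.pending a h
      exact ⟨h1, hpm _ h2, h3⟩
    · rw [hPnew a (by omega) ha]
      have : (3 * v + (a - s.p)) / 3 = v := by omega
      rw [this, hpv]
      exact ⟨by omega, by omega, hc0⟩
  · intro a b hab hb
    by_cases h : b < s.p
    · rw [hP a (by omega), hP b h, hpu _ (hpos _ (hs.pending b h).2.1),
        hpu _ (hpos _ (hs.pending a (by omega)).2.1)]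
      exact hs.sorted a b hab h
    · rw [hPnew b (by omega) hb]
      have : (3 * v + (b - s.p)) / 3 = v := by omega
      rw [this, hpv]
      by_cases h' : a < s.p
      · obtain ⟨h1, h2, h3⟩ := hs.pending a h'
        rw [hP a h', hpu _ (hpos _ h2)]
        have := hposle _ (show s.P a / 3 < G.n by omega) h3
        omega
      · rw [hPnew a (by omega) (by omega)]
        have : (3 * v + (a - s.p)) / 3 = v := by omega
        rw [this, hpv]
  -- All edges of v are pending. For other sources the new boundary s.h is harmless, because active
  -- old vertices have positions at most s.h.
  · intro e u w he hu
    rw [hc]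
    by_cases huv : u = v
    · subst huv
      left
      obtain ⟨h1, h2, h3⟩ := he
      refine ⟨s.p + e % 3, by omega, ?_⟩
      rw [hPnew _ (by omega) (by omega)]; omega
    · rw [hpu u huv] at hu ⊢
      have hnew : s.comp u = 0 → ∀ b < (s.visit v).k,
          (∀ b < s.k, ¬ (s.pos w ≤ s.B b ∧ s.B b < s.pos u)) ∨ s.h ≤ s.pos w →
          ¬ (s.pos w ≤ (s.visit v).B b ∧ (s.visit v).B b < s.pos u) := by
        intro hcu b hb h
        have hle := hposle u he.lt_left hcu
        rcases Nat.lt_succ_iff_lt_or_eq.1 hb with hb | rfl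
        · rw [hB b hb]
          rcases h with h | h
          · exact h b hb
          · have := hs.bound_lt b hb; omega
        · rw [hBk]; omega
      have hv' : w = v → s.comp u = 0 → ((s.visit v).pos w ≠ 0 ∧ (s.comp w ≠ 0 ∨ s.comp u = 0 ∧
          ∀ b < (s.visit v).k, ¬((s.visit v).pos w ≤ (s.visit v).B b ∧
            (s.visit v).B b < s.pos u))) := by
        rintro rfl hcu
        have hle := hposle u he.lt_left hcu
        rw [hpv]
        refine ⟨by omega, Or.inr ⟨hcu, fun b hb => ?_⟩⟩
        omega
      rcases hs.edge e u w he hu with ⟨a, ha, rfl⟩ | h1 | ⟨h1, h2⟩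
      · exact Or.inl ⟨a, by omega, hP a ha⟩
      · obtain ⟨h2, h3⟩ := hX e u w he h1
        exact Or.inr (Or.inr (hv' h2 h3))
      · right; right
        rw [hpu w (hpos w h1)]
        refine ⟨h1, h2.imp_right fun ⟨h3, h4⟩ => ⟨h3, fun b hb => hnew h3 b hb (Or.inl h4)⟩⟩
  · intro u hu
    exact hpm u (hs.root u hu)

/-- The vertices of the top segment reach each other. -/
theorem conn_top (hs : SccInv G X s) {k : ℕ} (hk : s.k = k + 1) {i j : ℕ} (hi : s.B k ≤ i)
    (hih : i < s.h) (hj : j < s.h) : G.Conn (s.S j) (s.S i) := by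
  rcases le_total j i with h | h
  · exact hs.up j i h hih
  · refine hs.down i j h hj fun b hb => ?_
    rcases (Nat.lt_succ_iff.1 (hk ▸ hb)).lt_or_eq with hb | rfl
    · have := hs.bound_strictMono b k hb (by omega); omega
    · omega

/-- An edge from the top segment to an active vertex below it closes a cycle through everything in
between, so the top boundary can go. Further boundaries are removed in later steps by the same edge.
-/
theorem merge (hs : SccInv G X s) {k e u v : ℕ} (hk : s.k = k + 1) (he : G.IsEdge e u v)
    (hv : v < G.n) (hu : s.B k < s.pos u) (hu0 : s.comp u = 0) (hv0 : s.comp v = 0)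
    (hv1 : s.pos v ≠ 0) (hv2 : s.pos v ≤ s.B k) : SccInv G X { s with k := k } := by
  obtain ⟨iu, hiu, rfl, hpu⟩ := hs.pos_index he.lt_left hu0 (by omega)
  obtain ⟨iv, hiv, rfl, hpv⟩ := hs.pos_index hv hv0 hv1
  refine { hs with
    bound_strictMono := fun i j hij hj => hs.bound_strictMono i j hij (by simp only at hj; omega)
    bound_lt := fun i hi => hs.bound_lt i (by simp only at hi; omega)
    bound_zero := fun hh => ?_
    down := fun i j hij hj hb => ?_
    edge := fun e u v he hu => ?_ }
  · obtain ⟨h1, h2⟩ := hs.bound_zero hh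
    refine ⟨?_, h2⟩
    simp only
    by_contra hk0
    have : k = 0 := by omega
    subst this
    omega
  · simp only at hb hj ⊢
    -- Across the removed boundary, the way down goes from j to the source of the edge, along the
    -- edge, and from its head to i. Elsewhere no boundary has changed.
    by_cases hbk : i < s.B k ∧ s.B k ≤ j
    · have h1 : G.Conn (s.S j) (s.S iu) := hs.conn_top hk (by omega) hiu hj
      refine (h1.trans he.conn).trans ?_
      rcases le_total iv i with h | h
      · exact hs.up iv i h (by omega)
      · refine hs.down i iv h hiv fun b hb' => ?_
        rcases (Nat.lt_succ_iff.1 (hk ▸ hb')).lt_or_eq with hb' | rfl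
        · have := hb b hb'; omega
        · omega
    · refine hs.down i j hij hj fun b hb' => ?_
      rcases (Nat.lt_succ_iff.1 (hk ▸ hb')).lt_or_eq with hb' | rfl
      · exact hb b hb'
      · exact hbk
  · rcases hs.edge e u v he hu with h1 | h1 | ⟨h1, h2⟩
    · exact Or.inl h1
    · exact Or.inr (Or.inl h1)
    · refine Or.inr (Or.inr ⟨h1, h2.imp_right fun ⟨h3, h4⟩ => ⟨h3, fun b hb => h4 b ?_⟩⟩)
      simp only at hb; omega

/-- When no pending edge starts in the top segment, its edges lead only into itself or to finished
vertices. So it is closed up to finished components, and it is strongly connected. It receives the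
largest number so far, which makes edges lead to numbers that are not larger. -/
theorem finish (hG : G.Valid) (hs : SccInv G (fun _ => False) s) {k : ℕ} (hk : s.k = k + 1)
    (hp : ∀ a < s.p, s.pos (s.P a / 3) ≤ s.B k) {comp' ord' : ℕ → ℕ}
    (hc₁ : ∀ i, s.B k ≤ i → i < s.h → comp' (s.S i) = s.id + 1)
    (hc₂ : ∀ v, (∀ i, s.B k ≤ i → i < s.h → s.S i ≠ v) → comp' v = s.comp v)
    (ho₁ : ∀ i < s.cnt, ord' i = s.ord i)
    (ho₂ : ∀ i, i < s.h - s.B k → ord' (s.cnt + i) = s.S (s.h - 1 - i)) :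
    SccInv G (fun _ => False) { s with
      comp := comp', ord := ord', h := s.B k, k := k, id := s.id + 1, cnt := s.cnt + (s.h - s.B k) } := by
  have hBh : s.B k < s.h := hs.bound_lt k (by omega)
  have hold : ∀ v, s.comp v ≠ 0 → comp' v = s.comp v := by
    intro v hv
    refine hc₂ v fun i _ hi h => hv ?_
    rw [← h]; exact (hs.stack i hi).2.2
  have hlow : ∀ i < s.B k, comp' (s.S i) = s.comp (s.S i) := by
    intro i hi
    refine hc₂ _ fun j hj hj' h => ?_
    have h1 := (hs.stack i (by omega)).2.1
    rw [← h, (hs.stack j hj').2.1] at h1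
    omega
  -- A vertex changes its component exactly if it is in the top segment, that is, active with a
  -- position greater than the top boundary.
  have hcases : ∀ v < G.n, comp' v = s.comp v ∧ (s.pos v ≤ s.B k ∨ s.comp v ≠ 0) ∨
      comp' v = s.id + 1 ∧ s.comp v = 0 ∧ ∃ i, s.B k ≤ i ∧ i < s.h ∧ s.S i = v ∧ s.pos v = i + 1 := by
    intro v hv
    by_cases h0 : s.comp v = 0
    · by_cases h1 : s.pos v = 0
      · refine Or.inl ⟨hc₂ v fun i _ hi h => ?_, Or.inl (by omega)⟩
        rw [← h, (hs.stack i hi).2.1] at h1; omega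
      · obtain ⟨i, hi, rfl, h2⟩ := hs.pos_index hv h0 h1
        by_cases hb : s.B k ≤ i
        · exact Or.inr ⟨hc₁ i hb hi, h0, i, hb, hi, rfl, h2⟩
        · exact Or.inl ⟨hlow i (by omega), Or.inl (by omega)⟩
    · exact Or.inl ⟨hold v h0, Or.inr h0⟩
  have hne : ∀ v, s.comp v ≠ 0 → comp' v ≠ 0 := fun v hv => by rwa [hold v hv]
  have hordS : ∀ i, s.cnt ≤ i → i < s.cnt + (s.h - s.B k) →
      ∃ j, s.B k ≤ j ∧ j < s.h ∧ ord' i = s.S j ∧ i + j = s.cnt + s.h - 1 := by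
    intro i h1 h2
    have := ho₂ (i - s.cnt) (by omega)
    rw [show s.cnt + (i - s.cnt) = i by omega] at this
    exact ⟨_, by omega, by omega, this, by omega⟩
  refine ⟨?_, ?_, ?_, ?_, ?_, ?_, ?_, ?_, ?_, hs.sorted, ?_, ?_, ?_, ?_, ?_, ?_, ?_, ?_, hs.root,
    hs.root_le⟩
  · intro i hi
    simp only at hi ⊢
    rw [hlow i hi]; exact hs.stack i (by omega)
  · intro v hv h1 h2
    simp only at h1 h2 ⊢
    rcases hcases v hv with ⟨h3, h4⟩ | ⟨h3, -⟩
    · rw [h3] at h1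
      exact ⟨h4.resolve_right (by simpa using h1), (hs.active v hv h1 h2).2⟩
    · omega
  · intro v hv h1
    rcases hcases v hv with ⟨h3, h4⟩ | ⟨h3, h4, i, -, -, -, h5⟩
    · simp only [h3] at h1; exact hs.seen v hv h1
    · simp only; omega
  · exact fun i j hij hj => hs.bound_strictMono i j hij (by simp only at hj; omega)
  · exact fun i hi => hs.bound_strictMono i k hi (by omega)
  · intro hh
    simp only at hh ⊢
    obtain ⟨h1, h2⟩ := hs.bound_zero (by omega)
    refine ⟨?_, h2⟩
    by_contra hk0
    have : k = 0 := by omega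
    subst this; omega
  · exact fun i j hij hj => hs.up i j hij (by simp only at hj; omega)
  · intro i j hij hj hb
    simp only at hj hb ⊢
    refine hs.down i j hij (by omega) fun b hb' => ?_
    rcases (Nat.lt_succ_iff.1 (hk ▸ hb')).lt_or_eq with hb' | rfl
    · exact hb b hb'
    · omega
  · intro a ha
    obtain ⟨h1, h2, h3⟩ := hs.pending a ha
    refine ⟨h1, h2, ?_⟩
    simp only
    rcases hcases (s.P a / 3) (by omega) with ⟨h4, -⟩ | ⟨-, -, i, h4, -, -, h5⟩
    · rw [h4, h3]
    · have := hp a ha; omega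
  · intro e u v he hu
    simp only at hu ⊢
    rcases hs.edge e u v he hu with h1 | h1 | ⟨h1, h2⟩
    · exact Or.inl h1
    · exact h1.elim
    · refine Or.inr (Or.inr ⟨h1, ?_⟩)
      rcases h2 with h2 | ⟨h3, h4⟩
      · exact Or.inl (hne v h2)
      · rcases hcases u he.lt_left with ⟨h5, -⟩ | ⟨-, -, i, h5, h6, -, h7⟩
        · by_cases hcv : comp' v = 0
          · exact Or.inr ⟨by rw [h5, h3], fun b hb => h4 b (by omega)⟩
          · exact Or.inl hcv
        · left
          have h8 := h4 k (by omega)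
          by_cases hcv : s.comp v = 0
          · obtain ⟨j, hj, rfl, h9⟩ := hs.pos_index (he.lt_right hG) hcv h1
            rw [hc₁ j (by omega) hj]; omega
          · exact hne v hcv
  · intro e u v he hu
    have hvn := he.lt_right hG
    simp only at hu ⊢
    rcases hcases u he.lt_left with ⟨h5, -⟩ | ⟨h5, h5', i, h6, h7, h8, h9⟩
    · rw [h5] at hu ⊢
      obtain ⟨h1, h2⟩ := hs.done e u v he hu
      rw [hold v h1]
      exact ⟨h1, h2⟩
    · rw [h5]
      have hle : comp' v ≤ s.id + 1 := by
        have := hs.comp_le v hvn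
        rcases hcases v hvn with ⟨h, -⟩ | ⟨h, -⟩ <;> omega
      refine ⟨?_, hle⟩
      -- A pending edge would start at or below the boundary, contrary to the choice of u. For a
      -- processed edge the head is finished, or it is not below the top boundary and is being
      -- finished now.
      rcases hs.edge e u v he (by omega) with ⟨a, ha, rfl⟩ | h1 | ⟨h1, h2⟩
      · have := hp a ha
        rw [he.2.1] at this; omega
      · exact h1.elim
      · by_cases hcv : s.comp v = 0
        · obtain ⟨j, hj, rfl, h10⟩ := hs.pos_index hvn hcv h1
          have := h2.resolve_left (by simpa using hcv)
          have := this.2 k (by omega)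
          rw [hc₁ j (by omega) hj]; omega
        · exact hne v hcv
  · intro u v hu hv h0 huv
    simp only at h0 huv
    rcases hcases u hu with ⟨h1, -⟩ | ⟨h1, -, i, h2, h3, rfl, -⟩ <;>
      rcases hcases v hv with ⟨k1, -⟩ | ⟨k1, -, j, k2, k3, rfl, -⟩
    · exact hs.comp_conn u v hu hv (by omega) (by omega)
    · have := hs.comp_le u hu; omega
    · have := hs.comp_le v hv; omega
    · exact hs.conn_top hk k2 k3 h3
  · intro v hv
    have := hs.comp_le v hv
    simp only
    rcases hcases v hv with ⟨h, -⟩ | ⟨h, -⟩ <;> omega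
  · intro i hi
    simp only at hi ⊢
    by_cases h : i < s.cnt
    · rw [ho₁ i h]
      exact ⟨(hs.ord_lt i h).1, hne _ (hs.ord_lt i h).2⟩
    · obtain ⟨j, h1, h2, h3, -⟩ := hordS i (by omega) hi
      rw [h3, hc₁ j h1 h2]
      exact ⟨(hs.stack j h2).1, by omega⟩
  · intro i j hi hj hij
    simp only at hi hj hij
    by_cases h : i < s.cnt <;> by_cases h' : j < s.cnt
    · rw [ho₁ i h, ho₁ j h'] at hij
      exact hs.ord_inj i j h h' hij
    · obtain ⟨m, h1, h2, h3, -⟩ := hordS j (by omega) hj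
      rw [ho₁ i h, h3] at hij
      have := (hs.ord_lt i h).2
      rw [hij] at this
      exact absurd (hs.stack m h2).2.2 this
    · obtain ⟨m, h1, h2, h3, -⟩ := hordS i (by omega) hi
      rw [ho₁ j h', h3] at hij
      have := (hs.ord_lt j h').2
      rw [← hij] at this
      exact absurd (hs.stack m h2).2.2 this
    · obtain ⟨m, h1, h2, h3, h4⟩ := hordS i (by omega) hi
      obtain ⟨m', k1, k2, k3, k4⟩ := hordS j (by omega) hj
      rw [h3, k3] at hij
      have e1 := (hs.stack m h2).2.1
      have e2 := (hs.stack m' k2).2.1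
      rw [hij] at e1
      omega
  · intro v hv hcv
    simp only at hcv ⊢
    rcases hcases v hv with ⟨h, -⟩ | ⟨-, -, j, h1, h2, rfl, -⟩
    · rw [h] at hcv
      obtain ⟨i, hi, h'⟩ := hs.ord_surj v hv hcv
      exact ⟨i, by omega, by rw [ho₁ i hi, h']⟩
    · refine ⟨s.cnt + (s.h - 1 - j), by omega, ?_⟩
      rw [ho₂ _ (by omega)]
      congr 1; omega
  · intro i j hij hj
    simp only at hj ⊢
    by_cases h' : j < s.cnt
    · rw [ho₁ i (by omega), ho₁ j h', hold _ (hs.ord_lt i (by omega)).2, hold _ (hs.ord_lt j h').2]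
      exact hs.ord_mono i j hij h'
    · obtain ⟨m, h1, h2, h3, -⟩ := hordS j (by omega) hj
      rw [h3, hc₁ m h1 h2]
      by_cases h : i < s.cnt
      · rw [ho₁ i h, hold _ (hs.ord_lt i h).2]
        have := hs.comp_le _ (hs.ord_lt i h).1
        omega
      · obtain ⟨m', k1, k2, k3, -⟩ := hordS i (by omega) (by omega)
        rw [k3, hc₁ m' k1 k2]

end SccInv

end RAM

/-! ### The component algorithm as a program, and its running time. -/

namespace RAM

variable {κ : ℚ → ℕ}

theorem Ensures.ite_pos {t : Test} {P₁ P₂ : Prog} {M : Mem} {T : ℕ} {R : Mem → Prop}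
    (ht : t.wordOnly = true ∨ κ = unitCost) (h : t.Holds M) (h₁ : Ensures κ P₁ M T R) :
    Ensures κ (.ite t P₁ P₂) M (t.size + T) R :=
  Ensures.ite ht (fun _ => h₁) fun h' => absurd h h'

theorem Ensures.ite_neg {t : Test} {P₁ P₂ : Prog} {M : Mem} {T : ℕ} {R : Mem → Prop}
    (ht : t.wordOnly = true ∨ κ = unitCost) (h : ¬ t.Holds M) (h₁ : Ensures κ P₂ M T R) :
    Ensures κ (.ite t P₁ P₂) M (t.size + T) R :=
  Ensures.ite ht (fun h' => absurd h' h) fun _ => h₁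

theorem Ensures.while_frame {t : Test} {P : Prog} {M₀ : Mem} (ht : t.wordOnly = true ∨ κ = unitCost)
    (I : Mem → Prop) (φ : Mem → ℕ) (hI : I M₀)
    (hstep : ∀ M, I M → t.Holds M → (∀ a, a ∉ P.writes → M.word a = M₀.word a) →
      (∀ a, a ∉ P.numWrites → M.num a = M₀.num a) →
        ∃ T, Ensures κ P M T fun M' => I M' ∧ φ M' + T + t.size ≤ φ M) :
    Ensures κ (.while t P) M₀ (φ M₀ + t.size) fun M' => I M' ∧ ¬ t.Holds M' := by
  have := Ensures.while (κ := κ) (t := t) (P := P) (M := M₀) ht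
    (fun M => I M ∧ (∀ a, a ∉ P.writes → M.word a = M₀.word a) ∧
      ∀ a, a ∉ P.numWrites → M.num a = M₀.num a) φ ⟨hI, fun _ _ => rfl, fun _ _ => rfl⟩ ?_
  · exact this.mono le_rfl fun M' h => ⟨h.1.1, h.2⟩
  · rintro M ⟨h1, h2, h3⟩ hM
    obtain ⟨T, hT⟩ := hstep M h1 hM h2 h3
    refine ⟨T, hT.frame.mono le_rfl ?_⟩
    rintro M' ⟨⟨k1, k2⟩, m2, m3⟩
    exact ⟨⟨k1, fun a ha => (m2 a ha).trans (h2 a ha), fun a ha => (m3 a ha).trans (h3 a ha)⟩, k2⟩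

/-- The state of the algorithm in the memory. -/
def SccState.ofMem (M : Mem) : SccState where
  S := M.word aS
  B := M.word aB
  P := M.word aStk
  pos := M.word aPos
  comp := M.word aComp
  ord := M.word aOrd
  h := M.word rH 0
  k := M.word rK 0
  p := M.word rP 0
  id := M.word rId 0
  cnt := M.word rCnt 0
  r := M.word rR 0

/-- Put the vertex in `rV` on the stack. -/
def sccVisit : Prog :=
  block [.set aS (reg rH) (reg rV), .set aPos (reg rV) (.succ (reg rH)), .set aB (reg rK) (reg rH),
    push (.get aTri (reg rV)), push (.succ (.get aTri (reg rV))),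
    push (.succ (.succ (.get aTri (reg rV)))),
    .set rH (.lit 0) (.succ (reg rH)), .set rK (.lit 0) (.succ (reg rK))]

/-- Start from the vertex in `rR` if it is new. -/
def sccRoot : Prog :=
  .seq (.ite (.eq (.get aPos (reg rR)) (.lit 0)) (.seq (.set rV (.lit 0) (reg rR)) sccVisit) .skip)
    (.set rR (.lit 0) (.succ (reg rR)))

/-- Process the top pending edge. -/
def sccEdge : Prog :=
  .seq (.set rX (.lit 0) (.get aStk (.pred (reg rP))))
    (.ite (.eq (.get aDst (reg rX)) (.lit 0)) (.set rP (.lit 0) (.pred (reg rP)))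
      (.seq (.set rV (.lit 0) (.pred (.get aDst (reg rX))))
        (.ite (.eq (.get aPos (reg rV)) (.lit 0))
          (.seq (.set rP (.lit 0) (.pred (reg rP))) sccVisit)
          (.ite (.and (.eq (.get aComp (reg rV)) (.lit 0)) (.not (.lt (reg rB) (.get aPos (reg rV)))))
            (.set rK (.lit 0) (.pred (reg rK))) (.set rP (.lit 0) (.pred (reg rP)))))))

/-- Move the top vertex of the stack to the current component. -/
def sccPopBody : Prog :=
  block [.set rH (.lit 0) (.pred (reg rH)), .set aComp (.get aS (reg rH)) (reg rId),
    .set aOrd (reg rCnt) (.get aS (reg rH)), .set rCnt (.lit 0) (.succ (reg rCnt))]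

/-- The top segment is a component. -/
def sccFinish : Prog :=
  .seq (.set rId (.lit 0) (.succ (reg rId)))
    (.seq (.while (.lt (reg rB) (reg rH)) sccPopBody) (.set rK (.lit 0) (.pred (reg rK))))

/-- One step of the algorithm. -/
def sccBody : Prog :=
  .ite (.eq (reg rH) (.lit 0)) sccRoot
    (.seq (.set rB (.lit 0) (.get aB (.pred (reg rK))))
      (.ite (.and (.lt (.lit 0) (reg rP)) (.lt (reg rB) (.get aPos (.get aSrc (.get aStk (.pred (reg rP)))))))
        sccEdge sccFinish))

/-- Compute the components, by the path-based algorithm with two stacks. -/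
def scc : Prog :=
  .while (.not (.and (.eq (reg rH) (.lit 0)) (.eq (reg rR) (reg rN)))) sccBody

/-- The potential of the algorithm. -/
def SccState.potential (n : ℕ) (s : SccState) : ℕ :=
  (n - s.r) + 6 * unmarked n s.pos + s.p + s.h + s.k

/-- A visit adds three pending edges, one stacked vertex and one boundary; the weight 6 of an
unvisited vertex pays for these five and for the step itself. -/
theorem SccState.potential_visit {n : ℕ} {s : SccState} {v : ℕ} (hv : v < n) (h : s.pos v = 0) :
    (s.visit v).potential n + 1 = s.potential n := by
  have := unmarked_update hv h (x := s.h + 1) (by omega)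
  simp only [SccState.potential, SccState.visit]
  omega

theorem sccRoot_rule {G : FlatGraph} {M : Mem} (hM : Holds G M)
    (hs : SccInv G (fun _ => False) (SccState.ofMem M)) (hh : M.word rH 0 = 0)
    (hr : M.word rR 0 < G.n) :
    Ensures κ sccRoot M 20 fun M' => SccInv G (fun _ => False) (SccState.ofMem M') ∧
      (SccState.ofMem M').potential G.n < (SccState.ofMem M).potential G.n := by
  by_cases h0 : M.word aPos (M.word rR 0) = 0
  · have e1 : SccState.ofMem (sccRoot.exec M) = { (SccState.ofMem M).visit (M.word rR 0) with
        r := M.word rR 0 + 1 } := by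
      have := hM.tri _ hr
      simp [SccState.ofMem, SccState.visit, sccRoot, sccVisit, block, push, Prog.exec, Expr.eval, Test.Holds, this, h0]
    refine (Ensures.exec (by rfl) (Or.inl (by rfl)) ?_).mono (by decide) fun _ h => h
    rw [e1]
    have := hs.visit hr h0 (fun i hi => absurd (show i < M.word rH 0 from hi) (by omega))
      (fun e u w _ h => h.elim)
    refine ⟨this.skip_root hr ?_, ?_⟩
    · simp [SccState.visit, SccState.ofMem]
    · have := SccState.potential_visit (s := SccState.ofMem M) hr h0
      refine lt_of_le_of_lt ?_ (lt_of_lt_of_eq (Nat.lt_succ_self _) this)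
      simp only [SccState.potential, SccState.visit, SccState.ofMem]
      omega
  · have e1 : SccState.ofMem (sccRoot.exec M) = { SccState.ofMem M with
        r := M.word rR 0 + 1 } := by
      simp [SccState.ofMem, sccRoot, sccVisit, block, push, Prog.exec, Expr.eval, Test.Holds, h0]
    refine (Ensures.exec (by rfl) (Or.inl (by rfl)) ?_).mono (by decide) fun _ h => h
    rw [e1]
    refine ⟨hs.skip_root hr h0, ?_⟩
    simp only [SccState.potential, SccState.ofMem]
    omega

/-- The top edge is absent, leads to a new vertex, leads below the top boundary, or is already
honoured. In all four cases the potential drops. -/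
theorem sccEdge_rule {G : FlatGraph} (hG : G.Valid) {M : Mem} (hM : Holds G M)
    (hs : SccInv G (fun _ => False) (SccState.ofMem M)) {k p : ℕ} (hk : M.word rK 0 = k + 1)
    (hB : M.word rB 0 = M.word aB k) (hp : M.word rP 0 = p + 1)
    (hpos : M.word aB k < M.word aPos (M.word aStk p / 3)) :
    Ensures κ sccEdge M 30 fun M' => SccInv G (fun _ => False) (SccState.ofMem M') ∧
      (SccState.ofMem M').potential G.n < (SccState.ofMem M).potential G.n := by
  have hpop := hs.pop (p := p) hp
  obtain ⟨he, hu0, hu1⟩ := hs.pending p (by simp only [SccState.ofMem]; omega)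
  obtain ⟨e, he'⟩ : ∃ e, e = M.word aStk p := ⟨_, rfl⟩
  have hee : (SccState.ofMem M).P p = e := he'.symm
  rw [hee] at he hu0 hu1 hpop
  rw [← he'] at hpos
  have hd := hM.dst e he
  refine (Ensures.exec (by rfl) (Or.inl (by rfl)) ?_).mono (by decide) fun _ h => h
  have hpot : ({ SccState.ofMem M with p := p } : SccState).potential G.n <
      (SccState.ofMem M).potential G.n := by
    simp only [SccState.potential, SccState.ofMem]; omega
  by_cases h0 : G.dst e = 0
  · have e1 : SccState.ofMem (sccEdge.exec M) = { SccState.ofMem M with p := p } := by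
      simp [SccState.ofMem, sccEdge, Prog.exec, Expr.eval, Test.Holds, hp, ← he', hd, h0]
    rw [e1]
    refine ⟨hpop.excuse ?_, hpot⟩
    rintro _ u v h rfl
    exact absurd h.2.2 (by omega)
  obtain ⟨v, hv⟩ : ∃ v, G.dst e = v + 1 := ⟨G.dst e - 1, by omega⟩
  have hedge : G.IsEdge e (e / 3) v := ⟨he, rfl, hv⟩
  have hvn := hedge.lt_right hG
  by_cases h1 : M.word aPos v = 0
  · have e1 : SccState.ofMem (sccEdge.exec M) = ({ SccState.ofMem M with p := p } : SccState).visit v := by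
      have := hM.tri _ hvn
      simp [SccState.ofMem, SccState.visit, sccEdge, sccVisit, block, push, Prog.exec, Expr.eval, Test.Holds, hp,
        ← he', hd, hv, h1, this]
    rw [e1]
    refine ⟨hpop.visit hvn h1 (fun i hi => ?_) ?_, ?_⟩
    · obtain ⟨j, hj, hj', hj''⟩ := hs.pos_index hedge.lt_left hu1 hu0
      have : G.Conn ((SccState.ofMem M).S i) ((SccState.ofMem M).S j) := by
        refine hs.conn_top hk ?_ hj hi
        change M.word aPos (e / 3) = j + 1 at hj''
        change M.word aB k ≤ j
        omega
      rw [hj'] at this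
      exact this.trans hedge.conn
    · rintro _ u w h rfl
      refine ⟨?_, ?_⟩
      · have := h.2.2; omega
      · rw [← h.2.1]; exact hu1
    · have := SccState.potential_visit (s := { SccState.ofMem M with p := p }) hvn h1
      omega
  -- A merge leaves the edge pending, since more than one boundary may have to be removed; here the
  -- number of boundaries pays.
  by_cases h2 : M.word aComp v = 0 ∧ ¬ M.word aB k < M.word aPos v
  · have e1 : SccState.ofMem (sccEdge.exec M) = { SccState.ofMem M with k := k } := by
      simp [SccState.ofMem, sccEdge, Prog.exec, Expr.eval, Test.Holds, hp, ← he', hd, hv, h1, hB, hk,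
        h2.1, h2.2]
    rw [e1]
    refine ⟨hs.merge hk hedge hvn hpos hu1 h2.1 h1 (not_lt.1 h2.2), ?_⟩
    simp only [SccState.potential, SccState.ofMem]; omega
  · have e1 : SccState.ofMem (sccEdge.exec M) = { SccState.ofMem M with p := p } := by
      have h2' : ¬ (M.word aComp v = 0 ∧ M.word aPos v ≤ M.word aB k) := by simpa using h2
      simp [SccState.ofMem, sccEdge, Prog.exec, Expr.eval, Test.Holds, hp, ← he', hd, hv, h1, hB, h2', hk]
    rw [e1]
    refine ⟨hpop.excuse ?_, hpot⟩
    rintro _ u w h rfl _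
    have hwv : w = v := by have := h.2.2; omega
    subst hwv
    refine ⟨h1, ?_⟩
    by_cases h3 : M.word aComp w = 0
    · right
      rw [← h.2.1]
      refine ⟨hu1, fun b hb => ?_⟩
      have h4 : M.word aB k < M.word aPos w := by tauto
      have h5 : M.word aB b ≤ M.word aB k := by
        rcases (Nat.lt_succ_iff.1 (hk ▸ hb : b < k + 1)).lt_or_eq with hb | rfl
        · exact (hs.bound_strictMono b k hb (by simp only [SccState.ofMem]; omega)).le
        · exact le_rfl
      change ¬ (M.word aPos w ≤ M.word aB b ∧ _)
      omega
    · exact Or.inl h3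

/-- Finishing takes time proportional to the size of the segment, and the potential releases one
unit for each of its vertices and one for the boundary. -/
theorem sccFinish_rule {G : FlatGraph} (hG : G.Valid) {M : Mem}
    (hs : SccInv G (fun _ => False) (SccState.ofMem M)) {k : ℕ} (hk : M.word rK 0 = k + 1)
    (hB : M.word rB 0 = M.word aB k)
    (hp : ∀ a < M.word rP 0, M.word aPos (M.word aStk a / 3) ≤ M.word aB k) :
    Ensures κ sccFinish M (5 * (M.word rH 0 - M.word aB k) + 3) fun M' =>
      SccInv G (fun _ => False) (SccState.ofMem M') ∧
      (SccState.ofMem M').potential G.n + 1 + (M.word rH 0 - M.word aB k) =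
        (SccState.ofMem M).potential G.n := by
  have hBh : M.word aB k < M.word rH 0 := hs.bound_lt k (by simp only [SccState.ofMem]; omega)
  refine (Ensures.set_seq (T := 5 * (M.word rH 0 - M.word aB k) + 2) ?_).mono (by omega) fun _ h => h
  obtain ⟨M₁, hM₁⟩ : ∃ M₁, M₁ = M.setWord rId ((Expr.lit 0).eval M) ((Expr.succ (reg rId)).eval M) := ⟨_, rfl⟩
  rw [← hM₁]
  have hH : M₁.word rH 0 = M.word rH 0 := by simp [hM₁]
  have hloop := Ensures.while_exec (κ := κ) (t := .lt (reg rB) (reg rH)) (P := sccPopBody) (M₀ := M₁)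
    (Or.inl rfl) rfl (Or.inl rfl)
    (fun M' => M.word aB k ≤ M'.word rH 0 ∧ M'.word rH 0 ≤ M.word rH 0 ∧
      M'.word rCnt 0 + M'.word rH 0 = M.word rCnt 0 + M.word rH 0 ∧
      (∀ i, M'.word rH 0 ≤ i → i < M.word rH 0 → M'.word aComp (M.word aS i) = M.word rId 0 + 1) ∧
      (∀ v, (∀ i, M'.word rH 0 ≤ i → i < M.word rH 0 → M.word aS i ≠ v) →
        M'.word aComp v = M.word aComp v) ∧
      (∀ i < M.word rCnt 0, M'.word aOrd i = M.word aOrd i) ∧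
      (∀ i < M.word rH 0 - M'.word rH 0,
        M'.word aOrd (M.word rCnt 0 + i) = M.word aS (M.word rH 0 - 1 - i)))
      (fun M' => M'.word rH 0 - M.word aB k) ?_ ?_
  · refine (Ensures.then (T₂ := 1) hloop ?_).mono ?_ fun _ h => h
    · rintro M₂ ⟨⟨h1, h2, h3, h4, h5, h6, h7⟩, h8⟩ hfr -
      have hrB : M₂.word rB 0 = M.word aB k := by
        rw [hfr _ (by decide), hM₁]; simp [hB]
      have hB2 : M₂.word rH 0 = M.word aB k := by
        simp only [Test.Holds, Expr.eval] at h8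
        omega
      have hk2 : M₂.word rK 0 = k + 1 := by
        rw [hfr _ (by decide), hM₁]; simp [hk]
      rw [hB2] at h3 h4 h5 h7
      refine Ensures.exec rfl (Or.inl rfl) ?_
      have e1 : SccState.ofMem ((Prog.set rK (.lit 0) (.pred (reg rK))).exec M₂) =
          { SccState.ofMem M with
            comp := M₂.word aComp, ord := M₂.word aOrd, h := M.word aB k, k := k,
            id := M.word rId 0 + 1, cnt := M.word rCnt 0 + (M.word rH 0 - M.word aB k) } := by
        have f1 := hfr aS (by decide)
        have f2 := hfr aB (by decide)
        have f3 := hfr aStk (by decide)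
        have f4 := hfr aPos (by decide)
        have f5 := hfr rP (by decide)
        have f6 := hfr rId (by decide)
        have f7 := hfr rR (by decide)
        have f8 : M₂.word rCnt 0 = M.word rCnt 0 + (M.word rH 0 - M.word aB k) := by omega
        simp [SccState.ofMem, Prog.exec, Expr.eval, f1, f2, f3, f4, f5, f6, f7, f8, hk2, hB2, hM₁]
      rw [e1]
      refine ⟨hs.finish hG hk hp h4 h5 h6 h7, ?_⟩
      simp only [SccState.potential, SccState.ofMem]
      omega
    · have : sccPopBody.size + (Test.lt (reg rB) (reg rH)).size = 5 := rfl
      rw [this, hH]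
      have : (Test.lt (reg rB) (reg rH)).size = 1 := rfl
      omega
  · refine ⟨by omega, by omega, by simp [hM₁], fun i h1 h2 => by omega, fun v _ => by simp [hM₁],
      fun i _ => by simp [hM₁], fun i hi => by omega⟩
  · rintro M₂ ⟨h1, h2, h3, h4, h5, h6, h7⟩ h8 hfr -
    have hrB : M₂.word rB 0 = M.word aB k := by
      rw [hfr _ (by decide), hM₁]; simp [hB]
    have hId : M₂.word rId 0 = M.word rId 0 + 1 := by
      rw [hfr _ (by decide), hM₁]; simp [Expr.eval]
    have hS : M₂.word aS = M.word aS := by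
      rw [hfr _ (by decide), hM₁]; simp
    simp only [Test.Holds, Expr.eval] at h8
    obtain ⟨x, hx⟩ : ∃ x, M₂.word rH 0 = x + 1 := ⟨M₂.word rH 0 - 1, by omega⟩
    have e1 : (sccPopBody.exec M₂).word rH 0 = x := by
      simp [sccPopBody, block, Prog.exec, Expr.eval, hx]
    have e2 : (sccPopBody.exec M₂).word rCnt 0 = M₂.word rCnt 0 + 1 := by
      simp [sccPopBody, block, Prog.exec, Expr.eval]
    have e3 : (sccPopBody.exec M₂).word aComp =
        Function.update (M₂.word aComp) (M.word aS x) (M.word rId 0 + 1) := by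
      simp [sccPopBody, block, Prog.exec, Expr.eval, hx, hS, hId]
    have e4 : (sccPopBody.exec M₂).word aOrd =
        Function.update (M₂.word aOrd) (M₂.word rCnt 0) (M.word aS x) := by
      simp [sccPopBody, block, Prog.exec, Expr.eval, hx, hS]
    rw [e1, e2, e3, e4]
    rw [hx] at h2 h3 h4 h5 h7
    refine ⟨⟨by omega, by omega, by omega, ?_, ?_, ?_, ?_⟩, by omega⟩
    · intro i hi hi'
      by_cases hix : M.word aS i = M.word aS x
      · rw [hix]; simp
      · rw [Function.update_of_ne hix]
        refine h4 i ?_ hi'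
        have : i ≠ x := fun h => hix (by rw [h])
        omega
    · intro v hv
      rw [Function.update_of_ne (hv x le_rfl (by omega)).symm]
      exact h5 v fun i hi hi' => hv i (by omega) hi'
    · intro i hi
      rw [Function.update_of_ne (by omega), h6 i hi]
    · intro i hi
      by_cases hix : i + 1 = M.word rH 0 - x
      · rw [show M.word rCnt 0 + i = M₂.word rCnt 0 by omega, Function.update_self]
        congr 1; omega
      · rw [Function.update_of_ne (by omega)]
        exact h7 i (by omega)

/-- The factor 100 converts units of potential into time. It generously covers the constant work of
each kind of step. -/
theorem sccBody_rule {G : FlatGraph} (hG : G.Valid) {M : Mem} (hM : Holds G M)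
    (hs : SccInv G (fun _ => False) (SccState.ofMem M))
    (ht : ¬ (M.word rH 0 = 0 ∧ M.word rR 0 = G.n)) :
    ∃ T, Ensures κ sccBody M T fun M' => SccInv G (fun _ => False) (SccState.ofMem M') ∧
      100 * (SccState.ofMem M').potential G.n + T + 4 ≤ 100 * (SccState.ofMem M).potential G.n := by
  by_cases hh : M.word rH 0 = 0
  · have hr : M.word rR 0 < G.n := by
      have := hs.root_le
      change M.word rR 0 ≤ G.n at this
      omega
    have htest : (Test.eq (reg rH) (.lit 0)).Holds M := hh
    refine ⟨21, (Ensures.ite_pos (T := 20) (Or.inl rfl) htest ((sccRoot_rule hM hs hh hr).mono le_rfl ?_)).mono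
      (by simp [Test.size]) fun _ h => h⟩
    rintro M' ⟨h1, h2⟩
    exact ⟨h1, by omega⟩
  have htest : ¬ (Test.eq (reg rH) (.lit 0)).Holds M := hh
  have hk0 := (hs.bound_zero (Nat.pos_of_ne_zero hh)).1
  obtain ⟨k, hk⟩ : ∃ k, M.word rK 0 = k + 1 := ⟨M.word rK 0 - 1, by
    change 0 < M.word rK 0 at hk0; omega⟩
  obtain ⟨M₁, hM₁⟩ : ∃ M₁, M₁ = M.setWord rB ((Expr.lit 0).eval M)
    ((Expr.get aB (.pred (reg rK))).eval M) := ⟨_, rfl⟩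
  have hst : SccState.ofMem M₁ = SccState.ofMem M := by simp [SccState.ofMem, hM₁]
  have hB : M₁.word rB 0 = M₁.word aB k := by simp [hM₁, Expr.eval, hk]
  have hk₁ : M₁.word rK 0 = k + 1 := by simp [hM₁, hk]
  have hH : Holds G M₁ := hM.congr (by simp [hM₁])
  rw [← hst] at hs ⊢
  have hP := hs.pending
  by_cases hc : 0 < M₁.word rP 0 ∧ M₁.word aB k < M₁.word aPos (M₁.word aStk (M₁.word rP 0 - 1) / 3)
  · obtain ⟨p, hp⟩ : ∃ p, M₁.word rP 0 = p + 1 := ⟨M₁.word rP 0 - 1, by omega⟩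
    have hsrc := hH.src (M₁.word aStk p) (hP p (by simp only [SccState.ofMem]; omega)).1
    rw [hp, Nat.add_sub_cancel] at hc
    refine ⟨40, (Ensures.ite_neg (T := 34) (Or.inl rfl) htest (Ensures.set_seq (T := 33) ?_)).mono
      (by simp [Test.size]) fun _ h => h⟩
    rw [← hM₁]
    refine Ensures.mono (T₁ := 3 + 30) (Ensures.ite_pos (Or.inl rfl) ?_
      ((sccEdge_rule hG hH hs hk₁ hB hp hc.2).mono le_rfl ?_)) le_rfl fun _ h => h
    · simp only [Test.Holds, Expr.eval, hp, Nat.add_sub_cancel, hsrc, hB]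
      exact hc
    · rintro M' ⟨h1, h2⟩
      exact ⟨h1, by omega⟩
  · refine ⟨5 * (M₁.word rH 0 - M₁.word aB k) + 10, (Ensures.ite_neg
      (T := 1 + (5 * (M₁.word rH 0 - M₁.word aB k) + 6)) (Or.inl rfl) htest
      (Ensures.set_seq (T := 5 * (M₁.word rH 0 - M₁.word aB k) + 6) ?_)).mono
      (by simp only [Test.size]; omega) fun _ h => h⟩
    rw [← hM₁]
    refine Ensures.mono (T₁ := 3 + (5 * (M₁.word rH 0 - M₁.word aB k) + 3)) (Ensures.ite_neg (Or.inl rfl) ?_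
      ((sccFinish_rule hG hs hk₁ hB ?_).mono le_rfl ?_)) (by omega) fun _ h => h
    · intro hc'
      simp only [Test.Holds, Expr.eval, hB] at hc'
      obtain ⟨h1, h2⟩ := hc'
      have h3 : M₁.word aStk (M₁.word rP 0 - 1) < 3 * G.n := (hP (M₁.word rP 0 - 1) (by simp only [SccState.ofMem]; omega)).1
      rw [hH.src _ h3] at h2
      exact hc ⟨h1, h2⟩
    -- Pending edges are sorted by the position of their source, so looking at the top one decides
    -- whether any of them starts in the top segment.
    · intro a ha
      by_contra hlt
      have := hs.sorted a (M₁.word rP 0 - 1) (by omega) (by simp only [SccState.ofMem]; omega)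
      simp only [SccState.ofMem] at this
      exact hc ⟨by omega, by omega⟩
    · rintro M' ⟨h1, h2⟩
      exact ⟨h1, by omega⟩

end RAM

/-! ### Condensations, and correctness of the computed components. -/

namespace FlatGraph

/-- The components of `G` are numbered such that edges do not lead to larger numbers, and `ord` lists
the vertices by increasing component. -/
structure IsCondensation (G : FlatGraph) (comp ord : ℕ → ℕ) : Prop where
  comp_iff : ∀ u v, u < G.n → v < G.n → (comp u = comp v ↔ G.Conn u v ∧ G.Conn v u)
  edge_le : ∀ e u v, G.IsEdge e u v → comp v ≤ comp u
  ord_lt : ∀ i < G.n, ord i < G.n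
  ord_surj : ∀ v < G.n, ∃ i < G.n, ord i = v
  ord_mono : ∀ i j, i ≤ j → j < G.n → comp (ord i) ≤ comp (ord j)

end FlatGraph

namespace RAM

variable {κ : ℚ → ℕ}

/-- Component 0 means unfinished. At the end every vertex has been visited and the stack is empty,
so every vertex is finished. -/
theorem SccInv.isCondensation {G : FlatGraph} {s : SccState}
    (hs : SccInv G (fun _ => False) s) (hh : s.h = 0) (hr : s.r = G.n) :
    G.IsCondensation s.comp s.ord := by
  have hdone : ∀ v < G.n, s.comp v ≠ 0 := by
    intro v hv h0
    have := (hs.active v hv h0 (hs.root v (by omega))).1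
    have := hs.root v (by omega)
    omega
  -- The list of finished vertices is injective and covers all vertices.
  have hcnt : s.cnt = G.n := by
    have : (Finset.range s.cnt).image s.ord = Finset.range G.n := by
      ext v
      simp only [Finset.mem_image, Finset.mem_range]
      constructor
      · rintro ⟨i, hi, rfl⟩; exact (hs.ord_lt i hi).1
      · intro hv; exact hs.ord_surj v hv (hdone v hv)
    have h2 := congrArg Finset.card this
    rw [Finset.card_image_of_injOn, Finset.card_range, Finset.card_range] at h2
    · exact h2
    · intro i hi j hj hij
      simp only [Finset.coe_range, Set.mem_Iio] at hi hj
      exact hs.ord_inj i j hi hj hij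
  have hle : ∀ u v, u < G.n → G.Conn u v → s.comp v ≤ s.comp u := by
    intro u v hu h
    induction h with
    | refl => exact le_rfl
    | tail h1 h2 ih =>
      obtain ⟨e, he, -⟩ := h2
      exact (hs.done e _ _ he (hdone _ he.lt_left)).2.trans ih
  refine ⟨fun u v hu hv => ⟨fun h => ⟨hs.comp_conn u v hu hv (hdone u hu) h,
    hs.comp_conn v u hv hu (hdone v hv) h.symm⟩, fun h => ?_⟩, fun e u v he =>
    (hs.done e u v he (hdone _ he.lt_left)).2, fun i hi => (hs.ord_lt i (by omega)).1, ?_, ?_⟩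
  · exact le_antisymm (hle v u hv h.2) (hle u v hu h.1)
  · intro v hv
    obtain ⟨i, hi, h⟩ := hs.ord_surj v hv (hdone v hv)
    exact ⟨i, by omega, h⟩
  · exact fun i j hij hj => hs.ord_mono i j hij (by omega)

/-- The initial potential is at most n for the roots and 6n for the unvisited vertices. -/
theorem scc_rule {G : FlatGraph} (hG : G.Valid) {M : Mem} (hM : Holds G M) (h1 : M.word aPos = 0)
    (h2 : M.word aComp = 0) (h3 : M.word rH = 0) (h4 : M.word rK = 0) (h5 : M.word rP = 0)
    (h6 : M.word rCnt = 0) (h7 : M.word rR = 0) :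
    Ensures κ scc M (700 * G.n + 4) fun M' => G.IsCondensation (M'.word aComp) (M'.word aOrd) := by
  have := Ensures.while_frame (κ := κ) (t := .not (.and (.eq (reg rH) (.lit 0)) (.eq (reg rR) (reg rN))))
    (P := sccBody) (M₀ := M) (Or.inl rfl) (fun M => SccInv G (fun _ => False) (SccState.ofMem M))
    (fun M => 100 * (SccState.ofMem M).potential G.n) (.init h1 h2 (by simp [SccState.ofMem, h3])
      (by simp [SccState.ofMem, h4]) (by simp [SccState.ofMem, h5]) (by simp [SccState.ofMem, h6])
      (by simp [SccState.ofMem, h7])) ?_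
  · refine (this.frame).mono ?_ ?_
    · have hu := unmarked_le G.n (M.word aPos)
      simp only [Test.size, SccState.potential, SccState.ofMem, h3, h4, h5, h7, Pi.zero_apply]
      omega
    · rintro M' ⟨⟨hs, ht⟩, hfr, -⟩
      simp only [Test.Holds, Expr.eval, not_not] at ht
      rw [hfr rN (by decide), hM.n] at ht
      exact hs.isCondensation ht.1 ht.2
  · intro M' hs ht hfr _
    have hH : Holds G M' := hM.congr fun a ha => hfr a (by revert a; decide)
    simp only [Test.Holds, Expr.eval, hH.n] at ht
    exact sccBody_rule hG hH hs ht

end RAM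

/-! ### From the transition table to a graph -/

notation "aZ" => (24 : ℕ)
notation "aZ'" => (25 : ℕ)

namespace DiPA

variable {n m : ℕ} (A : DiPA (Fin n) (Fin m))

/-- The edge `e` does not sample from a distribution with parameter `0`, where `Z` and `Z'` are the
sets of states with positive `d` and `d'`. -/
def FlatAlive (Z Z' : ℕ → Prop) (e : ℕ) : Prop :=
  (e % 3 = 0 ∧ A.encodeWord (3 * (e % 3) + 4) (e / 3) = 0 ∧
    A.encodeWord (3 * (e % 3) + 3) (e / 3) ≠ 0 ∨ Z (e / 3)) ∧
  (A.encodeWord (3 * (e % 3) + 3) (e / 3) = 1 → Z' (e / 3))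

open Classical in
/-- The graph of an automaton without the edges that are not alive. -/
noncomputable def flat (Z Z' : ℕ → Prop) : FlatGraph where
  n := n
  init := A.init
  dst e := if A.FlatAlive Z Z' e then A.encodeWord (3 * (e % 3) + 2) (e / 3) else 0
  gd e := e % 3
  out e := A.encodeWord (3 * (e % 3) + 3) (e / 3)
  asg e := A.encodeWord (3 * (e % 3) + 4) (e / 3)
  inp v := A.encodeWord 1 v

end DiPA

namespace RAM

variable {κ : ℚ → ℕ} {n m : ℕ}

/-- The edge with guard `c` of the vertex in `rI` is alive. -/
def aliveTest (c : ℕ) : Test :=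
  .and
    (.not (.and
      (.not (.and (.eq (.lit c) (.lit 0)) (.and (.eq (.get (3 * c + 4) (reg rI)) (.lit 0))
        (.not (.eq (.get (3 * c + 3) (reg rI)) (.lit 0))))))
      (.not (.eq (.get aZ (reg rI)) (.lit 1)))))
    (.not (.and (.eq (.get (3 * c + 3) (reg rI)) (.lit 1)) (.not (.eq (.get aZ' (reg rI)) (.lit 1)))))

/-- Write the edge with guard `c` of the vertex in `rI`. -/
def flattenEdge (c : ℕ) : Prog :=
  block [.ite (aliveTest c) (.set aDst (reg rX) (.get (3 * c + 2) (reg rI))) (.set aDst (reg rX) (.lit 0)),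
    .set aSrc (reg rX) (reg rI), .set aGd (reg rX) (.lit c),
    .set aOut (reg rX) (.get (3 * c + 3) (reg rI)), .set aAsg (reg rX) (.get (3 * c + 4) (reg rI)),
    .set rX (.lit 0) (.succ (reg rX))]

/-- Write the edges of the graph of an automaton. -/
def flatten : Prog :=
  .seq (forLoop rI rN (.seq (.set aTri (reg rI) (reg rX))
    (.seq (flattenEdge 0) (.seq (flattenEdge 1) (flattenEdge 2)))))
    (.set rE (.lit 0) (reg rX))

/-- The first `x` edges of `G` have been written. -/
def FlattenInv (G : FlatGraph) (x : ℕ) (M : Mem) : Prop :=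
  M.word rX 0 = x ∧ ∀ e < x, M.word aSrc e = e / 3 ∧ M.word aDst e = G.dst e ∧
    M.word aGd e = G.gd e ∧ M.word aOut e = G.out e ∧ M.word aAsg e = G.asg e

open Classical in
theorem flattenEdge_rule {A : DiPA (Fin n) (Fin m)} {M : Mem} {c v : ℕ} (hc : c < 3)
    (hM : ∀ a ≤ 10, M.word a = A.encodeWord a) (hv : M.word rI 0 = v)
    {Z Z' : ℕ → Prop} (hZ : M.word aZ v = 1 ↔ Z v) (hZ' : M.word aZ' v = 1 ↔ Z' v)
    (h : FlattenInv (A.flat Z Z') (3 * v + c) M) :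
    Ensures κ (flattenEdge c) M 30 (FlattenInv (A.flat Z Z') (3 * v + c + 1)) := by
  obtain ⟨hx, h⟩ := h
  have h4 := hM (3 * c + 4) (by omega)
  have h3 := hM (3 * c + 3) (by omega)
  have h2 := hM (3 * c + 2) (by omega)
  have hm : (3 * v + c) % 3 = c := by omega
  have hd : (3 * v + c) / 3 = v := by omega
  have hal : (aliveTest c).Holds M ↔ A.FlatAlive Z Z' (3 * v + c) := by
    simp only [DiPA.FlatAlive, hm, hd, aliveTest, Test.Holds, Expr.eval, hv, h3, h4, hZ, hZ']
    tauto
  have hdst : (A.flat Z Z').dst (3 * v + c) = if (aliveTest c).Holds M then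
      A.encodeWord (3 * c + 2) v else 0 := by
    simp only [DiPA.flat, hal, hm, hd]
  have hgd : (A.flat Z Z').gd (3 * v + c) = c := hm
  have hout : (A.flat Z Z').out (3 * v + c) = A.encodeWord (3 * c + 3) v := by simp only [DiPA.flat, hm, hd]
  have hasg : (A.flat Z Z').asg (3 * v + c) = A.encodeWord (3 * c + 4) v := by simp only [DiPA.flat, hm, hd]
  refine (Ensures.exec (by rfl) (Or.inl (by rfl)) ?_).mono
    (by simp [flattenEdge, block, Prog.size, aliveTest, Test.size]) fun _ h => h
  have key : ((flattenEdge c).exec M).word rX 0 = 3 * v + c + 1 ∧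
      ((flattenEdge c).exec M).word aSrc = Function.update (M.word aSrc) (3 * v + c) v ∧
      ((flattenEdge c).exec M).word aDst =
        Function.update (M.word aDst) (3 * v + c) ((A.flat Z Z').dst (3 * v + c)) ∧
      ((flattenEdge c).exec M).word aGd = Function.update (M.word aGd) (3 * v + c) c ∧
      ((flattenEdge c).exec M).word aOut =
        Function.update (M.word aOut) (3 * v + c) (A.encodeWord (3 * c + 3) v) ∧
      ((flattenEdge c).exec M).word aAsg =
        Function.update (M.word aAsg) (3 * v + c) (A.encodeWord (3 * c + 4) v) := by
    rw [hdst]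
    clear hdst hout hasg hgd hal h hm hd
    by_cases ht : (aliveTest c).Holds M <;> interval_cases c <;>
      simp [flattenEdge, block, Prog.exec, ht, Expr.eval, hv, hx, h2, h3, h4] at *
  obtain ⟨k1, k2, k3, k4, k5, k6⟩ := key
  refine ⟨k1, fun e he => ?_⟩
  rw [k2, k3, k4, k5, k6]
  rcases Nat.lt_succ_iff_lt_or_eq.1 he with he | rfl
  · simp only [Function.update_of_ne he.ne]
    exact h e he
  · simp only [Function.update_self, hd, hgd, hout, hasg, and_self]

/-- The register `rX` counts edges; it equals 3v when vertex v is reached. This fills `aTri` without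
multiplication. -/
theorem flatten_rule {A : DiPA (Fin n) (Fin m)} {M : Mem}
    (hM : ∀ a ≤ 10, M.word a = A.encodeWord a) (hN : M.word rN 0 = n) (hX : M.word rX 0 = 0)
    {Z Z' : ℕ → Prop} (hZ : ∀ v < n, M.word aZ v = 1 ↔ Z v) (hZ' : ∀ v < n, M.word aZ' v = 1 ↔ Z' v) :
    Ensures κ flatten M (200 * (n + 1)) (Holds (A.flat Z Z')) := by
  have := forLoop_const_rule (κ := κ) (i := rI) (N := rN) (M₀ := M)
    (P := (.seq (.set aTri (reg rI) (reg rX))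
      (.seq (flattenEdge 0) (.seq (flattenEdge 1) (flattenEdge 2)))))
    (by decide) (by decide) (by decide)
    (fun k M => FlattenInv (A.flat Z Z') (3 * k) M ∧ ∀ v < k, M.word aTri v = 3 * v) 100
    (by simp [FlattenInv, hX]) ?_
  · rw [hN] at this
    refine (Ensures.then (T₂ := 1) this ?_).mono (by omega) fun _ h => h
    rintro M₁ ⟨⟨h1, h2⟩, h3⟩ hfr -
    refine Ensures.exec rfl (Or.inl rfl) ?_
    have hc : ∀ a, a ≠ rE → ((Prog.set rE (.lit 0) (reg rX)).exec M₁).word a = M₁.word a := by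
      intro a ha; simp [Prog.exec, ha]
    have hn : (A.flat Z Z').n = n := rfl
    refine ⟨?_, ?_, ?_, ?_, ?_, ?_, ?_, ?_, ?_, ?_⟩
    · rw [hc _ (by decide), hfr _ (by decide), hN]; rfl
    · simp [Prog.exec, Expr.eval, h1, hn]
    · rw [hc _ (by decide)]; exact fun e he => (h2 e he).1
    · rw [hc _ (by decide)]; exact fun e he => (h2 e he).2.1
    · rw [hc _ (by decide)]; exact fun e he => (h2 e he).2.2.1
    · rw [hc _ (by decide)]; exact fun e he => (h2 e he).2.2.2.1
    · rw [hc _ (by decide)]; exact fun e he => (h2 e he).2.2.2.2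
    · rw [hc _ (by decide)]; exact h3
    · rw [hc _ (by decide), hfr _ (by decide), hM _ (by decide)]; exact fun _ _ => rfl
    · rw [hc _ (by decide), hfr _ (by decide), hM _ (by decide)]
      simp [DiPA.encodeWord, DiPA.flat]
  · rintro k M₁ hk hki ⟨h1, h2⟩ hfr -
    rw [hN] at hk
    have hM₁ : ∀ a ≤ 10, M₁.word a = A.encodeWord a := by
      intro a ha
      rw [hfr a (by rintro rfl; omega) (by
        intro h
        have : ∀ b ∈ ((Prog.set aTri (reg rI) (reg rX)).seq
          ((flattenEdge 0).seq ((flattenEdge 1).seq (flattenEdge 2)))).writes, 10 < b := by decide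
        have := this a h; omega), hM a ha]
    have hZ₁ : M₁.word aZ k = 1 ↔ Z k := by rw [hfr _ (by decide) (by decide)]; exact hZ k hk
    have hZ₁' : M₁.word aZ' k = 1 ↔ Z' k := by rw [hfr _ (by decide) (by decide)]; exact hZ' k hk
    have hsmall : ∀ c, ∀ b ∈ (flattenEdge c).writes, 10 < b ∧ b ≠ rI ∧ b ≠ aZ ∧ b ≠ aZ' ∧ b ≠ aTri := by
      intro c b hb
      simp only [flattenEdge, block, Prog.writes, List.mem_append, List.mem_cons,
        List.not_mem_nil, or_false] at hb
      omega
    have step : ∀ c < 3, ∀ M₂ : Mem, (∀ a ≤ 10, M₂.word a = A.encodeWord a) → M₂.word rI 0 = k →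
        (M₂.word aZ k = 1 ↔ Z k) → (M₂.word aZ' k = 1 ↔ Z' k) → (∀ v < k + 1, M₂.word aTri v = 3 * v) →
        FlattenInv (A.flat Z Z') (3 * k + c) M₂ → Ensures κ (flattenEdge c) M₂ 30 fun M₃ =>
          (∀ a ≤ 10, M₃.word a = A.encodeWord a) ∧ M₃.word rI 0 = k ∧ (M₃.word aZ k = 1 ↔ Z k) ∧
            (M₃.word aZ' k = 1 ↔ Z' k) ∧ (∀ v < k + 1, M₃.word aTri v = 3 * v) ∧
            FlattenInv (A.flat Z Z') (3 * k + c + 1) M₃ := by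
      intro c hc M₂ k1 k2 k3 k4 k5 k6
      refine (flattenEdge_rule hc k1 k2 k3 k4 k6).frame.mono le_rfl ?_
      rintro M₃ ⟨m1, m2, -⟩
      have hs := hsmall c
      refine ⟨fun a ha => ?_, ?_, ?_, ?_, ?_, m1⟩
      · rw [m2 a fun h => by have := hs a h; omega, k1 a ha]
      · rw [m2 _ fun h => (hs _ h).2.1 rfl, k2]
      · rw [m2 _ fun h => (hs _ h).2.2.1 rfl, k3]
      · rw [m2 _ fun h => (hs _ h).2.2.2.1 rfl, k4]
      · rw [m2 _ fun h => (hs _ h).2.2.2.2 rfl]; exact k5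
    refine (Ensures.set_seq (T := 30 + (30 + 30)) ?_).mono (by omega) fun _ h => h
    refine Ensures.seq ((step 0 (by omega) _ ?_ ?_ ?_ ?_ ?_ ?_).mono le_rfl ?_)
    · intro a ha
      rw [Mem.word_setWord_of_ne _ _ _ (by omega), hM₁ a ha]
    · simp [hki]
    · simp [hZ₁]
    · simp [hZ₁']
    · intro v hv
      simp only [Expr.eval, Mem.word_setWord_self, hki, h1.1]
      rcases Nat.lt_succ_iff_lt_or_eq.1 hv with hv | rfl
      · rw [Function.update_of_ne hv.ne]; exact h2 v hv
      · simp
    · exact ⟨by simp [h1.1], by simpa using h1.2⟩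
    rintro M₂ ⟨k1, k2, k3, k4, k5, k6⟩
    refine Ensures.seq ((step 1 (by omega) _ k1 k2 k3 k4 k5 k6).mono le_rfl ?_)
    rintro M₃ ⟨k1, k2, k3, k4, k5, k6⟩
    refine (step 2 (by omega) _ k1 k2 k3 k4 k5 k6).mono le_rfl ?_
    rintro M₄ ⟨-, -, -, -, k5, k6⟩
    refine ⟨⟨?_, fun e he => ?_⟩, by simpa using k5⟩
    · have := k6.1
      simp only [ne_eq, Nat.reduceEqDiff, not_false_eq_true, Mem.word_setWord_of_ne]
      omega
    · simpa using k6.2 e (by omega)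

end RAM

/-! ### The encoded transition table and its pruning. -/

namespace DiPA

variable {n m : ℕ} (A : DiPA (Fin n) (Fin m))

theorem encodeWord_dst (p : Fin n) (c : Guard) :
    A.encodeWord (3 * c.code + 2) p = (entryCode (A.δ p c)).1 := by
  cases c <;> simp [encodeWord, Guard.code]

theorem encodeWord_out (p : Fin n) (c : Guard) :
    A.encodeWord (3 * c.code + 3) p = (entryCode (A.δ p c)).2.1 := by
  cases c <;> simp [encodeWord, Guard.code]

theorem encodeWord_asg (p : Fin n) (c : Guard) :
    A.encodeWord (3 * c.code + 4) p = (entryCode (A.δ p c)).2.2 := by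
  cases c <;> simp [encodeWord, Guard.code]

/-- A transition from `p` that does not sample from a distribution with parameter `0`, where `Z` and
`Z'` are the sets of states with positive `d` and `d'`. -/
def EntryAlive (Z Z' : ℕ → Prop) (p : Fin n) (c : Guard) (o : Out (Fin m)) (b : Bool) : Prop :=
  (c = .tt ∧ b = false ∧ o ≠ .svar ∨ Z p) ∧ (o = .svar' → Z' p)

open Classical in
/-- The transition function without the transitions that are not alive. -/
noncomputable def prune (Z Z' : ℕ → Prop) (p : Fin n) (c : Guard) :
    Option (Fin n × Out (Fin m) × Bool) :=
  match A.δ p c with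
  | none => none
  | some (q, o, b) => if EntryAlive Z Z' p c o b then some (q, o, b) else none

variable {A}

theorem prune_eq_some {Z Z' : ℕ → Prop} {p : Fin n} {c : Guard} {q : Fin n} {o : Out (Fin m)}
    {b : Bool} : A.prune Z Z' p c = some (q, o, b) ↔
      A.δ p c = some (q, o, b) ∧ EntryAlive Z Z' p c o b := by
  unfold prune
  cases h : A.δ p c with
  | none => simp
  | some x =>
    obtain ⟨q', o', b'⟩ := x
    simp only [Option.some.injEq, Prod.mk.injEq]
    split_ifs with h'
    · simp only [Option.some.injEq, Prod.mk.injEq]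
      constructor
      · rintro ⟨rfl, rfl, rfl⟩; exact ⟨⟨rfl, rfl, rfl⟩, h'⟩
      · rintro ⟨h, -⟩; exact h
    · simp only [false_iff]
      rintro ⟨⟨rfl, rfl, rfl⟩, h⟩; exact h' h

theorem flatAlive_iff {Z Z' : ℕ → Prop} {p : Fin n} {c : Guard} {q : Fin n} {o : Out (Fin m)}
    {b : Bool} (h : A.δ p c = some (q, o, b)) :
    A.FlatAlive Z Z' (3 * p + c.code) ↔ EntryAlive Z Z' p c o b := by
  have hc := c.code_lt
  have h1 : (3 * (p : ℕ) + c.code) % 3 = c.code := by omega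
  have h2 : (3 * (p : ℕ) + c.code) / 3 = p := by omega
  have h3 : c.code = 0 ↔ c = .tt := by cases c <;> simp [Guard.code]
  simp only [FlatAlive, EntryAlive, h1, h2, encodeWord_out, encodeWord_asg, h, entryCode, h3, ne_eq,
    Out.code_eq_zero, Out.code_eq_one, Bool.toNat_eq_zero]

/-- The automaton A' is arbitrary because a pruned table need not satisfy the axioms by itself. It
will be A without pruning, or A with the transitions of probability zero removed. -/
theorem represents_flat {Z Z' : ℕ → Prop} {A' : DiPA (Fin n) (Fin m)} (h1 : A'.isInput = A.isInput)
    (h2 : A'.init = A.init) (h3 : A'.δ = A.prune Z Z') : (A.flat Z Z').Represents A' where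
  n_eq := rfl
  init_eq := by rw [h2]; rfl
  gd_eq p c := by
    have := c.code_lt
    simp only [flat]; omega
  inp_eq p := by rw [h1]; simp [flat, encodeWord]
  edge p c q o b h := by
    rw [h3, prune_eq_some] at h
    have hc := c.code_lt
    have e1 : (3 * (p : ℕ) + c.code) % 3 = c.code := by omega
    have e2 : (3 * (p : ℕ) + c.code) / 3 = p := by omega
    simp only [flat, flatAlive_iff h.1, h.2, if_true, e1, e2, encodeWord_out, encodeWord_asg,
      encodeWord_dst, h.1, entryCode, and_self]
  no_edge p c h := by
    rw [h3] at h
    have hc := c.code_lt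
    have e1 : (3 * (p : ℕ) + c.code) % 3 = c.code := by omega
    have e2 : (3 * (p : ℕ) + c.code) / 3 = p := by omega
    simp only [flat, e1, e2, encodeWord_dst]
    cases h' : A.δ p c with
    | none => simp [entryCode]
    | some x =>
      obtain ⟨q, o, b⟩ := x
      have : ¬ EntryAlive Z Z' p c o b := fun ha => by
        rw [prune_eq_some.2 ⟨h', ha⟩] at h; simp at h
      rw [flatAlive_iff h', if_neg this]

theorem prune_true : A.prune (fun _ => True) (fun _ => True) = A.δ := by
  funext p c
  unfold prune
  cases h : A.δ p c <;> simp [EntryAlive]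

end DiPA

/-! ### Deciding well-formedness -/

namespace FlatGraph

variable {G : FlatGraph} {comp ord : ℕ → ℕ}

/-- `e` is an edge within a component. -/
def Internal (G : FlatGraph) (comp : ℕ → ℕ) (e : ℕ) : Prop :=
  G.dst e ≠ 0 ∧ comp (e / 3) = comp (G.dst e - 1)

/-- The component `c` has an internal edge with guard `g`. -/
def HasGuard (G : FlatGraph) (comp : ℕ → ℕ) (g c : ℕ) : Prop :=
  ∃ e < 3 * G.n, (G.Internal comp e ∧ G.gd e = g) ∧ comp (e / 3) = c

theorem isEdge_of_dst_ne_zero {e : ℕ} (he : e < 3 * G.n) (hd : G.dst e ≠ 0) :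
    G.IsEdge e (e / 3) (G.dst e - 1) := ⟨he, rfl, by omega⟩

theorem IsEdge.dst_ne_zero {e u v : ℕ} (h : G.IsEdge e u v) : G.dst e ≠ 0 := by
  rw [h.2.2]; omega

theorem IsCondensation.internal_iff (hc : G.IsCondensation comp ord) (hG : G.Valid) {e u v : ℕ}
    (he : G.IsEdge e u v) : G.Internal comp e ↔ G.Conn v u := by
  have hu := he.lt_left
  have hv := he.lt_right hG
  have hd := he.dst_ne_zero
  have h1 := he.conn
  obtain ⟨-, rfl, h2⟩ := he
  rw [Internal, h2, Nat.add_sub_cancel, hc.comp_iff _ _ hu hv]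
  exact ⟨fun h => h.2.2, fun h => ⟨by omega, h1, h⟩⟩

/-- Lying on a G-cycle or L-cycle depends only on the component, so one pass over the edges answers
the question for all vertices. -/
theorem IsCondensation.loop_iff (hc : G.IsCondensation comp ord) (hG : G.Valid) {g q : ℕ}
    (hq : q < G.n) : G.Loop g q ↔ G.HasGuard comp g (comp q) := by
  constructor
  · rintro ⟨e, u, v, he, hg, h1, h2⟩
    have hi := (hc.internal_iff hG he).2 (h2.trans h1)
    refine ⟨e, he.1, ⟨hi, hg⟩, ?_⟩
    rw [he.2.1, hc.comp_iff _ _ he.lt_left hq]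
    exact ⟨he.conn.trans h2, h1⟩
  · rintro ⟨e, he, ⟨hi, hg⟩, hcq⟩
    have hed := isEdge_of_dst_ne_zero he hi.1
    obtain ⟨h1, h2⟩ := (hc.comp_iff _ _ hed.lt_left hq).1 hcq
    exact ⟨e, _, _, hed, hg, h2, ((hc.internal_iff hG hed).1 hi).trans h1⟩

/-- What can be reached by AG-paths (AL-paths) from the vertices in `U`. -/
def ReachFrom (G : FlatGraph) (g : ℕ) (U : ℕ → Prop) (v : ℕ) : Prop :=
  ∃ u < G.n, U u ∧ G.Reach (G.Assigns g) u v

/-- The start of a path that violates the second part of `WellFormedFor`. -/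
def OutHead (G : FlatGraph) (g' u : ℕ) : Prop :=
  ∃ e < 3 * G.n, (G.dst e ≠ 0 ∧ G.Conn G.init (e / 3) ∧ G.out e = 0 ∧ (G.asg e = 1 ∨ G.gd e = g')) ∧
    G.dst e - 1 = u

/-- The negation of `WellFormedFor`. -/
def FailFor (G : FlatGraph) (comp : ℕ → ℕ) (g g' : ℕ) : Prop :=
  (∃ v < G.n, G.ReachFrom g (fun u => G.Conn G.init u ∧ G.HasGuard comp g' (comp u)) v ∧
    G.HasGuard comp g (comp v)) ∨
  (∃ e < 3 * G.n, G.ReachFrom g (fun u => G.Conn G.init u ∧ G.HasGuard comp g' (comp u)) (e / 3) ∧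
    G.dst e ≠ 0 ∧ G.gd e = g ∧ G.out e = 0) ∨
  ∃ v < G.n, G.ReachFrom g (G.OutHead g') v ∧ G.HasGuard comp g (comp v)

/-- In the negation, the quantifier over the start of the path moves into a set of sources, so one
search serves all starting points at once. -/
theorem IsCondensation.wellFormedFor_iff (hc : G.IsCondensation comp ord) (hG : G.Valid) {g g' : ℕ} :
    G.WellFormedFor g g' ↔ ¬ G.FailFor comp g g' := by
  constructor
  · rintro h (⟨v, hv, ⟨u, hu, ⟨h1, h2⟩, h3⟩, h4⟩ | ⟨e, he, ⟨u, hu, ⟨h1, h2⟩, h3⟩, h4, h5, h6⟩ |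
      ⟨v, hv, ⟨u, hu, ⟨e, he, ⟨h1, h2, h3, h4⟩, rfl⟩, h5⟩, h6⟩)
    · exact (h.loop u v h1 ((hc.loop_iff hG hu).2 h2) h3).1 ((hc.loop_iff hG hv).2 h4)
    · exact (h.loop u _ h1 ((hc.loop_iff hG hu).2 h2) h3).2 e _ (isEdge_of_dst_ne_zero he h4) h5 h6
    · exact h.out e _ _ v (isEdge_of_dst_ne_zero he h1) h2 h3 h4 h5 ((hc.loop_iff hG hv).2 h6)
  · intro h
    constructor
    · intro p q h1 h2 h3
      have hp := h1.lt hG hG.1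
      have hq := h3.lt hG hp
      have hR : G.ReachFrom g (fun u => G.Conn G.init u ∧ G.HasGuard comp g' (comp u)) q :=
        ⟨p, hp, ⟨h1, (hc.loop_iff hG hp).1 h2⟩, h3⟩
      refine ⟨fun hl => h (Or.inl ⟨q, hq, hR, (hc.loop_iff hG hq).1 hl⟩), fun e v he hg ho => ?_⟩
      refine h (Or.inr (Or.inl ⟨e, he.1, ?_, he.dst_ne_zero, hg, ho⟩))
      rwa [he.2.1]
    · intro e u v q he h1 h2 h3 h4 hl
      have hv := he.lt_right hG
      have hq := h4.lt hG hv
      have hd := he.dst_ne_zero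
      obtain ⟨he, rfl, hv'⟩ := he
      exact h (Or.inr (Or.inr ⟨q, hq, ⟨v, hv, ⟨e, he, ⟨hd, h1, h2, h3⟩, by omega⟩, h4⟩,
        (hc.loop_iff hG hq).1 hl⟩))

/-- The negation of the first two parts of well-formedness. -/
def FailCycle (G : FlatGraph) (comp : ℕ → ℕ) : Prop :=
  (∃ e < 3 * G.n, G.Internal comp e ∧ G.Conn G.init (e / 3) ∧ G.asg e = 1 ∧
    (G.HasGuard comp 1 (comp (e / 3)) ∨ G.HasGuard comp 2 (comp (e / 3)))) ∨
  ∃ e < 3 * G.n, G.Internal comp e ∧ G.Conn G.init (e / 3) ∧ G.inp (e / 3) = 1 ∧ G.out e < 2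

/-- An assignment leaks iff it is reachable and stays within a component that also contains an edge
with a guard. Since codes of guards are at most 2, guards other than `true` are 1 and 2. -/
theorem IsCondensation.wellFormed_iff (hc : G.IsCondensation comp ord) (hG : G.Valid)
    (hgd : ∀ e < 3 * G.n, G.gd e ≤ 2) :
    G.WellFormed ↔ ¬ (G.FailCycle comp ∨ G.FailFor comp 1 2 ∨ G.FailFor comp 2 1) := by
  constructor
  · rintro h ((⟨e, he, h1, h2, h3, h4⟩ | ⟨e, he, h1, h2, h3, h4⟩) | h' | h')
    · have hed := isEdge_of_dst_ne_zero he h1.1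
      have key : ∀ g, g ≠ 0 → ¬ G.HasGuard comp g (comp (e / 3)) := by
        intro g hg hl
        obtain ⟨e', u', v', he', hg', k1, k2⟩ := (hc.loop_iff hG hed.lt_left).2 hl
        have := h.leaking e _ _ e' u' v' hed he' h2 (((hc.internal_iff hG hed).1 h1).trans k1) k2 h3
        omega
      exact h4.elim (key 1 (by decide)) (key 2 (by decide))
    · have hed := isEdge_of_dst_ne_zero he h1.1
      have := h.disclosing e _ _ hed h2 ((hc.internal_iff hG hed).1 h1) h3
      omega
    · exact (hc.wellFormedFor_iff hG).1 h.ge h'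
    · exact (hc.wellFormedFor_iff hG).1 h.lt h'
  · intro h
    refine ⟨?_, ?_, (hc.wellFormedFor_iff hG).2 fun h' => h (Or.inr (Or.inl h')),
      (hc.wellFormedFor_iff hG).2 fun h' => h (Or.inr (Or.inr h'))⟩
    · intro e u v e' u' v' he he' h1 h2 h3 ha
      by_contra hne
      have hi := (hc.internal_iff hG he).2 ((h2.trans he'.conn).trans h3)
      have hl : G.Loop (G.gd e') u := ⟨e', u', v', he', rfl, he.conn.trans h2, h3⟩
      rw [hc.loop_iff hG he.lt_left] at hl
      have := hgd e' he'.1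
      have h12 : G.gd e' = 1 ∨ G.gd e' = 2 := by omega
      obtain ⟨k1, rfl, -⟩ := he
      refine h (Or.inl (Or.inl ⟨e, k1, hi, h1, ha, ?_⟩))
      rcases h12 with h12 | h12 <;> rw [h12] at hl
      · exact Or.inl hl
      · exact Or.inr hl
    · intro e u v he h1 h2 h3
      by_contra hlt
      have hi := (hc.internal_iff hG he).2 h2
      obtain ⟨k1, rfl, -⟩ := he
      exact h (Or.inl (Or.inr ⟨e, k1, hi, h1, h3, by omega⟩))

end FlatGraph

/-! ### Passes over the graph that decide well-formedness. -/

namespace RAM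

notation "rFail" => (26 : ℕ)
notation "aRe" => (50 : ℕ)
notation "aC1" => (51 : ℕ)
notation "aC2" => (52 : ℕ)

variable {κ : ℚ → ℕ} {G : FlatGraph} {comp : ℕ → ℕ} {M : Mem} {T : ℕ}

/-- The arrays that the passes over a graph may change. -/
def scratch : List ℕ := [rI, aOk, aMk, aStk, rP, rX, rY, rFail, aRe, aC1, aC2]

/-- The memory holds the graph and its components. -/
structure Env (G : FlatGraph) (comp : ℕ → ℕ) (M : Mem) : Prop where
  holds : Holds G M
  comp : M.word aComp = comp

theorem Env.congr {M' : Mem} (h : Env G comp M)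
    (hM : ∀ a, scratch.contains a = false → M'.word a = M.word a) : Env G comp M' :=
  ⟨h.holds.congr fun a ha => hM a (by revert a; decide), by rw [hM _ (by decide), h.comp]⟩

/-- The arrays in `scratch` are disjoint from those that hold the graph and its components, so `Env`
survives every pass; the side conditions on array names are decided by evaluation. -/
theorem Env.fill {N a : ℕ} {t : Test} (E : Env G comp M) (ht : t.wordOnly = true) (C : ℕ → Prop)
    (hN : M.word N 0 ≤ 3 * G.n) (ha : scratch.contains a = true) (hNI : scratch.contains N = false)
    (hai : a ≠ rI)
    (hC : ∀ k M', k < M.word N 0 → M'.word rI 0 = k → Env G comp M' →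
      (∀ b, b ≠ rI → b ≠ a → M'.word b = M.word b) → (t.Holds M' ↔ C k)) :
    ∃ s M', Runs κ (fillLoop rI N a t) M s M' ∧ s ≤ (t.size + 3) * (3 * G.n) + 2 ∧ Env G comp M' ∧
      (∀ k < M.word N 0, M'.word a k = 1 ↔ C k) ∧ (∀ k < M.word N 0, M'.word a k ≤ 1) ∧
      ∀ b, b ≠ rI → b ≠ a → M'.word b = M.word b := by
  have hfr : ∀ M' : Mem, (∀ b, b ≠ rI → b ≠ a → M'.word b = M.word b) → Env G comp M' := by
    intro M' h
    refine E.congr fun b hb => h b ?_ ?_ <;> rintro rfl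
    · simp [scratch] at hb
    · rw [ha] at hb; cases hb
  have hNa : N ≠ a := by rintro rfl; rw [ha] at hNI; cases hNI
  have hNi : N ≠ rI := by rintro rfl; simp [scratch] at hNI
  obtain ⟨s, M', h1, h2, h3, h4, h5, -⟩ := fillLoop_rule (κ := κ) (Or.inl ht) C (M₀ := M) hai.symm hNa hNi
    fun k M' h1 h2 h3 _ => hC k M' h1 h2 (hfr M' h3) h3
  exact ⟨s, M', h1, h2.trans (by gcongr), hfr M' h5, h3, h4, h5⟩

theorem Env.mark {N a : ℕ} {e : Expr} {t : Test} (E : Env G comp M) (ht : t.wordOnly = true)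
    (C : ℕ → Prop) (f : ℕ → ℕ)
    (hN : M.word N 0 ≤ 3 * G.n) (ha : scratch.contains a = true) (hNI : scratch.contains N = false)
    (hai : a ≠ rI)
    (hC : ∀ k M', k < M.word N 0 → M'.word rI 0 = k → Env G comp M' →
      (∀ b, b ≠ rI → b ≠ a → M'.word b = M.word b) → (t.Holds M' ↔ C k) ∧ (C k → e.eval M' = f k)) :
    ∃ s M', Runs κ (markLoop rI N a e t) M s M' ∧ s ≤ (t.size + 3) * (3 * G.n) + 2 ∧ Env G comp M' ∧
      (∀ v, M'.word a v = 1 ↔ M.word a v = 1 ∨ ∃ k < M.word N 0, C k ∧ f k = v) ∧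
      (∀ v, M.word a v ≤ 1 → M'.word a v ≤ 1) ∧
      ∀ b, b ≠ rI → b ≠ a → M'.word b = M.word b := by
  have hfr : ∀ M' : Mem, (∀ b, b ≠ rI → b ≠ a → M'.word b = M.word b) → Env G comp M' := by
    intro M' h
    refine E.congr fun b hb => h b ?_ ?_ <;> rintro rfl
    · simp [scratch] at hb
    · rw [ha] at hb; cases hb
  have hNa : N ≠ a := by rintro rfl; rw [ha] at hNI; cases hNI
  have hNi : N ≠ rI := by rintro rfl; simp [scratch] at hNI
  obtain ⟨s, M', h1, h2, h3, h4, h5, -⟩ := markLoop_rule (κ := κ) (Or.inl ht) C f (M₀ := M) hai.symm hNa hNi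
    fun k M' h1 h2 h3 _ => hC k M' h1 h2 (hfr M' h3) h3
  exact ⟨s, M', h1, h2.trans (by gcongr), hfr M' h5, h3, h4, h5⟩

/-- `if t then rFail := 1` for all `i < N`. -/
theorem Env.fail {N : ℕ} {t : Test} (E : Env G comp M) (ht : t.wordOnly = true) (C : ℕ → Prop)
    (hN : M.word N 0 ≤ 3 * G.n) (hNI : scratch.contains N = false)
    (hC : ∀ k M', k < M.word N 0 → M'.word rI 0 = k → Env G comp M' →
      (∀ b, b ≠ rI → b ≠ rFail → M'.word b = M.word b) → (t.Holds M' ↔ C k)) :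
    ∃ s M', Runs κ (markLoop rI N rFail (.lit 0) t) M s M' ∧ s ≤ (t.size + 3) * (3 * G.n) + 2 ∧
      Env G comp M' ∧
      (M'.word rFail 0 = 1 ↔ M.word rFail 0 = 1 ∨ ∃ k < M.word N 0, C k) ∧
      ∀ b, b ≠ rI → b ≠ rFail → M'.word b = M.word b := by
  obtain ⟨s, M', h1, h2, h3, h4, -, h6⟩ := E.mark (κ := κ) (e := .lit 0) ht C (fun _ => 0) hN rfl hNI
    (by decide) fun k M' h1 h2 h3 h4 => ⟨hC k M' h1 h2 h3 h4, fun _ => rfl⟩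
  exact ⟨s, M', h1, h2, h3, by rw [h4]; simp, h6⟩

theorem Env.search {S : ℕ → Prop} (E : Env G comp M) (hG : G.Valid)
    (h1 : ∀ v < G.n, M.word aMk v ≤ 1)
    (hok : ∀ e < 3 * G.n, M.word aOk e = 1 ↔ G.dst e ≠ 0 ∧ S e) :
    ∃ s M', Runs κ search M s M' ∧ s ≤ 400 * G.n + 10 ∧ Env G comp M' ∧
      (∀ v < G.n, M'.word aMk v = 1 ↔ ∃ u < G.n, M.word aMk u = 1 ∧ G.Reach S u v) ∧
      (∀ v < G.n, M'.word aMk v ≤ 1) ∧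
      ∀ b, b ∉ [rI, rP, rX, rY, aMk, aStk] → M'.word b = M.word b := by
  obtain ⟨s, M', k1, k2, k3, k4⟩ := search_rule (κ := κ) hG E.holds h1 fun e he h => ((hok e he).1 h).1
  have hfr : ∀ b, b ∉ [rI, rP, rX, rY, aMk, aStk] → M'.word b = M.word b := fun b hb =>
    k1.frame.1 b fun h => hb ((by decide : ∀ b ∈ RAM.search.writes, b ∈ [rI, rP, rX, rY, aMk, aStk]) b h)
  refine ⟨s, M', k1, k2, E.congr fun a ha => hfr a fun h => ?_, fun v hv => ?_, k4, hfr⟩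
  · rw [(by decide : ∀ b ∈ [rI, rP, rX, rY, aMk, aStk], scratch.contains b = true) a h] at ha
    cases ha
  · rw [k3 v hv]
    refine exists_congr fun u => and_congr_right fun _ => and_congr_right fun _ => ?_
    constructor
    · refine fun h => Relation.ReflTransGen.mono (fun a b => ?_) _ _ h
      rintro ⟨e, he, hs⟩
      exact ⟨e, he, ((hok e he.1).1 hs).2⟩
    · refine fun h => Relation.ReflTransGen.mono (fun a b => ?_) _ _ h
      rintro ⟨e, he, hs⟩
      exact ⟨e, he, (hok e he.1).2 ⟨he.dst_ne_zero, hs⟩⟩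

/-- The edge `rI` may lie on an AG-path (AL-path). -/
def okTest (g : ℕ) : Test :=
  .and (.not (.eq (.get aDst (reg rI)) (.lit 0)))
    (.not (.and (.eq (.get aAsg (reg rI)) (.lit 1)) (.not (.eq (.get aGd (reg rI)) (.lit g)))))

/-- The vertex `rI` can be reached, and lies in a component marked in `b`. -/
def fromLoopTest (b : ℕ) : Test :=
  .and (.eq (.get aRe (reg rI)) (.lit 1)) (.eq (.get b (.get aComp (reg rI))) (.lit 1))

/-- The vertex `rI` is marked, and lies in a component marked in `a`. -/
def toLoopTest (a : ℕ) : Test :=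
  .and (.eq (.get aMk (reg rI)) (.lit 1)) (.eq (.get a (.get aComp (reg rI))) (.lit 1))

/-- The edge `rI` has guard `g` and outputs `σ`, and starts in a marked vertex. -/
def outTest (g : ℕ) : Test :=
  .and (.eq (.get aMk (.get aSrc (reg rI))) (.lit 1))
    (.and (.not (.eq (.get aDst (reg rI)) (.lit 0)))
      (.and (.eq (.get aGd (reg rI)) (.lit g)) (.eq (.get aOut (reg rI)) (.lit 0))))

/-- The edge `rI` can be reached, outputs `σ`, and is an assignment or has guard `g'`. -/
def outHeadTest (g' : ℕ) : Test :=
  .and (.not (.eq (.get aDst (reg rI)) (.lit 0)))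
    (.and (.eq (.get aRe (.get aSrc (reg rI))) (.lit 1))
      (.and (.eq (.get aOut (reg rI)) (.lit 0))
        (.not (.and (.not (.eq (.get aAsg (reg rI)) (.lit 1)))
          (.not (.eq (.get aGd (reg rI)) (.lit g')))))))

/-- Check `WellFormedFor g g'`, where `a` and `b` mark the components that have internal edges with
guards `g` and `g'`. -/
def checkFor (g g' a b : ℕ) : Prog :=
  .seq (fillLoop rI rE aOk (okTest g)) <|
  .seq (fillLoop rI rN aMk (fromLoopTest b)) <|
  .seq search <|
  .seq (markLoop rI rN rFail (.lit 0) (toLoopTest a)) <|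
  .seq (markLoop rI rE rFail (.lit 0) (outTest g)) <|
  .seq (fillLoop rI rN aMk (.eq (.lit 0) (.lit 1))) <|
  .seq (markLoop rI rE aMk (.pred (.get aDst (reg rI))) (outHeadTest g')) <|
  .seq search (markLoop rI rN rFail (.lit 0) (toLoopTest a))

/-- Two searches along the same edges: one from the reachable states on cycles with guard g', one
from the heads of the critical outputs. After each, the marked vertices are tested for what must not
be reached. -/
theorem checkFor_rule {g g' a b : ℕ} (hG : G.Valid) (E : Env G comp M) (ha : 50 < a) (hb : 50 < b)
    (hre : ∀ v < G.n, M.word aRe v = 1 ↔ G.Conn G.init v)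
    (hca : ∀ v < G.n, M.word a (comp v) = 1 ↔ G.HasGuard comp g (comp v))
    (hcb : ∀ v < G.n, M.word b (comp v) = 1 ↔ G.HasGuard comp g' (comp v)) :
    Ensures κ (checkFor g g' a b) M (2000 * (G.n + 1)) fun M' => Env G comp M' ∧
      (M'.word rFail 0 = 1 ↔ M.word rFail 0 = 1 ∨ G.FailFor comp g g') ∧
      ∀ c, 50 ≤ c → M'.word c = M.word c := by
  have hn := E.holds.n
  have he := E.holds.e
  obtain ⟨s₁, M₁, r₁, b₁, E₁, k₁, -, f₁⟩ := E.fill (κ := κ) (N := rE) (a := aOk) (t := okTest g) rfl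
    (fun e => G.dst e ≠ 0 ∧ G.Assigns g e) he.le rfl rfl (by decide) (by
      intro k M' hk hk' E' _
      rw [he] at hk
      simp only [okTest, Test.Holds, Expr.eval, hk', E'.holds.dst k hk, E'.holds.asg k hk,
        E'.holds.gd k hk, FlatGraph.Assigns]
      tauto)
  rw [he] at k₁
  obtain ⟨s₂, M₂, r₂, b₂, E₂, k₂, l₂, f₂⟩ := E₁.fill (κ := κ) (N := rN) (a := aMk) (t := fromLoopTest b) rfl
    (fun u => G.Conn G.init u ∧ G.HasGuard comp g' (comp u)) (by rw [E₁.holds.n]; omega) rfl rfl (by decide) (by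
      intro k M' hk hk' E' f'
      rw [E₁.holds.n] at hk
      simp only [fromLoopTest, Test.Holds, Expr.eval, hk', E'.comp, f' b (by omega) (by omega),
        f' aRe (by decide) (by decide), f₁ b (by omega) (by omega),
        f₁ aRe (by decide) (by decide), hre k hk, hcb k hk])
  rw [E₁.holds.n] at k₂ l₂
  obtain ⟨s₃, M₃, r₃, b₃, E₃, k₃, l₃, f₃⟩ := E₂.search (κ := κ) (S := G.Assigns g) hG l₂ (by
    intro e he; rw [f₂ aOk (by decide) (by decide)]; exact k₁ e he)
  replace k₃ : ∀ v < G.n, M₃.word aMk v = 1 ↔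
      G.ReachFrom g (fun u => G.Conn G.init u ∧ G.HasGuard comp g' (comp u)) v := by
    intro v hv
    rw [k₃ v hv]
    exact exists_congr fun u => and_congr_right fun hu => by rw [k₂ u hu]
  have hfa : ∀ c, 50 ≤ c → M₃.word c = M.word c := by
    intro c hc
    rw [f₃ c (by simp; omega), f₂ c (by omega) (by omega), f₁ c (by omega) (by omega)]
  have hff : M₃.word rFail = M.word rFail := by
    rw [f₃ _ (by decide), f₂ _ (by decide) (by decide), f₁ _ (by decide) (by decide)]
  obtain ⟨s₄, M₄, r₄, b₄, E₄, k₄, f₄⟩ := E₃.fail (κ := κ) (N := rN) (t := toLoopTest a) rfl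
    (fun v => G.ReachFrom g (fun u => G.Conn G.init u ∧ G.HasGuard comp g' (comp u)) v ∧
      G.HasGuard comp g (comp v)) (by rw [E₃.holds.n]; omega) rfl (by
      intro k M' hk hk' E' f'
      rw [E₃.holds.n] at hk
      simp only [toLoopTest, Test.Holds, Expr.eval, hk', E'.comp, f' a (by omega) (by omega),
        f' aMk (by decide) (by decide), hfa a (by omega), k₃ k hk, hca k hk])
  rw [E₃.holds.n, hff] at k₄
  obtain ⟨s₅, M₅, r₅, b₅, E₅, k₅, f₅⟩ := E₄.fail (κ := κ) (N := rE) (t := outTest g) rfl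
    (fun e => G.ReachFrom g (fun u => G.Conn G.init u ∧ G.HasGuard comp g' (comp u)) (e / 3) ∧
      G.dst e ≠ 0 ∧ G.gd e = g ∧ G.out e = 0) E₄.holds.e.le rfl (by
      intro k M' hk hk' E' f'
      rw [E₄.holds.e] at hk
      simp only [outTest, Test.Holds, Expr.eval, hk', E'.holds.dst k hk, E'.holds.src k hk,
        E'.holds.gd k hk, E'.holds.out k hk, f' aMk (by decide) (by decide),
        f₄ aMk (by decide) (by decide), k₃ (k / 3) (by omega)])
  rw [E₄.holds.e, k₄] at k₅
  -- The marks are cleared for the second search; the allowed edges in `aOk` are reused.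
  obtain ⟨s₆, M₆, r₆, b₆, E₆, k₆, l₆, f₆⟩ := E₅.fill (κ := κ) (N := rN) (a := aMk)
    (t := .eq (.lit 0) (.lit 1)) rfl (fun _ => False) (by rw [E₅.holds.n]; omega) rfl rfl (by decide) (by
      intro k M' _ _ _ _
      simp [Test.Holds, Expr.eval])
  rw [E₅.holds.n] at k₆ l₆
  have hfb : ∀ c, 50 ≤ c → M₆.word c = M.word c := by
    intro c hc
    rw [f₆ c (by omega) (by omega), f₅ c (by omega) (by omega), f₄ c (by omega) (by omega), hfa c hc]
  obtain ⟨s₇, M₇, r₇, b₇, E₇, k₇, l₇, f₇⟩ := E₆.mark (κ := κ) (N := rE) (a := aMk)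
    (e := .pred (.get aDst (reg rI))) (t := outHeadTest g') rfl
    (fun e => G.dst e ≠ 0 ∧ G.Conn G.init (e / 3) ∧ G.out e = 0 ∧ (G.asg e = 1 ∨ G.gd e = g'))
    (fun e => G.dst e - 1) E₆.holds.e.le rfl rfl (by decide) (by
      intro k M' hk hk' E' f'
      rw [E₆.holds.e] at hk
      simp only [outHeadTest, Test.Holds, Expr.eval, hk', E'.holds.dst k hk, E'.holds.src k hk,
        E'.holds.gd k hk, E'.holds.out k hk, E'.holds.asg k hk, f' aRe (by decide) (by decide),
        hfb aRe (by decide), hre (k / 3) (by omega), implies_true, and_true, ne_eq, not_and_or, not_not])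
  rw [E₆.holds.e] at k₇
  obtain ⟨s₈, M₈, r₈, b₈, E₈, k₈, l₈, f₈⟩ := E₇.search (κ := κ) (S := G.Assigns g) hG
    (fun v hv => l₇ v (l₆ v hv)) (by
      intro e he
      rw [f₇ aOk (by decide) (by decide), f₆ aOk (by decide) (by decide), f₅ aOk (by decide) (by decide),
        f₄ aOk (by decide) (by decide), f₃ aOk (by decide), f₂ aOk (by decide) (by decide)]
      exact k₁ e he)
  replace k₈ : ∀ v < G.n, M₈.word aMk v = 1 ↔ G.ReachFrom g (G.OutHead g') v := by
    intro v hv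
    rw [k₈ v hv]
    refine exists_congr fun u => and_congr_right fun hu => and_congr_left fun _ => ?_
    rw [k₇ u, k₆ u hu, false_or]
    rfl
  have hfc : ∀ c, 50 ≤ c → M₈.word c = M.word c := by
    intro c hc
    rw [f₈ c (by simp; omega), f₇ c (by omega) (by omega), hfb c hc]
  obtain ⟨s₉, M₉, r₉, b₉, E₉, k₉, f₉⟩ := E₈.fail (κ := κ) (N := rN) (t := toLoopTest a) rfl
    (fun v => G.ReachFrom g (G.OutHead g') v ∧ G.HasGuard comp g (comp v))
    (by rw [E₈.holds.n]; omega) rfl (by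
      intro k M' hk hk' E' f'
      rw [E₈.holds.n] at hk
      simp only [toLoopTest, Test.Holds, Expr.eval, hk', E'.comp, f' a (by omega) (by omega),
        f' aMk (by decide) (by decide), hfc a (by omega), k₈ k hk, hca k hk])
  rw [E₈.holds.n, f₈ rFail (by decide), f₇ rFail (by decide) (by decide),
    f₆ rFail (by decide) (by decide), k₅] at k₉
  refine ⟨_, M₉, r₁.seq <| r₂.seq <| r₃.seq <| r₄.seq <| r₅.seq <| r₆.seq <| r₇.seq <| r₈.seq r₉,
    ?_, E₉, ?_, fun c hc => ?_⟩
  · have z₁ : (okTest g).size = 8 := rfl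
    have z₂ : (fromLoopTest b).size = 3 := rfl
    have z₃ : (toLoopTest a).size = 3 := rfl
    have z₄ : (outTest g).size = 8 := rfl
    have z₅ : (outHeadTest g').size = 13 := rfl
    have z₆ : (Test.eq (.lit 0) (.lit 1)).size = 1 := rfl
    rw [z₁] at b₁
    rw [z₂] at b₂
    rw [z₃] at b₄ b₉
    rw [z₄] at b₅
    rw [z₆] at b₆
    rw [z₅] at b₇
    clear * - b₁ b₂ b₃ b₄ b₅ b₆ b₇ b₈ b₉
    omega
  · rw [k₉, FlatGraph.FailFor, or_assoc, or_assoc]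
  · rw [f₉ c (by omega) (by omega), hfc c hc]

/-- Mark in `aRe` the vertices that can be reached from the initial vertex. -/
def reachLoop : Prog :=
  .seq (fillLoop rI rE aOk (.not (.eq (.get aDst (reg rI)) (.lit 0)))) <|
  .seq (fillLoop rI rN aMk (.eq (reg rI) (.get 0 (.lit 2)))) <|
  .seq search (fillLoop rI rN aRe (.eq (.get aMk (reg rI)) (.lit 1)))

theorem reachLoop_rule (hG : G.Valid) (E : Env G comp M) :
    Ensures κ reachLoop M (500 * (G.n + 1)) fun M' => Env G comp M' ∧
      (∀ v < G.n, M'.word aRe v = 1 ↔ G.Conn G.init v) ∧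
      ∀ c, c ∉ [rI, rP, rX, rY, aMk, aStk, aOk, aRe] → M'.word c = M.word c := by
  have he := E.holds.e
  obtain ⟨s₁, M₁, r₁, b₁, E₁, k₁, -, f₁⟩ := E.fill (κ := κ) (N := rE) (a := aOk)
    (t := .not (.eq (.get aDst (reg rI)) (.lit 0))) rfl (fun e => G.dst e ≠ 0) he.le rfl rfl
    (by decide) (by
      intro k M' hk hk' E' _
      rw [he] at hk
      simp only [Test.Holds, Expr.eval, hk', E'.holds.dst k hk, ne_eq])
  rw [he] at k₁
  obtain ⟨s₂, M₂, r₂, b₂, E₂, k₂, l₂, f₂⟩ := E₁.fill (κ := κ) (N := rN) (a := aMk)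
    (t := .eq (reg rI) (.get 0 (.lit 2))) rfl (fun u => u = G.init) (by rw [E₁.holds.n]; omega) rfl rfl
    (by decide) (by
      intro k M' hk hk' E' f'
      simp only [Test.Holds, Expr.eval, hk', E'.holds.init])
  rw [E₁.holds.n] at k₂ l₂
  obtain ⟨s₃, M₃, r₃, b₃, E₃, k₃, l₃, f₃⟩ := E₂.search (κ := κ) (S := fun _ => True) hG l₂ (by
    intro e he; rw [f₂ aOk (by decide) (by decide), and_true]; exact k₁ e he)
  replace k₃ : ∀ v < G.n, M₃.word aMk v = 1 ↔ G.Conn G.init v := by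
    intro v hv
    rw [k₃ v hv]
    constructor
    · rintro ⟨u, hu, h1, h2⟩
      rw [(k₂ u hu).1 h1] at h2; exact h2
    · exact fun h => ⟨_, hG.1, (k₂ _ hG.1).2 rfl, h⟩
  obtain ⟨s₄, M₄, r₄, b₄, E₄, k₄, -, f₄⟩ := E₃.fill (κ := κ) (N := rN) (a := aRe)
    (t := .eq (.get aMk (reg rI)) (.lit 1)) rfl (fun v => G.Conn G.init v) (by rw [E₃.holds.n]; omega)
    rfl rfl (by decide) (by
      intro k M' hk hk' E' f'
      rw [E₃.holds.n] at hk
      simp only [Test.Holds, Expr.eval, hk', f' aMk (by decide) (by decide), k₃ k hk])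
  rw [E₃.holds.n] at k₄
  refine ⟨_, M₄, r₁.seq <| r₂.seq <| r₃.seq r₄, ?_, E₄, k₄, fun c hc => ?_⟩
  · simp only [Test.size] at b₁ b₂ b₄
    omega
  · simp only [List.mem_cons, List.not_mem_nil, or_false, not_or] at hc
    rw [f₄ c (by omega) (by omega), f₃ c (by simp; omega), f₂ c (by omega) (by omega),
      f₁ c (by omega) (by omega)]

/-- The edge `rI` is within a component. -/
def internalTest : Test :=
  .and (.not (.eq (.get aDst (reg rI)) (.lit 0)))
    (.eq (.get aComp (.get aSrc (reg rI))) (.get aComp (.pred (.get aDst (reg rI)))))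

theorem internalTest_holds {M' : Mem} (E : Env G comp M') {k : ℕ} (hk : k < 3 * G.n)
    (hI : M'.word rI 0 = k) : internalTest.Holds M' ↔ G.Internal comp k := by
  simp only [internalTest, Test.Holds, Expr.eval, hI, E.comp, E.holds.src k hk, E.holds.dst k hk,
    FlatGraph.Internal, ne_eq]

/-- Mark in `a` the components with an internal edge with guard `g`. -/
def guardLoop (g a : ℕ) : Prog :=
  markLoop rI rE a (.get aComp (.get aSrc (reg rI)))
    (.and internalTest (.eq (.get aGd (reg rI)) (.lit g)))

theorem guardLoop_rule {g a : ℕ} (E : Env G comp M) (h : scratch.contains a = true) (ha : a ≠ rI)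
    (h0 : M.word a = 0) :
    Ensures κ (guardLoop g a) M (50 * (G.n + 1)) fun M' => Env G comp M' ∧
      (∀ c, M'.word a c = 1 ↔ G.HasGuard comp g c) ∧ ∀ b, b ≠ rI → b ≠ a → M'.word b = M.word b := by
  obtain ⟨s, M', h1, h2, h3, h4, -, h5⟩ := E.mark (κ := κ) (N := rE) (a := a)
    (e := .get aComp (.get aSrc (reg rI))) (t := .and internalTest (.eq (.get aGd (reg rI)) (.lit g)))
    rfl (fun e => G.Internal comp e ∧ G.gd e = g) (fun e => comp (e / 3)) E.holds.e.le h rfl ha (by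
      intro k M' hk hk' E' _
      rw [E.holds.e] at hk
      refine ⟨and_congr (internalTest_holds E' hk hk') ?_, fun _ => ?_⟩
      · simp only [Test.Holds, Expr.eval, hk', E'.holds.gd k hk]
      · simp only [Expr.eval, hk', E'.comp, E'.holds.src k hk])
  refine ⟨s, M', h1, ?_, h3, fun c => ?_, h5⟩
  · simp only [internalTest, Test.size] at h2
    omega
  · rw [h4, h0, E.holds.e]
    simp [FlatGraph.HasGuard]

/-- The edge `rI` is an assignment on a reachable cycle with guards. -/
def leakTest : Test :=
  .and internalTest (.and (.eq (.get aRe (.get aSrc (reg rI))) (.lit 1))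
    (.and (.eq (.get aAsg (reg rI)) (.lit 1))
      (.not (.and (.not (.eq (.get aC1 (.get aComp (.get aSrc (reg rI)))) (.lit 1)))
        (.not (.eq (.get aC2 (.get aComp (.get aSrc (reg rI)))) (.lit 1)))))))

/-- The edge `rI` is an input edge on a reachable cycle that outputs `σ` or `σ'`. -/
def discloseTest : Test :=
  .and internalTest (.and (.eq (.get aRe (.get aSrc (reg rI))) (.lit 1))
    (.and (.eq (.get aInp (.get aSrc (reg rI))) (.lit 1)) (.lt (.get aOut (reg rI)) (.lit 2))))

/-- Check well-formedness of the graph whose components are known. -/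
def wfCheck : Prog :=
  .seq reachLoop <| .seq (guardLoop 1 aC1) <| .seq (guardLoop 2 aC2) <|
  .seq (markLoop rI rE rFail (.lit 0) leakTest) <|
  .seq (markLoop rI rE rFail (.lit 0) discloseTest) <|
  .seq (checkFor 1 2 aC1 aC2) <| .seq (checkFor 2 1 aC2 aC1) <|
  .ite (.eq (reg rFail) (.lit 1)) (.set 0 (.lit 0) (.lit 0)) (.set 0 (.lit 0) (.lit 1))

/-- No pass resets `rFail`, so its final value is the disjunction of all failures. -/
theorem wfCheck_rule {ord : ℕ → ℕ} (hG : G.Valid) (hgd : ∀ e < 3 * G.n, G.gd e ≤ 2)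
    (hc : G.IsCondensation comp ord) (E : Env G comp M) (h1 : M.word aC1 = 0) (h2 : M.word aC2 = 0)
    (hf : M.word rFail = 0) :
    Ensures κ wfCheck M (5000 * (G.n + 1)) fun M' =>
      M'.word 0 0 ≤ 1 ∧ (M'.word 0 0 = 1 ↔ G.WellFormed) := by
  obtain ⟨s₁, M₁, r₁, b₁, E₁, k₁, f₁⟩ := reachLoop_rule (κ := κ) hG E
  obtain ⟨s₂, M₂, r₂, b₂, E₂, k₂, f₂⟩ := guardLoop_rule (κ := κ) (g := 1) (a := aC1) E₁ rfl (by decide)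
    (by rw [f₁ _ (by decide), h1])
  obtain ⟨s₃, M₃, r₃, b₃, E₃, k₃, f₃⟩ := guardLoop_rule (κ := κ) (g := 2) (a := aC2) E₂ rfl (by decide)
    (by rw [f₂ _ (by decide) (by decide), f₁ _ (by decide), h2])
  have hf₃ : M₃.word rFail = 0 := by
    rw [f₃ _ (by decide) (by decide), f₂ _ (by decide) (by decide), f₁ _ (by decide), hf]
  have hre : ∀ v < G.n, M₃.word aRe v = 1 ↔ G.Conn G.init v := by
    rw [f₃ _ (by decide) (by decide), f₂ _ (by decide) (by decide)]; exact k₁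
  have hc1 : ∀ c, M₃.word aC1 c = 1 ↔ G.HasGuard comp 1 c := by
    rw [f₃ _ (by decide) (by decide)]; exact k₂
  obtain ⟨s₄, M₄, r₄, b₄, E₄, k₄, f₄⟩ := E₃.fail (κ := κ) (N := rE) (t := leakTest) rfl
    (fun e => G.Internal comp e ∧ G.Conn G.init (e / 3) ∧ G.asg e = 1 ∧
      (G.HasGuard comp 1 (comp (e / 3)) ∨ G.HasGuard comp 2 (comp (e / 3)))) E₃.holds.e.le rfl (by
      intro k M' hk hk' E' f'
      rw [E₃.holds.e] at hk
      refine and_congr (internalTest_holds E' hk hk') ?_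
      simp only [Test.Holds, Expr.eval, hk', E'.holds.src k hk, E'.holds.asg k hk, E'.comp,
        f' aRe (by decide) (by decide), f' aC1 (by decide) (by decide), f' aC2 (by decide) (by decide),
        hre (k / 3) (by omega), hc1, k₃, not_and_or, not_not])
  obtain ⟨s₅, M₅, r₅, b₅, E₅, k₅, f₅⟩ := E₄.fail (κ := κ) (N := rE) (t := discloseTest) rfl
    (fun e => G.Internal comp e ∧ G.Conn G.init (e / 3) ∧ G.inp (e / 3) = 1 ∧ G.out e < 2)
    E₄.holds.e.le rfl (by
      intro k M' hk hk' E' f'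
      rw [E₄.holds.e] at hk
      refine and_congr (internalTest_holds E' hk hk') ?_
      simp only [Test.Holds, Expr.eval, hk', E'.holds.src k hk, E'.holds.out k hk,
        E'.holds.inp (k / 3) (by omega), f' aRe (by decide) (by decide),
        f₄ aRe (by decide) (by decide), hre (k / 3) (by omega)])
  have hF : M₅.word rFail 0 = 1 ↔ G.FailCycle comp := by
    rw [k₅, k₄, hf₃, E₃.holds.e, E₄.holds.e]
    simp [FlatGraph.FailCycle]
  have hfr : ∀ c, 50 ≤ c → M₅.word c = M₃.word c := fun c hc => by
    rw [f₅ c (by omega) (by omega), f₄ c (by omega) (by omega)]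
  obtain ⟨s₆, M₆, r₆, b₆, E₆, k₆, f₆⟩ := checkFor_rule (κ := κ) (g := 1) (g' := 2) (a := aC1) (b := aC2)
    hG E₅ (by decide) (by decide) (by rw [hfr _ (by decide)]; exact hre)
    (by rw [hfr _ (by decide)]; exact fun v _ => hc1 _)
    (by rw [hfr _ (by decide)]; exact fun v _ => k₃ _)
  obtain ⟨s₇, M₇, r₇, b₇, E₇, k₇, f₇⟩ := checkFor_rule (κ := κ) (g := 2) (g' := 1) (a := aC2) (b := aC1)
    hG E₆ (by decide) (by decide) (by rw [f₆ _ (by decide), hfr _ (by decide)]; exact hre)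
    (by rw [f₆ _ (by decide), hfr _ (by decide)]; exact fun v _ => k₃ _)
    (by rw [f₆ _ (by decide), hfr _ (by decide)]; exact fun v _ => hc1 _)
  have hWF := hc.wellFormed_iff hG hgd
  rw [← hF, ← or_assoc, ← k₆, ← k₇] at hWF
  have hlast : Ensures κ (.ite (.eq (reg rFail) (.lit 1)) (.set 0 (.lit 0) (.lit 0))
      (.set 0 (.lit 0) (.lit 1))) M₇ 2 fun M' => M'.word 0 0 ≤ 1 ∧ (M'.word 0 0 = 1 ↔ G.WellFormed) := by
    refine Ensures.ite (T := 1) (Or.inl rfl) (fun h => Ensures.exec rfl (Or.inl rfl) ?_)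
      fun h => Ensures.exec rfl (Or.inl rfl) ?_
    · have : M₇.word rFail 0 = 1 := h
      simp [Prog.exec, Expr.eval, hWF, this]
    · have : ¬ M₇.word rFail 0 = 1 := h
      simp [Prog.exec, Expr.eval, hWF, this]
  obtain ⟨s₈, M₈, r₈, b₈, h₈⟩ := hlast
  refine ⟨_, M₈, r₁.seq <| r₂.seq <| r₃.seq <| r₄.seq <| r₅.seq <| r₆.seq <| r₇.seq r₈, ?_, h₈⟩
  have z₁ : leakTest.size = 15 := rfl
  have z₂ : discloseTest.size = 10 := rfl
  rw [z₁] at b₄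
  rw [z₂] at b₅
  clear * - b₁ b₂ b₃ b₄ b₅ b₆ b₇ b₈
  omega

end RAM

/-! ### Transitions that sample from a distribution with parameter zero -/

namespace DiPA

/-- `t` samples only from distributions with positive parameters. -/
def Live {Q Γ : Type*} (A : DiPA Q Γ) (t : Transition Q Γ) : Prop :=
  (t.asg = true ∨ t.guard ≠ .tt ∨ t.out = .svar → 0 < A.d t.src) ∧ (t.out = .svar' → 0 < A.d' t.src)

/-- A density with parameter 0 vanishes, and with it the integral of the step in question and
everything around it. -/
theorem pathProb_eq_zero {Q Γ : Type*} {A : DiPA Q Γ} {ρ : List (Step Q Γ)}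
    (hρ : ∀ s ∈ ρ, s.lab.out = s.tr.out) (h : ∃ s ∈ ρ, ¬ A.Live s.tr) (ε x : ℝ) :
    A.pathProb ε ρ x = 0 := by
  induction ρ generalizing x with
  | nil => simp at h
  | cons s ρ ih =>
    simp only [List.mem_cons, forall_eq_or_imp, exists_eq_or_imp] at hρ h
    by_cases hs : A.Live s.tr
    · have ih' := fun x => ih hρ.2 (by tauto) x
      cases ha : s.tr.asg
      · rw [pathProb_cons_of_not_asg _ _ _ _ _ ha, ih', mul_zero]
      · rw [pathProb_cons_asg _ _ _ _ _ ha]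
        simp [ih']
    · simp only [Live, not_and_or, Classical.not_imp, not_lt, nonpos_iff_eq_zero] at hs
      have hzero : ∀ m z, lapDensity 0 m z = 0 := fun m z => by simp [lapDensity]
      rcases hs with ⟨hu, hd⟩ | ⟨ho, hd⟩
      · have hdens : ∀ z, A.dens ε s z = 0 := fun z => by
          simp [dens, hd, hzero]
        cases ha : s.tr.asg
        · have hg : A.guardFactor ε s x = 0 := by
            rw [guardFactor, if_neg]
            · simp [hdens]
            · rw [hρ.1]
              simp only [ha, Bool.false_eq_true, false_or] at hu
              tauto
          rw [pathProb_cons_of_not_asg _ _ _ _ _ ha, hg, mul_zero, zero_mul]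
        · rw [pathProb_cons_asg _ _ _ _ _ ha]
          simp [hdens]
      · have hp : A.primeFactor ε s = 0 := by
          have hl := hρ.1
          rw [ho] at hl
          unfold primeFactor
          split
          · simp [hd, hzero]
          · rename_i hne
            rcases hlab : s.lab with g | ⟨_ | _, v, w⟩
            · rw [hlab] at hl; simp [Label.out] at hl
            · rw [hlab] at hl; simp [Label.out] at hl
            · exact absurd hlab (hne v w)
        cases ha : s.tr.asg
        · rw [pathProb_cons_of_not_asg _ _ _ _ _ ha, hp, zero_mul, zero_mul]
        · rw [pathProb_cons_asg _ _ _ _ _ ha, hp, zero_mul]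

variable {n m : ℕ} {A : DiPA (Fin n) (Fin m)}

/-- The states with positive `d`. -/
def PosD (A : DiPA (Fin n) (Fin m)) (v : ℕ) : Prop := ∃ h : v < n, 0 < A.d ⟨v, h⟩

/-- The states with positive `d'`. -/
def PosD' (A : DiPA (Fin n) (Fin m)) (v : ℕ) : Prop := ∃ h : v < n, 0 < A.d' ⟨v, h⟩

theorem entryAlive_iff_live {t : Transition (Fin n) (Fin m)} :
    EntryAlive A.PosD A.PosD' t.src t.guard t.out t.asg ↔ A.Live t := by
  have h1 : A.PosD t.src ↔ 0 < A.d t.src := ⟨fun ⟨_, h⟩ => h, fun h => ⟨t.src.2, h⟩⟩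
  have h2 : A.PosD' t.src ↔ 0 < A.d' t.src := ⟨fun ⟨_, h⟩ => h, fun h => ⟨t.src.2, h⟩⟩
  rw [EntryAlive, Live, h1, h2]
  refine and_congr_left fun _ => ?_
  cases t.asg <;> simp
  tauto

/-- The automaton without the transitions that are not live. -/
noncomputable def pruned (A : DiPA (Fin n) (Fin m))
    (h : ∃ q o, A.δ A.init .tt = some (q, o, true) ∧
      EntryAlive A.PosD A.PosD' A.init .tt o true) : DiPA (Fin n) (Fin m) :=
  -- The pruned table is a restriction of δ and inherits all axioms but one: the initial transition
  -- has to survive, which is the hypothesis.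
  have key : ∀ {p c x}, A.prune A.PosD A.PosD' p c = some x → A.δ p c = some x :=
    fun {_ _ x} hx => (prune_eq_some (q := x.1) (o := x.2.1) (b := x.2.2).1 hx).1
  have key' : ∀ {p c}, A.δ p c = none → A.prune A.PosD A.PosD' p c = none := fun {p c} hn => by
    cases hx : A.prune A.PosD A.PosD' p c with
    | none => rfl
    | some x => rw [key hx] at hn; cases hn
  { A with
    δ := A.prune A.PosD A.PosD'
    determinism := fun q hq => by
      obtain ⟨x, hx⟩ := Option.isSome_iff_exists.1 hq
      obtain ⟨h1, h2⟩ := A.determinism q (by rw [key hx]; rfl)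
      exact ⟨key' h1, key' h2⟩
    output_distinction := fun q q₁ o₁ b₁ q₂ o₂ b₂ h1 h2 =>
      A.output_distinction q q₁ o₁ b₁ q₂ o₂ b₂ (key h1) (key h2)
    initialization := by
      obtain ⟨q, o, h1, h2⟩ := h
      exact ⟨⟨q, o, prune_eq_some.2 ⟨h1, h2⟩⟩, key' A.initialization.2.1, key' A.initialization.2.2⟩
    non_input := fun q hq c hc => by
      obtain ⟨x, hx⟩ := Option.isSome_iff_exists.1 hc
      exact A.non_input q hq c (by rw [key hx]; rfl) }

theorem pathProb_pruned {h} (ε : ℝ) (ρ : List (Step (Fin n) (Fin m))) (x : ℝ) :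
    (A.pruned h).pathProb ε ρ x = A.pathProb ε ρ x := by
  induction ρ generalizing x with
  | nil => rfl
  | cons s ρ ih =>
    cases ha : s.tr.asg
    · rw [pathProb_cons_of_not_asg _ _ _ _ _ ha, pathProb_cons_of_not_asg _ _ _ _ _ ha, ih]; rfl
    · rw [pathProb_cons_asg _ _ _ _ _ ha, pathProb_cons_asg _ _ _ _ _ ha]
      simp only [ih]; rfl

theorem isTransition_pruned {h} {t : Transition (Fin n) (Fin m)} :
    (A.pruned h).IsTransition t ↔ A.IsTransition t ∧ A.Live t := by
  rw [← entryAlive_iff_live]; exact prune_eq_some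

theorem isPath_pruned {h} {p q : Fin n} {ts : List (Transition (Fin n) (Fin m))} :
    (A.pruned h).IsPath p ts q ↔ A.IsPath p ts q ∧ ∀ t ∈ ts, A.Live t := by
  induction ts generalizing p with
  | nil => simp [IsPath]
  | cons t ts ih =>
    simp only [IsPath, ih, isTransition_pruned, List.mem_cons, forall_eq_or_imp]
    tauto

theorem isExecution_pruned {h} {p q : Fin n} {ρ : List (Step (Fin n) (Fin m))} :
    (A.pruned h).IsExecution p ρ q ↔ A.IsExecution p ρ q ∧ ∀ s ∈ ρ, A.Live s.tr := by
  unfold IsExecution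
  rw [isPath_pruned, List.forall_mem_map]
  have : (A.pruned h).isInput = A.isInput := rfl
  rw [this]
  tauto

theorem map_tr_of_equivalent {Q Γ : Type*} {ρ ρ' : List (Step Q Γ)} (h : Equivalent ρ ρ') :
    ρ.map Step.tr = ρ'.map Step.tr := by
  have := congrArg (List.map Prod.fst) h
  simpa [Function.comp_def] using this

/-- Executions through a deleted transition have probability 0 and satisfy the inequality trivially.
Equivalent executions have the same transitions, so both survive the pruning or neither does. -/
theorem differentiallyPrivate_pruned {h} : (A.pruned h).DifferentiallyPrivate ↔
    A.DifferentiallyPrivate := by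
  refine exists_congr fun d => and_congr_right fun _ => forall₂_congr fun ε hε => ?_
  constructor
  · intro H ρ ρ' q q' h1 h2 h3 h4
    by_cases hl : ∀ s ∈ ρ, A.Live s.tr
    · have hl' : ∀ s ∈ ρ', A.Live s.tr := by
        have := map_tr_of_equivalent h3
        rw [← List.forall_mem_map (f := Step.tr) (P := A.Live)] at hl ⊢
        rwa [← this]
      have := H ρ ρ' q q' (isExecution_pruned.2 ⟨h1, hl⟩) (isExecution_pruned.2 ⟨h2, hl'⟩) h3 h4
      rwa [pathProb_pruned, pathProb_pruned] at this
    · push Not at hl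
      rw [pathProb_eq_zero (fun s hs => (h1.2 s hs).1) hl]
      exact mul_nonneg (Real.exp_pos _).le (A.pathProb_nonneg hε.le _ _)
  · intro H ρ ρ' q q' h1 h2 h3 h4
    rw [pathProb_pruned, pathProb_pruned]
    exact H ρ ρ' q q' (isExecution_pruned.1 h1).1 (isExecution_pruned.1 h2).1 h3 h4

theorem flat_valid (Z Z' : ℕ → Prop) : (A.flat Z Z').Valid := by
  refine ⟨A.init.2, fun e he => ?_⟩
  have he' : e < 3 * n := he
  obtain ⟨c, hc⟩ : ∃ c : Guard, c.code = e % 3 := by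
    have : e % 3 < 3 := Nat.mod_lt _ (by omega)
    interval_cases e % 3
    exacts [⟨.tt, rfl⟩, ⟨.ge, rfl⟩, ⟨.lt, rfl⟩]
  have := A.encodeWord_dst ⟨e / 3, by omega⟩ c
  simp only at this
  change (A.flat Z Z').dst e ≤ n
  simp only [flat, ← hc, this]
  split_ifs
  · rcases A.δ ⟨e / 3, by omega⟩ c with _ | ⟨q, o, b⟩
    · exact Nat.zero_le _
    · exact q.2
  · exact Nat.zero_le _

/-- Differential privacy is well-formedness of the graph of live transitions. -/
theorem differentiallyPrivate_iff :
    A.DifferentiallyPrivate ↔ (A.flat A.PosD A.PosD').WellFormed := by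
  by_cases h : ∃ q o, A.δ A.init .tt = some (q, o, true) ∧ EntryAlive A.PosD A.PosD' A.init .tt o true
  · have hrep : (A.flat A.PosD A.PosD').Represents (A.pruned h) := represents_flat rfl rfl rfl
    rw [← differentiallyPrivate_pruned (h := h), ← hrep.wellFormed_iff]
    refine ⟨fun hd => hd.wellFormed fun t ht => ?_, fun hw => hw.differentiallyPrivate⟩
    exact (isTransition_pruned.1 ht).2
  -- The initial transition itself is deleted, so there is no pruned automaton. Nonempty executions
  -- have probability 0 and the graph has no edge from its initial vertex, so both sides hold.
  · obtain ⟨⟨q₀, o₀, h0⟩, hge, hlt⟩ := A.initialization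
    have hdead : ∀ t, A.IsTransition t → t.src = A.init → ¬ A.Live t := by
      rintro ⟨p, c, q, o, b⟩ ht rfl hl
      rw [← entryAlive_iff_live] at hl
      have ht' : A.δ A.init c = some (q, o, b) := ht
      cases c with
      | tt =>
        rw [h0] at ht'
        simp only [Option.some.injEq, Prod.mk.injEq] at ht'
        obtain ⟨rfl, rfl, rfl⟩ := ht'
        exact h ⟨_, _, h0, hl⟩
      | ge => rw [hge] at ht'; cases ht'
      | lt => rw [hlt] at ht'; cases ht'
    have hedge : ∀ e v, ¬ (A.flat A.PosD A.PosD').IsEdge e (A.flat A.PosD A.PosD').init v := by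
      rintro e v ⟨-, h2, h3⟩
      have h2 : e / 3 = (A.init : ℕ) := h2
      obtain ⟨c, hc⟩ : ∃ c : Guard, c.code = e % 3 := by
        have : e % 3 < 3 := Nat.mod_lt _ (by omega)
        interval_cases e % 3
        exacts [⟨.tt, rfl⟩, ⟨.ge, rfl⟩, ⟨.lt, rfl⟩]
      have he : e = 3 * (A.init : ℕ) + c.code := by omega
      have hd : (A.flat A.PosD A.PosD').dst e ≠ 0 := by omega
      cases hδ : A.δ A.init c with
      | none =>
        apply hd
        simp only [flat, h2, ← hc, encodeWord_dst, hδ]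
        simp [entryCode]
      | some x =>
        obtain ⟨q, o, b⟩ := x
        apply hd
        simp only [flat]
        rw [if_neg]
        rw [he, flatAlive_iff hδ]
        intro hl
        exact hdead ⟨A.init, c, q, o, b⟩ hδ rfl (entryAlive_iff_live.1 hl)
    have hconn : ∀ u, (A.flat A.PosD A.PosD').Conn (A.flat A.PosD A.PosD').init u →
        u = (A.flat A.PosD A.PosD').init := by
      intro u hu
      rcases hu.cases_head with rfl | ⟨c, ⟨e, he, -⟩, -⟩
      · rfl
      · exact (hedge e c he).elim
    have hfor : ∀ g g', (A.flat A.PosD A.PosD').WellFormedFor g g' := by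
      refine fun g g' => ⟨?_, ?_⟩
      · rintro p q h1 ⟨e, u, v, he, -, h2, -⟩ -
        rw [hconn p h1] at h2
        rw [hconn u h2] at he
        exact (hedge e v he).elim
      · intro e u v q he h1
        rw [hconn u h1] at he
        exact (hedge e v he).elim
    refine iff_of_true ⟨1, one_pos, fun ε hε ρ ρ' q q' h1 h2 h3 _ => ?_⟩ ⟨?_, ?_, hfor 1 2, hfor 2 1⟩
    · cases ρ with
      | nil =>
        have : ρ' = [] := by simpa [Equivalent] using h3
        subst this
        simp only [pathProb, mul_one]
        exact Real.one_le_exp (by positivity)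
      | cons s ρ =>
        have hs : A.IsTransition s.tr ∧ s.tr.src = A.init := ⟨h1.1.1, h1.1.2.1⟩
        rw [pathProb_eq_zero (fun s hs => (h1.2 s hs).1) ⟨s, by simp, hdead _ hs.1 hs.2⟩]
        exact mul_nonneg (Real.exp_pos _).le (A.pathProb_nonneg hε.le _ _)
    · intro e u v e' u' v' he _ h1
      rw [hconn u h1] at he
      exact (hedge e v he).elim
    · intro e u v he h1
      rw [hconn u h1] at he
      exact (hedge e v he).elim

end DiPA

/-! ### The machines for differential privacy and well-formedness -/

namespace RAM

variable {κ : ℚ → ℕ} {n m : ℕ} {A : DiPA (Fin n) (Fin m)}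

/-- Compute the graph and its components. -/
def condense : Prog := .seq flatten scc

/-- The memory holds `A` and the flags `aZ`, `aZ'`, and is otherwise zero. -/
structure Prepared (A : DiPA (Fin n) (Fin m)) (Z Z' : ℕ → Prop) (M : Mem) : Prop where
  word : ∀ a ≤ 10, M.word a = A.encodeWord a
  num : M.num = A.encodeNum
  card : M.word rN 0 = n
  flag : ∀ v < n, M.word aZ v = 1 ↔ Z v
  flag' : ∀ v < n, M.word aZ' v = 1 ↔ Z' v
  zero : ∀ a, 12 < a → a ≠ aZ → a ≠ aZ' → M.word a = 0

theorem condense_rule {Z Z' : ℕ → Prop} {M : Mem} (h : Prepared A Z Z' M) :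
    Ensures κ condense M (1000 * (n + 1)) fun M' => Env (A.flat Z Z') (M'.word aComp) M' ∧
      (A.flat Z Z').IsCondensation (M'.word aComp) (M'.word aOrd) ∧
      (∀ a, a = rFail ∨ 50 ≤ a → M'.word a = 0) ∧ M'.num = A.encodeNum := by
  have hG := A.flat_valid Z Z'
  obtain ⟨s₁, M₁, r₁, b₁, h₁⟩ := flatten_rule (κ := κ) h.word h.card
    (by rw [h.zero _ (by decide) (by decide) (by decide)]; rfl) h.flag h.flag'
  have z : ∀ a, 12 < a → a ∉ flatten.writes → a ≠ aZ → a ≠ aZ' → M₁.word a = 0 := fun a h1 h2 h3 h4 => by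
    rw [r₁.frame.1 a h2, h.zero a h1 h3 h4]
  obtain ⟨s₂, M₂, r₂, b₂, h₂⟩ := scc_rule (κ := κ) hG h₁ (z _ (by decide) (by decide) (by decide) (by decide))
    (z _ (by decide) (by decide) (by decide) (by decide)) (z _ (by decide) (by decide) (by decide) (by decide))
    (z _ (by decide) (by decide) (by decide) (by decide)) (z _ (by decide) (by decide) (by decide) (by decide))
    (z _ (by decide) (by decide) (by decide) (by decide)) (z _ (by decide) (by decide) (by decide) (by decide))
  refine ⟨_, M₂, r₁.seq r₂, ?_, ⟨h₁.congr fun a ha => r₂.frame.1 a ?_, rfl⟩, h₂, fun a ha => ?_, ?_⟩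
  · have : (A.flat Z Z').n = n := rfl
    omega
  · revert a; decide
  · have w1 : ∀ b ∈ scc.writes, b ≠ rFail ∧ b < 50 := by decide
    have w2 : ∀ b ∈ flatten.writes, b ≠ rFail ∧ b < 50 := by decide
    rw [r₂.frame.1 a fun hb => by have := w1 a hb; omega]
    exact z a (by omega) (fun hb => by have := w2 a hb; omega) (by omega) (by omega)
  · rw [← h.num]
    funext a
    rw [r₂.frame.2 a (by rw [show scc.numWrites = [] from rfl]; simp),
      r₁.frame.2 a (by rw [show flatten.numWrites = [] from rfl]; simp)]

/-- Set the flags by tests, and analyze the graph. -/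
def prepare (t t' : Test) (P : Prog) : Prog :=
  .seq (.set rN (.lit 0) (.get 0 (.lit 0))) (.seq (fillLoop rI rN aZ t) (.seq (fillLoop rI rN aZ' t') P))

/-- The flags choose which transitions are kept. The time of each test enters separately, because
comparing a parameter with 0 costs its bit length. -/
theorem prepare_rule {Z Z' : ℕ → Prop} {t t' : Test} {P : Prog} {T : ℕ} {R : Mem → Prop} (τ τ' : ℕ → ℕ)
    (ht : ∀ v M, v < n → M.word rI 0 = v → (∀ a ≤ 10, M.word a = A.encodeWord a) →
      M.num = A.encodeNum → (t.Holds M ↔ Z v) ∧ t.time κ M ≤ τ v)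
    (ht' : ∀ v M, v < n → M.word rI 0 = v → (∀ a ≤ 10, M.word a = A.encodeWord a) →
      M.num = A.encodeNum → (t'.Holds M ↔ Z' v) ∧ t'.time κ M ≤ τ' v)
    (hP : ∀ M, Prepared A Z Z' M → Ensures κ P M T R) :
    Ensures κ (prepare t t' P) A.encode (∑ v ∈ Finset.range n, (τ v + 3) +
      ∑ v ∈ Finset.range n, (τ' v + 3) + T + 5) R := by
  refine (Ensures.set_seq (T := (∑ v ∈ Finset.range n, (τ v + 3) + 2) +
    ((∑ v ∈ Finset.range n, (τ' v + 3) + 2) + T)) ?_).mono (by omega) fun _ h => h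
  obtain ⟨M₀, hM₀⟩ : ∃ M₀, M₀ = A.encode.setWord rN ((Expr.lit 0).eval A.encode)
    ((Expr.get 0 (.lit 0)).eval A.encode) := ⟨_, rfl⟩
  rw [← hM₀]
  have hn : M₀.word rN 0 = n := by
    simp [hM₀, Expr.eval, DiPA.encode, DiPA.encodeWord]
  have hw : ∀ a, a ≠ rN → M₀.word a = A.encodeWord a := fun a ha => by
    rw [hM₀, Mem.word_setWord_of_ne _ _ _ ha]; rfl
  have hnum : M₀.num = A.encodeNum := by rw [hM₀]; rfl
  obtain ⟨s₁, M₁, r₁, b₁, k₁, -, f₁, n₁⟩ := fillLoop_time_rule (κ := κ) (i := rI) (N := rN) (a := aZ) (t := t)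
    Z τ (M₀ := M₀) (by decide) (by decide) (by decide) (by
      intro k M hk hk' hfr hnum'
      rw [hn] at hk
      refine ht k M hk hk' (fun a ha => ?_) (hnum'.trans hnum)
      rw [hfr a (by omega) (by omega), hw a (by omega)])
  rw [hn] at b₁ k₁
  obtain ⟨s₂, M₂, r₂, b₂, k₂, -, f₂, n₂⟩ := fillLoop_time_rule (κ := κ) (i := rI) (N := rN) (a := aZ') (t := t')
    Z' τ' (M₀ := M₁) (by decide) (by decide) (by decide) (by
      intro k M hk hk' hfr hnum'
      rw [f₁ _ (by decide) (by decide), hn] at hk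
      refine ht' k M hk hk' (fun a ha => ?_) (hnum'.trans (n₁.trans hnum))
      rw [hfr a (by omega) (by omega), f₁ a (by omega) (by omega), hw a (by omega)])
  rw [f₁ _ (by decide) (by decide), hn] at b₂ k₂
  have hpre : Prepared A Z Z' M₂ := by
    have hfr : ∀ a, a ≠ rI → a ≠ aZ → a ≠ aZ' → M₂.word a = M₀.word a := fun a h1 h2 h3 => by
      rw [f₂ a h1 h3, f₁ a h1 h2]
    refine ⟨fun a ha => ?_, n₂.trans (n₁.trans hnum), ?_, ?_, k₂, fun a h1 h2 h3 => ?_⟩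
    · rw [hfr a (by omega) (by omega) (by omega), hw a (by omega)]
    · rw [hfr _ (by decide) (by decide) (by decide), hn]
    · rw [f₂ _ (by decide) (by decide)]; exact k₁
    · rw [hfr a (by omega) h2 h3, hw a (by omega)]
      funext i
      have h0 : a ≠ 0 := by omega
      simp only [DiPA.encodeWord, if_neg h0, Pi.zero_apply]
      split_ifs
      · split <;> omega
      · rfl
  obtain ⟨s₃, M₃, r₃, b₃, h₃⟩ := hP M₂ hpre
  exact ⟨_, M₃, r₁.seq (r₂.seq r₃), by omega, h₃⟩

theorem Prepared.wfCheck {Z Z' : ℕ → Prop} {M : Mem} (h : Prepared A Z Z' M) :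
    Ensures κ (.seq condense wfCheck) M (6000 * (n + 1)) fun M' =>
      M'.word 0 0 ≤ 1 ∧ (M'.word 0 0 = 1 ↔ (A.flat Z Z').WellFormed) := by
  refine (Ensures.then (T₂ := 5000 * (n + 1)) (condense_rule h) ?_).mono (by omega) fun _ h => h
  rintro M₁ ⟨E, hc, hz, -⟩ - -
  refine wfCheck_rule (A.flat_valid Z Z') (fun e _ => ?_) hc E (hz _ (by decide)) (hz _ (by decide))
    (hz _ (by decide))
  change e % 3 ≤ 2
  omega

end RAM

/-! ### Bounds that are linear in the size of the automaton. -/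

namespace DiPA

variable {n m : ℕ} {A : DiPA (Fin n) (Fin m)}

/-- There is an initial state, so n ≥ 1, and additive constants can be absorbed. -/
theorem n_le_size : n + 1 ≤ 2 * A.size := by
  have := A.init.2
  unfold size
  omega

open RAM in
theorem exists_prog_differentiallyPrivate : ∃ (P : Prog) (K : ℕ), ∀ (n m : ℕ) (A : DiPA (Fin n) (Fin m)),
    ∃ (t : ℕ) (M : Mem), Runs bitLength P A.encode t M ∧ t ≤ K * A.bitSize ∧
      M.word 0 0 ≤ 1 ∧ (M.word 0 0 = 1 ↔ A.DifferentiallyPrivate) := by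
  -- Number array 4 is zero in the initial memory and provides the constant 0 for the tests 0 < d
  -- and 0 < d'.
  refine ⟨prepare (.numLt 4 (.lit 0) 0 (reg rI)) (.numLt 4 (.lit 0) 2 (reg rI)) (.seq condense wfCheck),
    13000, fun n m A => ?_⟩
  have hz : ∀ M : Mem, M.num = A.encodeNum → M.num 4 0 = 0 := by
    intro M hM
    rw [hM]
    simp [encodeNum]
  -- The denominator 1 contributes one bit; hence the summand 2 in the times of the tests.
  have h0 : bitLength 0 = 1 := by simp [bitLength]
  obtain ⟨d, hd⟩ : ∃ d : ℕ → ℕ, ∀ v : Fin n, d v = bitLength (A.d v) :=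
    ⟨fun v => if h : v < n then bitLength (A.d ⟨v, h⟩) else 0, fun v => by simp⟩
  obtain ⟨d', hd'⟩ : ∃ d' : ℕ → ℕ, ∀ v : Fin n, d' v = bitLength (A.d' v) :=
    ⟨fun v => if h : v < n then bitLength (A.d' ⟨v, h⟩) else 0, fun v => by simp⟩
  obtain ⟨t, M, h1, h2, h3, h4⟩ := prepare_rule (κ := bitLength) (A := A) (Z := A.PosD) (Z' := A.PosD')
    (t := .numLt 4 (.lit 0) 0 (reg rI)) (t' := .numLt 4 (.lit 0) 2 (reg rI))
    (fun v => d v + 2) (fun v => d' v + 2) (by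
      intro v M hv hI _ hM
      have : M.num 0 v = A.d ⟨v, hv⟩ := by rw [hM]; simp [encodeNum, hv]
      simp only [Test.Holds, Test.time, Expr.eval, hI, hz M hM, this, h0, PosD]
      refine ⟨by simp [hv], by have := hd ⟨v, hv⟩; simp only at this; omega⟩) (by
      intro v M hv hI _ hM
      have : M.num 2 v = A.d' ⟨v, hv⟩ := by rw [hM]; simp [encodeNum, hv]
      simp only [Test.Holds, Test.time, Expr.eval, hI, hz M hM, this, h0, PosD']
      refine ⟨by simp [hv], by have := hd' ⟨v, hv⟩; simp only at this; omega⟩)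
    (fun M hM => hM.wfCheck)
  refine ⟨t, M, h1, h2.trans ?_, h3, h4.trans differentiallyPrivate_iff.symm⟩
  have hs := A.n_le_size
  have e1 : ∑ v ∈ Finset.range n, (d v + 2 + 3) = ∑ q, bitLength (A.d q) + n * 5 := by
    rw [Finset.sum_range]
    simp [Finset.sum_add_distrib, hd, add_assoc]
  have e2 : ∑ v ∈ Finset.range n, (d' v + 2 + 3) = ∑ q, bitLength (A.d' q) + n * 5 := by
    rw [Finset.sum_range]
    simp [Finset.sum_add_distrib, hd', add_assoc]
  rw [e1, e2]
  simp only [bitSize, Finset.sum_add_distrib]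
  omega

-- Here both flags are set everywhere, so nothing is pruned and no parameter is read. This is why
-- the bound does not involve bit lengths.
open RAM in
theorem exists_prog_wellFormed : ∃ (P : Prog) (K : ℕ), ∀ (n m : ℕ) (A : DiPA (Fin n) (Fin m)),
    ∃ (t : ℕ) (M : Mem), Runs bitLength P A.encode t M ∧ t ≤ K * A.size ∧
      M.word 0 0 ≤ 1 ∧ (M.word 0 0 = 1 ↔ A.WellFormed) := by
  refine ⟨prepare (.eq (.lit 0) (.lit 0)) (.eq (.lit 0) (.lit 0)) (.seq condense wfCheck),
    13000, fun n m A => ?_⟩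
  obtain ⟨t, M, h1, h2, h3, h4⟩ := prepare_rule (κ := bitLength) (A := A) (Z := fun _ => True)
    (Z' := fun _ => True) (t := .eq (.lit 0) (.lit 0)) (t' := .eq (.lit 0) (.lit 0)) (fun _ => 1) (fun _ => 1)
    (by intro v M _ _ _ _; simp [Test.Holds, Test.time])
    (by intro v M _ _ _ _; simp [Test.Holds, Test.time]) (fun M hM => hM.wfCheck)
  refine ⟨t, M, h1, h2.trans ?_, h3, h4.trans (represents_flat rfl rfl prune_true.symm).wellFormed_iff.symm⟩
  have hs := A.n_le_size
  simp only [Finset.sum_const, Finset.card_range, smul_eq_mul]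
  omega

end DiPA

/-! ### The weight -/

namespace DiPA

variable {Q Γ : Type*} {A : DiPA Q Γ}

open Classical in
/-- The cost of a transition if it is critical. -/
noncomputable def criticalCost (A : DiPA Q Γ) (t : Transition Q Γ) : ℚ≥0 :=
  if A.isInput t.src = true then
    if t.out = .svar' then 2 * A.d t.src + A.d' t.src else 2 * A.d t.src
  else A.d t.src

theorem critical_iff {t : Transition Q Γ} (ht : A.IsTransition t) :
    A.Critical t ↔ ¬ (A.Reachable t.src ∧ A.Conn (fun _ => True) t.dst t.src) := by
  refine not_congr ⟨fun ⟨q, C, h1, h2, h3⟩ => (h2.conn_of_mem h1 h3).2, ?_⟩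
  rintro ⟨h1, ts, h2, -⟩
  exact ⟨t.src, t :: ts, h1, ⟨by simp, ht, rfl, h2⟩, by simp⟩

theorem cost_eq_of_critical {t : Transition Q Γ} (h : A.Critical t) : A.cost t = A.criticalCost t := by
  rw [cost, if_pos h, criticalCost]

theorem pathWeight_cons (t : Transition Q Γ) (ts : List (Transition Q Γ)) :
    A.pathWeight (t :: ts) = A.cost t + A.pathWeight ts := by
  simp [pathWeight]

theorem pathWeight_append (ts us : List (Transition Q Γ)) :
    A.pathWeight (ts ++ us) = A.pathWeight ts + A.pathWeight us := by
  simp [pathWeight]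

theorem le_weight {p q : Q} {ts : List (Transition Q Γ)} (h : A.IsPath p ts q) :
    ((A.pathWeight ts : ℝ) : EReal) ≤ A.weight :=
  le_iSup_of_le p <| le_iSup_of_le ts <| le_iSup_of_le q <| le_iSup_of_le h le_rfl

/-- Going round the cycle k times collects k times the cost. The cycle need not be reachable, since
the weight takes paths from all states. -/
theorem weight_eq_top {t : Transition Q Γ} (ht : A.IsTransition t)
    (hc : A.Conn (fun _ => True) t.dst t.src) (h0 : 0 < A.cost t) : A.weight = ⊤ := by
  obtain ⟨ts, h1, -⟩ := hc
  have key : ∀ k : ℕ, ∃ us, A.IsPath t.src us t.src ∧ k * A.cost t ≤ A.pathWeight us := by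
    intro k
    induction k with
    | zero => exact ⟨[], rfl, by simp⟩
    | succ k ih =>
      obtain ⟨us, k1, k2⟩ := ih
      refine ⟨t :: ts ++ us, isPath_append.2 ⟨_, ⟨ht, rfl, h1⟩, k1⟩, ?_⟩
      rw [pathWeight_append, pathWeight_cons]
      push_cast
      calc ((k : ℚ≥0) + 1) * A.cost t = A.cost t + k * A.cost t := by ring
        _ ≤ A.cost t + A.pathWeight ts + A.pathWeight us :=
          add_le_add (le_add_of_nonneg_right (zero_le)) k2
  refine (EReal.eq_top_iff_forall_lt _).2 fun y => ?_
  have h0' : (0 : ℝ) < A.cost t := by exact_mod_cast h0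
  obtain ⟨k, hk⟩ := exists_nat_gt (y / A.cost t)
  obtain ⟨us, k1, k2⟩ := key k
  refine lt_of_lt_of_le ?_ (le_weight k1)
  rw [div_lt_iff₀ h0'] at hk
  have : ((k * A.cost t : ℚ≥0) : ℝ) ≤ A.pathWeight us := by exact_mod_cast k2
  push_cast at this
  exact_mod_cast hk.trans_le this

end DiPA

/-! ### Longest paths in the graph of components. -/

namespace FlatGraph

variable {G : FlatGraph} {comp ord : ℕ → ℕ}

/-- `e` is an edge between different components. -/
def Cross (G : FlatGraph) (comp : ℕ → ℕ) (e : ℕ) : Prop :=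
  e < 3 * G.n ∧ G.dst e ≠ 0 ∧ comp (e / 3) ≠ comp (G.dst e - 1)

/-- `w` holds the largest costs of paths between components, using the edges in `D` between
different components, with the costs `r`. -/
structure Relaxed (G : FlatGraph) (comp : ℕ → ℕ) (r w : ℕ → ℚ) (D : ℕ → Prop) : Prop where
  nonneg : ∀ c, 0 ≤ w c
  le : ∀ e, G.Cross comp e → D e → r e + w (comp (G.dst e - 1)) ≤ w (comp (e / 3))
  attained : ∀ c, w c = 0 ∨ ∃ e, G.Cross comp e ∧ D e ∧ comp (e / 3) = c ∧
    w c = r e + w (comp (G.dst e - 1))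

theorem Relaxed.congr {r w : ℕ → ℚ} {D D' : ℕ → Prop} (h : G.Relaxed comp r w D)
    (hD : ∀ e, e < 3 * G.n → (D e ↔ D' e)) : G.Relaxed comp r w D' :=
  ⟨h.nonneg, fun e he hd => h.le e he ((hD e he.1).2 hd), fun c => (h.attained c).imp_right
    fun ⟨e, h1, h2, h3⟩ => ⟨e, h1, (hD e h1.1).1 h2, h3⟩⟩

theorem Relaxed.skip {r w : ℕ → ℚ} {D : ℕ → Prop} (h : G.Relaxed comp r w D) {e : ℕ}
    (he : G.Cross comp e → r e + w (comp (G.dst e - 1)) ≤ w (comp (e / 3))) :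
    G.Relaxed comp r w fun f => D f ∨ f = e := by
  refine ⟨h.nonneg, ?_, fun c => (h.attained c).imp_right fun ⟨f, h1, h2, h3⟩ => ⟨f, h1, Or.inl h2, h3⟩⟩
  rintro f hf (hd | rfl)
  · exact h.le f hf hd
  · exact he hf

/-- Edges between different components lead to strictly smaller numbers. If the processed edges
start in components up to that of e, none of them ends in the component whose value changes, and
their inequalities persist. -/
theorem Relaxed.update (hc : G.IsCondensation comp ord) {r w : ℕ → ℚ} {D : ℕ → Prop}
    (h : G.Relaxed comp r w D) {e : ℕ} (he : G.Cross comp e)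
    (hD : ∀ f, G.Cross comp f → D f → comp (f / 3) ≤ comp (e / 3))
    (hlt : w (comp (e / 3)) < r e + w (comp (G.dst e - 1))) :
    G.Relaxed comp r (Function.update w (comp (e / 3)) (r e + w (comp (G.dst e - 1))))
      fun f => D f ∨ f = e := by
  have hdst : ∀ f, G.Cross comp f → (D f ∨ f = e) → comp (G.dst f - 1) ≠ comp (e / 3) := by
    intro f hf hd
    have h1 := hc.edge_le f _ _ (isEdge_of_dst_ne_zero hf.1 hf.2.1)
    have h2 := hf.2.2
    rcases hd with hd | rfl
    · have := hD f hf hd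
      omega
    · omega
  refine ⟨fun c => ?_, fun f hf hd => ?_, fun c => ?_⟩
  · by_cases hce : c = comp (e / 3)
    · subst hce
      rw [Function.update_self]
      exact (h.nonneg _).trans hlt.le
    · rw [Function.update_of_ne hce]; exact h.nonneg c
  · rw [Function.update_of_ne (hdst f hf hd)]
    rcases hd with hd | rfl
    · by_cases hce : comp (f / 3) = comp (e / 3)
      · rw [hce, Function.update_self]
        have := h.le f hf hd
        rw [hce] at this
        exact this.trans hlt.le
      · rw [Function.update_of_ne hce]; exact h.le f hf hd
    · rw [Function.update_self]
  · by_cases hce : c = comp (e / 3)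
    · refine Or.inr ⟨e, he, Or.inr rfl, hce.symm, ?_⟩
      rw [hce, Function.update_self, Function.update_of_ne (hdst e he (Or.inr rfl))]
    · rw [Function.update_of_ne hce]
      refine (h.attained c).imp_right ?_
      rintro ⟨f, h1, h2, h3, h4⟩
      refine ⟨f, h1, Or.inl h2, h3, ?_⟩
      rw [Function.update_of_ne (hdst f h1 (Or.inl h2))]
      exact h4

/-- Some cycle that cannot be reached has positive cost. -/
def Unbounded (G : FlatGraph) (comp : ℕ → ℕ) (r : ℕ → ℚ) : Prop :=
  ∃ e < 3 * G.n, G.Internal comp e ∧ ¬ G.Conn G.init (e / 3) ∧ 0 < r e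

end FlatGraph

/-! ### The weight of an automaton as the length of a longest path between components. -/

namespace FlatGraph.Represents

variable {G : FlatGraph} {comp ord : ℕ → ℕ} {n m : ℕ} {A : DiPA (Fin n) (Fin m)}
  (hG : G.Represents A) (hc : G.IsCondensation comp ord) {r w : ℕ → ℚ}
  (hr : ∀ t, A.IsTransition t → r (edgeOf t) = A.criticalCost t)

include hG hc hr

omit hr in
theorem critical_iff {t : Transition (Fin n) (Fin m)} (ht : A.IsTransition t) :
    A.Critical t ↔ ¬ (G.Conn G.init t.src ∧ comp t.src = comp t.dst) := by
  have he := (hG.isEdge ht).1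
  have h1 : comp t.src = comp t.dst ↔ G.Internal comp (edgeOf t) := by
    rw [FlatGraph.Internal, he.2.1, he.2.2, Nat.add_sub_cancel]
    simp
  rw [DiPA.critical_iff ht, hG.reachable_iff, hG.conn_iff, h1, hc.internal_iff hG.valid he]

theorem weight_eq_top (h : G.Unbounded comp r) : A.weight = ⊤ := by
  obtain ⟨e, h1, h2, h3, h4⟩ := h
  obtain ⟨t, k1, rfl, k3, k4⟩ := hG.exists_transition (isEdge_of_dst_ne_zero h1 h2.1)
  have he := (hG.isEdge k1).1
  have hcr : A.Critical t := (hG.critical_iff hc k1).2 fun h => h3 (k3 ▸ h.1)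
  refine DiPA.weight_eq_top k1 (hG.conn_iff.2 ((hc.internal_iff hG.valid he).1 h2)) ?_
  rw [DiPA.cost_eq_of_critical hcr]
  rw [hr t k1] at h4
  exact_mod_cast h4

/-- Within a component a transition lies on a cycle. If it is reachable, it is not critical; if not,
a positive cost would make the weight unbounded. -/
theorem cost_eq_zero (h : ¬ G.Unbounded comp r) {t : Transition (Fin n) (Fin m)}
    (ht : A.IsTransition t) (hi : comp t.src = comp t.dst) : A.cost t = 0 := by
  by_cases hcr : A.Critical t
  · rw [DiPA.cost_eq_of_critical hcr]
    by_contra h0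
    have he := (hG.isEdge ht).1
    refine h ⟨edgeOf t, he.1, ?_, ?_, ?_⟩
    · rw [FlatGraph.Internal, he.2.1, he.2.2, Nat.add_sub_cancel]
      exact ⟨by omega, hi⟩
    · rw [he.2.1]
      exact fun h' => (hG.critical_iff hc ht).1 hcr ⟨h', hi⟩
    · rw [hr t ht]
      exact_mod_cast pos_iff_ne_zero.2 h0
  · rw [DiPA.cost, if_neg hcr]

theorem pathWeight_le (h : ¬ G.Unbounded comp r) (hw : G.Relaxed comp r w fun _ => True) {p q : Fin n}
    {ts : List (Transition (Fin n) (Fin m))} (hts : A.IsPath p ts q) :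
    (A.pathWeight ts : ℚ) ≤ w (comp p) := by
  induction ts generalizing p with
  | nil => simpa [DiPA.pathWeight] using hw.nonneg _
  | cons t ts ih =>
    obtain ⟨ht, rfl, hts⟩ := hts
    rw [DiPA.pathWeight_cons]
    push_cast
    have ih := ih hts
    by_cases hi : comp t.src = comp t.dst
    · rw [hG.cost_eq_zero hc hr h ht hi, hi]
      simpa using ih
    · have he := (hG.isEdge ht).1
      have := hw.le (edgeOf t) ⟨he.1, he.dst_ne_zero, by
        rw [he.2.1, he.2.2, Nat.add_sub_cancel]; exact hi⟩ trivial
      rw [he.2.1, he.2.2, Nat.add_sub_cancel, hr t ht,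
        ← DiPA.cost_eq_of_critical ((hG.critical_iff hc ht).2 fun h => hi h.2)] at this
      linarith

/-- Follow the edges at which the values are attained; component numbers decrease, so this ends.
Inside a component, a connecting path leads to the source of the next such edge, and its weight is
not negative. -/
theorem exists_pathWeight_ge (hw : G.Relaxed comp r w fun _ => True) (p : Fin n) :
    ∃ ts q, A.IsPath p ts q ∧ w (comp p) ≤ A.pathWeight ts := by
  obtain ⟨c, hcp⟩ : ∃ c, c = comp p := ⟨_, rfl⟩
  induction c using Nat.strong_induction_on generalizing p with
  | _ c ih =>
    rcases hw.attained (comp p) with h0 | ⟨e, h1, -, h2, h3⟩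
    · exact ⟨[], p, rfl, by rw [h0]; exact NNRat.cast_nonneg _⟩
    · have hed := isEdge_of_dst_ne_zero h1.1 h1.2.1
      obtain ⟨t, k1, rfl, k3, k4⟩ := hG.exists_transition hed
      have hle := hc.edge_le _ _ _ hed
      have hne := h1.2.2
      rw [← k3, ← k4] at hle hne
      rw [← k3] at h2
      rw [← k4] at h3
      obtain ⟨us, q, m1, m2⟩ := ih (comp t.dst) (by omega) t.dst rfl
      have hconn := ((hc.comp_iff _ _ (by rw [hG.n_eq]; exact t.src.2) (by rw [hG.n_eq]; exact p.2)).1 h2).2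
      obtain ⟨ts, l1, -⟩ := hG.conn_iff.2 hconn
      refine ⟨ts ++ t :: us, q, DiPA.isPath_append.2 ⟨_, l1, k1, rfl, m1⟩, ?_⟩
      rw [h3, DiPA.pathWeight_append, DiPA.pathWeight_cons, hr t k1,
        DiPA.cost_eq_of_critical ((hG.critical_iff hc k1).2 fun h => hne h.2)]
      push_cast
      have : (0 : ℚ) ≤ A.pathWeight ts := NNRat.cast_nonneg _
      linarith

theorem weight_eq (h : ¬ G.Unbounded comp r) (hw : G.Relaxed comp r w fun _ => True) {x : ℚ}
    (hx : ∀ v < n, w (comp v) ≤ x) (hx' : x = 0 ∨ ∃ v < n, x = w (comp v)) :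
    A.weight = ((x : ℝ) : EReal) := by
  refine le_antisymm ?_ ?_
  · refine iSup_le fun p => iSup_le fun ts => iSup_le fun q => iSup_le fun hts => ?_
    have h1 := (hG.pathWeight_le hc hr h hw hts).trans (hx p p.2)
    have h2 : ((A.pathWeight ts : ℚ) : ℝ) ≤ (x : ℝ) := by exact_mod_cast h1
    exact_mod_cast h2
  · rcases hx' with rfl | ⟨v, hv, rfl⟩
    · have := DiPA.le_weight (A := A) (p := A.init) (ts := []) rfl
      simpa [DiPA.pathWeight] using this
    · obtain ⟨ts, q, h1, h2⟩ := hG.exists_pathWeight_ge hc hr hw ⟨v, hv⟩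
      refine le_trans ?_ (DiPA.le_weight h1)
      have h3 : ((w (comp v) : ℚ) : ℝ) ≤ ((A.pathWeight ts : ℚ) : ℝ) := by exact_mod_cast h2
      exact_mod_cast h3

end FlatGraph.Represents

/-! ### Computing the weight -/

namespace RAM

variable {G : FlatGraph} {comp ord : ℕ → ℕ} {M : Mem} {r : ℕ → ℚ}

/-- The costs of the edges, from the parameters in `N`. -/
def edgeCost (G : FlatGraph) (N : ℕ → ℕ → ℚ) (e : ℕ) : ℚ :=
  if G.inp (e / 3) = 1 then
    if G.out e = 1 then N 0 (e / 3) + N 0 (e / 3) + N 2 (e / 3) else N 0 (e / 3) + N 0 (e / 3)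
  else N 0 (e / 3)

/-- Compute the cost of the edge `rI`. -/
def costBody : Prog :=
  .seq (.numCopy 6 (reg rI) 0 (.get aSrc (reg rI))) <|
  .ite (.eq (.get aInp (.get aSrc (reg rI))) (.lit 1))
    (.seq (.numAdd 6 (reg rI) 6 (reg rI) 0 (.get aSrc (reg rI)))
      (.ite (.eq (.get aOut (reg rI)) (.lit 1))
        (.numAdd 6 (reg rI) 6 (reg rI) 2 (.get aSrc (reg rI))) .skip)) .skip

/-- Numbers cannot be multiplied, so 2d is formed by adding d to itself. -/
theorem costBody_exec {k : ℕ} (E : Env G comp M) (hk : k < 3 * G.n) (hI : M.word rI 0 = k) :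
    (costBody.exec M).num 6 = Function.update (M.num 6) k (edgeCost G M.num k) := by
  have hs := E.holds.src k hk
  have hi := E.holds.inp (k / 3) (by omega)
  have ho := E.holds.out k hk
  have hn : ∀ b x, b ≠ 6 → (M.setNum 6 k x).num b = M.num b := fun b x hb => Mem.num_setNum_of_ne _ _ _ hb
  simp only [costBody, Prog.exec, Test.Holds, Expr.eval, Mem.word_setNum, hI, hs, hi, ho, edgeCost]
  split_ifs
  all_goals simp

/-- Compute the costs of the edges in number array `6`. -/
def costLoop : Prog := forLoop rI rE costBody

theorem costLoop_rule (E : Env G comp M) :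
    Ensures unitCost costLoop M (50 * G.n + 2) fun M' => Env G comp M' ∧
      (∀ e < 3 * G.n, M'.num 6 e = edgeCost G M.num e) ∧ (∀ a, a ≠ rI → M'.word a = M.word a) ∧
      ∀ a, a ≠ 6 → M'.num a = M.num a := by
  have key := forLoop_const_rule (κ := unitCost) (i := rI) (N := rE) (P := costBody) (M₀ := M)
    (by decide) (by decide) (by decide)
    (fun k M' => ∀ e < k, M'.num 6 e = edgeCost G M.num e) costBody.size (by simp) ?_
  · rw [E.holds.e] at key
    refine key.frame.mono ?_ fun M' ⟨h1, h2, h3⟩ => ?_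
    · simp only [costBody, Prog.size, Test.size]; omega
    · have hw : ∀ a, a ≠ rI → M'.word a = M.word a := fun a ha => h2 a (by
        rw [show (forLoop rI rE costBody).writes = [rI, rI] from rfl]; simp [ha])
      refine ⟨E.congr fun a ha => hw a ?_, h1, hw, fun a ha => h3 a ?_⟩
      · rintro rfl; simp [scratch] at ha
      · rw [show (forLoop rI rE costBody).numWrites = [6, 6, 6] from rfl]; simp [ha]
  · intro k M' hk hI h hw hn
    rw [E.holds.e] at hk
    refine Ensures.exec rfl (Or.inr rfl) fun e he => ?_
    have E' : Env G comp M' := E.congr fun a ha => hw a (by rintro rfl; simp [scratch] at ha)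
      (by rw [show costBody.writes = [] from rfl]; simp)
    have hc : edgeCost G M'.num k = edgeCost G M.num k := by
      simp only [edgeCost, hn 0 (by decide), hn 2 (by decide)]
    rw [Mem.num_setWord, costBody_exec E' hk hI, hc]
    rcases Nat.lt_succ_iff_lt_or_eq.1 he with he | rfl
    · rw [Function.update_of_ne he.ne]; exact h e he
    · rw [Function.update_self]

/-- The edge `rI` lies on a cycle that cannot be reached, and has positive cost. -/
def unboundedTest : Test :=
  .and internalTest (.and (.not (.eq (.get aRe (.get aSrc (reg rI))) (.lit 1)))
    (.numLt 4 (.lit 0) 6 (reg rI)))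

theorem unboundedLoop_rule (E : Env G comp M) (hre : ∀ v < G.n, M.word aRe v = 1 ↔ G.Conn G.init v)
    (h4 : M.num 4 0 = 0) (hr : ∀ e < 3 * G.n, M.num 6 e = r e) (hf : M.word rFail 0 = 0) :
    Ensures unitCost (markLoop rI rE rFail (.lit 0) unboundedTest) M (50 * G.n + 2) fun M' =>
      Env G comp M' ∧ (M'.word rFail 0 = 1 ↔ G.Unbounded comp r) ∧
      (∀ a, a ≠ rI → a ≠ rFail → M'.word a = M.word a) ∧ M'.num = M.num := by
  have hfr : ∀ M' : Mem, (∀ b, b ≠ rI → b ≠ rFail → M'.word b = M.word b) → Env G comp M' := by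
    intro M' h
    refine E.congr fun b hb => h b ?_ ?_ <;> rintro rfl <;> simp [scratch] at hb
  refine (markLoop_rule (κ := unitCost) (e := .lit 0) (t := unboundedTest) (Or.inr rfl)
    (fun e => G.Internal comp e ∧ ¬ G.Conn G.init (e / 3) ∧ 0 < r e) (fun _ => 0) (M₀ := M)
    (i := rI) (N := rE) (a := rFail) (by decide) (by decide) (by decide) ?_).mono ?_ ?_
  · intro k M' hk hI hw hn
    rw [E.holds.e] at hk
    have E' := hfr M' hw
    refine ⟨?_, fun _ => rfl⟩
    rw [unboundedTest, Test.Holds, internalTest_holds E' hk hI]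
    simp only [Test.Holds, Expr.eval, hI, E'.holds.src k hk, hn, h4, hr k hk,
      hw aRe (by decide) (by decide), hre (k / 3) (by omega)]
  · have : unboundedTest.size = 9 := rfl
    rw [this, E.holds.e]; omega
  · rintro M' ⟨h1, -, h3, h4⟩
    refine ⟨hfr M' h3, ?_, h3, h4⟩
    rw [h1, hf, E.holds.e, FlatGraph.Unbounded]
    simp

/-- Update the cost of the component at the start of the edge `rX`, if the edge leaves it. -/
def relaxEdge : Prog :=
  .seq (.ite (.and (.not (.eq (.get aDst (reg rX)) (.lit 0)))
      (.not (.eq (.get aComp (.get aSrc (reg rX))) (.get aComp (.pred (.get aDst (reg rX)))))))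
    (.seq (.numAdd 8 (.lit 0) 6 (reg rX) 7 (.get aComp (.pred (.get aDst (reg rX)))))
      (.ite (.numLt 7 (.get aComp (.get aSrc (reg rX))) 8 (.lit 0))
        (.numCopy 7 (.get aComp (.get aSrc (reg rX))) 8 (.lit 0)) .skip)) .skip)
    (.set rX (.lit 0) (.succ (reg rX)))

theorem relaxEdge_rule {D : ℕ → Prop} {e : ℕ} (hc : G.IsCondensation comp ord) (E : Env G comp M)
    (he : e < 3 * G.n) (hX : M.word rX 0 = e) (hr : ∀ e < 3 * G.n, M.num 6 e = r e)
    (h : G.Relaxed comp r (M.num 7) D)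
    (hD : ∀ f, G.Cross comp f → D f → comp (f / 3) ≤ comp (e / 3)) :
    Ensures unitCost relaxEdge M 11 fun M' => Env G comp M' ∧ M'.word rX 0 = e + 1 ∧
      (∀ e < 3 * G.n, M'.num 6 e = r e) ∧ G.Relaxed comp r (M'.num 7) fun f => D f ∨ f = e := by
  refine (Ensures.exec (κ := unitCost) (P := relaxEdge) (M := M) (R := fun M' => M'.word rX 0 = e + 1 ∧
    G.Relaxed comp r (M'.num 7) fun f => D f ∨ f = e) rfl (Or.inr rfl) ?_).frame.mono (by decide)
    fun M' ⟨⟨h1, h2⟩, h3, h4⟩ => ⟨E.congr fun a ha => h3 a ?_, h1, fun e he => ?_, h2⟩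
  · simp only [relaxEdge, Prog.exec, Test.Holds, Expr.eval, E.comp, hX, E.holds.dst e he,
      E.holds.src e he, hr e he, Mem.word_setNum, Mem.num_setNum_self, Function.update_self]
    rw [Mem.num_setNum_of_ne _ _ _ (by decide : (7 : ℕ) ≠ 8)]
    split_ifs with h1 h2
    · refine ⟨by simp [hX], ?_⟩
      have := h.update hc ⟨he, h1.1, h1.2⟩ hD h2
      simpa using this
    · refine ⟨by simp [hX], ?_⟩
      have := h.skip (e := e) fun _ => not_lt.1 h2
      simpa using this
    · refine ⟨by simp [hX], ?_⟩
      have := h.skip (e := e) fun h => absurd ⟨h.2.1, h.2.2⟩ h1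
      simpa using this
  · rw [show relaxEdge.writes = [rX] from rfl]
    rintro hm
    rw [List.mem_singleton.1 hm] at ha
    simp [scratch] at ha
  · rw [h4 6 (by decide), hr e he]

/-- Update the component of the vertex in place `rI` of `aOrd` along its edges. -/
def relaxBody : Prog :=
  .seq (.set rX (.lit 0) (.get aTri (.get aOrd (reg rI)))) (.seq relaxEdge (.seq relaxEdge relaxEdge))

/-- Compute the largest costs of paths from the components in number array `7`. -/
def relaxLoop : Prog := forLoop rI rN relaxBody

/-- The vertices are processed by increasing component, so the values at the heads of edges that
leave a component are final when they are read. -/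
theorem relaxLoop_rule (hc : G.IsCondensation comp ord) (E : Env G comp M) (ho : M.word aOrd = ord)
    (hr : ∀ e < 3 * G.n, M.num 6 e = r e) (h7 : M.num 7 = 0) :
    Ensures unitCost relaxLoop M (50 * G.n + 2) fun M' => Env G comp M' ∧
      G.Relaxed comp r (M'.num 7) (fun _ => True) ∧
      (∀ a, a ≠ rI → a ≠ rX → M'.word a = M.word a) ∧ ∀ a, a ≠ 7 → a ≠ 8 → M'.num a = M.num a := by
  have key := forLoop_const_rule (κ := unitCost) (i := rI) (N := rN) (P := relaxBody) (M₀ := M)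
    (by decide) (by decide) (by decide)
    (fun k M' => (∀ e < 3 * G.n, M'.num 6 e = r e) ∧
      G.Relaxed comp r (M'.num 7) fun f => ∃ i < k, f / 3 = ord i) 34 ⟨hr, ?_⟩ ?_
  · rw [E.holds.n] at key
    refine key.frame.mono (by omega) fun M' ⟨⟨_, h1⟩, h2, h3⟩ => ?_
    have hw : ∀ a, a ≠ rI → a ≠ rX → M'.word a = M.word a := fun a ha ha' => h2 a (by
      rw [show (forLoop rI rN relaxBody).writes = [rI, rX, rX, rX, rX, rI] from rfl]; simp [ha, ha'])
    refine ⟨E.congr fun a ha => hw a ?_ ?_, h1.congr fun e he => ⟨fun _ => trivial, fun _ => ?_⟩, hw,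
      fun a ha ha' => h3 a ?_⟩
    · rintro rfl; simp [scratch] at ha
    · rintro rfl; simp [scratch] at ha
    · obtain ⟨i, hi, h⟩ := hc.ord_surj (e / 3) (by omega)
      exact ⟨i, hi, h.symm⟩
    · rw [show (forLoop rI rN relaxBody).numWrites = [8, 7, 8, 7, 8, 7] from rfl]; simp [ha, ha']
  · rw [Mem.num_setWord, h7]
    exact ⟨fun _ => le_rfl, fun e _ ⟨i, hi, _⟩ => absurd hi (by omega), fun _ => Or.inl rfl⟩
  · rintro k M' hk hI ⟨h6, h⟩ hw hn
    rw [E.holds.n] at hk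
    have hv := hc.ord_lt k hk
    have hwr : relaxBody.writes = [rX, rX, rX, rX] := rfl
    have E' : Env G comp M' := E.congr fun a ha => hw a (by rintro rfl; simp [scratch] at ha)
      (by rw [hwr]; rintro hm; simp at hm; rw [hm] at ha; simp [scratch] at ha)
    have hx : M'.word aTri (M'.word aOrd k) = 3 * ord k := by
      rw [hw aOrd (by decide) (by decide), ho, E'.holds.tri _ hv]
    refine (Ensures.set_seq (T := 11 + (11 + 11)) ?_).mono (by omega) fun _ h => h
    simp only [Expr.eval, hI, hx]
    obtain ⟨M₀, hM₀⟩ : ∃ M₀, M₀ = M'.setWord rX 0 (3 * ord k) := ⟨_, rfl⟩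
    rw [← hM₀]
    have E₀ : Env G comp M₀ := E'.congr fun a ha => by
      rw [hM₀, Mem.word_setWord_of_ne]
      rintro rfl; simp [scratch] at ha
    have hd : ∀ j ≤ 2, (3 * ord k + j) / 3 = ord k := fun j hj => by omega
    have hd0 : 3 * ord k / 3 = ord k := by omega
    have hD : ∀ f, (∃ i < k, f / 3 = ord i) → comp (f / 3) ≤ comp (ord k) := by
      rintro f ⟨i, hi, hf⟩
      rw [hf]
      exact hc.ord_mono i k hi.le hk
    obtain ⟨s₁, M₁, r₁, b₁, E₁, x₁, k₁, R₁⟩ := relaxEdge_rule (e := 3 * ord k) hc E₀ (by omega)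
      (by rw [hM₀]; simp) (by rw [hM₀]; exact h6) (by rw [hM₀]; exact h) fun f _ hf => by
        rw [hd0]; exact hD f hf
    obtain ⟨s₂, M₂, r₂, b₂, E₂, x₂, k₂, R₂⟩ := relaxEdge_rule (e := 3 * ord k + 1) hc E₁ (by omega)
      x₁ k₁ R₁ fun f _ hf => by
        rw [hd 1 (by omega)]
        rcases hf with hf | rfl
        · exact hD f hf
        · rw [hd0]
    obtain ⟨s₃, M₃, r₃, b₃, E₃, x₃, k₃, R₃⟩ := relaxEdge_rule (e := 3 * ord k + 2) hc E₂ (by omega)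
      x₂ k₂ R₂ fun f _ hf => by
        rw [hd 2 (by omega)]
        rcases hf with (hf | rfl) | rfl
        · exact hD f hf
        · rw [hd0]
        · rw [hd 1 (by omega)]
    refine ⟨_, M₃, r₁.seq (r₂.seq r₃), by omega, k₃, R₃.congr fun f _ => ?_⟩
    constructor
    · rintro (((⟨i, hi, hf⟩ | rfl) | rfl) | rfl)
      · exact ⟨i, by omega, hf⟩
      · exact ⟨k, by omega, hd0⟩
      · exact ⟨k, by omega, hd 1 (by omega)⟩
      · exact ⟨k, by omega, hd 2 (by omega)⟩
    · rintro ⟨i, hi, hf⟩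
      rcases Nat.lt_succ_iff_lt_or_eq.1 hi with hi | rfl
      · exact Or.inl (Or.inl (Or.inl ⟨i, hi, hf⟩))
      · have : f = 3 * ord i ∨ f = 3 * ord i + 1 ∨ f = 3 * ord i + 2 := by omega
        tauto

/-- Take the maximum with the value for the component of the vertex `rI`. -/
def maxBody : Prog :=
  .ite (.numLt 5 (.lit 0) 7 (.get aComp (reg rI))) (.numCopy 5 (.lit 0) 7 (.get aComp (reg rI))) .skip

/-- Compute the largest cost of a path in cell `0` of number array `5`. -/
def maxLoop : Prog := forLoop rI rN maxBody

theorem maxLoop_rule (E : Env G comp M) (h5 : M.num 5 0 = 0) :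
    Ensures unitCost maxLoop M (50 * G.n + 2) fun M' =>
      (∀ v < G.n, M.num 7 (comp v) ≤ M'.num 5 0) ∧
      (M'.num 5 0 = 0 ∨ ∃ v < G.n, M'.num 5 0 = M.num 7 (comp v)) ∧
      ∀ a, a ≠ rI → M'.word a = M.word a := by
  have key := forLoop_const_rule (κ := unitCost) (i := rI) (N := rN) (P := maxBody) (M₀ := M)
    (by decide) (by decide) (by decide)
    (fun k M' => (∀ v < k, M.num 7 (comp v) ≤ M'.num 5 0) ∧
      (M'.num 5 0 = 0 ∨ ∃ v < k, M'.num 5 0 = M.num 7 (comp v))) maxBody.size (by simp [h5]) ?_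
  · rw [E.holds.n] at key
    refine key.frame.mono ?_ fun M' ⟨⟨h1, h2⟩, h3, _⟩ => ⟨h1, h2, fun a ha => h3 a ?_⟩
    · simp only [maxBody, Prog.size, Test.size]; omega
    · rw [show (forLoop rI rN maxBody).writes = [rI, rI] from rfl]; simp [ha]
  · rintro k M' hk hI ⟨h1, h2⟩ hw hn
    refine Ensures.exec rfl (Or.inr rfl) ?_
    have hcomp : M'.word aComp = comp := by rw [hw _ (by decide) (by decide), E.comp]
    have h7 := hn 7 (by decide)
    simp only [Mem.num_setWord, maxBody, Prog.exec, Test.Holds, Expr.eval, hI, hcomp, h7]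
    split_ifs with h
    · simp only [Mem.num_setNum_self, Function.update_self]
      refine ⟨fun v hv => ?_, Or.inr ⟨k, by omega, rfl⟩⟩
      rcases Nat.lt_succ_iff_lt_or_eq.1 hv with hv | rfl
      · exact (h1 v hv).trans h.le
      · exact le_rfl
    · refine ⟨fun v hv => ?_, h2.imp_right fun ⟨v, hv, h⟩ => ⟨v, by omega, h⟩⟩
      rcases Nat.lt_succ_iff_lt_or_eq.1 hv with hv | rfl
      · exact h1 v hv
      · exact not_lt.1 h

/-- Write the result. -/
def reportWeight : Prog :=
  .seq (.ite (.eq (reg rFail) (.lit 1)) (.set 0 (.lit 0) (.lit 1)) (.set 0 (.lit 0) (.lit 0)))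
    (.numCopy 0 (.lit 0) 5 (.lit 0))

theorem reportWeight_rule : Ensures unitCost reportWeight M 5 fun M' =>
    (M'.word 0 0 = 1 ↔ M.word rFail 0 = 1) ∧ M'.num 0 0 = M.num 5 0 := by
  refine (Ensures.exec (κ := unitCost) (P := reportWeight) rfl (Or.inr rfl) ?_).mono (by decide) fun _ h => h
  simp only [reportWeight, Prog.exec, Test.Holds, Expr.eval]
  split_ifs with h <;> simp [h]

/-- Compute the weight, when the flags have been set. -/
def weigh : Prog :=
  .seq condense <| .seq reachLoop <| .seq costLoop <|
  .seq (markLoop rI rE rFail (.lit 0) unboundedTest) <| .seq relaxLoop <| .seq maxLoop reportWeight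

theorem edgeCost_edgeOf {n m : ℕ} {A : DiPA (Fin n) (Fin m)} (hG : G.Represents A)
    {t : Transition (Fin n) (Fin m)} (ht : A.IsTransition t) :
    edgeCost G A.encodeNum (FlatGraph.Represents.edgeOf t) = A.criticalCost t := by
  obtain ⟨⟨h0, h1, h2⟩, -, h3, -⟩ := hG.isEdge ht
  have e0 : A.encodeNum 0 t.src = A.d t.src := by simp [DiPA.encodeNum]
  have e2 : A.encodeNum 2 t.src = A.d' t.src := by simp [DiPA.encodeNum]
  have hi : G.inp t.src = 1 ↔ A.isInput t.src = true := by rw [hG.inp_eq]; simp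
  have ho : G.out (FlatGraph.Represents.edgeOf t) = 1 ↔ t.out = .svar' := by
    rw [h3, Out.code_eq_one]
  simp only [edgeCost, h1, e0, e2, hi, ho, DiPA.criticalCost]
  by_cases hs : t.out = .svar'
  · simp only [ho.2 hs, hs, if_true]
    split_ifs <;> push_cast <;> ring
  · simp only [mt ho.1 hs, hs, if_false]
    split_ifs <;> push_cast <;> ring

/-- The graph is not pruned here, because costs belong to all transitions. Number arrays from 4 on
are initially zero, which provides the constant 0 and the starting values of the maxima. -/
theorem Prepared.weigh {n m : ℕ} {A : DiPA (Fin n) (Fin m)}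
    (h : Prepared A (fun _ => True) (fun _ => True) M) :
    Ensures unitCost RAM.weigh M (3000 * (n + 1)) fun M' =>
      A.weight = if M'.word 0 0 = 1 then ⊤ else ((M'.num 0 0 : ℝ) : EReal) := by
  obtain ⟨G, hGA⟩ : ∃ G, G = A.flat (fun _ => True) (fun _ => True) := ⟨_, rfl⟩
  have hG : G.Represents A := hGA ▸ DiPA.represents_flat rfl rfl DiPA.prune_true.symm
  obtain ⟨s₁, M₁, r₁, b₁, E₁, hc, z₁, n₁⟩ := condense_rule (κ := unitCost) h
  rw [← hGA] at E₁ hc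
  have hz : ∀ a, 4 ≤ a → M₁.num a = 0 := by
    intro a ha
    rw [n₁]
    funext i
    simp only [DiPA.encodeNum, Pi.zero_apply]
    split_ifs
    · split <;> first | omega | rfl
    · rfl
  obtain ⟨s₂, M₂, r₂, b₂, E₂, k₂, f₂⟩ := reachLoop_rule (κ := unitCost) hG.valid E₁
  have hn₂ : M₂.num = M₁.num := funext fun a => r₂.frame.2 a (by
    rw [show reachLoop.numWrites = [] from rfl]; simp)
  obtain ⟨s₃, M₃, r₃, b₃, E₃, k₃, f₃, g₃⟩ := costLoop_rule E₂
  rw [hn₂, n₁] at k₃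
  have hn₃ : ∀ a, 4 ≤ a → a ≠ 6 → M₃.num a = 0 := fun a h1 h2 => by rw [g₃ a h2, hn₂, hz a h1]
  obtain ⟨s₄, M₄, r₄, b₄, E₄, k₄, f₄, g₄⟩ := unboundedLoop_rule E₃
    (by rw [f₃ _ (by decide)]; exact k₂) (by rw [hn₃ 4 (by decide) (by decide)]; rfl) k₃
    (by rw [f₃ _ (by decide), f₂ _ (by decide), z₁ _ (by decide)]; rfl)
  obtain ⟨s₅, M₅, r₅, b₅, E₅, k₅, f₅, g₅⟩ := relaxLoop_rule hc E₄
    (by rw [f₄ _ (by decide) (by decide), f₃ _ (by decide), f₂ _ (by decide)])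
    (by rw [g₄]; exact k₃) (by rw [g₄, hn₃ 7 (by decide) (by decide)])
  obtain ⟨s₆, M₆, r₆, b₆, k₆, l₆, f₆⟩ := maxLoop_rule E₅
    (by rw [g₅ 5 (by decide) (by decide), g₄, hn₃ 5 (by decide) (by decide)]; rfl)
  obtain ⟨s₇, M₇, r₇, b₇, k₇, l₇⟩ := reportWeight_rule (M := M₆)
  rw [f₆ _ (by decide), f₅ _ (by decide) (by decide), k₄] at k₇
  have hr : ∀ t, A.IsTransition t → _ := fun t ht => edgeCost_edgeOf hG ht
  refine ⟨_, M₇, r₁.seq <| r₂.seq <| r₃.seq <| r₄.seq <| r₅.seq <| r₆.seq r₇, ?_, ?_⟩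
  · have := hG.n_eq
    clear * - b₁ b₂ b₃ b₄ b₅ b₆ b₇ this
    omega
  · beta_reduce
    rw [l₇]
    split_ifs with ht
    · exact hG.weight_eq_top hc hr (k₇.1 ht)
    · rw [hG.n_eq] at k₆ l₆
      exact hG.weight_eq hc hr (fun h => ht (k₇.2 h)) k₅ k₆ l₆

end RAM

namespace DiPA

open RAM in
theorem exists_prog_weight : ∃ (P : Prog) (K : ℕ), ∀ (n m : ℕ) (A : DiPA (Fin n) (Fin m)),
    ∃ (t : ℕ) (M : Mem), Runs unitCost P A.encode t M ∧ t ≤ K * A.size ∧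
      A.weight = if M.word 0 0 = 1 then ⊤ else ((M.num 0 0 : ℝ) : EReal) := by
  refine ⟨prepare (.eq (.lit 0) (.lit 0)) (.eq (.lit 0) (.lit 0)) weigh, 8000, fun n m A => ?_⟩
  obtain ⟨t, M, h1, h2, h3⟩ := prepare_rule (κ := unitCost) (A := A) (Z := fun _ => True)
    (Z' := fun _ => True) (t := .eq (.lit 0) (.lit 0)) (t' := .eq (.lit 0) (.lit 0)) (fun _ => 1) (fun _ => 1)
    (by intro v M _ _ _ _; simp [Test.Holds, Test.time])
    (by intro v M _ _ _ _; simp [Test.Holds, Test.time]) (fun M hM => hM.weigh)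
  refine ⟨t, M, h1, h2.trans ?_, h3⟩
  have hs := A.n_le_size
  simp only [Finset.sum_const, Finset.card_range, smul_eq_mul]
  omega

end DiPA

theorem mainTheorem3 :
    -- the differential privacy problem is decidable in linear time
    (∃ (P : RAM.Prog) (K : ℕ), ∀ (n m : ℕ) (A : DiPA (Fin n) (Fin m)),
      ∃ (t : ℕ) (M : RAM.Mem), RAM.Runs RAM.bitLength P A.encode t M ∧ t ≤ K * A.bitSize ∧
        M.word 0 0 ≤ 1 ∧ (M.word 0 0 = 1 ↔ A.DifferentiallyPrivate)) ∧
    -- well-formedness is decidable in linear time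
    (∃ (P : RAM.Prog) (K : ℕ), ∀ (n m : ℕ) (A : DiPA (Fin n) (Fin m)),
      ∃ (t : ℕ) (M : RAM.Mem), RAM.Runs RAM.bitLength P A.encode t M ∧ t ≤ K * A.size ∧
        M.word 0 0 ≤ 1 ∧ (M.word 0 0 = 1 ↔ A.WellFormed)) ∧
    -- the weight is computable in linear time, with unit cost for the arithmetic of numbers
    (∃ (P : RAM.Prog) (K : ℕ), ∀ (n m : ℕ) (A : DiPA (Fin n) (Fin m)),
      ∃ (t : ℕ) (M : RAM.Mem), RAM.Runs RAM.unitCost P A.encode t M ∧ t ≤ K * A.size ∧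
        A.weight = if M.word 0 0 = 1 then ⊤ else ((M.num 0 0 : ℝ) : EReal)) := by
  exact ⟨DiPA.exists_prog_differentiallyPrivate, DiPA.exists_prog_wellFormed, DiPA.exists_prog_weight⟩
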